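/- Let $T=\mathbb C$ and consider the first Painlevé equation $x''=6x^2+t$ as the Hamiltonian system $x'=\partial H/\partial y$, $y'=-\partial H/\partial x$ with $H(x,y,t)=\tfrac12y^2-2x^3-tx$. For $t\in T$ carry out the following construction (the surfaces for varying $t$ form families over $T$). (1) Let $\varSigma$ be the Hirzebruch surface of degree $2$, glued from four charts $\mathbb C^2_{(q_i,p_i)}$ by $q_1q_2=1$, $p_1=-q_2^2p_2$; $q_3=q_1$, $p_1p_3=1$; $q_4=q_2$, $p_2p_4=1$ (hence also $q_3q_4=1$, $p_4=-q_4^2p_3$), with $(x,y)=(q_3,p_3)$. Here the blowup of a point $(a,0)$ of a chart $(x,y)$ has the two new charts $(q,p)$, $(Q,P)$ with $x-a=qp$, $y=p$ and $x-a=Q$, $y=QP$. Blow up $(q_4,p_4)=(0,0)$, with new charts $(q^{(1)},p^{(1)})$, $(Q^{(1)},P^{(1)})$, and then $(q^{(1)},p^{(1)})=(0,0)$, with new charts $(q^{(2)},p^{(2)})$, $(Q^{(2)},P^{(2)})$; call the result $S$. Let $C=\{Q^{(1)}=0\}\cup\{P^{(2)}=0\}\subset S$, let $U$ be the union of the charts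 $(Q^{(1)},P^{(1)})$ and $(Q^{(2)},P^{(2)})$, and let $a^{(2)}$ be the point $(Q^{(2)},P^{(2)})=(0,4)$. (2) Let $V=\mathbb C^2_{(r,s)}\cup\mathbb C^2_{(R,S)}\to U$ be the double cover $Q^{(1)}=s^2$, $P^{(1)}=r$; $Q^{(2)}=S$, $P^{(2)}=R^2$, branched along $C$, and let $V\to W=\mathbb C^2$, $(r,s)\mapsto(rs,s)$, $(R,S)\mapsto(R,RS)$, be the blowdown of the ramification curve to $p=(0,0)$. The deck involution induces $-1$ on $W$. (3) Let $X\to W$ be the result of six successive pairs of blowups: first of $p_\pm=(\pm2,0)\in W$, with new charts $(z^{(3)},w^{(3)})$ and $(u^{(3)},v^{(3)})$ of the type $(q,p)$, and then for $k=3,\dots,7$ of the points $(z^{(k)},w^{(k)})=(a_k,0)$ and $(u^{(k)},v^{(k)})=(b_k,0)$, with new charts of the type $(q,p)$ denoted $(z^{(k+1)},w^{(k+1)})$ and $(u^{(k+1)},v^{(k+1)})$, where $a_k=b_k=0$ for $k=3,4,5$, $a_6=-b_6=t/2$, $a_7=b_7=1/2$. (4) Let $F_t$ be the gluing of $S\setminus(C\cup\{a^{(2)}\})$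 with $X/\sigma$, via $U\leftarrow V\to W\leftarrow X$, where $\sigma$ is the involution of $X$ induced by $-1$ on $W$. Let $\overline E_t$ be obtained from $F_t$ by replacing the singular point $p$ (the image of $p\in X$) by the curve $C$, i.e. by gluing $S\setminus\{a^{(2)}\}$ with $(X\setminus\{p\})/\sigma$. Let $V_t\subset\overline E_t$ be the union of the vertical leaves, i.e. the set of points at which the foliation defined by the Painlevé equation on the total space of the family of the $\overline E_t$ is not transversal to the fibre $\overline E_t$, and let $E_t=\overline E_t\setminus V_t$. **Theorem.** There is exactly one holomorphic involution $\sigma$ of (the family) $X$ that induces $-1$ on $W$, and with it, for every $t\in\mathbb C$: (a) The map $\overline E_t\to F_t$ that contracts $C$ to $p$ and is the identity elsewhere is a resolution of $p\in F_t$ with $\overline E_t$ smooth, whose exceptional set $C$ is a smooth rational curve with self-intersection number $-2$ (so it is the minimal resolution). The set $V_t$ is the union of nine smooth rational curves with self-intersection number $-2$ that meet transversally, in at most one point for each pair, according to the Dynkin diagram $E_8^{(1)}$ (a chain of eight nodes and a ninth node joined to the third one), the ninth curve being $C$. (b) As a complex surface, $$E_t=\mathbb C^2_{(x,y)}\cup\bigl(\mathbb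 C^2_{(z,w)}\cup\mathbb C^2_{(u,v)}\bigr)/\sigma,$$ where $(x,y)$ is the original chart and $(z^{(8)},w^{(8)})=(-z/2,w)$, $(u^{(8)},v^{(8)})=(-u/2,v)$. Here $\mathbb C^2_{(z,w)}$ and $\mathbb C^2_{(u,v)}$ are glued exactly along $\{w\ne0\}=\{v\ne0\}$ via $u=z-2tw^{-2}-8w^{-6}$, $v=w$; the holomorphic involution $\sigma$ of $\mathbb C^2_{(z,w)}\cup\mathbb C^2_{(u,v)}$ is given by $$(z,w)\mapsto(u,v)=(-z,-w),$$ $$(z,w)\mapsto(z,w)=(-z+2tw^{-2}+8w^{-6},-w)\quad(w\ne0),$$ $$(u,v)\mapsto(u,v)=(-u-2tv^{-2}-8v^{-6},-v)\quad(v\ne0);$$ and $\mathbb C^2_{(x,y)}$ is glued with the quotient exactly along $\{x\ne0\}=\{w\ne0\}/\sigma=\{v\ne0\}/\sigma$ via $$x=\frac1{w^2},\quad y=-\frac2{w^3}-\frac{tw}2-\frac{w^2}2+\frac{zw^3}2;\qquad x=\frac1{v^2},\quad y=\frac2{v^3}+\frac{tv}2-\frac{v^2}2+\frac{uv^3}2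 .$$ All these gluing maps and the maps $\sigma$ are symplectic: $dx\wedge dy=dz\wedge dw=du\wedge dv$. -/

import Mathlib

open Topology Filter

/-! ## Complex spaces with a structure sheaf of functions -/

/-- A (reduced) complex ringed space: a topological space with a sheaf of `ℂ`-algebras of continuous
`ℂ`-valued functions. `HolAt f x` says that the germ of `f` at `x` is holomorphic. Complex
manifolds, their quotients, gluings and fibres are all treated in this one setting. -/
class HolSpace (X : Type) [TopologicalSpace X] where
  HolAt : (X → ℂ) → X → Prop
  congr : ∀ {f g : X → ℂ} {x : X}, HolAt f x → f =ᶠ[𝓝 x] g → HolAt g x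
  nearby : ∀ {f : X → ℂ} {x : X}, HolAt f x → ∀ᶠ y in 𝓝 x, HolAt f y
  cont : ∀ {f : X → ℂ} {x : X}, HolAt f x → ContinuousAt f x
  const : ∀ (c : ℂ) (x : X), HolAt (fun _ => c) x
  add : ∀ {f g : X → ℂ} {x : X}, HolAt f x → HolAt g x → HolAt (fun y => f y + g y) x
  mul : ∀ {f g : X → ℂ} {x : X}, HolAt f x → HolAt g x → HolAt (fun y => f y * g y) x

namespace HolSpace

/-- The affine spaces `ℂⁿ`, with their analytic functions. -/
instance instAffine {E : Type} [NormedAddCommGroup E] [NormedSpace ℂ E] : HolSpace E where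
  HolAt f x := AnalyticAt ℂ f x
  congr h e := h.congr e
  nearby h := h.eventually_analyticAt
  cont h := h.continuousAt
  const _ _ := analyticAt_const
  add h k := h.add k
  mul h k := h.mul k

/-- Subspaces: a function is holomorphic if it locally extends to a holomorphic function on the
ambient space. For an open subset this is restriction; for the fibre of a family it is the
usual structure of the fibre. -/
instance instSubtype {X : Type} [TopologicalSpace X] [HolSpace X] {p : X → Prop} :
    HolSpace (Subtype p) where
  HolAt f x := ∃ g : X → ℂ, HolAt g x.1 ∧ (fun y : Subtype p => g y.1) =ᶠ[𝓝 x] f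
  congr := by
    rintro f g x ⟨k, hk, e⟩ h
    exact ⟨k, hk, e.trans h⟩
  nearby := by
    rintro f x ⟨k, hk, e⟩
    have h1 : ∀ᶠ y : Subtype p in 𝓝 x, HolAt k y.1 :=
      continuous_subtype_val.continuousAt.eventually (nearby hk)
    filter_upwards [h1, e.eventually_nhds] with y hy hy'
    exact ⟨k, hy, hy'⟩
  cont := by
    rintro f x ⟨k, hk, e⟩
    exact ContinuousAt.congr
      (ContinuousAt.comp (f := fun y : Subtype p => y.1) (cont hk)
        continuous_subtype_val.continuousAt) e
  const c x := ⟨fun _ => c, const c _, Eventually.of_forall fun _ => rfl⟩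
  add := by
    rintro f g x ⟨k, hk, e⟩ ⟨l, hl, e'⟩
    exact ⟨_, add hk hl, e.add e'⟩
  mul := by
    rintro f g x ⟨k, hk, e⟩ ⟨l, hl, e'⟩
    exact ⟨_, mul hk hl, e.mul e'⟩

/-- Disjoint unions. -/
instance instSigma {J : Type} {A : J → Type} [∀ j, TopologicalSpace (A j)]
    [∀ j, HolSpace (A j)] : HolSpace (Σ j, A j) where
  HolAt f x := HolAt (fun a => f ⟨x.1, a⟩) x.2
  congr := by
    rintro f g ⟨j, a⟩ h e
    rw [Sigma.nhds_mk] at e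
    exact congr h e
  nearby := by
    rintro f ⟨j, a⟩ h
    rw [Sigma.nhds_mk]
    exact nearby h
  cont := by
    rintro f ⟨j, a⟩ h
    rw [ContinuousAt, Sigma.nhds_mk]
    exact cont h
  const c x := const c x.2
  add h k := add h k
  mul h k := mul h k

/-- Disjoint unions of two spaces. -/
instance instSum {A B : Type} [TopologicalSpace A] [HolSpace A] [TopologicalSpace B]
    [HolSpace B] : HolSpace (A ⊕ B) where
  HolAt f x := match x with
    | Sum.inl a => HolAt (fun b => f (Sum.inl b)) a
    | Sum.inr a => HolAt (fun b => f (Sum.inr b)) a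
  congr := by
    rintro f g (a | a) h e
    · rw [nhds_inl] at e
      exact congr (X := A) h e
    · rw [nhds_inr] at e
      exact congr (X := B) h e
  nearby := by
    rintro f (a | a) h
    · rw [nhds_inl]
      exact nearby (X := A) h
    · rw [nhds_inr]
      exact nearby (X := B) h
  cont := by
    rintro f (a | a) h
    · rw [ContinuousAt, nhds_inl]
      exact cont (X := A) h
    · rw [ContinuousAt, nhds_inr]
      exact cont (X := B) h
  const := by
    rintro c (a | a)
    · exact const (X := A) c a
    · exact const (X := B) c a
  add := by
    rintro f g (a | a) h k
    · exact add (X := A) h k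
    · exact add (X := B) h k
  mul := by
    rintro f g (a | a) h k
    · exact mul (X := A) h k
    · exact mul (X := B) h k

/-- Quotients and gluings `A → A/r`, with the quotient topology: a function on an open subset of
`A/r` is holomorphic if and only if its pullback to `A` is. -/
instance instQuot {A : Type} [TopologicalSpace A] [HolSpace A] {r : A → A → Prop} :
    HolSpace (Quot r) where
  HolAt f x := ∃ O : Set (Quot r), IsOpen O ∧ x ∈ O ∧
    ∀ a : A, Quot.mk r a ∈ O → HolAt (fun b => f (Quot.mk r b)) a
  congr := by
    rintro f g x ⟨O, hO, hx, h⟩ e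
    obtain ⟨N, hN, hNo, hxN⟩ := eventually_nhds_iff.1 e
    refine ⟨O ∩ N, hO.inter hNo, ⟨hx, hxN⟩, fun a ha => congr (h a ha.1) ?_⟩
    have : ∀ᶠ b in 𝓝 a, Quot.mk r b ∈ N :=
      (continuous_quot_mk.continuousAt (x := a)).eventually (hNo.mem_nhds ha.2)
    filter_upwards [this] with b hb
    exact hN _ hb
  nearby := by
    rintro f x ⟨O, hO, hx, h⟩
    filter_upwards [hO.mem_nhds hx] with y hy
    exact ⟨O, hO, hy, h⟩
  cont := by
    rintro f x ⟨O, hO, hx, h⟩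
    intro s hs
    obtain ⟨T, hTs, hTo, hT⟩ := mem_nhds_iff.1 hs
    refine mem_nhds_iff.2 ⟨O ∩ f ⁻¹' T, fun y hy => hTs hy.2, ?_, hx, hT⟩
    refine isOpen_coinduced.2 (isOpen_iff_mem_nhds.2 fun a ha => ?_)
    have h1 : ∀ᶠ b in 𝓝 a, Quot.mk r b ∈ O :=
      (continuous_quot_mk.continuousAt (x := a)).eventually (hO.mem_nhds ha.1)
    have h2 : ∀ᶠ b in 𝓝 a, f (Quot.mk r b) ∈ T :=
      (cont (h a ha.1)).eventually (hTo.mem_nhds ha.2)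
    filter_upwards [h1, h2] with b hb hb'
    exact ⟨hb, hb'⟩
  const c x := ⟨Set.univ, isOpen_univ, trivial, fun a _ => const c a⟩
  add := by
    rintro f g x ⟨O, hO, hx, h⟩ ⟨N, hN, hxN, k⟩
    exact ⟨O ∩ N, hO.inter hN, ⟨hx, hxN⟩, fun a ha => add (h a ha.1) (k a ha.2)⟩
  mul := by
    rintro f g x ⟨O, hO, hx, h⟩ ⟨N, hN, hxN, k⟩
    exact ⟨O ∩ N, hO.inter hN, ⟨hx, hxN⟩, fun a ha => mul (h a ha.1) (k a ha.2)⟩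

end HolSpace

section HolSpaces

variable {X Y : Type} [TopologicalSpace X] [HolSpace X] [TopologicalSpace Y] [HolSpace Y]

/-- Holomorphic maps. -/
def IsHolMap (f : X → Y) : Prop :=
  Continuous f ∧ ∀ (x : X) (g : Y → ℂ), HolSpace.HolAt g (f x) → HolSpace.HolAt (g ∘ f) x

/-- Open embeddings that are biholomorphic onto their (open) image. -/
def IsOpenHolEmbedding (f : X → Y) : Prop :=
  IsOpenEmbedding f ∧ IsHolMap f ∧
    ∀ (x : X) (g : Y → ℂ), HolSpace.HolAt (g ∘ f) x → HolSpace.HolAt g (f x)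

/-- `(α, β)` is a system of local holomorphic coordinates at the point `y` of a surface. -/
def IsLocalCoord (α β : Y → ℂ) (y : Y) : Prop :=
  ∃ N : Set Y, IsOpen N ∧ y ∈ N ∧ IsOpenHolEmbedding (fun n : N => ((α n, β n) : ℂ × ℂ))

variable (Y) in
/-- Smooth complex surfaces: Hausdorff and locally biholomorphic to open subsets of `ℂ²`. -/
def IsSmoothSurface : Prop :=
  T2Space Y ∧ ∀ y : Y, ∃ α β : Y → ℂ, IsLocalCoord α β y

/-- `L` is a smooth rational curve of self-intersection number `n` in the surface `Y`.
The curve is parametrized by the two standard charts `γ₀, γ₁` of the projective line, `β₀` and `β₁`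
are local equations of `L` along the two parts, and along the overlap `β₁ = a ^ (-n) β₀` to first
order, that is, the normal bundle is the line bundle of degree `n`. -/
def IsSmoothRationalCurve (L : Set Y) (n : ℤ) : Prop :=
  ∃ (γ₀ γ₁ : ℂ → Y) (α₀ β₀ α₁ β₁ : Y → ℂ),
    Continuous γ₀ ∧ Continuous γ₁ ∧
    L = Set.range γ₀ ∪ Set.range γ₁ ∧
    (∀ a : ℂ, a ≠ 0 → γ₁ a⁻¹ = γ₀ a) ∧ γ₁ 0 ∉ Set.range γ₀ ∧
    (∀ a : ℂ, IsLocalCoord α₀ β₀ (γ₀ a) ∧ α₀ (γ₀ a) = a ∧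
      ∀ᶠ y in 𝓝 (γ₀ a), y ∈ L ↔ β₀ y = 0) ∧
    (∀ a : ℂ, IsLocalCoord α₁ β₁ (γ₁ a) ∧ α₁ (γ₁ a) = a ∧
      ∀ᶠ y in 𝓝 (γ₁ a), y ∈ L ↔ β₁ y = 0) ∧
    ∀ a : ℂ, a ≠ 0 → ∃ u : Y → ℂ, HolSpace.HolAt u (γ₀ a) ∧ u (γ₀ a) = a ^ (-n) ∧
      ∀ᶠ y in 𝓝 (γ₀ a), β₁ y = u y * β₀ y

/-- Two curves cross transversally at the point `y`. -/
def CrossTransversally (L L' : Set Y) (y : Y) : Prop :=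
  ∃ α β : Y → ℂ, IsLocalCoord α β y ∧
    ∀ᶠ x in 𝓝 y, (x ∈ L ↔ α x = 0) ∧ (x ∈ L' ↔ β x = 0)

/-- `ρ : X → Y` is a resolution of the (only) singular point `p` of `Y`. -/
structure IsResolution (ρ : X → Y) (p : Y) : Prop where
  smooth : IsSmoothSurface X
  hol : IsHolMap ρ
  proper : IsProperMap ρ
  dense : Dense {x | ρ x ≠ p}
  /-- `ρ` is biholomorphic away from `p`. -/
  iso : IsOpenHolEmbedding (fun x : {x // ρ x ≠ p} => ρ x)
  surj : ∀ y, ∃ x, ρ x = y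

end HolSpaces

/-- Biholomorphic maps. -/
structure Biholo (X Y : Type) [TopologicalSpace X] [HolSpace X] [TopologicalSpace Y]
    [HolSpace Y] extends X ≃ Y where
  hol : IsHolMap toFun
  hol_inv : IsHolMap invFun

/-! ## Families of surfaces over the time line, and blowups

All surfaces are built in families over `T = ℂ`. A point `(t, q, p)` of `ℂ³` is the point `(q, p)`
of the `(q, p)`-plane over the time `t`. -/

abbrev TPlane : Type := ℂ × ℂ × ℂ

/-- A chart of `X` with values in the family of planes: a map from a subset of `T × ℂ²` to `X`. -/
structure LocalChart (X : Type) where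
  dom : Set TPlane
  map : dom → X

namespace LocalChart

variable {X : Type}

/-- `κ.At v x`: the point `x` has the coordinates `v` in the chart `κ`. -/
def At (κ : LocalChart X) (v : TPlane) (x : X) : Prop := ∃ h : v ∈ κ.dom, κ.map ⟨v, h⟩ = x

open Classical in
/-- A function in terms of a chart. -/
noncomputable def pull (κ : LocalChart X) (g : X → ℂ) (v : TPlane) : ℂ :=
  if h : v ∈ κ.dom then g (κ.map ⟨v, h⟩) else 0

end LocalChart

section Blowup

variable {X : Type} {J : Type} (κ : J → LocalChart X) (c : J → ℂ → ℂ)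

/-- `x` is the `j`-th centre at some time `t`: the point `(c j t, 0)` of the chart `κ j`. -/
def IsCentre (j : J) (x : X) : Prop := ∃ t : ℂ, (κ j).At (t, c j t, 0) x

/-- `x - a = q p, y = p` with `a = c j t`. -/
def blowMap₁ (j : J) (v : TPlane) : TPlane := (v.1, c j v.1 + v.2.1 * v.2.2, v.2.2)

/-- `x - a = Q, y = Q P` with `a = c j t`. -/
def blowMap₂ (j : J) (v : TPlane) : TPlane := (v.1, c j v.1 + v.2.1, v.2.1 * v.2.2)

/-- The domain of the new chart `(q, p)`: only the other centres have to be left out. -/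
def blowDom₁ (j : J) : Set TPlane :=
  {v | ∃ h : blowMap₁ c j v ∈ (κ j).dom, ∀ k, k ≠ j → ¬ IsCentre κ c k ((κ j).map ⟨_, h⟩)}

/-- The domain of the new chart `(Q, P)`: only the other centres have to be left out. -/
def blowDom₂ (j : J) : Set TPlane :=
  {v | ∃ h : blowMap₂ c j v ∈ (κ j).dom, ∀ k, k ≠ j → ¬ IsCentre κ c k ((κ j).map ⟨_, h⟩)}

/-- The pieces of the blowup: `X` without the centres, and for every centre the two new charts. -/
abbrev BlowPieces : Type :=
  {x : X // ∀ j, ¬ IsCentre κ c j x} ⊕ ((Σ j, blowDom₁ κ c j) ⊕ (Σ j, blowDom₂ κ c j))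

/-- How the pieces of the blowup are glued. The exceptional curve over the `j`-th centre is
`{p = 0} ∪ {Q = 0}`, with `P = 1 / q` along it. -/
inductive BlowRel : BlowPieces κ c → BlowPieces κ c → Prop
  | base₁ (x : {x : X // ∀ j, ¬ IsCentre κ c j x}) (j : J) (v : blowDom₁ κ c j) :
      (κ j).map ⟨_, v.2.fst⟩ = x.1 → BlowRel (Sum.inl x) (Sum.inr (Sum.inl ⟨j, v⟩))
  | base₂ (x : {x : X // ∀ j, ¬ IsCentre κ c j x}) (j : J) (v : blowDom₂ κ c j) :
      (κ j).map ⟨_, v.2.fst⟩ = x.1 → BlowRel (Sum.inl x) (Sum.inr (Sum.inr ⟨j, v⟩))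
  | charts (j : J) (v : blowDom₁ κ c j) (v' : blowDom₂ κ c j) :
      v.1.1 = v'.1.1 → v.1.2.1 * v'.1.2.2 = 1 → v.1.2.2 = v'.1.2.1 * v'.1.2.2 →
      BlowRel (Sum.inr (Sum.inl ⟨j, v⟩)) (Sum.inr (Sum.inr ⟨j, v'⟩))

/-- The simultaneous blowup of the family `X` at the centres `(c j t, 0)` of the charts `κ j`. -/
def Blowup : Type := Quot (BlowRel κ c)

instance [TopologicalSpace X] [TopologicalSpace J] : TopologicalSpace (Blowup κ c) :=
  inferInstanceAs (TopologicalSpace (Quot (BlowRel κ c)))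

instance [TopologicalSpace X] [HolSpace X] [TopologicalSpace J] : HolSpace (Blowup κ c) :=
  inferInstanceAs (HolSpace (Quot (BlowRel κ c)))

namespace Blowup

/-- The blowdown morphism. -/
def proj : Blowup κ c → X :=
  Quot.lift
    (fun a => match a with
      | Sum.inl x => x.1
      | Sum.inr (Sum.inl ⟨j, v⟩) => (κ j).map ⟨_, v.2.fst⟩
      | Sum.inr (Sum.inr ⟨j, v⟩) => (κ j).map ⟨_, v.2.fst⟩)
    (by
      rintro _ _ (⟨x, j, v, h⟩ | ⟨x, j, v, h⟩ | ⟨j, v, v', h1, h2, h3⟩)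
      · exact h.symm
      · exact h.symm
      · have : blowMap₁ c j v.1 = blowMap₂ c j v'.1 := by
          have e : v.1.2.1 * v.1.2.2 = v'.1.2.1 := by
            rw [h3, ← mul_assoc, mul_comm v.1.2.1, mul_assoc, h2, mul_one]
          simp only [blowMap₁, blowMap₂]
          rw [e, ← h3, h1]
        exact congrArg (κ j).map (Subtype.ext this))

/-- The new chart `(q, p)`. -/
def chart₁ (j : J) : LocalChart (Blowup κ c) :=
  ⟨blowDom₁ κ c j, fun v => Quot.mk _ (Sum.inr (Sum.inl ⟨j, v⟩))⟩

/-- The new chart `(Q, P)`. -/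
def chart₂ (j : J) : LocalChart (Blowup κ c) :=
  ⟨blowDom₂ κ c j, fun v => Quot.mk _ (Sum.inr (Sum.inr ⟨j, v⟩))⟩

/-- A chart of `X`, regarded as a chart of the blowup (away from the centres). -/
def oldChart (φ : LocalChart X) : LocalChart (Blowup κ c) :=
  ⟨{v | ∃ h : v ∈ φ.dom, ∀ j, ¬ IsCentre κ c j (φ.map ⟨v, h⟩)},
    fun v => Quot.mk _ (Sum.inl ⟨φ.map ⟨v.1, v.2.fst⟩, v.2.snd⟩)⟩

end Blowup

end Blowup

/-! ## The Hirzebruch surface and the surface `S` -/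

/-- The gluing of the four charts `(q_i, p_i)`, numbered from `0` here. The last relation is the
one that the other three imply for `p₃` and `p₄` where these do not vanish. -/
inductive HirzebruchRel : (Σ _ : Fin 4, TPlane) → (Σ _ : Fin 4, TPlane) → Prop
  | r12 (t q₁ p₁ q₂ p₂ : ℂ) : q₁ * q₂ = 1 → p₁ = -q₂ ^ 2 * p₂ →
      HirzebruchRel ⟨0, (t, q₁, p₁)⟩ ⟨1, (t, q₂, p₂)⟩
  | r13 (t q₁ p₁ q₃ p₃ : ℂ) : q₃ = q₁ → p₁ * p₃ = 1 →
      HirzebruchRel ⟨0, (t, q₁, p₁)⟩ ⟨2, (t, q₃, p₃)⟩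
  | r24 (t q₂ p₂ q₄ p₄ : ℂ) : q₄ = q₂ → p₂ * p₄ = 1 →
      HirzebruchRel ⟨1, (t, q₂, p₂)⟩ ⟨3, (t, q₄, p₄)⟩
  | r34 (t q₃ p₃ q₄ p₄ : ℂ) : q₃ * q₄ = 1 → p₄ = -q₄ ^ 2 * p₃ →
      HirzebruchRel ⟨2, (t, q₃, p₃)⟩ ⟨3, (t, q₄, p₄)⟩

/-- `Σ × T`, where `Σ` is the Hirzebruch surface of degree `2`. -/
def Hirzebruch : Type := Quot HirzebruchRel

instance : TopologicalSpace Hirzebruch :=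
  inferInstanceAs (TopologicalSpace (Quot HirzebruchRel))

noncomputable instance : HolSpace Hirzebruch := inferInstanceAs (HolSpace (Quot HirzebruchRel))

namespace Hirzebruch

def chart (i : Fin 4) : LocalChart Hirzebruch := ⟨Set.univ, fun v => Quot.mk _ ⟨i, v.1⟩⟩

def time : Hirzebruch → ℂ :=
  Quot.lift (fun a => a.2.1) (by rintro _ _ (_ | _ | _ | _) <;> rfl)

end Hirzebruch

/-- First blowup, at the point `(q₄, p₄) = (0, 0)`. -/
abbrev firstκ : Unit → LocalChart Hirzebruch := fun _ => Hirzebruch.chart 3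

def S₁ : Type := Blowup firstκ (fun _ _ => 0)

instance : TopologicalSpace S₁ :=
  inferInstanceAs (TopologicalSpace (Blowup firstκ (fun _ _ => 0)))

noncomputable instance : HolSpace S₁ :=
  inferInstanceAs (HolSpace (Blowup firstκ (fun _ _ => 0)))

namespace S₁

/-- The chart `(q⁽¹⁾, p⁽¹⁾)`. -/
def qp : LocalChart S₁ := Blowup.chart₁ firstκ (fun _ _ => 0) ()

/-- The chart `(Q⁽¹⁾, P⁽¹⁾)`. -/
def QP : LocalChart S₁ := Blowup.chart₂ firstκ (fun _ _ => 0) ()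

/-- The original chart `(x, y)`. -/
def xy : LocalChart S₁ := Blowup.oldChart firstκ (fun _ _ => 0) (Hirzebruch.chart 2)

def proj : S₁ → Hirzebruch := Blowup.proj firstκ (fun _ _ => 0)

lemma qp_mem (v : TPlane) : v ∈ qp.dom :=
  ⟨trivial, fun k hk => absurd (Subsingleton.elim k ()) hk⟩

lemma QP_mem (v : TPlane) : v ∈ QP.dom :=
  ⟨trivial, fun k hk => absurd (Subsingleton.elim k ()) hk⟩

end S₁

/-- Second blowup, at the point `(q⁽¹⁾, p⁽¹⁾) = (0, 0)`. -/
abbrev secondκ : Unit → LocalChart S₁ := fun _ => S₁.qp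

/-- The surface `S` (times `T`). -/
def SSpace : Type := Blowup secondκ (fun _ _ => 0)

instance : TopologicalSpace SSpace :=
  inferInstanceAs (TopologicalSpace (Blowup secondκ (fun _ _ => 0)))

noncomputable instance : HolSpace SSpace :=
  inferInstanceAs (HolSpace (Blowup secondκ (fun _ _ => 0)))

namespace SSpace

/-- The chart `(Q⁽¹⁾, P⁽¹⁾)`. -/
def QP₁ : LocalChart SSpace := Blowup.oldChart secondκ (fun _ _ => 0) S₁.QP

/-- The chart `(Q⁽²⁾, P⁽²⁾)`. -/
def QP₂ : LocalChart SSpace := Blowup.chart₂ secondκ (fun _ _ => 0) ()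

/-- The original chart `(x, y)`. -/
def xy : LocalChart SSpace := Blowup.oldChart secondκ (fun _ _ => 0) S₁.xy

def proj : SSpace → S₁ := Blowup.proj secondκ (fun _ _ => 0)

def time (s : SSpace) : ℂ := (s.proj.proj).time

/-- The curve `C = {Q⁽¹⁾ = 0} ∪ {P⁽²⁾ = 0}`. -/
def C : Set SSpace := {s | (∃ t P, QP₁.At (t, 0, P) s) ∨ ∃ t Q, QP₂.At (t, Q, 0) s}

/-- The singular point `a⁽²⁾ = {(Q⁽²⁾, P⁽²⁾) = (0, 4)}` (at any time). -/
def a₂ : Set SSpace := {s | ∃ t, QP₂.At (t, 0, 4) s}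

/-- The chart `(Q⁽¹⁾, P⁽¹⁾)` of the first blowup does not contain the second centre. -/
lemma QP₁_mem (v : TPlane) : v ∈ QP₁.dom := by
  refine ⟨S₁.QP_mem v, fun _ => ?_⟩
  rintro ⟨t, h, e⟩
  let P : S₁ → Prop := Quot.lift
    (fun a => match a with
      | Sum.inl _ => False
      | Sum.inr (Sum.inl ⟨_, v⟩) => v.1.2.1 = 0 ∧ v.1.2.2 = 0
      | Sum.inr (Sum.inr _) => False)
    (by
      rintro _ _ (⟨x, j, v, h⟩ | ⟨x, j, v, h⟩ | ⟨j, v, v', h1, h2, h3⟩)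
      · refine propext ⟨False.elim, fun hv => x.2 () ⟨v.1.1, trivial, ?_⟩⟩
        rw [← h]
        refine congrArg (Hirzebruch.chart 3).map (Subtype.ext ?_)
        simp only [blowMap₁, hv.1, hv.2]
        simp
      · rfl
      · refine propext ⟨fun hv => ?_, False.elim⟩
        rw [hv.1, zero_mul] at h2
        exact zero_ne_one h2)
  have h1 : P (S₁.qp.map ⟨(t, 0, 0), h⟩) := ⟨rfl, rfl⟩
  have h2 : P (S₁.QP.map ⟨v, S₁.QP_mem v⟩) := by
    rw [← e]; exact h1
  exact h2

lemma QP₂_mem (v : TPlane) : v ∈ QP₂.dom :=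
  ⟨S₁.qp_mem _, fun k hk => absurd (Subsingleton.elim k ()) hk⟩

end SSpace

/-! ## The branched double cover `V → U ⊂ S`, and its blowdown `V → W` -/

/-- `(r, s)` and `(R, S)` are glued by `S = 1 / r`, `R = r s`. -/
inductive VRel : TPlane ⊕ TPlane → TPlane ⊕ TPlane → Prop
  | mk (t r s R S : ℂ) : r * S = 1 → R = r * s → VRel (Sum.inl (t, r, s)) (Sum.inr (t, R, S))

/-- The double cover `V` of the neighbourhood `U` of `C`. -/
def VSpace : Type := Quot VRel

namespace VSpace

/-- The double covering `V → U ⊂ S`, with branch curve `C`: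
`(Q⁽¹⁾, P⁽¹⁾) = (s², r)` and `(Q⁽²⁾, P⁽²⁾) = (S, R²)`. -/
def cover : VSpace → SSpace :=
  Quot.lift
    (fun a => match a with
      | Sum.inl (t, r, s) => SSpace.QP₁.map ⟨(t, s ^ 2, r), SSpace.QP₁_mem _⟩
      | Sum.inr (t, R, S) => SSpace.QP₂.map ⟨(t, S, R ^ 2), SSpace.QP₂_mem _⟩)
    (by
      rintro _ _ ⟨t, r, s, R, S, h, rfl⟩
      refine Quot.sound (BlowRel.base₂ _ () _ ?_)
      refine Quot.sound (BlowRel.charts () _ _ rfl ?_ ?_)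
      · simp only [blowMap₂]
        rw [zero_add, mul_comm]; exact h
      · simp only [blowMap₂]
        linear_combination (r * s ^ 2) * h)

/-- The deck involution of the double covering. -/
def deck : VSpace → VSpace :=
  Quot.lift
    (fun a => match a with
      | Sum.inl (t, r, s) => Quot.mk _ (Sum.inl (t, r, -s))
      | Sum.inr (t, R, S) => Quot.mk _ (Sum.inr (t, -R, S)))
    (by
      rintro _ _ ⟨t, r, s, R, S, h, rfl⟩
      exact Quot.sound (VRel.mk _ _ _ _ _ h (by ring)))

/-- The blowdown of `D = {s = 0} ∪ {R = 0}` to the point `p = (0, 0)` of the plane `W`: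
`(r⁽²⁾, s⁽²⁾) = (r s, s) = (R, R S)`. -/
def blowdown : VSpace → TPlane :=
  Quot.lift
    (fun a => match a with
      | Sum.inl (t, r, s) => (t, r * s, s)
      | Sum.inr (t, R, S) => (t, R, R * S))
    (by
      rintro _ _ ⟨t, r, s, R, S, h, rfl⟩
      have : s = r * s * S := by linear_combination (-s) * h
      simp only [← this])

lemma time_cover (v : VSpace) : (cover v).time = (blowdown v).1 := by
  obtain ⟨⟨t, r, s⟩ | ⟨t, R, S⟩⟩ := v <;> rfl

end VSpace

/-- The involution of the plane `W` induced by the deck involution. -/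
def sigmaW (v : TPlane) : TPlane := (v.1, -v.2.1, -v.2.2)

lemma VSpace.blowdown_deck (v : VSpace) : v.deck.blowdown = sigmaW v.blowdown := by
  obtain ⟨⟨t, r, s⟩ | ⟨t, R, S⟩⟩ := v <;>
    simp [VSpace.deck, VSpace.blowdown, sigmaW]

/-! ## The pair of six-time blowups `X → W`

The sign `true` stands for the blowups over `p₊ = (2, 0)`, with the charts `(z⁽ᵏ⁾, w⁽ᵏ⁾)` and
`(Z⁽ᵏ⁾, W⁽ᵏ⁾)`, the sign `false` for those over `p₋ = (-2, 0)`, with the charts `(u⁽ᵏ⁾, v⁽ᵏ⁾)` and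
`(U⁽ᵏ⁾, V⁽ᵏ⁾)`. -/

/-- A stage of the sequence of blowups: a family of surfaces over `W`, with the two charts that
contain the next two centres. -/
structure Stage where
  carrier : Type
  [top : TopologicalSpace carrier]
  [hol : HolSpace carrier]
  chart : Bool → LocalChart carrier
  toW : carrier → TPlane

namespace Stage

attribute [instance] Stage.top Stage.hol

noncomputable def start : Stage := ⟨TPlane, fun _ => ⟨Set.univ, fun v => v.1⟩, id⟩

/-- Blow up the points `(c₊ t, 0)` and `(c₋ t, 0)` of the two charts at once. -/
noncomputable def next (A : Stage) (cplus cminus : ℂ → ℂ) : Stage :=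
  let c : Bool → ℂ → ℂ := fun b => if b then cplus else cminus
  ⟨Blowup A.chart c, Blowup.chart₁ A.chart c, fun x => A.toW (Blowup.proj A.chart c x)⟩

end Stage

/-- Six pairs of blowups; after the last one the charts are `(z⁽⁸⁾, w⁽⁸⁾)` and `(u⁽⁸⁾, v⁽⁸⁾)`. -/
noncomputable def stageX : Stage :=
  (((((Stage.start.next (fun _ => 2) (fun _ => -2)).next (fun _ => 0) (fun _ => 0)).next
    (fun _ => 0) (fun _ => 0)).next (fun _ => 0) (fun _ => 0)).next
    (fun t => t / 2) (fun t => -t / 2)).next (fun _ => 1 / 2) (fun _ => 1 / 2)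

/-- The family of surfaces `X`. -/
def XSpace : Type := stageX.carrier

noncomputable instance : TopologicalSpace XSpace := inferInstanceAs (TopologicalSpace stageX.carrier)

noncomputable instance : HolSpace XSpace := inferInstanceAs (HolSpace stageX.carrier)

namespace XSpace

noncomputable def toW : XSpace → TPlane := stageX.toW

/-- The chart `(z⁽⁸⁾, w⁽⁸⁾)`. -/
noncomputable def zw₈ : LocalChart XSpace := stageX.chart true

/-- The chart `(u⁽⁸⁾, v⁽⁸⁾)`. -/
noncomputable def uv₈ : LocalChart XSpace := stageX.chart false

/-- The point `p` of `X` (at any time). -/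
def p : Set XSpace := {x | x.toW.2 = (0, 0)}

/-- `σ` is a holomorphic involution of `X` induced by the involution of `W`. -/
def IsInducedInvolution (σ : XSpace → XSpace) : Prop :=
  IsHolMap σ ∧ Function.Involutive σ ∧ ∀ x, (σ x).toW = sigmaW x.toW

/-- The fibre of `X` at time `t`. -/
abbrev Fibre (t : ℂ) : Type := {x : XSpace // x.toW.1 = t}

end XSpace

/-! ## Gluing: the surfaces `F` and its resolution -/

section Glue

variable (A : Set SSpace) (B : Set XSpace) (σ : XSpace → XSpace)

/-- The gluing of `A ⊂ S` with `B / σ`, `B ⊂ X`, via `S ⊃ U ← V → W ← X`; the relation `invol` is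
dividing by `σ`. -/
inductive GlueRel : A ⊕ B → A ⊕ B → Prop
  | invol (x y : B) : σ x.1 = y.1 → GlueRel (Sum.inr x) (Sum.inr y)
  | cover (s : A) (x : B) (v : VSpace) : v.cover = s.1 → v.blowdown = x.1.toW →
      GlueRel (Sum.inl s) (Sum.inr x)

def Glue : Type := Quot (GlueRel A B σ)

instance : TopologicalSpace (Glue A B σ) :=
  inferInstanceAs (TopologicalSpace (Quot (GlueRel A B σ)))

noncomputable instance : HolSpace (Glue A B σ) :=
  inferInstanceAs (HolSpace (Quot (GlueRel A B σ)))

namespace Glue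

variable {A B σ}

/-- `e` is the point `s` of `A`. -/
def IsS (s : SSpace) (e : Glue A B σ) : Prop := ∃ h : s ∈ A, Quot.mk _ (Sum.inl ⟨s, h⟩) = e

/-- `e` is the class of the point `x` of `B`. -/
def IsX (x : XSpace) (e : Glue A B σ) : Prop := ∃ h : x ∈ B, Quot.mk _ (Sum.inr ⟨x, h⟩) = e

/-- `e` lies over the time `t`. -/
def AtTime (t : ℂ) (e : Glue A B σ) : Prop :=
  (∃ s, IsS s e ∧ s.time = t) ∨ ∃ x, IsX x e ∧ x.toW.1 = t

end Glue

end Glue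

/-- The family `F = (S \ C) ∪ (X / σ)`: in `S`, the part `U` is replaced by `X / σ`, so that also
the point `a⁽²⁾`, which has been blown up in `X`, is removed from `S`. -/
abbrev FSpace (σ : XSpace → XSpace) : Type := Glue (SSpace.C ∪ SSpace.a₂)ᶜ Set.univ σ

/-- The surface `F_t`. -/
abbrev FFibre (σ : XSpace → XSpace) (t : ℂ) : Type := {f : FSpace σ // Glue.AtTime t f}

/-- The family with the singular point `p` of `F` replaced by the curve `C`. -/
abbrev EbarSpace (σ : XSpace → XSpace) : Type := Glue SSpace.a₂ᶜ XSpace.pᶜ σ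

/-- The compactified surface `Ē_t`. -/
abbrev Ebar (σ : XSpace → XSpace) (t : ℂ) : Type := {e : EbarSpace σ // Glue.AtTime t e}

/-- The map `ρ : Ē_t → F_t` that contracts `C` to the point `p` and is the identity elsewhere. -/
def IsContraction (σ : XSpace → XSpace) (t : ℂ) (ρ : Ebar σ t → FFibre σ t) : Prop :=
  (∀ (s : SSpace) (e : Ebar σ t), s ∉ SSpace.C → Glue.IsS s e.1 → Glue.IsS s (ρ e).1) ∧
  (∀ (x : XSpace) (e : Ebar σ t), Glue.IsX x e.1 → Glue.IsX x (ρ e).1) ∧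
  ∀ (s : SSpace) (e : Ebar σ t), s ∈ SSpace.C → Glue.IsS s e.1 →
    ∃ x ∈ XSpace.p, Glue.IsX x (ρ e).1

/-! ## The first Painlevé equation, vertical leaves, and the space `E_t` -/

/-- The Hamiltonian `H(x, y, t) = y² / 2 - 2 x³ - t x` of the first Painlevé equation. -/
noncomputable def hamiltonianPI (x y t : ℂ) : ℂ := y ^ 2 / 2 - 2 * x ^ 3 - t * x

/-- The Painlevé vector field `∂/∂t + (∂H/∂y) ∂/∂x - (∂H/∂x) ∂/∂y` at the point `(t, x, y)`. -/
noncomputable def fieldPI (v : TPlane) : TPlane :=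
  (1, deriv (fun y => hamiltonianPI v.2.1 y v.1) v.2.2,
    -deriv (fun x => hamiltonianPI x v.2.2 v.1) v.2.1)

/-- The chart `(x, y)` of the total space of the family `Ē`. -/
def chartXY (σ : XSpace → XSpace) : LocalChart (EbarSpace σ) :=
  ⟨{v | ∃ h : v ∈ SSpace.xy.dom, SSpace.xy.map ⟨v, h⟩ ∈ SSpace.a₂ᶜ},
    fun v => Quot.mk _ (Sum.inl ⟨SSpace.xy.map ⟨v.1, v.2.fst⟩, v.2.snd⟩)⟩

/-- The foliation of the total space of `Ē` defined by the first Painlevé equation is transversal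
to the fibre through `e`: the Painlevé vector field, whose `∂/∂t`-component is `1`, extends
holomorphically from the chart `(x, y)` to a neighbourhood of `e` (as a derivation of holomorphic
functions). -/
def IsTransversalPI (σ : XSpace → XSpace) (e : EbarSpace σ) : Prop :=
  ∀ g : EbarSpace σ → ℂ, HolSpace.HolAt g e → ∃ h : EbarSpace σ → ℂ, HolSpace.HolAt h e ∧
    ∀ᶠ e' in 𝓝 e, ∀ v : TPlane, (chartXY σ).At v e' →
      h e' = fderiv ℂ ((chartXY σ).pull g) v (fieldPI v)

/-- The union `V_t` of the vertical leaves in `Ē_t`: the points at which the foliation fails to be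
transversal to the fibre. -/
def verticalLeaves (σ : XSpace → XSpace) (t : ℂ) : Set (Ebar σ t) :=
  {e | ¬ IsTransversalPI σ e.1}

/-- Okamoto's space `E_t = Ē_t \ V_t`. -/
abbrev OkamotoSpace (σ : XSpace → XSpace) (t : ℂ) : Type :=
  {e : Ebar σ t // e ∉ verticalLeaves σ t}

/-- Adjacency in the Dynkin diagram of type `E₈⁽¹⁾`: a chain of the nodes `0, …, 7`, and the node
`8` attached to the node `2`. -/
def AdjE8 (i j : Fin 9) : Prop :=
  (j.1 = i.1 + 1 ∧ j.1 ≤ 7) ∨ (i.1 = j.1 + 1 ∧ i.1 ≤ 7) ∨ (i.1 = 2 ∧ j.1 = 8) ∨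
    (i.1 = 8 ∧ j.1 = 2)

/-- The curves `L 0, …, L 8` form a configuration of `(-2)`-curves of type `E₈⁽¹⁾`. -/
def IsE8Configuration {Y : Type} [TopologicalSpace Y] [HolSpace Y] (L : Fin 9 → Set Y) : Prop :=
  (∀ i, IsSmoothRationalCurve (L i) (-2)) ∧
  ∀ i j, i ≠ j →
    (AdjE8 i j → ∃ y, L i ∩ L j = {y} ∧ CrossTransversally (L i) (L j) y) ∧
    (¬ AdjE8 i j → L i ∩ L j = ∅)

/-! ## The explicit model -/

/-- `(z, w) ↦ (u, v)`. -/
noncomputable def mapZWtoUV (t : ℂ) (a : ℂ × ℂ) : ℂ × ℂ :=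
  (a.1 - 2 * t / a.2 ^ 2 - 8 / a.2 ^ 6, a.2)

/-- `(z, w) ↦ (x, y)`. -/
noncomputable def mapZWtoXY (t : ℂ) (a : ℂ × ℂ) : ℂ × ℂ :=
  (1 / a.2 ^ 2, -2 / a.2 ^ 3 - t * a.2 / 2 - a.2 ^ 2 / 2 + a.1 * a.2 ^ 3 / 2)

/-- `(u, v) ↦ (x, y)`. -/
noncomputable def mapUVtoXY (t : ℂ) (a : ℂ × ℂ) : ℂ × ℂ :=
  (1 / a.2 ^ 2, 2 / a.2 ^ 3 + t * a.2 / 2 - a.2 ^ 2 / 2 + a.1 * a.2 ^ 3 / 2)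

/-- The involution within the chart `(z, w)`. -/
noncomputable def mapSigmaZW (t : ℂ) (a : ℂ × ℂ) : ℂ × ℂ :=
  (-a.1 + 2 * t / a.2 ^ 2 + 8 / a.2 ^ 6, -a.2)

/-- The involution within the chart `(u, v)`. -/
noncomputable def mapSigmaUV (t : ℂ) (a : ℂ × ℂ) : ℂ × ℂ :=
  (-a.1 - 2 * t / a.2 ^ 2 - 8 / a.2 ^ 6, -a.2)

/-- A map of planes is symplectic at `a`: it pulls back `dx ∧ dy` to `dz ∧ dw`. -/
def IsSymplecticAt (f : ℂ × ℂ → ℂ × ℂ) (a : ℂ × ℂ) : Prop :=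
  DifferentiableAt ℂ f a ∧ ∀ b c : ℂ × ℂ,
    (fderiv ℂ f a b).1 * (fderiv ℂ f a c).2 - (fderiv ℂ f a b).2 * (fderiv ℂ f a c).1 =
      b.1 * c.2 - b.2 * c.1

/-- Gluing of `ℂ²_(z,w)` and `ℂ²_(u,v)` along `{w ≠ 0} = {v ≠ 0}`. -/
inductive HornRel (t : ℂ) : (ℂ × ℂ) ⊕ (ℂ × ℂ) → (ℂ × ℂ) ⊕ (ℂ × ℂ) → Prop
  | mk (a : ℂ × ℂ) : a.2 ≠ 0 → HornRel t (Sum.inl a) (Sum.inr (mapZWtoUV t a))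

/-- `ℂ²_(z,w) ∪ ℂ²_(u,v)`. -/
def Horn (t : ℂ) : Type := Quot (HornRel t)

instance (t : ℂ) : TopologicalSpace (Horn t) :=
  inferInstanceAs (TopologicalSpace (Quot (HornRel t)))

noncomputable instance (t : ℂ) : HolSpace (Horn t) :=
  inferInstanceAs (HolSpace (Quot (HornRel t)))

namespace Horn

def zw (t : ℂ) (a : ℂ × ℂ) : Horn t := Quot.mk _ (Sum.inl a)

def uv (t : ℂ) (a : ℂ × ℂ) : Horn t := Quot.mk _ (Sum.inr a)

/-- The involution `σ`, which exchanges the two charts: `(z, w) ↦ (u, v) = (-z, -w)` and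
`(u, v) ↦ (z, w) = (-u, -v)`. -/
def sigma (t : ℂ) : Horn t → Horn t :=
  Quot.lift
    (fun a => match a with
      | Sum.inl a => uv t (-a)
      | Sum.inr a => zw t (-a))
    (by
      rintro _ _ ⟨a, ha⟩
      have e : uv t (-a) = uv t (mapZWtoUV t (-mapZWtoUV t a)) := by
        congr 1
        ext
        · simp only [mapZWtoUV, Prod.fst_neg, Prod.snd_neg]
          rw [Even.neg_pow (by decide), Even.neg_pow (by decide)]
          ring
        · simp [mapZWtoUV]
      exact e.trans (Quot.sound (HornRel.mk _ (by simpa [mapZWtoUV] using ha))).symm)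

end Horn

/-- `(ℂ²_(z,w) ∪ ℂ²_(u,v)) / σ`. -/
def HornQuot (t : ℂ) : Type := Quot (fun a b : Horn t => Horn.sigma t a = b)

instance (t : ℂ) : TopologicalSpace (HornQuot t) :=
  inferInstanceAs (TopologicalSpace (Quot (fun a b : Horn t => Horn.sigma t a = b)))

noncomputable instance (t : ℂ) : HolSpace (HornQuot t) :=
  inferInstanceAs (HolSpace (Quot (fun a b : Horn t => Horn.sigma t a = b)))

def HornQuot.mk (t : ℂ) (a : Horn t) : HornQuot t := Quot.mk _ a

/-- Gluing of `ℂ²_(x,y)` with the quotient. -/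
inductive ModelRel (t : ℂ) : (ℂ × ℂ) ⊕ HornQuot t → (ℂ × ℂ) ⊕ HornQuot t → Prop
  | zw (a : ℂ × ℂ) : a.2 ≠ 0 →
      ModelRel t (Sum.inl (mapZWtoXY t a)) (Sum.inr (HornQuot.mk t (Horn.zw t a)))
  | uv (a : ℂ × ℂ) : a.2 ≠ 0 →
      ModelRel t (Sum.inl (mapUVtoXY t a)) (Sum.inr (HornQuot.mk t (Horn.uv t a)))

/-- `ℂ²_(x,y) ∪ (ℂ²_(z,w) ∪ ℂ²_(u,v)) / σ`. -/
def Model (t : ℂ) : Type := Quot (ModelRel t)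

instance (t : ℂ) : TopologicalSpace (Model t) :=
  inferInstanceAs (TopologicalSpace (Quot (ModelRel t)))

noncomputable instance (t : ℂ) : HolSpace (Model t) :=
  inferInstanceAs (HolSpace (Quot (ModelRel t)))

namespace Model

def xy (t : ℂ) (a : ℂ × ℂ) : Model t := Quot.mk _ (Sum.inl a)

def ofHorn (t : ℂ) (a : Horn t) : Model t := Quot.mk _ (Sum.inr (HornQuot.mk t a))

end Model

/-! Near a movable pole a solution of the first Painlevé equation has `x = 1 / η²` with `η`
vanishing to first order, and `η` is determined only up to sign. This is why a double cover is used.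
In the coordinates `(ξ, η)` of `W` one has `x = 1 / η²`, `y = -ξ / η³`, and the equation becomes `η'
= ξ / 2`, `ξ' = (3/2) (ξ² - 4) / η - t η³`. Along `η = 0` the second component has a pole whose
numerator vanishes exactly at `p_± = (±2, 0)`. Over `p_+` the polar parts met in the successive
charts `(z, w)` are `(3/2) (z² - 4) / w`, `5z / w`, `4z / w`, `3z / w`, `(2z - t) / w`, `(z - 1/2) /
w`. Their zeros are the centres, and each blowup lowers the leading coefficient by one because `w' =
1` at the points over `p_+`. After six blowups the field is polynomial (`fieldZ`,
`fieldRelatedAt_blowMap₁`), with `z` as the free parameter of the pole. The involution `(ξ, η) ↦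
(-ξ, -η)` exchanges the two towers of blowups and lifts because the centres obey `XStage.cen_not`;
two lifts agree on the dense set `η ≠ 0`.

Off `C` the double cover is unramified, so apart from `p` the quotient `X / σ` looks locally like
`X`, and `Ē_t` amounts to the Hirzebruch surface blown up eight times. Self-intersection numbers
follow: the section at infinity has `-2`; the fibre over `x = ∞` starts from `0` and loses two;
every exceptional curve starts from `-1` and all but the last lose one. Here they are obtained from
explicit transition functions (`IsSmoothRationalCurve.of_charts`). In suitable charts the curves are
coordinate lines meeting only at origins, so the diagram `E₈⁽¹⁾` becomes a finite check on labels. A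
line is vertical because some coordinate has a derivative with a genuine pole there
(`IsPainleveField.not_isTransversalPI`); in the charts `(x, y)` and `(z⁽⁸⁾, w⁽⁸⁾)` the field is
holomorphic. Together these give `verticalLeaves_eq`.

The surface `F_t` has at `p` the quotient singularity `W / ±1`. A function on `F_t` near `p` pulls
back to an even function on the double cover, hence is an analytic function of the square of the
branched coordinate (`AnalyticAt.exists_comp_sq`); this makes the contraction holomorphic along `C`.
Properness follows from compact tubes around `C` that shrink to `C`.

What is left of `Ē_t` is covered by the chart `(x, y)` and the last two charts modulo `σ`. Comparing
their projections to `W` gives the stated gluing formulas.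

All spaces are quotients of disjoint unions of charts. Two devices control them. `EtaleRel` makes
the quotient map open and lets it detect holomorphy. Predicates that are invariant under the
generating relation bound the generated equivalence from above, which decides when two points are
equal. -/

/-! ## Local biholomorphisms of complex ringed spaces -/

section HolOpen

variable {A B C : Type} [TopologicalSpace A] [HolSpace A] [TopologicalSpace B] [HolSpace B]
  [TopologicalSpace C] [HolSpace C]

/-- `f` is holomorphic at the point `a`. -/
def HolMapAt (f : A → B) (a : A) : Prop :=
  ContinuousAt f a ∧ ∀ g : B → ℂ, HolSpace.HolAt g (f a) → HolSpace.HolAt (g ∘ f) a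

/-- `f` is continuous and open at `a`, and detects holomorphy of germs at `f a`. -/
def HolOpenAt (f : A → B) (a : A) : Prop :=
  map f (𝓝 a) = 𝓝 (f a) ∧
    ∀ g : B → ℂ, HolSpace.HolAt g (f a) ↔ HolSpace.HolAt (g ∘ f) a

theorem HolSpace.holAt_congr {f g : A → ℂ} {x : A} (h : f =ᶠ[𝓝 x] g) :
    HolSpace.HolAt f x ↔ HolSpace.HolAt g x :=
  ⟨fun k => HolSpace.congr k h, fun k => HolSpace.congr k h.symm⟩

theorem isHolMap_iff {f : A → B} : IsHolMap f ↔ ∀ a, HolMapAt f a :=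
  ⟨fun h a => ⟨h.1.continuousAt, h.2 a⟩,
    fun h => ⟨continuous_iff_continuousAt.2 fun a => (h a).1, fun a => (h a).2⟩⟩

theorem HolOpenAt.holMapAt {f : A → B} {a : A} (h : HolOpenAt f a) : HolMapAt f a :=
  ⟨h.1.le, fun g => (h.2 g).1⟩

theorem HolOpenAt.continuousAt {f : A → B} {a : A} (h : HolOpenAt f a) : ContinuousAt f a :=
  h.1.le

theorem HolMapAt.comp {g : B → C} {f : A → B} {a : A} (hg : HolMapAt g (f a))
    (hf : HolMapAt f a) : HolMapAt (g ∘ f) a :=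
  ⟨ContinuousAt.comp hg.1 hf.1, fun k hk => hf.2 (k ∘ g) (hg.2 k hk)⟩

theorem HolOpenAt.comp {g : B → C} {f : A → B} {a : A} (hg : HolOpenAt g (f a))
    (hf : HolOpenAt f a) : HolOpenAt (g ∘ f) a :=
  ⟨by rw [← map_map, hf.1, hg.1, Function.comp], fun k => (hg.2 k).trans (hf.2 (k ∘ g))⟩

/-- This passes from a chart `f` to the space: the neighbourhood filter and the holomorphic germs at
`f a` are both read off at `a`. Injectivity of `f` is not needed, so `f` may be a quotient map at a
fixed point of an involution. -/
theorem HolOpenAt.cancel {g : B → C} {f : A → B} {a : A} (hf : HolOpenAt f a)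
    (h : HolOpenAt (g ∘ f) a) : HolOpenAt g (f a) :=
  ⟨by rw [← hf.1, map_map, h.1, Function.comp], fun k => (h.2 k).trans (hf.2 (k ∘ g)).symm⟩

theorem HolOpenAt.cancel_holMapAt {g : B → C} {f : A → B} {a : A} (hf : HolOpenAt f a)
    (h : HolMapAt (g ∘ f) a) : HolMapAt g (f a) :=
  ⟨by rw [ContinuousAt, ← hf.1, tendsto_map'_iff]; exact h.1,
    fun k hk => (hf.2 (k ∘ g)).2 (h.2 k hk)⟩

theorem HolMapAt.congr {f g : A → B} {a : A} (h : HolMapAt f a) (e : f =ᶠ[𝓝 a] g) :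
    HolMapAt g a := by
  refine ⟨h.1.congr e, fun k hk => HolSpace.congr (h.2 k (by rwa [e.eq_of_nhds])) ?_⟩
  filter_upwards [e] with x hx
  simp [hx]

theorem HolOpenAt.congr {f g : A → B} {a : A} (h : HolOpenAt f a) (e : f =ᶠ[𝓝 a] g) :
    HolOpenAt g a := by
  refine ⟨by rw [← map_congr e, h.1, e.eq_of_nhds], fun k => ?_⟩
  rw [← e.eq_of_nhds, h.2 k]
  refine HolSpace.holAt_congr ?_
  filter_upwards [e] with x hx
  simp [hx]

theorem holOpenAt_id (a : A) : HolOpenAt (id : A → A) a := ⟨map_id, fun _ => Iff.rfl⟩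

/-- A germ with a holomorphic inverse. -/
theorem HolOpenAt.of_inverse {f : A → B} {g : B → A} {a : A} (hf : HolMapAt f a)
    (hg : HolMapAt g (f a)) (hgf : ∀ᶠ x in 𝓝 a, g (f x) = x)
    (hfg : ∀ᶠ y in 𝓝 (f a), f (g y) = y) : HolOpenAt f a := by
  have e : g (f a) = a := hgf.self_of_nhds
  refine ⟨le_antisymm hf.1 ?_, fun k => ⟨hf.2 k, fun hk => ?_⟩⟩
  · intro s hs
    have h1 : ∀ᶠ y in 𝓝 (f a), f (g y) ∈ s := by
      have : Tendsto g (𝓝 (f a)) (𝓝 a) := by simpa [ContinuousAt, e] using hg.1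
      exact this hs
    filter_upwards [h1, hfg] with y hy hy'
    rwa [hy'] at hy
  · refine HolSpace.congr (hg.2 (k ∘ f) (by rwa [e])) ?_
    filter_upwards [hfg] with y hy
    simp [hy]

theorem holMapAt_subtype_val {p : A → Prop} (x : Subtype p) :
    HolMapAt (Subtype.val : Subtype p → A) x :=
  ⟨continuous_subtype_val.continuousAt, fun g hg => ⟨g, hg, EventuallyEq.rfl⟩⟩

theorem holOpenAt_subtype_val {p : A → Prop} (x : Subtype p) (h : ∀ᶠ y in 𝓝 x.1, p y) :
    HolOpenAt (Subtype.val : Subtype p → A) x := by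
  have e : map (Subtype.val : Subtype p → A) (𝓝 x) = 𝓝 x.1 := map_nhds_subtype_val_eq_nhds h
  refine ⟨e, fun g => ⟨(holMapAt_subtype_val x).2 g, ?_⟩⟩
  rintro ⟨k, hk, hkg⟩
  refine HolSpace.congr hk ?_
  rw [EventuallyEq, ← e, eventually_map]
  exact hkg
where
  map_nhds_subtype_val_eq_nhds {p : A → Prop} {x : Subtype p} (h : ∀ᶠ y in 𝓝 x.1, p y) :
      map (Subtype.val : Subtype p → A) (𝓝 x) = 𝓝 x.1 := by
    rw [nhds_subtype_eq_comap]
    exact map_comap_of_mem (mem_of_superset h fun y hy => ⟨⟨y, hy⟩, rfl⟩)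

theorem HolMapAt.codRestrict {q : B → Prop} {f : A → B} {a : A} (hf : HolMapAt f a)
    (h : ∀ x, q (f x)) : HolMapAt (fun x => (⟨f x, h x⟩ : Subtype q)) a := by
  refine ⟨hf.1.codRestrict h, ?_⟩
  rintro g ⟨k, hk, hkg⟩
  refine HolSpace.congr (hf.2 k hk) ?_
  exact (hf.1.codRestrict h).eventually hkg

-- Extension by zero outside `q` is allowed here because `f` maps a neighbourhood of `a` onto one of
-- `f a`; the values off `q` are never seen.
open Classical in
theorem HolOpenAt.codRestrict {q : B → Prop} {f : A → B} {a : A} (hf : HolOpenAt f a)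
    (h : ∀ x, q (f x)) : HolOpenAt (fun x => (⟨f x, h x⟩ : Subtype q)) a := by
  refine ⟨?_, fun g => ⟨(hf.holMapAt.codRestrict h).2 g, fun hg => ?_⟩⟩
  · rw [nhds_subtype_eq_comap]
    rw [← hf.1]
    exact (comap_map (f := map (fun x => (⟨f x, h x⟩ : Subtype q)) (𝓝 a))
      Subtype.val_injective).symm
  · refine ⟨fun y => if hy : q y then g ⟨y, hy⟩ else 0, ?_, ?_⟩
    · rw [hf.2]
      refine HolSpace.congr hg (Eventually.of_forall fun x => ?_)
      simp [h x]
    · refine Eventually.of_forall fun y => ?_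
      simp [y.2]

theorem holOpenAt_inl (a : A) : HolOpenAt (Sum.inl : A → A ⊕ B) a :=
  ⟨(nhds_inl a).symm, fun _ => Iff.rfl⟩

theorem holOpenAt_inr (b : B) : HolOpenAt (Sum.inr : B → A ⊕ B) b :=
  ⟨(nhds_inr b).symm, fun _ => Iff.rfl⟩

theorem holOpenAt_sigmaMk {J : Type} {F : J → Type} [∀ j, TopologicalSpace (F j)]
    [∀ j, HolSpace (F j)] (j : J) (a : F j) : HolOpenAt (fun b => (⟨j, b⟩ : Σ j, F j)) a :=
  ⟨(Sigma.nhds_mk j a).symm, fun _ => Iff.rfl⟩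

theorem holMapAt_affine {E F : Type} [NormedAddCommGroup E] [NormedSpace ℂ E]
    [NormedAddCommGroup F] [NormedSpace ℂ F] {f : E → F} {a : E} (h : AnalyticAt ℂ f a) :
    HolMapAt f a :=
  ⟨h.continuousAt, fun _ hg => AnalyticAt.comp hg h⟩

theorem HolOpenAt.of_analytic {E F : Type} [NormedAddCommGroup E] [NormedSpace ℂ E]
    [NormedAddCommGroup F] [NormedSpace ℂ F] {f : E → F} {g : F → E} {a : E}
    (hf : AnalyticAt ℂ f a) (hg : AnalyticAt ℂ g (f a)) (hgf : ∀ᶠ x in 𝓝 a, g (f x) = x)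
    (hfg : ∀ᶠ y in 𝓝 (f a), f (g y) = y) : HolOpenAt f a :=
  .of_inverse (holMapAt_affine hf) (holMapAt_affine hg) hgf hfg

/-- The inverse function theorem. -/
theorem exists_holOpenAt_of_hasFDerivAt {E F : Type} [NormedAddCommGroup E] [NormedSpace ℂ E]
    [NormedAddCommGroup F] [NormedSpace ℂ F] [CompleteSpace E] [CompleteSpace F] {f : E → F} {f' : E ≃L[ℂ] F}
    {a : E} (hf : AnalyticAt ℂ f a) (h : HasFDerivAt f (f' : E →L[ℂ] F) a) :
    ∃ U, IsOpen U ∧ a ∈ U ∧ Set.InjOn f U ∧ ∀ w ∈ U, HolOpenAt f w := by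
  have hs : HasStrictFDerivAt f (f' : E →L[ℂ] F) a := by
    have := hf.hasStrictFDerivAt
    rwa [h.fderiv] at this
  let P := hs.toOpenPartialHomeomorph f
  have hPa : a ∈ P.source := hs.mem_toOpenPartialHomeomorph_source
  have hsymm : AnalyticAt ℂ P.symm (f a) :=
    P.analyticAt_symm' hPa (i := f') hf h.fderiv
  have h1 : ∀ᶠ w in 𝓝 a, AnalyticAt ℂ f w := hf.eventually_analyticAt
  have h2 : ∀ᶠ w in 𝓝 a, AnalyticAt ℂ P.symm (f w) :=
    hf.continuousAt.eventually hsymm.eventually_analyticAt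
  obtain ⟨U, hU, hUo, haU⟩ := eventually_nhds_iff.1
    ((h1.and h2).and (P.open_source.mem_nhds hPa))
  refine ⟨U, hUo, haU, fun x hx y hy e => P.injOn (hU x hx).2 (hU y hy).2 e, fun w hw => ?_⟩
  obtain ⟨⟨k1, k2⟩, k3⟩ := hU w hw
  refine .of_analytic k1 k2 ?_ ?_
  · filter_upwards [P.open_source.mem_nhds k3] with x hx
    exact P.left_inv hx
  · filter_upwards [P.open_target.mem_nhds (P.map_source k3)] with y hy
    exact P.right_inv hy

theorem IsOpenHolEmbedding.of_holOpenAt {f : A → B} (hf : ∀ a, HolOpenAt f a)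
    (hi : Function.Injective f) : IsOpenHolEmbedding f := by
  refine ⟨.of_continuous_injective_isOpenMap
    (continuous_iff_continuousAt.2 fun a => (hf a).continuousAt) hi
    (IsOpenMap.of_nhds_le fun a => (hf a).1.ge), isHolMap_iff.2 fun a => (hf a).holMapAt,
    fun a g => ((hf a).2 g).2⟩

theorem IsOpenHolEmbedding.holOpenAt {f : A → B} (hf : IsOpenHolEmbedding f) (a : A) :
    HolOpenAt f a :=
  ⟨hf.1.map_nhds_eq a, fun g => ⟨hf.2.1.2 a g, hf.2.2 a g⟩⟩

/-- Restriction of a local biholomorphism to fibres. -/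
theorem HolOpenAt.fibre {p : A → Prop} {q : B → Prop} {f : A → B} (hq : ∀ a, p a ↔ q (f a))
    (a : Subtype p) (hf : HolOpenAt f a.1) {N : Set A} (hN : N ∈ 𝓝 a.1) (hi : Set.InjOn f N) :
    HolOpenAt (fun x : Subtype p => (⟨f x.1, (hq x.1).1 x.2⟩ : Subtype q)) a := by
  have hm := (hf.holMapAt.comp (holMapAt_subtype_val a)).codRestrict
    (q := q) (fun x => (hq x.1).1 x.2)
  have hop : map (fun x : Subtype p => (⟨f x.1, (hq x.1).1 x.2⟩ : Subtype q)) (𝓝 a) =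
      𝓝 ⟨f a.1, (hq a.1).1 a.2⟩ := by
    refine le_antisymm hm.1 fun s hs => ?_
    rw [mem_map, nhds_subtype_eq_comap, mem_comap] at hs
    obtain ⟨t, ht, hts⟩ := hs
    rw [nhds_subtype_eq_comap, mem_comap]
    refine ⟨f '' t, by rw [← hf.1]; exact image_mem_map ht, ?_⟩
    rintro ⟨_, hy⟩ ⟨x, hx, rfl⟩
    exact hts (show (⟨x, (hq x).2 hy⟩ : Subtype p) ∈ _ from hx)
  refine ⟨hop, fun g => ⟨hm.2 g, ?_⟩⟩
  rintro ⟨k, hk, hkg⟩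
  have : Nonempty A := ⟨a.1⟩
  have hinv : ∀ x ∈ N, Function.invFunOn f N (f x) = x := fun x hx =>
    hi.leftInvOn_invFunOn hx
  -- A function on the fibre of `A` extends to a germ `k` on `A`, and the local inverse of `f`
  -- carries `k` to `B`. This is where injectivity on `N` enters.
  refine ⟨k ∘ Function.invFunOn f N, ?_, ?_⟩
  · rw [hf.2]
    refine HolSpace.congr hk ?_
    filter_upwards [hN] with x hx
    simp [hinv x hx]
  · rw [EventuallyEq, ← hop, eventually_map]
    have : ∀ᶠ x : Subtype p in 𝓝 a, x.1 ∈ N := continuous_subtype_val.continuousAt hN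
    filter_upwards [hkg, this] with x hx hx'
    simp only [Function.comp] at hx ⊢
    rw [hinv _ hx', ← hx]

/-- A relation all of whose instances extend to germs of local biholomorphisms. -/
def EtaleRel (r : A → A → Prop) : Prop :=
  ∀ a b, r a b → ∃ (Z : Type) (_ : TopologicalSpace Z) (_ : HolSpace Z) (z : Z) (f g : Z → A),
    f z = a ∧ g z = b ∧ HolOpenAt f z ∧ HolOpenAt g z ∧
      ∀ᶠ y in 𝓝 z, Quot.mk r (f y) = Quot.mk r (g y)

namespace EtaleRel

variable {r : A → A → Prop}

/-- Preimages under `Quot.mk` are saturated, so the germs `f` and `g` through a related pair carry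
the condition from one point to the other. The generated equivalence is followed one step at a time.
-/
theorem mem_nhds_iff (hr : EtaleRel r) {a b : A} (h : Quot.mk r a = Quot.mk r b)
    (s : Set (Quot r)) : Quot.mk r ⁻¹' s ∈ 𝓝 a ↔ Quot.mk r ⁻¹' s ∈ 𝓝 b := by
  replace h := Quot.eqvGen_exact h
  induction h with
  | rel a b h =>
    obtain ⟨Z, _, _, z, f, g, rfl, rfl, hf, hg, e⟩ := hr _ _ h
    rw [← hf.1, ← hg.1, mem_map, mem_map]
    refine congr_sets ?_
    filter_upwards [e] with y hy
    exact iff_of_eq (congrArg (· ∈ s) hy)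
  | refl => rfl
  | symm _ _ _ ih => exact ih.symm
  | trans _ _ _ _ _ ih ih' =>
    exact ih.trans ih'

theorem holAt_iff (hr : EtaleRel r) {a b : A} (h : Quot.mk r a = Quot.mk r b)
    (k : Quot r → ℂ) : HolSpace.HolAt (k ∘ Quot.mk r) a ↔ HolSpace.HolAt (k ∘ Quot.mk r) b := by
  replace h := Quot.eqvGen_exact h
  induction h with
  | rel a b h =>
    obtain ⟨Z, _, _, z, f, g, rfl, rfl, hf, hg, e⟩ := hr _ _ h
    rw [hf.2, hg.2]
    refine HolSpace.holAt_congr ?_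
    filter_upwards [e] with y hy
    simp [hy]
  | refl => rfl
  | symm _ _ _ ih => exact ih.symm
  | trans _ _ _ _ _ ih ih' =>
    exact ih.trans ih'

theorem map_nhds (hr : EtaleRel r) (a : A) : map (Quot.mk r) (𝓝 a) = 𝓝 (Quot.mk r a) := by
  refine le_antisymm continuous_quot_mk.continuousAt fun s hs => ?_
  rw [mem_map] at hs
  -- The witness consists of the classes all of whose representatives have the preimage of `s` as a
  -- neighbourhood. By `mem_nhds_iff` one representative suffices, so this set is open.
  refine _root_.mem_nhds_iff.2 ⟨{y | ∀ b, Quot.mk r b = y → Quot.mk r ⁻¹' s ∈ 𝓝 b}, ?_, ?_, ?_⟩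
  · intro y hy
    obtain ⟨b, rfl⟩ := Quot.exists_rep y
    exact (mem_of_mem_nhds (hy b rfl) : b ∈ Quot.mk r ⁻¹' s)
  · refine isOpen_coinduced.2 (isOpen_iff_mem_nhds.2 fun b hb => ?_)
    have := hb b rfl
    filter_upwards [eventually_mem_nhds_iff.2 this] with c hc
    intro d hd
    exact (hr.mem_nhds_iff hd s).2 hc
  · intro b hb
    exact (hr.mem_nhds_iff hb s).2 hs

theorem holOpenAt (hr : EtaleRel r) (a : A) : HolOpenAt (Quot.mk r) a := by
  refine ⟨hr.map_nhds a, fun g => ⟨?_, fun h => ?_⟩⟩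
  · rintro ⟨O, -, ha, h⟩
    exact h a ha
  · have h1 : ∀ᶠ x in 𝓝 (Quot.mk r a), ∀ b, Quot.mk r b = x →
        HolSpace.HolAt (g ∘ Quot.mk r) b := by
      rw [← hr.map_nhds a, eventually_map]
      filter_upwards [HolSpace.nearby h] with c hc b hb
      exact (hr.holAt_iff hb g).2 hc
    obtain ⟨O, hO, hOo, haO⟩ := eventually_nhds_iff.1 h1
    exact ⟨O, hOo, haO, fun b hb => hO _ hb b rfl⟩

end EtaleRel

/-- Separation of two points in terms of charts. -/
theorem exists_disjoint_nhds_of_isClosed {A B Y : Type} [TopologicalSpace A] [TopologicalSpace B]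
    [TopologicalSpace Y] {f : A → Y} {g : B → Y} (hf : ∀ a, map f (𝓝 a) = 𝓝 (f a))
    (hg : ∀ b, map g (𝓝 b) = 𝓝 (g b)) (h : IsClosed {x : A × B | f x.1 = g x.2}) {a : A} {b : B}
    (hab : f a ≠ g b) : Disjoint (𝓝 (f a)) (𝓝 (g b)) := by
  have : {x : A × B | f x.1 = g x.2}ᶜ ∈ 𝓝 (a, b) := h.isOpen_compl.mem_nhds hab
  rw [nhds_prod_eq, mem_prod_iff] at this
  obtain ⟨s, hs, t, ht, hst⟩ := this
  rw [← hf, ← hg, disjoint_iff, ← Filter.empty_mem_iff_bot, mem_inf_iff]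
  refine ⟨_, image_mem_map hs, _, image_mem_map ht, ?_⟩
  refine (Set.eq_empty_iff_forall_notMem.2 ?_).symm
  rintro _ ⟨⟨x, hx, rfl⟩, y, hy, e⟩
  exact hst (Set.mk_mem_prod hx hy) e.symm

end HolOpen

attribute [fun_prop] analyticAt_fst analyticAt_snd

/-! ## Blowups of families of surfaces -/

/-- An injective chart with open domain that is biholomorphic onto its image and respects the
time. -/
structure LocalChart.IsGood {X : Type} [TopologicalSpace X] [HolSpace X] (κ : LocalChart X)
    (τ : X → ℂ) : Prop where
  isOpen : IsOpen κ.dom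
  inj : Function.Injective κ.map
  hol : ∀ v, HolOpenAt κ.map v
  time : ∀ v, τ (κ.map v) = v.1.1

/-- The hypotheses under which centres are blown up. -/
structure IsBlowupDatum {X J : Type} [TopologicalSpace X] [HolSpace X] (κ : J → LocalChart X)
    (c : J → ℂ → ℂ) (τ : X → ℂ) : Prop where
  t2 : T2Space X
  cont : Continuous τ
  good : ∀ j, (κ j).IsGood τ
  analytic : ∀ j t, AnalyticAt ℂ (c j) t
  mem : ∀ j t, (t, c j t, 0) ∈ (κ j).dom

section BlowMaps

variable {J : Type} {c : J → ℂ → ℂ}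

theorem analyticAt_blowMap₁ {j : J} (hc : ∀ t, AnalyticAt ℂ (c j) t) (v : TPlane) :
    AnalyticAt ℂ (blowMap₁ c j) v := by
  have h : AnalyticAt ℂ (fun v : TPlane => c j v.1) v := (hc v.1).comp (f := Prod.fst) (by fun_prop)
  unfold blowMap₁
  fun_prop

theorem analyticAt_blowMap₂ {j : J} (hc : ∀ t, AnalyticAt ℂ (c j) t) (v : TPlane) :
    AnalyticAt ℂ (blowMap₂ c j) v := by
  have h : AnalyticAt ℂ (fun v : TPlane => c j v.1) v := (hc v.1).comp (f := Prod.fst) (by fun_prop)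
  unfold blowMap₂
  fun_prop

theorem eventually_ne_of_continuousAt {E : Type} [TopologicalSpace E] {f : E → ℂ} {v : E}
    (hf : ContinuousAt f v) {a : ℂ} (h : f v ≠ a) : ∀ᶠ w in 𝓝 v, f w ≠ a :=
  hf.eventually (isOpen_ne.mem_nhds h)

theorem holOpenAt_blowMap₁ {j : J} (hc : ∀ t, AnalyticAt ℂ (c j) t) {v : TPlane}
    (hv : v.2.2 ≠ 0) : HolOpenAt (blowMap₁ c j) v := by
  have h : AnalyticAt ℂ (fun v : TPlane => c j v.1) (blowMap₁ c j v) :=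
    (hc _).comp (f := Prod.fst) (by fun_prop)
  refine .of_analytic (g := fun u => (u.1, (u.2.1 - c j u.1) / u.2.2, u.2.2))
    (analyticAt_blowMap₁ hc v) ?_ ?_ ?_
  · have : (blowMap₁ c j v).2.2 ≠ 0 := hv
    fun_prop (disch := assumption)
  · filter_upwards [eventually_ne_of_continuousAt (f := fun v : TPlane => v.2.2) (by fun_prop) hv]
      with w hw
    ext <;> simp [blowMap₁, hw]
  · filter_upwards [eventually_ne_of_continuousAt (f := fun v : TPlane => v.2.2)
      (v := blowMap₁ c j v) (by fun_prop) hv] with w hw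
    ext <;> simp [blowMap₁, hw]

theorem holOpenAt_blowMap₂ {j : J} (hc : ∀ t, AnalyticAt ℂ (c j) t) {v : TPlane}
    (hv : v.2.1 ≠ 0) : HolOpenAt (blowMap₂ c j) v := by
  have h : AnalyticAt ℂ (fun v : TPlane => c j v.1) (blowMap₂ c j v) :=
    (hc _).comp (f := Prod.fst) (by fun_prop)
  have h0 : (blowMap₂ c j v).2.1 - c j (blowMap₂ c j v).1 ≠ 0 := by simpa [blowMap₂] using hv
  refine .of_analytic (g := fun u => (u.1, u.2.1 - c j u.1, u.2.2 / (u.2.1 - c j u.1)))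
    (analyticAt_blowMap₂ hc v) ?_ ?_ ?_
  · fun_prop (disch := assumption)
  · filter_upwards [eventually_ne_of_continuousAt (f := fun v : TPlane => v.2.1) (by fun_prop) hv]
      with w hw
    ext <;> simp [blowMap₂, hw]
  · filter_upwards [eventually_ne_of_continuousAt (f := fun v : TPlane => v.2.1 - c j v.1)
      (v := blowMap₂ c j v) (by have := h.continuousAt; fun_prop) h0] with w hw
    ext <;> simp [blowMap₂]
    field_simp

end BlowMaps

namespace Blowup

variable {X J : Type} {κ : J → LocalChart X} {c : J → ℂ → ℂ}

/-- A point that is not blown up. -/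
def base (x : {x : X // ∀ j, ¬ IsCentre κ c j x}) : Blowup κ c := Quot.mk _ (Sum.inl x)

theorem cases (x : Blowup κ c) : (∃ a, base a = x) ∨ (∃ j v, (chart₁ κ c j).map v = x) ∨
    ∃ j v, (chart₂ κ c j).map v = x := by
  obtain ⟨a | ⟨j, v⟩ | ⟨j, v⟩⟩ := x
  · exact .inl ⟨a, rfl⟩
  · exact .inr (.inl ⟨j, v, rfl⟩)
  · exact .inr (.inr ⟨j, v, rfl⟩)

theorem proj_chart₁ (j : J) (v : blowDom₁ κ c j) :
    proj κ c ((chart₁ κ c j).map v) = (κ j).map ⟨_, v.2.fst⟩ := rfl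

theorem proj_chart₂ (j : J) (v : blowDom₂ κ c j) :
    proj κ c ((chart₂ κ c j).map v) = (κ j).map ⟨_, v.2.fst⟩ := rfl

theorem base_eq_chart₁ {x : {x : X // ∀ j, ¬ IsCentre κ c j x}} {j : J} {v : blowDom₁ κ c j} :
    base x = (chart₁ κ c j).map v ↔ x.1 = (κ j).map ⟨_, v.2.fst⟩ :=
  ⟨fun h => congrArg (proj κ c) h, fun h => Quot.sound (.base₁ x j v h.symm)⟩

theorem base_eq_chart₂ {x : {x : X // ∀ j, ¬ IsCentre κ c j x}} {j : J} {v : blowDom₂ κ c j} :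
    base x = (chart₂ κ c j).map v ↔ x.1 = (κ j).map ⟨_, v.2.fst⟩ :=
  ⟨fun h => congrArg (proj κ c) h, fun h => Quot.sound (.base₂ x j v h.symm)⟩

theorem base_eq_base {x y : {x : X // ∀ j, ¬ IsCentre κ c j x}} :
    base x = base y ↔ x.1 = y.1 :=
  ⟨fun h => congrArg (proj κ c) h, fun h => congrArg base (Subtype.ext h)⟩

/-- A point off the centres has exactly one preimage. -/
theorem eq_base {x : Blowup κ c} (h : ∀ j, ¬ IsCentre κ c j (proj κ c x)) :
    x = base ⟨proj κ c x, h⟩ := by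
  obtain ⟨a, rfl⟩ | ⟨j, v, rfl⟩ | ⟨j, v, rfl⟩ := x.cases
  · rfl
  · exact (base_eq_chart₁.2 rfl).symm
  · exact (base_eq_chart₂.2 rfl).symm

theorem eq_of_proj_eq {x y : Blowup κ c} (h : ∀ j, ¬ IsCentre κ c j (proj κ c x))
    (e : proj κ c x = proj κ c y) : x = y := by
  rw [eq_base h, eq_base (x := y) (by rwa [← e])]
  exact congrArg base (Subtype.ext e)

/-- `x` lies over the `j`-th centre at the time `t`, in the direction `(a : b)`. -/
def slope (j : J) (t a b : ℂ) : Blowup κ c → Prop :=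
  Quot.lift
    (fun x => match x with
      | Sum.inl _ => False
      | Sum.inr (Sum.inl ⟨k, v⟩) => k = j ∧ v.1.1 = t ∧ v.1.2.2 = 0 ∧ v.1.2.1 * b = a
      | Sum.inr (Sum.inr ⟨k, v⟩) => k = j ∧ v.1.1 = t ∧ v.1.2.1 = 0 ∧ b = a * v.1.2.2)
    (by
      rintro _ _ (⟨x, k, ⟨⟨s, q, p⟩, hv⟩, h⟩ | ⟨x, k, ⟨⟨s, q, p⟩, hv⟩, h⟩ |
        ⟨k, ⟨⟨s, q, p⟩, hv⟩, ⟨⟨s', q', p'⟩, hv'⟩, h1, h2, h3⟩)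
      · refine propext ⟨False.elim, ?_⟩
        rintro ⟨-, -, h2, -⟩
        refine x.2 k ⟨s, ?_⟩
        simp only at h2
        subst h2
        simp only [← h, blowMap₁, mul_zero, add_zero]
        exact ⟨by simpa [blowMap₁] using hv.fst, rfl⟩
      · refine propext ⟨False.elim, ?_⟩
        rintro ⟨-, -, h2, -⟩
        refine x.2 k ⟨s, ?_⟩
        simp only at h2
        subst h2
        simp only [← h, blowMap₂, zero_mul, add_zero]
        exact ⟨by simpa [blowMap₂] using hv.fst, rfl⟩
      · simp only at h1 h2 h3
        subst h1 h3
        have hp : p' ≠ 0 := right_ne_zero_of_mul_eq_one h2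
        refine propext (and_congr Iff.rfl (and_congr Iff.rfl (and_congr (by simp [hp]) ?_)))
        constructor
        · rintro rfl
          linear_combination (-b) * h2
        · rintro rfl
          linear_combination a * h2)

theorem chart₁_eq_of_ne {j : J} {v : blowDom₁ κ c j} {y : Blowup κ c}
    (hy : ¬ IsCentre κ c j (proj κ c y)) :
    (chart₁ κ c j).map v = y ↔ (κ j).map ⟨_, v.2.fst⟩ = proj κ c y := by
  refine ⟨fun h => congrArg (proj κ c) h, fun h => eq_of_proj_eq ?_ h⟩
  intro l
  by_cases hl : l = j
  · rw [hl, show proj κ c ((chart₁ κ c j).map v) = proj κ c y from h]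
    exact hy
  · exact v.2.snd l hl

theorem chart₂_eq_of_ne {j : J} {v : blowDom₂ κ c j} {y : Blowup κ c}
    (hy : ¬ IsCentre κ c j (proj κ c y)) :
    (chart₂ κ c j).map v = y ↔ (κ j).map ⟨_, v.2.fst⟩ = proj κ c y := by
  refine ⟨fun h => congrArg (proj κ c) h, fun h => eq_of_proj_eq ?_ h⟩
  intro l
  by_cases hl : l = j
  · rw [hl, show proj κ c ((chart₂ κ c j).map v) = proj κ c y from h]
    exact hy
  · exact v.2.snd l hl

end Blowup

/-! ### Equality of points and local biholomorphy in the charts of a blowup -/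

namespace IsBlowupDatum

open Blowup

variable {X J : Type} [TopologicalSpace X] [HolSpace X] {κ : J → LocalChart X} {c : J → ℂ → ℂ}
  {τ : X → ℂ}

section

variable (D : IsBlowupDatum κ c τ)
include D

theorem isCentre_iff {j : J} {v : TPlane} (h : v ∈ (κ j).dom) :
    IsCentre κ c j ((κ j).map ⟨v, h⟩) ↔ v.2.1 = c j v.1 ∧ v.2.2 = 0 := by
  constructor
  · rintro ⟨t, ht, e⟩
    have := (D.good j).inj e
    rw [Subtype.mk.injEq] at this
    simp [← this]
  · rintro ⟨h1, h2⟩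
    obtain ⟨t, q, p⟩ := v
    simp only at h1 h2
    subst h1 h2
    exact ⟨t, h, rfl⟩

/-- The charts respect the time, so the only candidate is the centre at the time of `x`. Being a
centre thus becomes an equation, which is closed in a Hausdorff space. -/
theorem isCentre_iff' {j : J} {x : X} :
    IsCentre κ c j x ↔ (κ j).map ⟨_, D.mem j (τ x)⟩ = x := by
  constructor
  · rintro ⟨t, ht, rfl⟩
    simp only [(D.good j).time]
  · exact fun h => ⟨_, D.mem j (τ x), h⟩

theorem isClosed_isCentre (j : J) : IsClosed {x | IsCentre κ c j x} := by
  have := D.t2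
  simp_rw [D.isCentre_iff']
  have h1 : Continuous (κ j).map :=
    continuous_iff_continuousAt.2 fun v => ((D.good j).hol v).continuousAt
  have h2 : Continuous (c j) := continuous_iff_continuousAt.2 fun t => (D.analytic j t).continuousAt
  have h3 := D.cont
  exact isClosed_eq (h1.comp (Continuous.subtype_mk (by fun_prop) _)) continuous_id

theorem isOpen_noncentre [Finite J] : IsOpen {x | ∀ j, ¬ IsCentre κ c j x} := by
  simp_rw [Set.ofPred_forall]
  exact isOpen_iInter_of_finite fun j => (D.isClosed_isCentre j).isOpen_compl

theorem isOpen_otherCentres [Finite J] (j : J) :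
    IsOpen {u : TPlane | ∃ h : u ∈ (κ j).dom, ∀ k, k ≠ j → ¬ IsCentre κ c k ((κ j).map ⟨u, h⟩)} := by
  have h1 : Continuous (κ j).map :=
    continuous_iff_continuousAt.2 fun v => ((D.good j).hol v).continuousAt
  have h2 : IsOpen {x | ∀ k, k ≠ j → ¬ IsCentre κ c k x} := by
    simp_rw [Set.ofPred_forall]
    exact isOpen_iInter_of_finite fun k => isOpen_iInter_of_finite fun _ =>
      (D.isClosed_isCentre k).isOpen_compl
  convert (D.good j).isOpen.isOpenMap_subtype_val _ (h2.preimage h1) using 1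
  ext u
  simp

theorem isOpen_blowDom₁ [Finite J] (j : J) : IsOpen (blowDom₁ κ c j) :=
  (D.isOpen_otherCentres j).preimage
    (continuous_iff_continuousAt.2 fun v => (analyticAt_blowMap₁ (D.analytic j) v).continuousAt)

theorem isOpen_blowDom₂ [Finite J] (j : J) : IsOpen (blowDom₂ κ c j) :=
  (D.isOpen_otherCentres j).preimage
    (continuous_iff_continuousAt.2 fun v => (analyticAt_blowMap₂ (D.analytic j) v).continuousAt)

theorem noncentre₁ {j : J} (v : blowDom₁ κ c j) (hv : v.1.2.2 ≠ 0) (k : J) :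
    ¬ IsCentre κ c k ((κ j).map ⟨_, v.2.fst⟩) := by
  by_cases hk : k = j
  · subst hk
    rw [D.isCentre_iff]
    exact fun h => hv h.2
  · exact v.2.snd k hk

theorem noncentre₂ {j : J} (v : blowDom₂ κ c j) (hv : v.1.2.1 ≠ 0) (k : J) :
    ¬ IsCentre κ c k ((κ j).map ⟨_, v.2.fst⟩) := by
  by_cases hk : k = j
  · subst hk
    rw [D.isCentre_iff]
    exact fun h => hv (by simpa [blowMap₂] using h.1)
  · exact v.2.snd k hk

theorem holMapAt_proj_chart₁ {j : J} (v : blowDom₁ κ c j) :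
    HolMapAt (fun v : blowDom₁ κ c j => (κ j).map ⟨_, v.2.fst⟩) v :=
  (((D.good j).hol _).holMapAt).comp
    (((holMapAt_affine (analyticAt_blowMap₁ (D.analytic j) v)).comp
      (holMapAt_subtype_val v)).codRestrict _)

theorem holMapAt_proj_chart₂ {j : J} (v : blowDom₂ κ c j) :
    HolMapAt (fun v : blowDom₂ κ c j => (κ j).map ⟨_, v.2.fst⟩) v :=
  (((D.good j).hol _).holMapAt).comp
    (((holMapAt_affine (analyticAt_blowMap₂ (D.analytic j) v)).comp
      (holMapAt_subtype_val v)).codRestrict _)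

variable [Finite J]

theorem holOpenAt_proj_chart₁ {j : J} (v : blowDom₁ κ c j) (hv : v.1.2.2 ≠ 0) :
    HolOpenAt (fun v : blowDom₁ κ c j => (κ j).map ⟨_, v.2.fst⟩) v :=
  ((D.good j).hol _).comp
    (((holOpenAt_blowMap₁ (D.analytic j) hv).comp
      (holOpenAt_subtype_val v ((D.isOpen_blowDom₁ j).mem_nhds v.2))).codRestrict _)

theorem holOpenAt_proj_chart₂ {j : J} (v : blowDom₂ κ c j) (hv : v.1.2.1 ≠ 0) :
    HolOpenAt (fun v : blowDom₂ κ c j => (κ j).map ⟨_, v.2.fst⟩) v :=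
  ((D.good j).hol _).comp
    (((holOpenAt_blowMap₂ (D.analytic j) hv).comp
      (holOpenAt_subtype_val v ((D.isOpen_blowDom₂ j).mem_nhds v.2))).codRestrict _)

/-- Off the exceptional curve the new charts are local biholomorphisms to `X`, so the germs are the
chart and its projection. On the overlap of the two new charts the germs are the identity and the
change of coordinates. -/
theorem etaleRel : EtaleRel (BlowRel κ c) := by
  rintro _ _ (⟨x, j, v, h⟩ | ⟨x, j, v, h⟩ | ⟨j, v, v', h1, h2, h3⟩)
  · have hv : v.1.2.2 ≠ 0 := by
      intro h0
      refine x.2 j ?_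
      rw [← h, D.isCentre_iff]
      simp [blowMap₁, h0]
    have hev : ∀ᶠ w : blowDom₁ κ c j in 𝓝 v, w.1.2.2 ≠ 0 :=
      eventually_ne_of_continuousAt (f := fun w : blowDom₁ κ c j => w.1.2.2) (by fun_prop) hv
    have hval := holOpenAt_subtype_val (p := fun w : blowDom₁ κ c j => w.1.2.2 ≠ 0) ⟨v, hv⟩ hev
    refine ⟨{w : blowDom₁ κ c j // w.1.2.2 ≠ 0}, inferInstance, inferInstance, ⟨v, hv⟩,
      fun w => Sum.inl ⟨(κ j).map ⟨_, w.1.2.fst⟩, D.noncentre₁ w.1 w.2⟩,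
      fun w => Sum.inr (Sum.inl ⟨j, w.1⟩), ?_, rfl, ?_, ?_, ?_⟩
    · exact congrArg Sum.inl (Subtype.ext h)
    · have h1 : HolOpenAt (fun w : {w : blowDom₁ κ c j // w.1.2.2 ≠ 0} =>
          (κ j).map ⟨_, w.1.2.fst⟩) ⟨v, hv⟩ :=
        HolOpenAt.comp (g := fun v : blowDom₁ κ c j => (κ j).map ⟨_, v.2.fst⟩)
          (f := Subtype.val) (D.holOpenAt_proj_chart₁ v hv) hval
      exact (holOpenAt_inl _).comp (h1.codRestrict _)
    · exact (holOpenAt_inr _).comp ((holOpenAt_inl _).comp ((holOpenAt_sigmaMk j _).comp hval))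
    · exact Eventually.of_forall fun w => Quot.sound (.base₁ _ j w.1 rfl)
  · have hv : v.1.2.1 ≠ 0 := by
      intro h0
      refine x.2 j ?_
      rw [← h, D.isCentre_iff]
      simp [blowMap₂, h0]
    have hev : ∀ᶠ w : blowDom₂ κ c j in 𝓝 v, w.1.2.1 ≠ 0 :=
      eventually_ne_of_continuousAt (f := fun w : blowDom₂ κ c j => w.1.2.1) (by fun_prop) hv
    have hval := holOpenAt_subtype_val (p := fun w : blowDom₂ κ c j => w.1.2.1 ≠ 0) ⟨v, hv⟩ hev
    refine ⟨{w : blowDom₂ κ c j // w.1.2.1 ≠ 0}, inferInstance, inferInstance, ⟨v, hv⟩,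
      fun w => Sum.inl ⟨(κ j).map ⟨_, w.1.2.fst⟩, D.noncentre₂ w.1 w.2⟩,
      fun w => Sum.inr (Sum.inr ⟨j, w.1⟩), ?_, rfl, ?_, ?_, ?_⟩
    · exact congrArg Sum.inl (Subtype.ext h)
    · have h1 : HolOpenAt (fun w : {w : blowDom₂ κ c j // w.1.2.1 ≠ 0} =>
          (κ j).map ⟨_, w.1.2.fst⟩) ⟨v, hv⟩ :=
        HolOpenAt.comp (g := fun v : blowDom₂ κ c j => (κ j).map ⟨_, v.2.fst⟩)
          (f := Subtype.val) (D.holOpenAt_proj_chart₂ v hv) hval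
      exact (holOpenAt_inl _).comp (h1.codRestrict _)
    · exact (holOpenAt_inr _).comp ((holOpenAt_inr _).comp ((holOpenAt_sigmaMk j _).comp hval))
    · exact Eventually.of_forall fun w => Quot.sound (.base₂ _ j w.1 rfl)
  · have hv : v.1.2.1 ≠ 0 := left_ne_zero_of_mul_eq_one h2
    have hev : ∀ᶠ w : blowDom₁ κ c j in 𝓝 v, w.1.2.1 ≠ 0 :=
      eventually_ne_of_continuousAt (f := fun w : blowDom₁ κ c j => w.1.2.1) (by fun_prop) hv
    have hval := holOpenAt_subtype_val (p := fun w : blowDom₁ κ c j => w.1.2.1 ≠ 0) ⟨v, hv⟩ hev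
    -- From `P = 1 / q` and `p = Q P` one gets `Q = q p`.
    let φ : TPlane → TPlane := fun w => (w.1, w.2.1 * w.2.2, 1 / w.2.1)
    have hφ : HolOpenAt φ v.1 := by
      have hv' : (φ v.1).2.2 ≠ 0 := by simpa [φ] using hv
      refine .of_analytic (g := fun u => (u.1, 1 / u.2.2, u.2.1 * u.2.2)) ?_ ?_ ?_ ?_
      · fun_prop (disch := assumption)
      · fun_prop (disch := assumption)
      · filter_upwards [eventually_ne_of_continuousAt (f := fun w : TPlane => w.2.1)
          (v := v.1) (by fun_prop) hv] with w hw
        ext <;> simp [φ]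
        field_simp
      · filter_upwards [eventually_ne_of_continuousAt (f := fun w : TPlane => w.2.2)
          (v := φ v.1) (by fun_prop) hv'] with w hw
        ext <;> simp [φ]
        field_simp
    have hb : ∀ w : TPlane, w.2.1 ≠ 0 → blowMap₂ c j (φ w) = blowMap₁ c j w := by
      intro w hw
      simp only [φ, blowMap₁, blowMap₂]
      ext <;> simp
      field_simp
    have hmem : ∀ w : {w : blowDom₁ κ c j // w.1.2.1 ≠ 0}, φ w.1.1 ∈ blowDom₂ κ c j := by
      intro w
      simp only [blowDom₂, Set.mem_ofPred_eq, hb w.1.1 w.2]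
      exact w.1.2
    refine ⟨{w : blowDom₁ κ c j // w.1.2.1 ≠ 0}, inferInstance, inferInstance, ⟨v, hv⟩,
      fun w => Sum.inr (Sum.inl ⟨j, w.1⟩), fun w => Sum.inr (Sum.inr ⟨j, ⟨φ w.1.1, hmem w⟩⟩),
      rfl, ?_, ?_, ?_, ?_⟩
    · have hφv : φ v.1 = v'.1 := by
        ext
        · exact h1
        · simp only [φ, h3]
          linear_combination v'.1.2.1 * h2
        · simp only [φ]
          field_simp
          linear_combination (-1 : ℂ) * h2
      simp only [hφv]
    · exact (holOpenAt_inr _).comp ((holOpenAt_inl _).comp ((holOpenAt_sigmaMk j _).comp hval))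
    · refine (holOpenAt_inr _).comp ((holOpenAt_inr _).comp ((holOpenAt_sigmaMk j _).comp ?_))
      exact ((hφ.comp (holOpenAt_subtype_val v ((D.isOpen_blowDom₁ j).mem_nhds v.2))).comp
        hval).codRestrict _
    · refine Eventually.of_forall fun w => Quot.sound (.charts j _ _ rfl ?_ ?_)
      · simp [φ, w.2]
      · have := w.2
        simp only [φ]
        field_simp

variable [TopologicalSpace J]

theorem holOpenAt_base (x : {x : X // ∀ j, ¬ IsCentre κ c j x}) :
    HolOpenAt (base (κ := κ) (c := c)) x :=
  (D.etaleRel.holOpenAt _).comp (holOpenAt_inl _)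

theorem holOpenAt_chart₁ (j : J) (v : blowDom₁ κ c j) : HolOpenAt (chart₁ κ c j).map v :=
  (D.etaleRel.holOpenAt _).comp
    ((holOpenAt_inr _).comp ((holOpenAt_inl _).comp (holOpenAt_sigmaMk j _)))

theorem holOpenAt_chart₂ (j : J) (v : blowDom₂ κ c j) : HolOpenAt (chart₂ κ c j).map v :=
  (D.etaleRel.holOpenAt _).comp
    ((holOpenAt_inr _).comp ((holOpenAt_inr _).comp (holOpenAt_sigmaMk j _)))

theorem holMapAt_proj (x : Blowup κ c) : HolMapAt (proj κ c) x := by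
  obtain ⟨a, rfl⟩ | ⟨j, v, rfl⟩ | ⟨j, v, rfl⟩ := x.cases
  · exact (D.holOpenAt_base a).cancel_holMapAt (holMapAt_subtype_val a)
  · exact (D.holOpenAt_chart₁ j v).cancel_holMapAt (D.holMapAt_proj_chart₁ v)
  · exact (D.holOpenAt_chart₂ j v).cancel_holMapAt (D.holMapAt_proj_chart₂ v)

theorem continuous_proj : Continuous (proj κ c) :=
  continuous_iff_continuousAt.2 fun x => (D.holMapAt_proj x).1

theorem holOpenAt_proj {x : Blowup κ c} (h : ∀ j, ¬ IsCentre κ c j (proj κ c x)) :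
    HolOpenAt (proj κ c) x := by
  rw [eq_base h]
  exact (D.holOpenAt_base _).cancel
    (holOpenAt_subtype_val (p := fun x => ∀ j, ¬ IsCentre κ c j x) _ (D.isOpen_noncentre.mem_nhds h))

omit [TopologicalSpace J] [Finite J]

/-- Off the exceptional curve the projection determines the point. On it, `p = 0` erases `q` in
`blowMap₁`, and the invariant `slope` recovers it. -/
theorem chart₁_eq_chart₁ {j : J} {v w : blowDom₁ κ c j} :
    (chart₁ κ c j).map v = (chart₁ κ c j).map w ↔ v = w := by
  refine ⟨fun h => ?_, fun h => by rw [h]⟩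
  have h1 : blowMap₁ c j v.1 = blowMap₁ c j w.1 :=
    congrArg Subtype.val ((D.good j).inj (congrArg (proj κ c) h))
  by_cases h0 : v.1.2.2 = 0
  · have h2 : slope j v.1.1 v.1.2.1 1 ((chart₁ κ c j).map v) := ⟨rfl, rfl, h0, mul_one _⟩
    rw [h] at h2
    obtain ⟨-, h3, h4, h5⟩ := h2
    rw [mul_one] at h5
    exact Subtype.ext (Prod.ext h3.symm (Prod.ext h5.symm (h0.trans h4.symm)))
  · simp only [blowMap₁, Prod.mk.injEq] at h1
    obtain ⟨h2, h3, h4⟩ := h1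
    rw [h2, ← h4] at h3
    exact Subtype.ext (Prod.ext h2 (Prod.ext (mul_right_cancel₀ h0 (add_left_cancel h3)) h4))

theorem chart₂_eq_chart₂ {j : J} {v w : blowDom₂ κ c j} :
    (chart₂ κ c j).map v = (chart₂ κ c j).map w ↔ v = w := by
  refine ⟨fun h => ?_, fun h => by rw [h]⟩
  have h1 : blowMap₂ c j v.1 = blowMap₂ c j w.1 :=
    congrArg Subtype.val ((D.good j).inj (congrArg (proj κ c) h))
  by_cases h0 : v.1.2.1 = 0
  · have h2 : slope j v.1.1 1 v.1.2.2 ((chart₂ κ c j).map v) := ⟨rfl, rfl, h0, (one_mul _).symm⟩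
    rw [h] at h2
    obtain ⟨-, h3, h4, h5⟩ := h2
    rw [one_mul] at h5
    exact Subtype.ext (Prod.ext h3.symm (Prod.ext (h0.trans h4.symm) h5))
  · simp only [blowMap₂, Prod.mk.injEq] at h1
    obtain ⟨h2, h3, h4⟩ := h1
    rw [h2] at h3
    have h5 := add_left_cancel h3
    rw [← h5] at h4
    exact Subtype.ext (Prod.ext h2 (Prod.ext h5 (mul_left_cancel₀ h0 h4)))

theorem chart₁_eq_chart₂ {j : J} {v : blowDom₁ κ c j} {w : blowDom₂ κ c j} :
    (chart₁ κ c j).map v = (chart₂ κ c j).map w ↔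
      v.1.1 = w.1.1 ∧ v.1.2.1 * w.1.2.2 = 1 ∧ v.1.2.2 = w.1.2.1 * w.1.2.2 := by
  refine ⟨fun h => ?_, fun h => Quot.sound (.charts j v w h.1 h.2.1 h.2.2)⟩
  have h1 : blowMap₁ c j v.1 = blowMap₂ c j w.1 :=
    congrArg Subtype.val ((D.good j).inj (congrArg (proj κ c) h))
  simp only [blowMap₁, blowMap₂, Prod.mk.injEq] at h1
  obtain ⟨h2, h3, h4⟩ := h1
  refine ⟨h2, ?_, h4⟩
  by_cases h0 : v.1.2.2 = 0
  · have h5 : slope j v.1.1 v.1.2.1 1 ((chart₁ κ c j).map v) := ⟨rfl, rfl, h0, mul_one _⟩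
    rw [h] at h5
    exact h5.2.2.2.symm
  · rw [h2] at h3
    have h5 := add_left_cancel h3
    refine mul_right_cancel₀ h0 ?_
    linear_combination w.1.2.2 * h5 - h4

end

end IsBlowupDatum

/-! ### Separation, good charts and exceptional curves of a blowup -/

namespace IsBlowupDatum

open Blowup

variable {X J : Type} [TopologicalSpace X] [HolSpace X] {κ : J → LocalChart X} {c : J → ℂ → ℂ}
  {τ : X → ℂ} [TopologicalSpace J] [Finite J]

section

variable (D : IsBlowupDatum κ c τ)
include D

/-- For each pair of pieces the coincidence set is closed: within one centre it is given by explicit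
equations, and over two different centres it reduces to equality of projections, since each chart
leaves out the other centres. -/
theorem t2Space_blowup : T2Space (Blowup κ c) := by
  have := D.t2
  have hb := fun a => (D.holOpenAt_base a).1
  have h1 := fun j v => (D.holOpenAt_chart₁ j v).1
  have h2 := fun j v => (D.holOpenAt_chart₂ j v).1
  have m1 : ∀ j, Continuous fun v : blowDom₁ κ c j => (κ j).map ⟨_, v.2.fst⟩ := fun j =>
    continuous_iff_continuousAt.2 fun v => (D.holMapAt_proj_chart₁ v).1
  have m2 : ∀ j, Continuous fun v : blowDom₂ κ c j => (κ j).map ⟨_, v.2.fst⟩ := fun j =>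
    continuous_iff_continuousAt.2 fun v => (D.holMapAt_proj_chart₂ v).1
  have hb1 : ∀ x j v, base x ≠ (chart₁ κ c j).map v →
      Disjoint (𝓝 (base x)) (𝓝 ((chart₁ κ c j).map v)) := fun x j v h => by
    refine exists_disjoint_nhds_of_isClosed hb (h1 j) ?_ h
    simp_rw [base_eq_chart₁]
    exact isClosed_eq (by fun_prop) ((m1 j).comp continuous_snd)
  have hb2 : ∀ x j v, base x ≠ (chart₂ κ c j).map v →
      Disjoint (𝓝 (base x)) (𝓝 ((chart₂ κ c j).map v)) := fun x j v h => by
    refine exists_disjoint_nhds_of_isClosed hb (h2 j) ?_ h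
    simp_rw [base_eq_chart₂]
    exact isClosed_eq (by fun_prop) ((m2 j).comp continuous_snd)
  have h12 : ∀ j v k w, (chart₁ κ c j).map v ≠ (chart₂ κ c k).map w →
      Disjoint (𝓝 ((chart₁ κ c j).map v)) (𝓝 ((chart₂ κ c k).map w)) := fun j v k w h => by
    refine exists_disjoint_nhds_of_isClosed (h1 j) (h2 k) ?_ h
    by_cases hjk : j = k
    · subst hjk
      simp_rw [D.chart₁_eq_chart₂, Set.ofPred_and]
      refine .inter ?_ (.inter ?_ ?_) <;> exact isClosed_eq (by fun_prop) (by fun_prop)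
    · have : ∀ x : blowDom₁ κ c j × blowDom₂ κ c k, _ := fun x =>
        chart₁_eq_of_ne (v := x.1) (y := (chart₂ κ c k).map x.2) (x.2.2.snd j hjk)
      simp_rw [this, proj_chart₂]
      exact isClosed_eq ((m1 j).comp continuous_fst) ((m2 k).comp continuous_snd)
  rw [t2Space_iff_disjoint_nhds]
  intro x y hxy
  obtain ⟨a, rfl⟩ | ⟨j, v, rfl⟩ | ⟨j, v, rfl⟩ := x.cases <;>
    obtain ⟨b, rfl⟩ | ⟨k, w, rfl⟩ | ⟨k, w, rfl⟩ := y.cases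
  · refine exists_disjoint_nhds_of_isClosed hb hb ?_ hxy
    simp_rw [base_eq_base]
    exact isClosed_eq (by fun_prop) (by fun_prop)
  · exact hb1 _ _ _ hxy
  · exact hb2 _ _ _ hxy
  · exact (hb1 _ _ _ hxy.symm).symm
  · refine exists_disjoint_nhds_of_isClosed (h1 j) (h1 k) ?_ hxy
    by_cases hjk : j = k
    · subst hjk
      simp_rw [D.chart₁_eq_chart₁]
      exact isClosed_eq (by fun_prop) (by fun_prop)
    · have : ∀ x : blowDom₁ κ c j × blowDom₁ κ c k, _ := fun x =>
        chart₁_eq_of_ne (v := x.1) (y := (chart₁ κ c k).map x.2) (x.2.2.snd j hjk)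
      simp_rw [this, proj_chart₁]
      exact isClosed_eq ((m1 j).comp continuous_fst) ((m1 k).comp continuous_snd)
  · exact h12 _ _ _ _ hxy
  · exact (hb2 _ _ _ hxy.symm).symm
  · exact (h12 _ _ _ _ hxy.symm).symm
  · refine exists_disjoint_nhds_of_isClosed (h2 j) (h2 k) ?_ hxy
    by_cases hjk : j = k
    · subst hjk
      simp_rw [D.chart₂_eq_chart₂]
      exact isClosed_eq (by fun_prop) (by fun_prop)
    · have : ∀ x : blowDom₂ κ c j × blowDom₂ κ c k, _ := fun x =>
        chart₂_eq_of_ne (v := x.1) (y := (chart₂ κ c k).map x.2) (x.2.2.snd j hjk)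
      simp_rw [this, proj_chart₂]
      exact isClosed_eq ((m2 j).comp continuous_fst) ((m2 k).comp continuous_snd)

theorem isGood_chart₁ (j : J) : (chart₁ κ c j).IsGood (fun x => τ (proj κ c x)) :=
  ⟨D.isOpen_blowDom₁ j, fun _ _ h => D.chart₁_eq_chart₁.1 h, D.holOpenAt_chart₁ j,
    fun _ => (D.good j).time _⟩

theorem isGood_chart₂ (j : J) : (chart₂ κ c j).IsGood (fun x => τ (proj κ c x)) :=
  ⟨D.isOpen_blowDom₂ j, fun _ _ h => D.chart₂_eq_chart₂.1 h, D.holOpenAt_chart₂ j,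
    fun _ => (D.good j).time _⟩

theorem isGood_oldChart {φ : LocalChart X} (h : φ.IsGood τ) :
    (oldChart κ c φ).IsGood (fun x => τ (proj κ c x)) := by
  have hφ : Continuous φ.map := continuous_iff_continuousAt.2 fun v => (h.hol v).continuousAt
  have ho : IsOpen (oldChart κ c φ).dom := by
    convert h.isOpen.isOpenMap_subtype_val _ (D.isOpen_noncentre.preimage hφ) using 1
    ext u
    simp [oldChart]
  refine ⟨ho, ?_, ?_, ?_⟩
  · intro v w e
    have := h.inj (congrArg (proj κ c) e)
    exact Subtype.ext (Subtype.mk.inj this)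
  · intro v
    refine (D.holOpenAt_base _).comp (HolOpenAt.codRestrict (f := fun v : (oldChart κ c φ).dom =>
      φ.map ⟨v.1, v.2.fst⟩) ?_ _)
    exact (h.hol _).comp ((holOpenAt_subtype_val v (ho.mem_nhds v.2)).codRestrict _)
  · intro v
    exact h.time ⟨v.1, v.2.fst⟩

theorem dense_noncentre : Dense {x | ∀ j, ¬ IsCentre κ c j (proj κ c x)} := by
  intro x
  rw [mem_closure_iff_nhds]
  intro N hN
  obtain ⟨a, rfl⟩ | ⟨j, v, rfl⟩ | ⟨j, v, rfl⟩ := x.cases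
  · exact ⟨_, mem_of_mem_nhds hN, a.2⟩
  · rw [← (D.holOpenAt_chart₁ j v).1, mem_map] at hN
    have h1 := image_mem_map (m := Subtype.val) hN
    rw [(holOpenAt_subtype_val v ((D.isOpen_blowDom₁ j).mem_nhds v.2)).1] at h1
    have h2 : Dense {w : TPlane | w.2.2 ≠ 0} := (dense_compl_singleton (0 : ℂ)).preimage
      (isOpenMap_snd.comp isOpenMap_snd)
    obtain ⟨_, ⟨w, hw, rfl⟩, hw'⟩ := mem_closure_iff_nhds.1 (h2 v.1) _ h1
    exact ⟨_, hw, D.noncentre₁ w hw'⟩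
  · rw [← (D.holOpenAt_chart₂ j v).1, mem_map] at hN
    have h1 := image_mem_map (m := Subtype.val) hN
    rw [(holOpenAt_subtype_val v ((D.isOpen_blowDom₂ j).mem_nhds v.2)).1] at h1
    have h2 : Dense {w : TPlane | w.2.1 ≠ 0} := (dense_compl_singleton (0 : ℂ)).preimage
      (isOpenMap_fst.comp isOpenMap_snd)
    obtain ⟨_, ⟨w, hw, rfl⟩, hw'⟩ := mem_closure_iff_nhds.1 (h2 v.1) _ h1
    exact ⟨_, hw, D.noncentre₂ w hw'⟩

/-- Density is first moved off the exceptional curves, where the blowdown is open. It is needed for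
determining the involution of `X` by its effect on a dense part. -/
theorem dense_preimage_proj {U : Set X} (hU : Dense U) : Dense (proj κ c ⁻¹' U) := by
  intro x
  rw [mem_closure_iff_nhds]
  intro N hN
  obtain ⟨y, hy, hy'⟩ := mem_closure_iff_nhds.1 (D.dense_noncentre x) _ (interior_mem_nhds.2 hN)
  have h1 := image_mem_map (m := proj κ c) (mem_interior_iff_mem_nhds.1 hy)
  rw [(D.holOpenAt_proj hy').1] at h1
  obtain ⟨_, ⟨z, hz, rfl⟩, hz'⟩ := mem_closure_iff_nhds.1 (hU _) _ h1
  exact ⟨z, hz, hz'⟩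

omit [TopologicalSpace J] [Finite J]

theorem exc_chart₁ {j : J} {v : blowDom₁ κ c j} :
    (∃ k, IsCentre κ c k (proj κ c ((chart₁ κ c j).map v))) ↔ v.1.2.2 = 0 := by
  constructor
  · rintro ⟨k, hk⟩
    by_contra h
    exact D.noncentre₁ v h k hk
  · intro h
    refine ⟨j, ?_⟩
    rw [proj_chart₁, D.isCentre_iff]
    simp [blowMap₁, h]

theorem exc_chart₂ {j : J} {v : blowDom₂ κ c j} :
    (∃ k, IsCentre κ c k (proj κ c ((chart₂ κ c j).map v))) ↔ v.1.2.1 = 0 := by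
  constructor
  · rintro ⟨k, hk⟩
    by_contra h
    exact D.noncentre₂ v h k hk
  · intro h
    refine ⟨j, ?_⟩
    rw [proj_chart₂, D.isCentre_iff]
    simp [blowMap₂, h]

end

end IsBlowupDatum

/-! ### Proper transforms -/

section Proper

variable {X J : Type} (κ : J → LocalChart X) (c : J → ℂ → ℂ) (L : X → Prop)

/-- The proper transform of a curve `L` that is given by `p = 0` in the charts `(q, p)`. -/
def Blowup.proper (hL : ∀ j v (h : v ∈ (κ j).dom), L ((κ j).map ⟨v, h⟩) ↔ v.2.2 = 0) :
    Blowup κ c → Prop :=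
  Quot.lift
    (fun x => match x with
      | Sum.inl x => L x.1
      | Sum.inr (Sum.inl _) => False
      | Sum.inr (Sum.inr ⟨_, v⟩) => v.1.2.2 = 0)
    (by
      rintro _ _ (⟨x, k, ⟨⟨s, q, p⟩, hv⟩, h⟩ | ⟨x, k, ⟨⟨s, q, p⟩, hv⟩, h⟩ |
        ⟨k, ⟨⟨s, q, p⟩, hv⟩, ⟨⟨s', q', p'⟩, hv'⟩, h1, h2, h3⟩)
      -- In the chart `(q, p)` the equation `p = 0` describes only the exceptional curve, so a base
      -- point of `L` in this chart would have to be the centre.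
      · refine propext ⟨fun h' => x.2 k ⟨s, ?_⟩, False.elim⟩
        change L x.1 at h'
        rw [← h, hL] at h'
        simp only [blowMap₁] at h'
        subst h'
        simp only [← h, blowMap₁, mul_zero, add_zero]
        exact ⟨by simpa [blowMap₁] using hv.fst, rfl⟩
      · refine propext (show L x.1 ↔ p = 0 from ?_)
        rw [← h, hL]
        simp only [blowMap₂, mul_eq_zero, or_iff_right_iff_imp]
        rintro rfl
        refine absurd ?_ (x.2 k)
        simp only [← h, blowMap₂, zero_mul, add_zero]
        exact ⟨s, by simpa [blowMap₂] using hv.fst, rfl⟩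
      · refine propext ⟨False.elim, fun h' => ?_⟩
        simp only at h2 h'
        simp [h'] at h2)

/-- The proper transform of a curve `L` that is given by `q = 0` in the charts `(q, p)`, if the
points `(0, 0)` are blown up. -/
def Blowup.properFst (hc : c = fun _ _ => 0)
    (hL : ∀ j v (h : v ∈ (κ j).dom), L ((κ j).map ⟨v, h⟩) ↔ v.2.1 = 0) : Blowup κ c → Prop :=
  Quot.lift
    (fun x => match x with
      | Sum.inl x => L x.1
      | Sum.inr (Sum.inl ⟨_, v⟩) => v.1.2.1 = 0
      | Sum.inr (Sum.inr _) => False)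
    (by
      subst hc
      rintro _ _ (⟨x, k, ⟨⟨s, q, p⟩, hv⟩, h⟩ | ⟨x, k, ⟨⟨s, q, p⟩, hv⟩, h⟩ |
        ⟨k, ⟨⟨s, q, p⟩, hv⟩, ⟨⟨s', q', p'⟩, hv'⟩, h1, h2, h3⟩)
      · refine propext (show L x.1 ↔ q = 0 from ?_)
        rw [← h, hL]
        simp only [blowMap₁, zero_add, mul_eq_zero, or_iff_left_iff_imp]
        rintro rfl
        refine absurd ?_ (x.2 k)
        simp only [← h, blowMap₁, mul_zero, add_zero]
        exact ⟨s, by simpa [blowMap₁] using hv.fst, rfl⟩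
      · refine propext ⟨fun h' => x.2 k ⟨s, ?_⟩, False.elim⟩
        change L x.1 at h'
        rw [← h, hL] at h'
        simp only [blowMap₂, zero_add] at h'
        subst h'
        simp only [← h, blowMap₂, zero_mul, add_zero]
        exact ⟨by simpa [blowMap₂] using hv.fst, rfl⟩
      · refine propext ⟨fun h' => ?_, False.elim⟩
        simp only at h2 h'
        simp [h'] at h2)

end Proper

/-! ### Symmetries -/

/-- An involution of `X` that permutes the charts `κ j` and the centres. -/
structure IsBlowupSymmetry {X J : Type} [TopologicalSpace X] [HolSpace X] (κ : J → LocalChart X)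
    (c : J → ℂ → ℂ) (s : X → X) (e : J → J) (ε : ℂ) : Prop where
  hol : ∀ x, HolMapAt s x
  invol : ∀ x, s (s x) = x
  invol_index : ∀ j, e (e j) = j
  sq : ε * ε = 1
  chart : ∀ j v x, (κ j).At v x → (κ (e j)).At (v.1, ε * v.2.1, -v.2.2) (s x)
  centre : ∀ j t, c (e j) t = ε * c j t

namespace IsBlowupSymmetry

open Blowup

variable {X J : Type} [TopologicalSpace X] [HolSpace X] {κ : J → LocalChart X} {c : J → ℂ → ℂ}
  {s : X → X} {e : J → J} {ε : ℂ} (h : IsBlowupSymmetry κ c s e ε)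
include h

theorem isCentre {j : J} {x : X} (hx : IsCentre κ c j x) : IsCentre κ c (e j) (s x) := by
  obtain ⟨t, ht⟩ := hx
  refine ⟨t, ?_⟩
  have := h.chart _ _ _ ht
  simpa [h.centre] using this

theorem isCentre_iff {j : J} {x : X} : IsCentre κ c j (s x) ↔ IsCentre κ c (e j) x :=
  ⟨fun hx => by simpa [h.invol] using h.isCentre hx,
    fun hx => by simpa [h.invol_index] using h.isCentre hx⟩

/-- In `q = (x - a) / y` the numerator is multiplied by `ε` and the denominator by `-1`. Hence the
sign of the first coordinate alternates along a sequence of such blowups. -/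
theorem blowMap₁ (j : J) (v : TPlane) : _root_.blowMap₁ c (e j) (v.1, -ε * v.2.1, -v.2.2) =
    ((_root_.blowMap₁ c j v).1, ε * (_root_.blowMap₁ c j v).2.1, -(_root_.blowMap₁ c j v).2.2) := by
  simp [_root_.blowMap₁, h.centre]
  ring

/-- Here `Q = x - a` keeps the factor `ε`, and `P = y / Q` acquires `-1 / ε = -ε`. -/
theorem blowMap₂ (j : J) (v : TPlane) : _root_.blowMap₂ c (e j) (v.1, ε * v.2.1, -ε * v.2.2) =
    ((_root_.blowMap₂ c j v).1, ε * (_root_.blowMap₂ c j v).2.1, -(_root_.blowMap₂ c j v).2.2) := by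
  have := h.sq
  simp [_root_.blowMap₂, h.centre]
  constructor
  · ring
  · linear_combination (v.2.1 * v.2.2) * this

theorem mem₁ {j : J} {v : TPlane} (hv : v ∈ blowDom₁ κ c j) :
    ∃ hw : (v.1, -ε * v.2.1, -v.2.2) ∈ blowDom₁ κ c (e j),
      (κ (e j)).map ⟨_, hw.fst⟩ = s ((κ j).map ⟨_, hv.fst⟩) := by
  obtain ⟨h1, h2⟩ := h.chart _ _ _ ⟨hv.fst, rfl⟩
  refine ⟨?_, ?_⟩
  · simp only [blowDom₁, Set.mem_ofPred_eq, h.blowMap₁]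
    refine ⟨h1, fun k hk => ?_⟩
    rw [h2, h.isCentre_iff]
    exact hv.snd _ fun e' => hk (by rw [← e', h.invol_index])
  · simp only [h.blowMap₁]
    exact h2

theorem mem₂ {j : J} {v : TPlane} (hv : v ∈ blowDom₂ κ c j) :
    ∃ hw : (v.1, ε * v.2.1, -ε * v.2.2) ∈ blowDom₂ κ c (e j),
      (κ (e j)).map ⟨_, hw.fst⟩ = s ((κ j).map ⟨_, hv.fst⟩) := by
  obtain ⟨h1, h2⟩ := h.chart _ _ _ ⟨hv.fst, rfl⟩
  refine ⟨?_, ?_⟩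
  · simp only [blowDom₂, Set.mem_ofPred_eq, h.blowMap₂]
    refine ⟨h1, fun k hk => ?_⟩
    rw [h2, h.isCentre_iff]
    exact hv.snd _ fun e' => hk (by rw [← e', h.invol_index])
  · simp only [h.blowMap₂]
    exact h2

/-- The induced involution of the blowup. -/
def lift : Blowup κ c → Blowup κ c :=
  Quot.lift
    (fun x => match x with
      | Sum.inl x => base ⟨s x.1, fun j hj => x.2 _ (h.isCentre_iff.1 hj)⟩
      | Sum.inr (Sum.inl ⟨j, v⟩) => (chart₁ κ c (e j)).map ⟨_, (h.mem₁ v.2).fst⟩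
      | Sum.inr (Sum.inr ⟨j, v⟩) => (chart₂ κ c (e j)).map ⟨_, (h.mem₂ v.2).fst⟩)
    (by
      rintro _ _ (⟨x, k, v, hx⟩ | ⟨x, k, v, hx⟩ | ⟨k, v, v', h1, h2, h3⟩)
      · refine base_eq_chart₁.2 ?_
        rw [(h.mem₁ v.2).snd, hx]
      · refine base_eq_chart₂.2 ?_
        rw [(h.mem₂ v.2).snd, hx]
      · refine Quot.sound (.charts _ _ _ h1 ?_ ?_)
        · have := h.sq
          simp only
          linear_combination h2 + v.1.2.1 * v'.1.2.2 * this
        · have := h.sq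
          simp only
          linear_combination (-1 : ℂ) * h3 + (v'.1.2.1 * v'.1.2.2) * this)

theorem lift_base {x} : h.lift (base x) = base ⟨s x.1, fun _ hj => x.2 _ (h.isCentre_iff.1 hj)⟩ :=
  rfl

theorem proj_lift (x : Blowup κ c) : proj κ c (h.lift x) = s (proj κ c x) := by
  obtain ⟨a, rfl⟩ | ⟨j, v, rfl⟩ | ⟨j, v, rfl⟩ := x.cases
  · rfl
  · exact (h.mem₁ v.2).snd
  · exact (h.mem₂ v.2).snd

theorem chart₁_lift (j : J) (v : TPlane) (x : Blowup κ c) (hx : (chart₁ κ c j).At v x) :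
    (chart₁ κ c (e j)).At (v.1, -ε * v.2.1, -v.2.2) (h.lift x) := by
  obtain ⟨hv, rfl⟩ := hx
  exact ⟨(h.mem₁ hv).fst, rfl⟩

theorem chart₂_lift (j : J) (v : TPlane) (x : Blowup κ c) (hx : (chart₂ κ c j).At v x) :
    (chart₂ κ c (e j)).At (v.1, ε * v.2.1, -ε * v.2.2) (h.lift x) := by
  obtain ⟨hv, rfl⟩ := hx
  exact ⟨(h.mem₂ hv).fst, rfl⟩

theorem lift_lift (x : Blowup κ c) : h.lift (h.lift x) = x := by
  have hs := h.sq
  obtain ⟨a, rfl⟩ | ⟨j, v, rfl⟩ | ⟨j, v, rfl⟩ := x.cases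
  · simp only [lift_base, h.invol]
  · have h0 := h.chart₁_lift _ _ _ (h.chart₁_lift j _ _ ⟨v.2, rfl⟩)
    have h1 : ((v.1.1, -ε * (-ε * v.1.2.1), - -v.1.2.2) : TPlane) = v.1 := by
      ext <;> simp
      linear_combination v.1.2.1 * hs
    simp only [h.invol_index, h1] at h0
    exact h0.snd.symm
  · have h0 := h.chart₂_lift _ _ _ (h.chart₂_lift j _ _ ⟨v.2, rfl⟩)
    have h1 : ((v.1.1, ε * (ε * v.1.2.1), -ε * (-ε * v.1.2.2)) : TPlane) = v.1 := by
      ext <;> simp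
      · linear_combination v.1.2.1 * hs
      · linear_combination v.1.2.2 * hs
    simp only [h.invol_index, h1] at h0
    exact h0.snd.symm

theorem holMapAt_lift [TopologicalSpace J] [Finite J] {τ : X → ℂ}
    (D : IsBlowupDatum κ c τ) (x : Blowup κ c) : HolMapAt h.lift x := by
  obtain ⟨a, rfl⟩ | ⟨j, v, rfl⟩ | ⟨j, v, rfl⟩ := x.cases
  · refine (D.holOpenAt_base a).cancel_holMapAt ?_
    exact (D.holOpenAt_base _).holMapAt.comp
      (((h.hol _).comp (holMapAt_subtype_val a)).codRestrict _)
  · refine (D.holOpenAt_chart₁ j v).cancel_holMapAt ?_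
    have : AnalyticAt ℂ (fun v : TPlane => ((v.1, -ε * v.2.1, -v.2.2) : TPlane)) v.1 := by fun_prop
    exact (D.holOpenAt_chart₁ _ _).holMapAt.comp
      (((holMapAt_affine this).comp (holMapAt_subtype_val v)).codRestrict _)
  · refine (D.holOpenAt_chart₂ j v).cancel_holMapAt ?_
    have : AnalyticAt ℂ (fun v : TPlane => ((v.1, ε * v.2.1, -ε * v.2.2) : TPlane)) v.1 := by fun_prop
    exact (D.holOpenAt_chart₂ _ _).holMapAt.comp
      (((holMapAt_affine this).comp (holMapAt_subtype_val v)).codRestrict _)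

end IsBlowupSymmetry

/-! ## The Hirzebruch surface -/

namespace Hirzebruch

/-- Explicit equality of points of the charts of the Hirzebruch surface. -/
def Same : Fin 4 → TPlane → Fin 4 → TPlane → Prop
  | 0, v, 0, w => v = w
  | 0, v, 1, w => v.1 = w.1 ∧ v.2.1 * w.2.1 = 1 ∧ v.2.2 = -w.2.1 ^ 2 * w.2.2
  | 0, v, 2, w => v.1 = w.1 ∧ w.2.1 = v.2.1 ∧ v.2.2 * w.2.2 = 1
  | 0, v, 3, w => v.1 = w.1 ∧ v.2.1 * w.2.1 = 1 ∧ v.2.2 * w.2.2 = -w.2.1 ^ 2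
  | 1, v, 0, w => v.1 = w.1 ∧ w.2.1 * v.2.1 = 1 ∧ w.2.2 = -v.2.1 ^ 2 * v.2.2
  | 1, v, 1, w => v = w
  | 1, v, 2, w => v.1 = w.1 ∧ v.2.1 * w.2.1 = 1 ∧ v.2.2 * w.2.2 = -w.2.1 ^ 2
  | 1, v, 3, w => v.1 = w.1 ∧ w.2.1 = v.2.1 ∧ v.2.2 * w.2.2 = 1
  | 2, v, 0, w => v.1 = w.1 ∧ v.2.1 = w.2.1 ∧ w.2.2 * v.2.2 = 1
  | 2, v, 1, w => v.1 = w.1 ∧ w.2.1 * v.2.1 = 1 ∧ w.2.2 * v.2.2 = -v.2.1 ^ 2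
  | 2, v, 2, w => v = w
  | 2, v, 3, w => v.1 = w.1 ∧ v.2.1 * w.2.1 = 1 ∧ w.2.2 = -w.2.1 ^ 2 * v.2.2
  | 3, v, 0, w => v.1 = w.1 ∧ w.2.1 * v.2.1 = 1 ∧ w.2.2 * v.2.2 = -v.2.1 ^ 2
  | 3, v, 1, w => v.1 = w.1 ∧ v.2.1 = w.2.1 ∧ w.2.2 * v.2.2 = 1
  | 3, v, 2, w => v.1 = w.1 ∧ w.2.1 * v.2.1 = 1 ∧ v.2.2 = -v.2.1 ^ 2 * w.2.2
  | 3, v, 3, w => v = w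

theorem same_of_rel (i : Fin 4) (v : TPlane) {a b : Σ _ : Fin 4, TPlane} (h : HirzebruchRel a b) :
    Same i v a.1 a.2 ↔ Same i v b.1 b.2 := by
  obtain ⟨s, q, p⟩ := v
  obtain ⟨t, q₁, p₁, q₂, p₂, h1, h2⟩ | ⟨t, q₁, p₁, q₂, p₂, h1, h2⟩ | ⟨t, q₁, p₁, q₂, p₂, h1, h2⟩ |
    ⟨t, q₁, p₁, q₂, p₂, h1, h2⟩ := h <;> fin_cases i <;>
    simp only [Same, Prod.mk.injEq] <;>
    refine and_congr_right fun _ => ?_ <;> grind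

/-- `Same i v` is invariant under the generating relation, hence descends to the quotient; this
gives one direction. For the other, the diagonal overlaps `0, 3` and `1, 2` are not generators and
have to be composed. -/
theorem mk_eq_iff {i j : Fin 4} {v w : TPlane} :
    (Quot.mk HirzebruchRel ⟨i, v⟩ = Quot.mk HirzebruchRel ⟨j, w⟩) ↔ Same i v j w := by
  constructor
  · intro h
    let P : Quot HirzebruchRel → Prop := Quot.lift (fun a => Same i v a.1 a.2)
      (fun a b hab => propext (same_of_rel i v hab))
    have h1 : P (Quot.mk _ ⟨i, v⟩) := by
      change Same i v i v
      fin_cases i <;> rfl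
    rw [h] at h1
    exact h1
  -- On a diagonal overlap all coordinates that have to be inverted are nonzero, so the two points
  -- are joined through a third chart: `2` here and `0` in `key'`.
  · have key : ∀ t q p q' p', q * q' = 1 → p * p' = -q' ^ 2 →
        Quot.mk HirzebruchRel ⟨0, (t, q, p)⟩ = Quot.mk HirzebruchRel ⟨3, (t, q', p')⟩ := by
      intro t q p q' p' h1 h2
      have hq : q' ≠ 0 := right_ne_zero_of_mul_eq_one h1
      have hp : p ≠ 0 := by rintro rfl; simp [hq] at h2
      refine (Quot.sound (.r13 t q p q (1 / p) rfl (by field_simp))).trans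
        (Quot.sound (.r34 _ _ _ _ _ h1 ?_))
      field_simp
      linear_combination h2
    have key' : ∀ t q p q' p', q * q' = 1 → p * p' = -q' ^ 2 →
        Quot.mk HirzebruchRel ⟨1, (t, q, p)⟩ = Quot.mk HirzebruchRel ⟨2, (t, q', p')⟩ := by
      intro t q p q' p' h1 h2
      have hq : q' ≠ 0 := right_ne_zero_of_mul_eq_one h1
      have hq' : q ≠ 0 := left_ne_zero_of_mul_eq_one h1
      have hp : p ≠ 0 := by rintro rfl; simp [hq] at h2
      refine (Quot.sound (.r12 t q' (-q ^ 2 * p) q p ((mul_comm _ _).trans h1) rfl)).symm.trans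
        (Quot.sound (.r13 _ _ _ _ _ rfl ?_))
      linear_combination (-q ^ 2) * h2 + (q * q' + 1) * h1
    obtain ⟨t, q, p⟩ := v
    obtain ⟨t', q', p'⟩ := w
    fin_cases i <;> fin_cases j <;> simp only [Same] <;> intro h <;>
      first
      | (rw [h])
      | (obtain ⟨rfl, h1, h2⟩ := h
         first
         | exact Quot.sound (.r12 _ _ _ _ _ h1 h2)
         | exact Quot.sound (.r13 _ _ _ _ _ h1 h2)
         | exact Quot.sound (.r24 _ _ _ _ _ h1 h2)
         | exact Quot.sound (.r34 _ _ _ _ _ h1 h2)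
         | exact Eq.symm (Quot.sound (HirzebruchRel.r12 _ _ _ _ _ h1 h2))
         | exact Eq.symm (Quot.sound (HirzebruchRel.r13 _ _ _ _ _ h1 h2))
         | exact Eq.symm (Quot.sound (HirzebruchRel.r24 _ _ _ _ _ h1 h2))
         | exact Eq.symm (Quot.sound (HirzebruchRel.r34 _ _ _ _ _ h1 h2))
         | exact key _ _ _ _ _ h1 h2
         | exact key' _ _ _ _ _ h1 h2
         | exact (key _ _ _ _ _ h1 h2).symm
         | exact (key' _ _ _ _ _ h1 h2).symm)

theorem isClosed_same (i j : Fin 4) : IsClosed {x : TPlane × TPlane | Same i x.1 j x.2} := by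
  fin_cases i <;> fin_cases j <;> simp only [Same, Set.ofPred_and] <;>
    first
    | exact isClosed_eq (by fun_prop) (by fun_prop)
    | (refine .inter ?_ (.inter ?_ ?_) <;> exact isClosed_eq (by fun_prop) (by fun_prop))

/-- Each of the four transition maps of the Hirzebruch surface is given by a formula that is its own
inverse. -/
theorem holOpenAt_of_involutive {φ : TPlane → TPlane} {v : TPlane} (h : AnalyticAt ℂ φ v)
    (h' : AnalyticAt ℂ φ (φ v)) (e : ∀ᶠ w in 𝓝 v, φ (φ w) = w) (e' : ∀ᶠ w in 𝓝 (φ v), φ (φ w) = w) :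
    HolOpenAt φ v := .of_analytic h h' e e'

theorem etaleRel : EtaleRel HirzebruchRel := by
  have hi : ∀ (i : Fin 4) (v : TPlane),
      HolOpenAt (fun v => (⟨i, v⟩ : Σ _ : Fin 4, TPlane)) v := fun i v => holOpenAt_sigmaMk (F := fun _ => TPlane) i v
  have e1 : ∀ v : TPlane, v.2.1 ≠ 0 → ∀ᶠ w in 𝓝 v, w.2.1 ≠ 0 := fun v hv =>
    eventually_ne_of_continuousAt (f := fun w : TPlane => w.2.1) (by fun_prop) hv
  have e2 : ∀ v : TPlane, v.2.2 ≠ 0 → ∀ᶠ w in 𝓝 v, w.2.2 ≠ 0 := fun v hv =>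
    eventually_ne_of_continuousAt (f := fun w : TPlane => w.2.2) (by fun_prop) hv
  rintro _ _ (⟨t, q₁, p₁, q₂, p₂, h1, h2⟩ | ⟨t, q₁, p₁, q₂, p₂, h1, h2⟩ |
    ⟨t, q₁, p₁, q₂, p₂, h1, h2⟩ | ⟨t, q₁, p₁, q₂, p₂, h1, h2⟩)
  · have hq : q₁ ≠ 0 := left_ne_zero_of_mul_eq_one h1
    have hq' : ((t, 1 / q₁, -q₁ ^ 2 * p₁) : TPlane).2.1 ≠ 0 := by simpa using hq
    refine ⟨TPlane, inferInstance, inferInstance, (t, q₁, p₁), fun v => ⟨0, v⟩,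
      fun v => ⟨1, (v.1, 1 / v.2.1, -v.2.1 ^ 2 * v.2.2)⟩, rfl, ?_, hi 0 _, (hi 1 _).comp
        (f := fun v : TPlane => (v.1, 1 / v.2.1, -v.2.1 ^ 2 * v.2.2))
        (holOpenAt_of_involutive ?_ ?_ ?_ ?_), ?_⟩
    · simp only [Sigma.mk.injEq, Prod.mk.injEq, heq_eq_eq, true_and]
      grind
    · fun_prop (disch := assumption)
    · fun_prop (disch := assumption)
    · filter_upwards [e1 _ hq] with w hw
      ext <;> simp
      field_simp
    · filter_upwards [e1 _ hq'] with w hw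
      ext <;> simp
      field_simp
    · filter_upwards [e1 _ hq] with w hw
      exact Quot.sound (.r12 _ _ _ _ _ (by field_simp) (by field_simp))
  · have hq : p₁ ≠ 0 := left_ne_zero_of_mul_eq_one h2
    have hq' : ((t, q₁, 1 / p₁) : TPlane).2.2 ≠ 0 := by simpa using hq
    refine ⟨TPlane, inferInstance, inferInstance, (t, q₁, p₁), fun v => ⟨0, v⟩,
      fun v => ⟨2, (v.1, v.2.1, 1 / v.2.2)⟩, rfl, ?_, hi 0 _, (hi 2 _).comp
        (f := fun v : TPlane => (v.1, v.2.1, 1 / v.2.2))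
        (holOpenAt_of_involutive ?_ ?_ ?_ ?_), ?_⟩
    · simp only [Sigma.mk.injEq, Prod.mk.injEq, heq_eq_eq, true_and]
      grind
    · fun_prop (disch := assumption)
    · fun_prop (disch := assumption)
    · filter_upwards [e2 _ hq] with w hw
      ext <;> simp
    · filter_upwards [e2 _ hq'] with w hw
      ext <;> simp
    · filter_upwards [e2 _ hq] with w hw
      exact Quot.sound (.r13 _ _ _ _ _ rfl (by field_simp))
  · have hq : p₁ ≠ 0 := left_ne_zero_of_mul_eq_one h2
    have hq' : ((t, q₁, 1 / p₁) : TPlane).2.2 ≠ 0 := by simpa using hq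
    refine ⟨TPlane, inferInstance, inferInstance, (t, q₁, p₁), fun v => ⟨1, v⟩,
      fun v => ⟨3, (v.1, v.2.1, 1 / v.2.2)⟩, rfl, ?_, hi 1 _, (hi 3 _).comp
        (f := fun v : TPlane => (v.1, v.2.1, 1 / v.2.2))
        (holOpenAt_of_involutive ?_ ?_ ?_ ?_), ?_⟩
    · simp only [Sigma.mk.injEq, Prod.mk.injEq, heq_eq_eq, true_and]
      grind
    · fun_prop (disch := assumption)
    · fun_prop (disch := assumption)
    · filter_upwards [e2 _ hq] with w hw
      ext <;> simp
    · filter_upwards [e2 _ hq'] with w hw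
      ext <;> simp
    · filter_upwards [e2 _ hq] with w hw
      exact Quot.sound (.r24 _ _ _ _ _ rfl (by field_simp))
  · have hq : q₁ ≠ 0 := left_ne_zero_of_mul_eq_one h1
    have hq' : ((t, 1 / q₁, -p₁ / q₁ ^ 2) : TPlane).2.1 ≠ 0 := by simpa using hq
    have hq2 : q₁ ^ 2 ≠ 0 := pow_ne_zero 2 hq
    have hq2' : ((t, 1 / q₁, -p₁ / q₁ ^ 2) : TPlane).2.1 ^ 2 ≠ 0 := pow_ne_zero 2 hq'
    refine ⟨TPlane, inferInstance, inferInstance, (t, q₁, p₁), fun v => ⟨2, v⟩,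
      fun v => ⟨3, (v.1, 1 / v.2.1, -v.2.2 / v.2.1 ^ 2)⟩, rfl, ?_, hi 2 _, (hi 3 _).comp
        (f := fun v : TPlane => (v.1, 1 / v.2.1, -v.2.2 / v.2.1 ^ 2))
        (holOpenAt_of_involutive ?_ ?_ ?_ ?_), ?_⟩
    · simp only [Sigma.mk.injEq, Prod.mk.injEq, heq_eq_eq, true_and]
      grind
    · fun_prop (disch := assumption)
    · fun_prop (disch := assumption)
    · filter_upwards [e1 _ hq] with w hw
      ext <;> simp
      field_simp
    · filter_upwards [e1 _ hq'] with w hw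
      ext <;> simp
      field_simp
    · filter_upwards [e1 _ hq] with w hw
      exact Quot.sound (.r34 _ _ _ _ _ (by field_simp) (by field_simp))

theorem holOpenAt_mk (i : Fin 4) (v : TPlane) :
    HolOpenAt (fun v : TPlane => (Quot.mk _ ⟨i, v⟩ : Hirzebruch)) v :=
  (etaleRel.holOpenAt ⟨i, v⟩).comp (holOpenAt_sigmaMk (F := fun _ => TPlane) i v)

theorem t2Space : T2Space Hirzebruch := by
  rw [t2Space_iff_disjoint_nhds]
  rintro ⟨i, v⟩ ⟨j, w⟩ h
  refine exists_disjoint_nhds_of_isClosed (fun a => (holOpenAt_mk i a).1)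
    (fun a => (holOpenAt_mk j a).1) ?_ h
  convert isClosed_same i j using 3
  exact mk_eq_iff

theorem continuous_time : Continuous time :=
  continuous_quot_lift _ (continuous_sigma fun _ => continuous_fst)

theorem isGood_chart (i : Fin 4) : (chart i).IsGood time := by
  refine ⟨isOpen_univ, ?_, ?_, fun _ => rfl⟩
  · intro v w h
    have h1 := mk_eq_iff.1 h
    refine Subtype.ext ?_
    fin_cases i <;> exact h1
  · intro v
    exact (holOpenAt_mk i v.1).comp (holOpenAt_subtype_val v (Eventually.of_forall fun _ => trivial))

theorem isBlowupDatum : IsBlowupDatum firstκ (fun _ _ => 0) time where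
  t2 := t2Space
  cont := continuous_time
  good _ := isGood_chart 3
  analytic _ _ := analyticAt_const
  mem _ _ := trivial

theorem isCentre_mk {i : Fin 4} {v : TPlane} :
    IsCentre firstκ (fun _ _ => 0) () (Quot.mk _ ⟨i, v⟩ : Hirzebruch) ↔
      i = 3 ∧ v.2.1 = 0 ∧ v.2.2 = 0 := by
  constructor
  · rintro ⟨t, _, h⟩
    have h1 := mk_eq_iff.1 h
    clear h
    obtain ⟨s, q, p⟩ := v
    fin_cases i <;> simp [Same] at h1 ⊢
    exact ⟨h1.2.1.symm, h1.2.2.symm⟩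
  · rintro ⟨rfl, h1, h2⟩
    obtain ⟨s, q, p⟩ := v
    simp only at h1 h2
    subst h1 h2
    exact ⟨s, trivial, rfl⟩

/-- The section at infinity. -/
def infty : Hirzebruch → Prop :=
  Quot.lift (fun a => (a.1 = 0 ∨ a.1 = 1) ∧ a.2.2.2 = 0) (by
    rintro _ _ (⟨t, q₁, p₁, q₂, p₂, h1, h2⟩ | ⟨t, q₁, p₁, q₂, p₂, h1, h2⟩ |
      ⟨t, q₁, p₁, q₂, p₂, h1, h2⟩ | ⟨t, q₁, p₁, q₂, p₂, h1, h2⟩)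
    · have := right_ne_zero_of_mul_eq_one h1
      simp [h2, this]
    · simp [left_ne_zero_of_mul_eq_one h2]
    · simp [left_ne_zero_of_mul_eq_one h2]
    · simp)

/-- The fibre over `x = ∞`. -/
def fibre : Hirzebruch → Prop :=
  Quot.lift (fun a => (a.1 = 1 ∨ a.1 = 3) ∧ a.2.2.1 = 0) (by
    rintro _ _ (⟨t, q₁, p₁, q₂, p₂, h1, h2⟩ | ⟨t, q₁, p₁, q₂, p₂, h1, h2⟩ |
      ⟨t, q₁, p₁, q₂, p₂, h1, h2⟩ | ⟨t, q₁, p₁, q₂, p₂, h1, h2⟩)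
    · simp [right_ne_zero_of_mul_eq_one h1]
    · simp
    · simp [h1]
    · simp [right_ne_zero_of_mul_eq_one h1])

end Hirzebruch

/-! ## The surface `S` -/

theorem LocalChart.IsGood.holOpenAt_total {X : Type} [TopologicalSpace X] [HolSpace X]
    {κ : LocalChart X} {τ : X → ℂ} (h : κ.IsGood τ) (hd : ∀ v, v ∈ κ.dom) (v : TPlane) :
    HolOpenAt (fun v => κ.map ⟨v, hd v⟩) v :=
  (h.hol ⟨v, hd v⟩).comp ((holOpenAt_id v).codRestrict hd)

namespace SSpace

theorem isBlowupDatum : IsBlowupDatum secondκ (fun _ _ => 0) (fun s : S₁ => s.proj.time) where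
  t2 := Hirzebruch.isBlowupDatum.t2Space_blowup
  cont := Hirzebruch.continuous_time.comp Hirzebruch.isBlowupDatum.continuous_proj
  good _ := Hirzebruch.isBlowupDatum.isGood_chart₁ ()
  analytic _ _ := analyticAt_const
  mem _ _ := S₁.qp_mem _

theorem t2Space : T2Space SSpace := isBlowupDatum.t2Space_blowup

theorem continuous_time : Continuous SSpace.time :=
  isBlowupDatum.cont.comp isBlowupDatum.continuous_proj

/-- The second centre lies on the exceptional curve of the first blowup, which no base point meets.
-/
theorem not_isCentre_base (x : {x : Hirzebruch // ∀ j, ¬ IsCentre firstκ (fun _ _ => 0) j x})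
    (j : Unit) : ¬ IsCentre secondκ (fun _ _ => 0) j (Blowup.base x : S₁) := by
  rintro ⟨t, ht, h⟩
  refine x.2 () ⟨t, trivial, ?_⟩
  have := congrArg S₁.proj h
  refine Eq.trans ?_ this
  refine congrArg (Hirzebruch.chart 3).map (Subtype.ext ?_)
  simp [blowMap₁]

/-- The six charts that cover `S`: two charts of the Hirzebruch surface along the section at
infinity, the chart `(x, y)`, and the charts of the second blowup and `(Q⁽¹⁾, P⁽¹⁾)`. -/
noncomputable def chart : Fin 6 → LocalChart SSpace
  | 0 => Blowup.oldChart secondκ (fun _ _ => 0)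
      (Blowup.oldChart firstκ (fun _ _ => 0) (Hirzebruch.chart 0))
  | 1 => Blowup.oldChart secondκ (fun _ _ => 0)
      (Blowup.oldChart firstκ (fun _ _ => 0) (Hirzebruch.chart 1))
  | 2 => xy
  | 3 => Blowup.chart₁ secondκ (fun _ _ => 0) ()
  | 4 => QP₂
  | 5 => QP₁

theorem isGood_old (i : Fin 4) : (Blowup.oldChart secondκ (fun _ _ => 0)
    (Blowup.oldChart firstκ (fun _ _ => 0) (Hirzebruch.chart i))).IsGood SSpace.time :=
  isBlowupDatum.isGood_oldChart
    (Hirzebruch.isBlowupDatum.isGood_oldChart (Hirzebruch.isGood_chart i))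

theorem isGood_chart (i : Fin 6) : (chart i).IsGood SSpace.time := by
  fin_cases i
  · exact isGood_old 0
  · exact isGood_old 1
  · exact isGood_old 2
  · exact isBlowupDatum.isGood_chart₁ ()
  · exact isBlowupDatum.isGood_chart₂ ()
  · exact isBlowupDatum.isGood_oldChart (Hirzebruch.isBlowupDatum.isGood_chart₂ ())

theorem mem_old {i : Fin 4} (hi : i ≠ 3) (v : TPlane) : v ∈ (Blowup.oldChart secondκ (fun _ _ => 0)
    (Blowup.oldChart firstκ (fun _ _ => 0) (Hirzebruch.chart i))).dom :=
  ⟨⟨trivial, fun _ h => hi (Hirzebruch.isCentre_mk.1 h).1⟩, not_isCentre_base _⟩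

theorem mem_chart (i : Fin 6) (v : TPlane) : v ∈ (chart i).dom := by
  fin_cases i
  · exact mem_old (by decide) v
  · exact mem_old (by decide) v
  · exact mem_old (i := 2) (by decide) v
  · exact ⟨S₁.qp_mem _, fun k hk => absurd (Subsingleton.elim k ()) hk⟩
  · exact QP₂_mem v
  · exact QP₁_mem v

/-- The point with the given coordinates in one of the six charts. -/
noncomputable def pt (i : Fin 6) (v : TPlane) : SSpace := (chart i).map ⟨v, mem_chart i v⟩

theorem holOpenAt_pt (i : Fin 6) (v : TPlane) : HolOpenAt (pt i) v :=
  (isGood_chart i).holOpenAt_total (mem_chart i) v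

theorem pt_injective (i : Fin 6) : Function.Injective (pt i) := fun _ _ h =>
  congrArg Subtype.val ((isGood_chart i).inj h)

theorem time_pt (i : Fin 6) (v : TPlane) : (pt i v).time = v.1 := (isGood_chart i).time _

theorem at_iff {i : Fin 6} {v : TPlane} {s : SSpace} : (chart i).At v s ↔ pt i v = s :=
  ⟨fun h => h.snd, fun h => ⟨mem_chart i v, h⟩⟩

/-- The image in the Hirzebruch surface of a point of one of the six charts. -/
noncomputable def hirz : Fin 6 → TPlane → Σ _ : Fin 4, TPlane
  | 0, v => ⟨0, v⟩
  | 1, v => ⟨1, v⟩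
  | 2, v => ⟨2, v⟩
  | 3, v => ⟨3, (v.1, 0 + (0 + v.2.1 * v.2.2) * v.2.2, v.2.2)⟩
  | 4, v => ⟨3, (v.1, 0 + (0 + v.2.1) * (v.2.1 * v.2.2), v.2.1 * v.2.2)⟩
  | 5, v => ⟨3, (v.1, 0 + v.2.1, v.2.1 * v.2.2)⟩

theorem proj_pt (i : Fin 6) (v : TPlane) : (pt i v).proj.proj = Quot.mk _ (hirz i v) := by
  fin_cases i <;> rfl

/-- The equality of points away from the centres can be checked in the Hirzebruch surface. -/
theorem eq_of_proj_eq {s s' : SSpace} (h : ¬ IsCentre firstκ (fun _ _ => 0) () s.proj.proj)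
    (e : s.proj.proj = s'.proj.proj) : s = s' := by
  have h1 : s.proj = s'.proj := Blowup.eq_of_proj_eq (fun _ => h) e
  refine Blowup.eq_of_proj_eq (fun _ => ?_) h1
  have := Blowup.eq_base (x := s.proj) (fun _ => h)
  intro h2
  change IsCentre secondκ (fun _ _ => 0) () s.proj at h2
  rw [this] at h2
  exact not_isCentre_base _ _ h2

theorem pt_eq_pt_of_same {i j : Fin 6} {v w : TPlane} (hi : (hirz i v).1 ≠ 3)
    (h : Hirzebruch.Same (hirz i v).1 (hirz i v).2 (hirz j w).1 (hirz j w).2) :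
    pt i v = pt j w := by
  refine eq_of_proj_eq ?_ ?_
  · rw [proj_pt]
    exact fun h' => hi (Hirzebruch.isCentre_mk (i := (hirz i v).1) (v := (hirz i v).2) |>.1 h').1
  · rw [proj_pt, proj_pt]
    exact Hirzebruch.mk_eq_iff.2 h

theorem pt_zero_eq_pt_one {t q p : ℂ} (hq : q ≠ 0) : pt 0 (t, q, p) = pt 1 (t, 1 / q, -q ^ 2 * p) := by
  refine pt_eq_pt_of_same (by simp [hirz]) ⟨rfl, ?_, ?_⟩ <;> simp [hirz] <;> field_simp

theorem pt_one_eq_pt_three {t q p : ℂ} (hp : p ≠ 0) : pt 1 (t, q, p) = pt 3 (t, q * p ^ 2, 1 / p) := by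
  refine pt_eq_pt_of_same (by simp [hirz]) ⟨rfl, ?_, ?_⟩ <;> simp [hirz] <;> field_simp

theorem pt_three_eq_pt_four {t q p : ℂ} (hq : q ≠ 0) :
    pt 3 (t, q, p) = pt 4 (t, q * p, 1 / q) :=
  isBlowupDatum.chart₁_eq_chart₂.2 ⟨rfl, by simp [hq], by simp; field_simp⟩

theorem pt_four_eq_pt_five {t q p : ℂ} (hq : q ≠ 0) :
    pt 4 (t, q, p) = pt 5 (t, q ^ 2 * p, 1 / q) := by
  refine Eq.symm (Blowup.base_eq_chart₂.2 (Eq.symm ?_))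
  refine Hirzebruch.isBlowupDatum.chart₁_eq_chart₂.2 ⟨rfl, ?_, ?_⟩ <;> simp [blowMap₂] <;> field_simp

/-- The coordinates `(x, y)` in terms of the six charts. -/
noncomputable def toXY : Fin 6 → TPlane → TPlane
  | 0, v => (v.1, v.2.1, 1 / v.2.2)
  | 1, v => (v.1, 1 / v.2.1, -1 / (v.2.1 ^ 2 * v.2.2))
  | 2, v => v
  | 3, v => (v.1, 1 / (v.2.1 * v.2.2 ^ 2), -1 / (v.2.1 ^ 2 * v.2.2 ^ 3))
  | 4, v => (v.1, 1 / (v.2.1 ^ 2 * v.2.2), -1 / (v.2.1 ^ 3 * v.2.2))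
  | 5, v => (v.1, 1 / v.2.1, -v.2.2 / v.2.1)

/-- The product of the equations of the boundary curves in the six charts. -/
noncomputable def bdry : Fin 6 → TPlane → ℂ
  | 0, v => v.2.2
  | 1, v => v.2.1 * v.2.2
  | 2, _ => 1
  | 3, v => v.2.1 * v.2.2
  | 4, v => v.2.1 * v.2.2
  | 5, v => v.2.1

/-- The chart `(x, y)` avoids both centres, where the blowups are isomorphisms, so the identity can
be checked in the Hirzebruch surface. -/
theorem pt_two_toXY {i : Fin 6} {v : TPlane} (h : bdry i v ≠ 0) : pt 2 (toXY i v) = pt i v := by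
  obtain ⟨t, q, p⟩ := v
  refine pt_eq_pt_of_same (by simp [hirz]) ?_
  fin_cases i <;> simp only [bdry, ne_eq, mul_eq_zero, not_or] at h <;>
    simp only [toXY, hirz, Hirzebruch.Same] <;> grind

/-- The charts `(q₄, p₄)` and `(q⁽¹⁾, p⁽¹⁾)` can be dispensed with. Apart from the points blown up
in them, their points with nonzero second coordinate come from the other charts of the Hirzebruch
surface, and those with zero second coordinate have `q ≠ 0` and lie in `(x, y)` or `(Q⁽¹⁾, P⁽¹⁾)`
respectively. -/
theorem exists_pt (s : SSpace) : ∃ i v, pt i v = s := by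
  have old : ∀ x : Hirzebruch, (∀ j, ¬ IsCentre firstκ (fun _ _ => 0) j x) → ∃ (i : Fin 6) (v : _),
      (hirz i v).1 ≠ 3 ∧ (Quot.mk _ (hirz i v) : Hirzebruch) = x := by
    rintro ⟨i, t, q, p⟩ hx
    fin_cases i
    · exact ⟨0, (t, q, p), by simp [hirz], rfl⟩
    · exact ⟨1, (t, q, p), by simp [hirz], rfl⟩
    · exact ⟨2, (t, q, p), by simp [hirz], rfl⟩
    · by_cases hp : p = 0
      · have hq : q ≠ 0 := fun hq => hx () ((Hirzebruch.isCentre_mk (i := 3)).2 ⟨rfl, hq, hp⟩)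
        refine ⟨2, (t, 1 / q, -p / q ^ 2), by simp [hirz], Hirzebruch.mk_eq_iff.2 ⟨rfl, ?_, ?_⟩⟩ <;>
          simp <;> field_simp
      · refine ⟨1, (t, q, 1 / p), by simp [hirz], Hirzebruch.mk_eq_iff.2 ⟨rfl, rfl, ?_⟩⟩
        simp [hp]
  have old' : ∀ s : SSpace, ¬ IsCentre firstκ (fun _ _ => 0) () s.proj.proj → ∃ i v, pt i v = s := by
    intro s hs
    obtain ⟨i, v, hi, hv⟩ := old _ (fun _ => hs)
    refine ⟨i, v, eq_of_proj_eq ?_ ?_⟩ <;> rw [proj_pt, hv]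
    exact hs
  obtain ⟨x, rfl⟩ | ⟨j, v, rfl⟩ | ⟨j, v, rfl⟩ := Blowup.cases s
  · obtain ⟨⟨y | ⟨⟨⟩, ⟨t, q, p⟩, hv⟩ | ⟨⟨⟩, v, hv⟩⟩, hx⟩ := x
    · exact old' _ (y.2 ())
    · by_cases hp : p = 0
      · have hq : q ≠ 0 := by
          rintro rfl
          subst hp
          exact hx () ⟨t, S₁.qp_mem _, rfl⟩
        refine ⟨5, (t, q * p, 1 / q), Blowup.base_eq_base.2 (Eq.symm ?_)⟩
        refine Hirzebruch.isBlowupDatum.chart₁_eq_chart₂.2 ⟨rfl, ?_, ?_⟩ <;> simp <;> field_simp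
      · refine old' _ ?_
        exact fun h => Hirzebruch.isBlowupDatum.noncentre₁ ⟨_, hv⟩ hp () h
    · exact ⟨5, v, rfl⟩
  · exact ⟨3, v.1, rfl⟩
  · exact ⟨4, v.1, rfl⟩

/-! ### The boundary curves in `S` -/

/-- The section at infinity. -/
def infty (s : SSpace) : Prop := Hirzebruch.infty s.proj.proj

/-- The proper transform of the fibre over `x = ∞` in the first blowup. -/
def fibre₁ : S₁ → Prop := Blowup.properFst firstκ (fun _ _ => 0) Hirzebruch.fibre rfl
  (fun _ v _ => by
    change (((3 : Fin 4) = 1 ∨ (3 : Fin 4) = 3) ∧ v.2.1 = 0) ↔ v.2.1 = 0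
    simp)

/-- The proper transform of the fibre over `x = ∞`. -/
def fibre : SSpace → Prop := Blowup.properFst secondκ (fun _ _ => 0) fibre₁ rfl
  (fun _ _ _ => Iff.rfl)

/-- The exceptional curve of the second blowup. -/
def exc (s : SSpace) : Prop := ∃ j, IsCentre secondκ (fun _ _ => 0) j s.proj

/-- The proper transform of the exceptional curve of the first blowup. -/
def branch : SSpace → Prop := Blowup.proper secondκ (fun _ _ => 0)
  (fun s : S₁ => ∃ j, IsCentre firstκ (fun _ _ => 0) j s.proj)
  (fun _ _ _ => Hirzebruch.isBlowupDatum.exc_chart₁)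

theorem infty_pt {i : Fin 6} {v : TPlane} : infty (pt i v) ↔ (i = 0 ∨ i = 1) ∧ v.2.2 = 0 := by
  rw [infty, proj_pt]
  change ((hirz i v).1 = 0 ∨ (hirz i v).1 = 1) ∧ (hirz i v).2.2.2 = 0 ↔ _
  fin_cases i <;> simp [hirz]

theorem fibre_pt {i : Fin 6} {v : TPlane} : fibre (pt i v) ↔ (i = 1 ∨ i = 3) ∧ v.2.1 = 0 := by
  fin_cases i
  · change (((0 : Fin 4) = 1 ∨ (0 : Fin 4) = 3) ∧ v.2.1 = 0) ↔ _
    simp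
  · change (((1 : Fin 4) = 1 ∨ (1 : Fin 4) = 3) ∧ v.2.1 = 0) ↔ _
    simp
  · change (((2 : Fin 4) = 1 ∨ (2 : Fin 4) = 3) ∧ v.2.1 = 0) ↔ _
    simp
  · change v.2.1 = 0 ↔ _
    simp
  · change False ↔ _
    simp
  · change False ↔ _
    simp

theorem exc_pt {i : Fin 6} {v : TPlane} :
    exc (pt i v) ↔ (i = 3 ∧ v.2.2 = 0) ∨ (i = 4 ∧ v.2.1 = 0) := by
  have hb : ∀ x, exc (Blowup.base x) ↔ False := fun x => ⟨fun ⟨j, hj⟩ => x.2 j hj, False.elim⟩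
  fin_cases i
  · exact (hb _).trans (by simp)
  · exact (hb _).trans (by simp)
  · exact (hb _).trans (by simp)
  · exact isBlowupDatum.exc_chart₁.trans (by simp)
  · exact isBlowupDatum.exc_chart₂.trans (by simp)
  · exact (hb _).trans (by simp)

theorem branch_pt {i : Fin 6} {v : TPlane} :
    branch (pt i v) ↔ (i = 4 ∧ v.2.2 = 0) ∨ (i = 5 ∧ v.2.1 = 0) := by
  have hb : ∀ (x : {x : Hirzebruch // ∀ j, ¬ IsCentre firstκ (fun _ _ => 0) j x}) hx,
      branch (Blowup.base ⟨Blowup.base x, hx⟩) ↔ False :=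
    fun x _ => ⟨fun ⟨j, hj⟩ => x.2 j hj, False.elim⟩
  fin_cases i
  · exact (hb _ _).trans (by simp)
  · exact (hb _ _).trans (by simp)
  · exact (hb _ _).trans (by simp)
  · change False ↔ _
    simp
  · change v.2.2 = 0 ↔ _
    simp
  · exact Hirzebruch.isBlowupDatum.exc_chart₂.trans (by simp)

theorem mem_C_iff {s : SSpace} : s ∈ C ↔ branch s := by
  constructor
  · rintro (⟨t, P, h⟩ | ⟨t, Q, h⟩)
    · rw [← at_iff (i := 5) |>.1 h, branch_pt]
      simp
    · rw [← at_iff (i := 4) |>.1 h, branch_pt]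
      simp
  · intro h
    obtain ⟨i, ⟨t, q, p⟩, rfl⟩ := exists_pt s
    rw [branch_pt] at h
    obtain ⟨rfl, h⟩ | ⟨rfl, h⟩ := h
    · simp only at h
      subst h
      exact .inr ⟨t, q, at_iff (i := 4) |>.2 rfl⟩
    · simp only at h
      subst h
      exact .inl ⟨t, p, at_iff (i := 5) |>.2 rfl⟩

theorem mem_a₂_iff {s : SSpace} : s ∈ a₂ ↔ ∃ t, pt 4 (t, 0, 4) = s :=
  exists_congr fun _ => at_iff (i := 4)

/-- The point lies on the second exceptional curve, which only the charts `3` and `4` meet; its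
coordinate `P = 4` reads `q = 1 / P = 1 / 4` in chart `3`. -/
theorem pt_mem_a₂ {i : Fin 6} {v : TPlane} : pt i v ∈ a₂ ↔
    (i = 4 ∧ v.2.1 = 0 ∧ v.2.2 = 4) ∨ (i = 3 ∧ v.2.2 = 0 ∧ v.2.1 = 1 / 4) := by
  rw [mem_a₂_iff]
  obtain ⟨s, q, p⟩ := v
  constructor
  · rintro ⟨t, ht⟩
    have h1 : exc (pt i (s, q, p)) := by
      rw [← ht, exc_pt]
      simp
    rw [exc_pt] at h1
    obtain ⟨rfl, h1⟩ | ⟨rfl, h1⟩ := h1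
    · have := isBlowupDatum.chart₁_eq_chart₂.1 ht.symm
      refine .inr ⟨rfl, h1, ?_⟩
      simp only at this ⊢
      linear_combination (1 / 4) * this.2.1
    · have := pt_injective 4 ht
      simp only [Prod.mk.injEq] at this
      simp [← this.2.1, ← this.2.2]
  · rintro (⟨rfl, h1, h2⟩ | ⟨rfl, h1, h2⟩)
    · simp only at h1 h2
      subst h1 h2
      exact ⟨s, rfl⟩
    · simp only at h1 h2
      subst h1 h2
      refine ⟨s, ?_⟩
      rw [pt_three_eq_pt_four (by simp)]
      norm_num

theorem isClosed_a₂ : IsClosed a₂ := by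
  have := t2Space
  have h : a₂ = {s | pt 4 (s.time, 0, 4) = s} := by
    ext s
    rw [mem_a₂_iff]
    constructor
    · rintro ⟨t, rfl⟩
      simp [time_pt]
    · exact fun h => ⟨_, h⟩
  rw [h]
  have h1 : Continuous (pt 4) := continuous_iff_continuousAt.2 fun v => (holOpenAt_pt 4 v).continuousAt
  have h2 := continuous_time
  exact isClosed_eq (h1.comp (by fun_prop)) continuous_id

end SSpace

/-! ## The blowups `X → W` -/

namespace XStage

/-- The centres of the blowups. -/
noncomputable def ctr : ℕ → Bool → ℂ → ℂ
  | 0, true => fun _ => 2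
  | 0, false => fun _ => -2
  | 1, _ => fun _ => 0
  | 2, _ => fun _ => 0
  | 3, _ => fun _ => 0
  | 4, true => fun t => t / 2
  | 4, false => fun t => -t / 2
  | _, _ => fun _ => 1 / 2

/-- The stages of the sequence of blowups. -/
noncomputable def stage : ℕ → Stage
  | 0 => .start
  | k + 1 => (stage k).next (ctr k true) (ctr k false)

/-- The carrier of the `k`-th stage. -/
abbrev Carrier (k : ℕ) : Type := (stage k).carrier

/-- The centres of the `k`-th pair of blowups. -/
noncomputable def cen (k : ℕ) : Bool → ℂ → ℂ := fun b => if b then ctr k true else ctr k false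

theorem cen_eq (k : ℕ) (b : Bool) : cen k b = ctr k b := by
  cases b <;> simp [cen]

theorem analyticAt_cen (k : ℕ) (b : Bool) (t : ℂ) : AnalyticAt ℂ (cen k b) t := by
  rw [cen_eq]
  match k, b with
  | 0, true => exact analyticAt_const
  | 0, false => exact analyticAt_const
  | 1, _ => exact analyticAt_const
  | 2, _ => exact analyticAt_const
  | 3, _ => exact analyticAt_const
  | 4, true => simp only [ctr]; fun_prop
  | 4, false => simp only [ctr]; fun_prop
  | n + 5, _ => exact analyticAt_const

/-- The base point of `W` over which the charts with the sign `b` lie. -/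
noncomputable def sgn (b : Bool) : ℂ := if b then 2 else -2

theorem cen_zero (b : Bool) (t : ℂ) : cen 0 b t = sgn b := by
  cases b <;> simp [cen, sgn, ctr]

theorem sgn_injective {b b' : Bool} (h : sgn b = sgn b') : b = b' := by
  cases b <;> cases b' <;> simp [sgn] at h ⊢ <;> norm_num [Complex.ext_iff] at h

/-- The two points that are blown up in `W`. -/
def IsPm (w : TPlane) : Prop := ∃ b, w.2 = (sgn b, 0)

/-- The projection of a stage to the preceding one. -/
noncomputable def pr (k : ℕ) (x : Carrier (k + 1)) : Carrier k :=
  Blowup.proj (stage k).chart (cen k) x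

/-- The properties of the stages that are needed in the induction. -/
structure IsGood (k : ℕ) : Prop where
  t2 : T2Space (Carrier k)
  hol : ∀ x, HolMapAt (stage k).toW x
  good : ∀ b, ((stage k).chart b).IsGood (fun x => ((stage k).toW x).1)
  dom : ∀ b v, v ∈ ((stage k).chart b).dom
  toW : ∀ b v, ((stage k).toW (((stage k).chart b).map v)).2.2 = v.1.2.2
  -- The centres of different sign lie over different points of `W`. Leaving out the other centre
  -- therefore never cuts into a chart.
  disj : ∀ b t, ((stage k).toW (((stage k).chart b).map ⟨(t, cen k b t, 0), dom b _⟩)).2.1 = sgn b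
  inj : ∀ x y, ¬ IsPm ((stage k).toW x) → (stage k).toW x = (stage k).toW y → x = y
  surj : ∀ w, ¬ IsPm w → ∃ x, (stage k).toW x = w
  isOpen : ∀ x, ¬ IsPm ((stage k).toW x) → HolOpenAt (stage k).toW x
  dense : Dense {x | ((stage k).toW x).2.2 ≠ 0}

theorem IsGood.datum {k : ℕ} (h : IsGood k) :
    IsBlowupDatum (stage k).chart (cen k) (fun x => ((stage k).toW x).1) where
  t2 := h.t2
  cont := continuous_fst.comp (continuous_iff_continuousAt.2 fun x => (h.hol x).1)
  good := h.good
  analytic := analyticAt_cen k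
  mem b _ := h.dom b _

theorem IsGood.isPm {k : ℕ} (h : IsGood k) {b : Bool} {x : Carrier k}
    (hx : IsCentre (stage k).chart (cen k) b x) : ((stage k).toW x).2 = (sgn b, 0) := by
  obtain ⟨t, h1, rfl⟩ := hx
  exact Prod.ext (h.disj b t) (h.toW b _)

theorem isGood_zero : IsGood 0 where
  t2 := inferInstanceAs (T2Space TPlane)
  hol x := (holOpenAt_id (A := TPlane) x).holMapAt
  good _ := ⟨isOpen_univ, Subtype.val_injective,
    fun v => holOpenAt_subtype_val (A := TPlane) v (Eventually.of_forall fun _ => trivial), fun _ => rfl⟩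
  dom _ _ := trivial
  toW _ _ := rfl
  disj := cen_zero
  inj _ _ _ h := h
  surj w _ := ⟨w, rfl⟩
  isOpen x _ := holOpenAt_id (A := TPlane) x
  dense := (dense_compl_singleton (0 : ℂ)).preimage (isOpenMap_snd.comp isOpenMap_snd)

theorem IsGood.not_isCentre {k : ℕ} (h : IsGood k) {x : Carrier k}
    (hx : ¬ IsPm ((stage k).toW x)) (b : Bool) : ¬ IsCentre (stage k).chart (cen k) b x :=
  fun hb => hx ⟨b, h.isPm hb⟩

/-- The charts of the next stage are defined everywhere, and over `p_±` where `p = 0`. -/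
theorem IsGood.next_chart {k : ℕ} (h : IsGood k)
    (h0 : ∀ b t (q : ℂ), ((stage k).toW (((stage k).chart b).map
      ⟨(t, cen k b t + q * 0, 0), h.dom b _⟩)).2.1 = sgn b) (b : Bool) (v : TPlane) :
    v ∈ ((stage (k + 1)).chart b).dom := by
  refine ⟨h.dom b _, fun b' hb hc => ?_⟩
  have h1 := h.isPm hc
  have h2 := h.toW b ⟨blowMap₁ (cen k) b v, h.dom b _⟩
  obtain ⟨t, q, p⟩ := v
  have h3 : p = 0 := h2.symm.trans (congrArg Prod.snd h1)
  subst h3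
  exact hb (sgn_injective ((congrArg Prod.fst h1).symm.trans (h0 b t q)))

/-- Off `p_±` the blowdown is an isomorphism, which preserves the statements about `toW`. The field
`disj` persists because the next centre again has `p = 0`, and `blowMap₁` sends this whole line to
the old centre. -/
theorem IsGood.succ {k : ℕ} (h : IsGood k) : IsGood (k + 1) := by
  have h0 : ∀ b t q, ((stage k).toW (((stage k).chart b).map
      ⟨(t, cen k b t + q * 0, 0), h.dom b _⟩)).2.1 = sgn b := by
    intro b t q
    simpa using h.disj b t
  have D := h.datum
  exact {
    t2 := D.t2Space_blowup
    hol := fun x => (h.hol _).comp (D.holMapAt_proj x)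
    good := D.isGood_chart₁
    dom := h.next_chart h0
    toW := fun b v => h.toW b _
    disj := fun b t => h0 b t _
    inj := fun x y hx hxy => Blowup.eq_of_proj_eq (h.not_isCentre hx) (h.inj _ _ hx hxy)
    surj := fun w hw => by
      obtain ⟨x, rfl⟩ := h.surj w hw
      exact ⟨Blowup.base ⟨x, h.not_isCentre hw⟩, rfl⟩
    isOpen := fun x hx => (h.isOpen _ hx).comp (D.holOpenAt_proj (h.not_isCentre hx))
    dense := D.dense_preimage_proj h.dense }

theorem isGood : ∀ k, IsGood k
  | 0 => isGood_zero
  | k + 1 => (isGood k).succ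

theorem datum (k : ℕ) : IsBlowupDatum (stage k).chart (cen k) (fun x => ((stage k).toW x).1) :=
  (isGood k).datum

/-! ### The charts and the boundary curves of the stages -/

/-- The second charts of the `j`-th blowups, in the later stages. -/
noncomputable def node : (k j : ℕ) → Bool → LocalChart (Carrier k)
  | 0, _ => fun _ => ⟨∅, fun v => v.2.elim⟩
  | k + 1, j => fun b => if j = k then Blowup.chart₂ (stage k).chart (cen k) b
      else Blowup.oldChart (stage k).chart (cen k) (node k j b)

theorem node_self (k : ℕ) (b : Bool) :
    node (k + 1) k b = Blowup.chart₂ (stage k).chart (cen k) b :=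
  if_pos rfl

theorem node_of_lt {k j : ℕ} (h : j < k) (b : Bool) :
    node (k + 1) j b = Blowup.oldChart (stage k).chart (cen k) (node k j b) :=
  if_neg h.ne

theorem isGood_node {k j : ℕ} (h : j < k) (b : Bool) :
    (node k j b).IsGood (fun x => ((stage k).toW x).1) := by
  induction k with
  | zero => omega
  | succ k ih =>
    rcases (Nat.lt_succ_iff_lt_or_eq.1 h) with h | rfl
    · rw [node_of_lt h]
      exact (datum k).isGood_oldChart (ih h)
    · rw [node_self]
      exact (datum j).isGood_chart₂ b

/-- The projection to `W` in the charts `(z, w)`. -/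
noncomputable def chartW : ℕ → Bool → TPlane → TPlane
  | 0, _ => id
  | k + 1, b => fun v => chartW k b (blowMap₁ (cen k) b v)

theorem toW_chart (k : ℕ) (b : Bool) (v : ((stage k).chart b).dom) :
    (stage k).toW (((stage k).chart b).map v) = chartW k b v.1 := by
  induction k with
  | zero => rfl
  | succ k ih => exact ih ⟨_, (isGood k).dom b _⟩

theorem toW_node {k j : ℕ} (h : j < k) (b : Bool) (v : (node k j b).dom) :
    (stage k).toW ((node k j b).map v) = chartW j b (blowMap₂ (cen j) b v.1) := by
  induction k with
  | zero => omega
  | succ k ih =>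
    rcases (Nat.lt_succ_iff_lt_or_eq.1 h) with h | rfl
    · revert v
      rw [node_of_lt h]
      exact fun v => ih h ⟨v.1, v.2.fst⟩
    · revert v
      rw [node_self]
      exact fun v => toW_chart j b ⟨_, (isGood j).dom b _⟩

theorem chartW_snd (k : ℕ) (b : Bool) (v : TPlane) : (chartW k b v).2.2 = v.2.2 := by
  induction k generalizing v with
  | zero => rfl
  | succ k ih => exact ih _

theorem chartW_base (k : ℕ) (b : Bool) (t : ℂ) : (chartW k b (t, cen k b t, 0)).2.1 = sgn b := by
  rw [← toW_chart k b ⟨_, (isGood k).dom b _⟩]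
  exact (isGood k).disj b t

theorem chartW_succ_base (k : ℕ) (b : Bool) (t z : ℂ) : (chartW (k + 1) b (t, z, 0)).2.1 = sgn b := by
  have := chartW_base k b t
  simpa [chartW, blowMap₁] using this

/-- The exceptional curves of the last blowups; in `W`, the line `{s = 0}`. -/
def newCurve : (k : ℕ) → Carrier k → Prop
  | 0 => fun w : TPlane => w.2.2 = 0
  | k + 1 => fun x => ∃ b, IsCentre (stage k).chart (cen k) b (pr k x)

theorem newCurve_chart (k : ℕ) (b : Bool) (v : TPlane) (h : v ∈ ((stage k).chart b).dom) :
    newCurve k (((stage k).chart b).map ⟨v, h⟩) ↔ v.2.2 = 0 := by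
  match k with
  | 0 => rfl
  | k + 1 => exact (datum k).exc_chart₁

/-- The proper transforms of the line `{s = 0}` and of the exceptional curves. -/
noncomputable def curve : (k i : ℕ) → Carrier k → Prop
  | 0, _ => fun _ => False
  | k + 1, i => fun x => if i = k then
      Blowup.proper (stage k).chart (cen k) (newCurve k) (newCurve_chart k) x
      else curve k i (pr k x)

theorem curve_self (k : ℕ) (x : Carrier (k + 1)) : curve (k + 1) k x ↔
    Blowup.proper (stage k).chart (cen k) (newCurve k) (newCurve_chart k) x := by
  simp [curve]

theorem curve_of_lt {k i : ℕ} (h : i < k) (x : Carrier (k + 1)) :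
    curve (k + 1) i x ↔ curve k i (pr k x) := by
  simp [curve, h.ne]

/-- A new chart `(q, p)` misses the proper transform of the curve `p = 0` through the centre. The
next centres lie in these charts, so they avoid all older curves, and the preimage of an older curve
is already its proper transform. -/
theorem not_curve_chart {k i : ℕ} (h : i < k) (b : Bool) (v : ((stage k).chart b).dom) :
    ¬ curve k i (((stage k).chart b).map v) := by
  induction k with
  | zero => omega
  | succ k ih =>
    rcases (Nat.lt_succ_iff_lt_or_eq.1 h) with h | rfl
    · rw [curve_of_lt h]
      exact ih h ⟨_, (isGood k).dom b _⟩
    · rw [curve_self]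
      exact id

/-- In the second chart of the `j`-th blowup, `P = 0` is the proper transform of the curve on which
the centre lay, and `Q = 0` is the new exceptional curve. The latter receives the number `j + 1`
once a point on it has been blown up. -/
theorem curve_node {k i j : ℕ} (hi : i < k) (hj : j < k) (b : Bool) (v : (node k j b).dom) :
    curve k i ((node k j b).map v) ↔ (i = j ∧ v.1.2.2 = 0) ∨ (i = j + 1 ∧ v.1.2.1 = 0) := by
  induction k with
  | zero => omega
  | succ k ih =>
    rcases (Nat.lt_succ_iff_lt_or_eq.1 hj) with hj | rfl
    · revert v
      rw [node_of_lt hj]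
      intro v
      rcases (Nat.lt_succ_iff_lt_or_eq.1 hi) with hi | rfl
      · rw [curve_of_lt hi]
        exact ih hi hj ⟨v.1, v.2.fst⟩
      · rw [curve_self]
        change newCurve i ((node i j b).map ⟨v.1, v.2.fst⟩) ↔ _
        obtain ⟨i, rfl⟩ : ∃ i', i = i' + 1 := ⟨i - 1, by omega⟩
        obtain ⟨v, hv, hv'⟩ := v
        revert hv
        rcases (Nat.lt_succ_iff_lt_or_eq.1 hj) with hj | rfl
        · rw [node_of_lt hj]
          intro hv hv'
          refine iff_of_false ?_ ?_
          · rintro ⟨b', hb'⟩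
            exact hv.snd b' hb'
          · simp only
            omega
        · rw [node_self]
          intro hv hv'
          exact (datum j).exc_chart₂.trans (by simp)
    · revert v
      rw [node_self]
      intro v
      rcases (Nat.lt_succ_iff_lt_or_eq.1 hi) with hi | rfl
      · rw [curve_of_lt hi]
        refine iff_of_false (not_curve_chart hi b ⟨_, (isGood j).dom b _⟩) ?_
        omega
      · rw [curve_self]
        exact Iff.trans (show _ ↔ v.1.2.2 = 0 from Iff.rfl) (by simp)

theorem curve_of_not_isPm {k i : ℕ} (hi : i < k) {x : Carrier k} (hx : ¬ IsPm ((stage k).toW x)) :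
    curve k i x ↔ i = 0 ∧ ((stage k).toW x).2.2 = 0 := by
  induction k with
  | zero => omega
  | succ k ih =>
    rcases (Nat.lt_succ_iff_lt_or_eq.1 hi) with hi | rfl
    · rw [curve_of_lt hi]
      exact ih hi hx
    · rw [curve_self]
      have h1 := (isGood i).not_isCentre hx
      have h2 := Blowup.eq_base (x := x) h1
      rw [h2]
      change newCurve i (pr i x) ↔ _
      match i with
      | 0 =>
        exact ⟨fun h => ⟨rfl, h⟩, fun h => h.2⟩
      | i + 1 =>
        refine iff_of_false ?_ (by simp)
        rintro ⟨b, hb⟩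
        exact hx ⟨b, (isGood i).isPm hb⟩

/-- Every point over `p_±` lies in one of the charts, with vanishing second coordinate. -/
theorem exists_node_or_chart {k : ℕ} (hk : 0 < k) {b : Bool} {x : Carrier k}
    (hx : ((stage k).toW x).2 = (sgn b, 0)) : (∃ t z, ((stage k).chart b).At (t, z, 0) x) ∨
      ∃ j, j < k ∧ ∃ t q, (node k j b).At (t, q, 0) x := by
  have side : ∀ (k : ℕ) (b' : Bool) (v), ((stage (k + 1)).toW (((stage (k + 1)).chart b').map v)).2 =
      (sgn b, 0) → b' = b ∧ v.1.2.2 = 0 := by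
    intro k b' v h
    rw [toW_chart] at h
    have h1 := congrArg Prod.snd h
    rw [chartW_snd] at h1
    obtain ⟨⟨t, z, p⟩, hv⟩ := v
    simp only at h1
    subst h1
    have h2 := congrArg Prod.fst h
    rw [chartW_succ_base] at h2
    exact ⟨sgn_injective h2, rfl⟩
  induction k with
  | zero => omega
  | succ k ih =>
    by_cases hc : ∃ b', IsCentre (stage k).chart (cen k) b' (pr k x)
    · obtain ⟨b', hb'⟩ := hc
      obtain ⟨a, rfl⟩ | ⟨j, v, rfl⟩ | ⟨j, v, rfl⟩ := Blowup.cases x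
      · exact absurd hb' (a.2 b')
      · obtain ⟨rfl, hv⟩ := side k j v hx
        obtain ⟨⟨t, z, p⟩, hv'⟩ := v
        simp only at hv
        subst hv
        exact .inl ⟨t, z, hv', rfl⟩
      · obtain ⟨⟨t, q, p⟩, hv⟩ := v
        have h2 : q = 0 := (datum k).exc_chart₂.1 ⟨b', hb'⟩
        subst h2
        have hjb : j = b := by
          refine sgn_injective ?_
          have hxx := congrArg Prod.fst hx
          refine Eq.trans ?_ hxx
          refine Eq.trans ?_ (congrArg (fun w : TPlane => w.2.1)
            (toW_chart k j ⟨_, (isGood k).dom j _⟩)).symm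
          have h3 : blowMap₂ (cen k) j (t, 0, p) = (t, cen k j t, 0) := by simp [blowMap₂]
          exact (chartW_base k j t).symm.trans
            (congrArg (fun v => (chartW k j v).2.1) h3.symm)
        subst hjb
        by_cases hp : p = 0
        · subst hp
          refine .inr ⟨k, Nat.lt_succ_self k, t, 0, ?_⟩
          rw [node_self]
          exact ⟨hv, rfl⟩
        -- On the exceptional curve `q = 1 / P`.
        · refine .inl ⟨t, 1 / p, (isGood (k + 1)).dom j _, ?_⟩
          exact (datum k).chart₁_eq_chart₂.2 ⟨rfl, by simp [hp], by simp⟩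
    · have hc' : ∀ b', ¬ IsCentre (stage k).chart (cen k) b' (pr k x) := fun b' h => hc ⟨b', h⟩
      have hxb := Blowup.eq_base (x := x) hc'
      rcases Nat.eq_zero_or_pos k with rfl | hk
      · refine absurd ⟨b, (x.proj _ _).1, (isGood 0).dom b _, ?_⟩ hc
        change ((_ : ℂ), cen 0 b _, (0 : ℂ)) = Blowup.proj (stage 0).chart (cen 0) x
        rw [cen_zero]
        exact Prod.ext rfl hx.symm
      · rcases ih hk (x := pr k x) hx with ⟨t, z, h1, h2⟩ | ⟨j, hj, t, q, h1, h2⟩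
        -- A point `(z, 0)` of the old chart other than the centre has the new coordinates `Q = z -
        -- c` and `P = 0`.
        · refine .inr ⟨k, Nat.lt_succ_self k, t, z - cen k b t, ?_⟩
          rw [node_self]
          have h3 : blowMap₂ (cen k) b (t, z - cen k b t, 0) = (t, z, 0) := by simp [blowMap₂]
          have h4 : (t, z - cen k b t, 0) ∈ blowDom₂ (stage k).chart (cen k) b := by
            simp only [blowDom₂, Set.mem_ofPred_eq, h3]
            exact ⟨h1, fun b' _ => by rw [h2]; exact hc' b'⟩
          refine ⟨h4, ?_⟩
          refine (Eq.trans hxb (Blowup.base_eq_chart₂.2 ?_)).symm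
          exact Eq.trans h2.symm (congrArg ((stage k).chart b).map (Subtype.ext h3.symm))
        · refine .inr ⟨j, by omega, t, q, ?_⟩
          rw [node_of_lt hj]
          refine ⟨⟨h1, fun b' => by rw [h2]; exact hc' b'⟩, ?_⟩
          exact Eq.trans (congrArg Blowup.base (Subtype.ext h2)) hxb.symm

/-- The second charts contain all points outside of the other pair of charts where the next
centre is not hit. -/
theorem mem_dom_node {k j : ℕ} (h : j < k) (b : Bool) {v : TPlane}
    (h1 : v ∈ blowDom₂ (stage j).chart (cen j) b) (h2 : cen (j + 1) b v.1 * v.2.2 ≠ 1) :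
    v ∈ (node k j b).dom := by
  induction k with
  | zero => omega
  | succ k ih =>
    rcases (Nat.lt_succ_iff_lt_or_eq.1 h) with h | rfl
    · have h3 := ih h
      rw [node_of_lt h]
      refine ⟨h3, ?_⟩
      rintro b' ⟨t, ht, e⟩
      obtain ⟨k, rfl⟩ : ∃ k', k = k' + 1 := ⟨k - 1, by omega⟩
      -- Later centres lie on exceptional curves over points already left out of the chart, so only
      -- the centre right after the `j`-th one can be hit.
      rcases (Nat.lt_succ_iff_lt_or_eq.1 h) with h | rfl
      · have h4 : newCurve (k + 1) ((node (k + 1) j b).map ⟨v, h3⟩) := by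
          rw [← e, newCurve_chart]
        clear e
        revert h3
        rw [node_of_lt h]
        rintro h3 ⟨b'', hb''⟩
        exact h3.snd b'' hb''
      · have e' : ((stage (j + 1)).chart b').map ⟨_, ht⟩ =
            (Blowup.chart₂ (stage j).chart (cen j) b).map ⟨v, h1⟩ := by
          revert h3
          rw [node_self]
          exact fun _ e => e
        have hbb : b' = b := by
          have h5 := congrArg (fun x => ((stage (j + 1)).toW x)) e'
          have h6 : (stage (j + 1)).toW ((Blowup.chart₂ (stage j).chart (cen j) b).map ⟨v, h1⟩) =
            chartW j b (blowMap₂ (cen j) b v) := toW_chart j b ⟨_, (isGood j).dom b _⟩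
          simp only [h6, toW_chart] at h5
          by_contra hne
          refine h1.snd b' hne ?_
          have h7 := congrArg (Blowup.proj (stage j).chart (cen j)) e'
          change _ = ((stage j).chart b).map ⟨_, h1.fst⟩ at h7
          rw [← h7]
          refine ⟨t, (isGood j).dom b' _, ?_⟩
          refine congrArg ((stage j).chart b').map (Subtype.ext ?_)
          simp [blowMap₁]
        subst hbb
        have h5 := (datum j).chart₁_eq_chart₂.1 e'
        exact h2 (by rw [← h5.1]; exact h5.2.1)
    · rw [node_self]
      exact h1

/-! ### The involution -/

/-- This is the condition under which the involution lifts. As the sign alternates, the centres `t /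
2` and `-t / 2` for `k = 4` are opposite, whereas the two centres `1 / 2` for `k = 5` are equal. -/
theorem cen_not (k : ℕ) (hk : k ≤ 5) (b : Bool) (t : ℂ) : cen k (!b) t = (-1) ^ (k + 1) * cen k b t := by
  interval_cases k <;> cases b <;> simp [cen_eq, ctr] <;> ring

theorem sgnW_zero (b : Bool) (v : TPlane) (x : Carrier 0) (h : ((stage 0).chart b).At v x) :
    ((stage 0).chart (!b)).At (v.1, (-1) * v.2.1, -v.2.2) (sigmaW x) := by
  obtain ⟨_, rfl⟩ := h
  refine ⟨trivial, ?_⟩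
  change ((v.1, (-1) * v.2.1, -v.2.2) : TPlane) = sigmaW v
  simp [sigmaW]

/-- The involution of the `k`-th stage. -/
structure IsSymmetry (k : ℕ) (s : Carrier k → Carrier k) : Prop where
  hol : ∀ x, HolMapAt s x
  invol : ∀ x, s (s x) = x
  chart : ∀ b v x, ((stage k).chart b).At v x →
    ((stage k).chart (!b)).At (v.1, (-1) ^ (k + 1) * v.2.1, -v.2.2) (s x)
  toW : ∀ x, (stage k).toW (s x) = sigmaW ((stage k).toW x)
  newCurve : ∀ x, newCurve k (s x) ↔ newCurve k x
  curve : ∀ i < k, ∀ x, curve k i (s x) ↔ curve k i x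

/-- The involution is lifted through one pair of blowups at a time. Invariance of the curves is
carried along, so that they descend to the quotient by `σ`. -/
theorem exists_symmetry : ∀ k ≤ 6, ∃ s, IsSymmetry k s
  | 0, _ => ⟨sigmaW, {
      hol := fun x => holMapAt_affine (E := TPlane) (F := TPlane) (by unfold sigmaW; fun_prop)
      invol := fun x => by
        change sigmaW (sigmaW x) = (x : TPlane)
        simp only [sigmaW, neg_neg]
        rfl
      chart := fun b v x h => by simpa using sgnW_zero b v x h
      toW := fun _ => rfl
      newCurve := fun x => neg_eq_zero (a := (show TPlane from x).2.2)
      curve := fun _ h => absurd h (Nat.not_lt_zero _) }⟩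
  | k + 1, hk => by
    obtain ⟨s, hs⟩ := exists_symmetry k (by omega)
    have S : IsBlowupSymmetry (stage k).chart (cen k) s not ((-1) ^ (k + 1)) :=
      { hol := hs.hol
        invol := hs.invol
        invol_index := Bool.not_not
        sq := by rw [← mul_pow]; simp
        chart := hs.chart
        centre := cen_not k (by omega) }
    refine ⟨S.lift, S.holMapAt_lift (datum k), S.lift_lift, fun b v x hx => ?_, fun x => ?_,
      fun x => ?_, fun i hi x => ?_⟩
    · have := S.chart₁_lift b v x hx
      rw [show ((-1 : ℂ)) ^ (k + 1 + 1) = -(-1) ^ (k + 1) by ring]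
      exact this
    · exact (congrArg (stage k).toW (S.proj_lift x)).trans (hs.toW _)
    · have h1 : pr k (S.lift x) = s (pr k x) := S.proj_lift x
      change (∃ b, IsCentre (stage k).chart (cen k) b (pr k (S.lift x))) ↔
        ∃ b, IsCentre (stage k).chart (cen k) b (pr k x)
      rw [h1]
      exact ⟨fun ⟨b, hb⟩ => ⟨!b, S.isCentre_iff.1 hb⟩,
        fun ⟨b, hb⟩ => ⟨!b, S.isCentre hb⟩⟩
    · rcases (Nat.lt_succ_iff_lt_or_eq.1 hi) with hi | rfl
      · refine (curve_of_lt hi _).trans (Iff.trans ?_ (curve_of_lt hi _).symm)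
        have h1 : pr k (S.lift x) = s (pr k x) := S.proj_lift x
        rw [h1]
        exact hs.curve i hi _
      · refine (curve_self i _).trans (Iff.trans ?_ (curve_self i _).symm)
        obtain ⟨a, rfl⟩ | ⟨j, v, rfl⟩ | ⟨j, v, rfl⟩ := Blowup.cases x
        · exact hs.newCurve a.1
        · exact Iff.rfl
        · change -((-1 : ℂ) ^ (i + 1)) * v.1.2.2 = 0 ↔ v.1.2.2 = 0
          simp

/-- Where the last coordinate of `W` is nonzero the projection to `W` is injective and determines
the lift. This part is dense, and the stage is Hausdorff. -/
theorem symmetry_unique {k : ℕ} {s s' : Carrier k → Carrier k} (hs : Continuous s)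
    (hs' : Continuous s') (h : ∀ x, (stage k).toW (s x) = sigmaW ((stage k).toW x))
    (h' : ∀ x, (stage k).toW (s' x) = sigmaW ((stage k).toW x)) : s = s' := by
  have := (isGood k).t2
  refine Continuous.ext_on (isGood k).dense hs hs' fun x hx => ?_
  refine (isGood k).inj _ _ ?_ (by rw [h, h'])
  rw [h]
  rintro ⟨b, hb⟩
  have := congrArg Prod.snd hb
  exact hx (by simpa [sigmaW] using this)

end XStage

/-! ## The surface `X` and its involution -/

namespace XSpace

theorem t2Space : T2Space XSpace := (XStage.isGood 6).t2

theorem holMapAt_toW (x : XSpace) : HolMapAt toW x := (XStage.isGood 6).hol x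

theorem continuous_toW : Continuous toW :=
  continuous_iff_continuousAt.2 fun x => (holMapAt_toW x).1

theorem holOpenAt_toW {x : XSpace} (h : ¬ XStage.IsPm x.toW) : HolOpenAt toW x :=
  (XStage.isGood 6).isOpen x h

theorem eq_of_toW_eq {x y : XSpace} (h : ¬ XStage.IsPm x.toW) (e : x.toW = y.toW) : x = y :=
  (XStage.isGood 6).inj x y h e

theorem exists_toW_eq {w : TPlane} (h : ¬ XStage.IsPm w) : ∃ x : XSpace, x.toW = w :=
  (XStage.isGood 6).surj w h

/-- The exceptional curves of the blowups and the line `{s = 0}`. -/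
def curve (i : ℕ) (x : XSpace) : Prop := XStage.curve 6 i x

theorem exists_involution : ∃ σ, IsInducedInvolution σ ∧
    (∀ v x, zw₈.At v x → uv₈.At (v.1, -v.2.1, -v.2.2) (σ x)) ∧
    (∀ v x, uv₈.At v x → zw₈.At (v.1, -v.2.1, -v.2.2) (σ x)) ∧
    ∀ i < 6, ∀ x, curve i (σ x) ↔ curve i x := by
  obtain ⟨s, hs⟩ := XStage.exists_symmetry 6 le_rfl
  refine ⟨s, ⟨isHolMap_iff.2 hs.hol, hs.invol, hs.toW⟩, fun v x h => ?_, fun v x h => ?_, hs.curve⟩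
  · have := hs.chart true v x h
    norm_num at this
    exact this
  · have := hs.chart false v x h
    norm_num at this
    exact this

namespace IsInducedInvolution

variable {σ : XSpace → XSpace} (hσ : IsInducedInvolution σ)
include hσ

theorem unique {τ : XSpace → XSpace} (hτ : IsInducedInvolution τ) : τ = σ :=
  XStage.symmetry_unique (k := 6) hτ.1.1 hσ.1.1 hτ.2.2 hσ.2.2

theorem at_uv {v : TPlane} {x : XSpace} (h : zw₈.At v x) : uv₈.At (v.1, -v.2.1, -v.2.2) (σ x) := by
  obtain ⟨τ, h1, h2, -⟩ := exists_involution
  rw [h1.unique hσ]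
  exact h2 v x h

theorem at_zw {v : TPlane} {x : XSpace} (h : uv₈.At v x) : zw₈.At (v.1, -v.2.1, -v.2.2) (σ x) := by
  obtain ⟨τ, h1, -, h2, -⟩ := exists_involution
  rw [h1.unique hσ]
  exact h2 v x h

theorem curve_iff {i : ℕ} (hi : i < 6) (x : XSpace) : curve i (σ x) ↔ curve i x := by
  obtain ⟨τ, h1, -, -, h2⟩ := exists_involution
  rw [h1.unique hσ]
  exact h2 i hi x

theorem holOpenAt (x : XSpace) : HolOpenAt σ x :=
  .of_inverse (isHolMap_iff.1 hσ.1 x) (isHolMap_iff.1 hσ.1 _)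
    (Eventually.of_forall hσ.2.1) (Eventually.of_forall hσ.2.1)

end IsInducedInvolution

end XSpace

/-! ## The correspondence between `W` and `S` -/

open Classical in
/-- The double covering `V → U`, as a map of `W` without the point `p`. -/
noncomputable def wS (w : TPlane) : SSpace :=
  if w.2.1 = 0 then SSpace.pt 5 (w.1, w.2.2 ^ 2, w.2.1 / w.2.2)
  else SSpace.pt 4 (w.1, w.2.2 / w.2.1, w.2.1 ^ 2)

theorem wS_of_fst_ne {w : TPlane} (h : w.2.1 ≠ 0) :
    wS w = SSpace.pt 4 (w.1, w.2.2 / w.2.1, w.2.1 ^ 2) := if_neg h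

theorem wS_of_snd_ne {w : TPlane} (h : w.2.2 ≠ 0) :
    wS w = SSpace.pt 5 (w.1, w.2.2 ^ 2, w.2.1 / w.2.2) := by
  by_cases h1 : w.2.1 = 0
  · exact if_pos h1
  · rw [wS_of_fst_ne h1, SSpace.pt_four_eq_pt_five (div_ne_zero h h1)]
    congr 3 <;> field_simp

theorem fst_or_snd_ne {w : TPlane} (h : w.2 ≠ (0, 0)) : w.2.1 ≠ 0 ∨ w.2.2 ≠ 0 := by
  by_contra! h1
  exact h (Prod.ext h1.1 h1.2)

theorem time_wS (w : TPlane) : (wS w).time = w.1 := by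
  unfold wS
  split <;> exact SSpace.time_pt _ _

theorem wS_eq_xy {w : TPlane} (h : w.2.2 ≠ 0) :
    wS w = SSpace.pt 2 (w.1, 1 / w.2.2 ^ 2, -w.2.1 / w.2.2 ^ 3) := by
  rw [wS_of_snd_ne h, ← SSpace.pt_two_toXY (by simpa [SSpace.bdry] using h)]
  simp only [SSpace.toXY]
  congr 3
  field_simp

theorem wS_sigmaW (w : TPlane) : wS (sigmaW w) = wS w := by
  simp [wS, sigmaW, neg_div_neg_eq]

theorem branch_wS {w : TPlane} (h : w.2 ≠ (0, 0)) : ¬ SSpace.branch (wS w) := by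
  rcases fst_or_snd_ne h with h | h
  · rw [wS_of_fst_ne h, SSpace.branch_pt]
    simp [h]
  · rw [wS_of_snd_ne h, SSpace.branch_pt]
    simp [h]

theorem exc_wS {w : TPlane} (h : w.2 ≠ (0, 0)) : SSpace.exc (wS w) ↔ w.2.2 = 0 := by
  by_cases h1 : w.2.2 = 0
  · have h2 := (fst_or_snd_ne h).resolve_right (not_not.2 h1)
    rw [wS_of_fst_ne h2, SSpace.exc_pt]
    simp [h1]
  · rw [wS_of_snd_ne h1, SSpace.exc_pt]
    simp [h1]

theorem infty_wS (w : TPlane) : ¬ SSpace.infty (wS w) := by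
  unfold wS
  split <;> simp [SSpace.infty_pt]

theorem fibre_wS (w : TPlane) : ¬ SSpace.fibre (wS w) := by
  unfold wS
  split <;> simp [SSpace.fibre_pt]

/-- On `W` the coordinate `P⁽²⁾` is `ξ²`, so `P⁽²⁾ = 4` means `ξ = ±2`: the points `p_±` are the two
preimages of `a⁽²⁾`. -/
theorem wS_mem_a₂ {w : TPlane} (h : w.2 ≠ (0, 0)) : wS w ∈ SSpace.a₂ ↔ XStage.IsPm w := by
  by_cases h1 : w.2.1 = 0
  · have h2 := (fst_or_snd_ne h).resolve_left (not_not.2 h1)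
    rw [wS_of_snd_ne h2, SSpace.pt_mem_a₂]
    refine iff_of_false (by simp) ?_
    rintro ⟨b, hb⟩
    exact h2 (congrArg Prod.snd hb)
  · rw [wS_of_fst_ne h1, SSpace.pt_mem_a₂]
    have h2 : w.2.1 ^ 2 = 4 ↔ w.2.1 = 2 ∨ w.2.1 = -2 := by
      rw [show (4 : ℂ) = 2 ^ 2 by norm_num, sq_eq_sq_iff_eq_or_eq_neg]
    simp only [XStage.IsPm, Bool.exists_bool, XStage.sgn, Prod.ext_iff, h2]
    simp [h1]
    tauto

/-- Off `p` the fibres of the double cover are the orbits of the deck involution, so dividing by it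
gives back an open part of `S`. The exceptional curve separates the cases `η = 0` and `η ≠ 0`, each
of which lies in one chart. -/
theorem wS_eq_wS {w w' : TPlane} (h : w.2 ≠ (0, 0)) (h' : w'.2 ≠ (0, 0)) :
    wS w = wS w' ↔ w' = w ∨ w' = sigmaW w := by
  constructor
  · intro e
    have ht : w.1 = w'.1 := by rw [← time_wS, ← time_wS, e]
    obtain ⟨t, ξ, η⟩ := w
    obtain ⟨t', ξ', η'⟩ := w'
    simp only at ht
    subst ht
    have h3 : η = 0 ↔ η' = 0 := by
      have h1 := exc_wS h
      have h2 := exc_wS h'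
      rw [e] at h1
      exact h1.symm.trans h2
    by_cases hη : η = 0
    · have hη' := h3.1 hη
      subst hη hη'
      have k1 : ξ ≠ 0 := by simpa using h
      have k2 : ξ' ≠ 0 := by simpa using h'
      rw [wS_of_fst_ne k1, wS_of_fst_ne k2] at e
      have := congrArg (fun w : TPlane => w.2.2) (SSpace.pt_injective 4 e)
      simp only at this
      rcases sq_eq_sq_iff_eq_or_eq_neg.1 this with h | h
      · exact .inl (by rw [h])
      · exact .inr (by simp [sigmaW, h])
    · have hη' : η' ≠ 0 := fun h => hη (h3.2 h)
      rw [wS_of_snd_ne hη, wS_of_snd_ne hη'] at e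
      have e := SSpace.pt_injective 5 e
      simp only [Prod.mk.injEq, true_and] at e
      rcases sq_eq_sq_iff_eq_or_eq_neg.1 e.1 with h | h
      · refine .inl ?_
        subst h
        have := e.2
        field_simp at this
        rw [this]
      · refine .inr ?_
        subst h
        have := e.2
        rw [div_neg, neg_eq_iff_eq_neg, ← neg_div, div_left_inj' hη'] at this
        simp [sigmaW, this]
  · rintro (rfl | rfl)
    · rfl
    · exact (wS_sigmaW w).symm

/-- The blowdown contracts only the ramification curve over `C`. As soon as either `C` or `p` is
left out, the correspondence between `S` and `W` is the graph of `wS`. -/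
theorem cover_blowdown {s : SSpace} {w : TPlane} (h : s ∉ SSpace.C ∨ w.2 ≠ (0, 0)) :
    (∃ v : VSpace, v.cover = s ∧ v.blowdown = w) ↔ w.2 ≠ (0, 0) ∧ s = wS w := by
  constructor
  · rintro ⟨v, rfl, rfl⟩
    obtain ⟨⟨t, r, S⟩ | ⟨t, R, S⟩⟩ := v
    · change SSpace.pt 5 (t, S ^ 2, r) ∉ SSpace.C ∨ (r * S, S) ≠ ((0, 0) : ℂ × ℂ) at h
      change (r * S, S) ≠ ((0, 0) : ℂ × ℂ) ∧ SSpace.pt 5 (t, S ^ 2, r) = wS (t, r * S, S)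
      have hS : S ≠ 0 := by
        rintro rfl
        simp [SSpace.mem_C_iff, SSpace.branch_pt] at h
      refine ⟨by simp [hS], ?_⟩
      rw [wS_of_snd_ne hS]
      simp [hS]
    · change SSpace.pt 4 (t, S, R ^ 2) ∉ SSpace.C ∨ (R, R * S) ≠ ((0, 0) : ℂ × ℂ) at h
      change (R, R * S) ≠ ((0, 0) : ℂ × ℂ) ∧ SSpace.pt 4 (t, S, R ^ 2) = wS (t, R, R * S)
      have hR : R ≠ 0 := by
        rintro rfl
        simp [SSpace.mem_C_iff, SSpace.branch_pt] at h
      refine ⟨by simp [hR], ?_⟩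
      rw [wS_of_fst_ne hR]
      simp [hR]
  · rintro ⟨h1, rfl⟩
    obtain ⟨t, ξ, η⟩ := w
    rcases fst_or_snd_ne h1 with h1 | h1
    · refine ⟨Quot.mk _ (Sum.inr (t, ξ, η / ξ)), (wS_of_fst_ne h1).symm, ?_⟩
      change ((t, ξ, ξ * (η / ξ)) : TPlane) = _
      rw [mul_div_cancel₀ _ h1]
    · refine ⟨Quot.mk _ (Sum.inl (t, ξ / η, η)), (wS_of_snd_ne h1).symm, ?_⟩
      change ((t, ξ / η * η, η) : TPlane) = _
      rw [div_mul_cancel₀ _ h1]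

theorem holOpenAt_sq {v : TPlane} (h : v.2.2 ≠ 0) :
    HolOpenAt (fun v : TPlane => (v.1, v.2.1, v.2.2 ^ 2)) v := by
  let u : ℂˣ := Units.mk0 (2 * v.2.2) (by simpa using h)
  let f' : TPlane ≃L[ℂ] TPlane := (ContinuousLinearEquiv.refl ℂ ℂ).prodCongr
    ((ContinuousLinearEquiv.refl ℂ ℂ).prodCongr (ContinuousLinearEquiv.unitsEquivAut ℂ u))
  have h1 : HasFDerivAt (fun v : TPlane => (v.1, v.2.1, v.2.2 ^ 2)) (f' : TPlane →L[ℂ] TPlane) v := by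
    have h2 : HasFDerivAt (fun v : TPlane => v.2.2)
      ((ContinuousLinearMap.snd ℂ ℂ ℂ).comp (ContinuousLinearMap.snd ℂ ℂ (ℂ × ℂ))) v :=
      (((ContinuousLinearMap.snd ℂ ℂ ℂ).comp (ContinuousLinearMap.snd ℂ ℂ (ℂ × ℂ)))).hasFDerivAt
    have h3 : HasFDerivAt (fun v : TPlane => v.2.1)
      ((ContinuousLinearMap.fst ℂ ℂ ℂ).comp (ContinuousLinearMap.snd ℂ ℂ (ℂ × ℂ))) v :=
      (((ContinuousLinearMap.fst ℂ ℂ ℂ).comp (ContinuousLinearMap.snd ℂ ℂ (ℂ × ℂ)))).hasFDerivAt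
    refine (hasFDerivAt_fst.prodMk (h3.prodMk (h2.pow 2))).congr_fderiv ?_
    ext <;> simp [f', u, ContinuousLinearEquiv.unitsEquivAut]
  obtain ⟨U, -, hv, -, hU⟩ := exists_holOpenAt_of_hasFDerivAt
    (f := fun v : TPlane => (v.1, v.2.1, v.2.2 ^ 2)) (by fun_prop) h1
  exact hU v hv

/-- In each of the two charts the map squares one coordinate and keeps the others, up to
biholomorphic changes; off `p` one can choose the chart in which the squared coordinate is nonzero.
-/
theorem holOpenAt_wS {w : TPlane} (h : w.2 ≠ (0, 0)) : HolOpenAt wS w := by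
  rcases fst_or_snd_ne h with h1 | h1
  · have k1 : HolOpenAt (fun w : TPlane => ((w.1, w.2.2 / w.2.1, w.2.1) : TPlane)) w := by
      refine .of_analytic (g := fun w => (w.1, w.2.2, w.2.1 * w.2.2)) (by fun_prop (disch := assumption))
        (by fun_prop) ?_ ?_
      · filter_upwards [eventually_ne_of_continuousAt (f := fun v : TPlane => v.2.1) (by fun_prop) h1]
          with w hw
        ext <;> simp [div_mul_cancel₀ _ hw]
      · filter_upwards [eventually_ne_of_continuousAt (f := fun v : TPlane => v.2.2)
          (v := (w.1, w.2.2 / w.2.1, w.2.1)) (by fun_prop) h1] with w hw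
        ext <;> simp [hw]
    refine HolOpenAt.congr (((SSpace.holOpenAt_pt 4 _).comp (holOpenAt_sq h1)).comp
      (f := fun w : TPlane => ((w.1, w.2.2 / w.2.1, w.2.1) : TPlane)) k1) ?_
    filter_upwards [eventually_ne_of_continuousAt (f := fun v : TPlane => v.2.1) (by fun_prop) h1]
      with w hw
    exact (wS_of_fst_ne hw).symm
  · have k1 : HolOpenAt (fun w : TPlane => ((w.1, w.2.1 / w.2.2, w.2.2) : TPlane)) w := by
      refine .of_analytic (g := fun w => (w.1, w.2.1 * w.2.2, w.2.2)) (by fun_prop (disch := assumption))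
        (by fun_prop) ?_ ?_
      · filter_upwards [eventually_ne_of_continuousAt (f := fun v : TPlane => v.2.2) (by fun_prop) h1]
          with w hw
        ext <;> simp [div_mul_cancel₀ _ hw]
      · filter_upwards [eventually_ne_of_continuousAt (f := fun v : TPlane => v.2.2)
          (v := (w.1, w.2.1 / w.2.2, w.2.2)) (by fun_prop) h1] with w hw
        ext <;> simp [hw]
    have k2 : HolOpenAt (fun w : TPlane => ((w.1, w.2.2, w.2.1) : TPlane)) (w.1, w.2.1 / w.2.2, w.2.2 ^ 2) :=
      .of_analytic (g := fun w => (w.1, w.2.2, w.2.1)) (by fun_prop) (by fun_prop)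
        (Eventually.of_forall fun _ => rfl) (Eventually.of_forall fun _ => rfl)
    have k3 := (SSpace.holOpenAt_pt 5 (w.1, w.2.2 ^ 2, w.2.1 / w.2.2)).comp
      (f := fun w : TPlane => ((w.1, w.2.2, w.2.1) : TPlane)) k2
    have k4 := HolOpenAt.comp (f := fun v : TPlane => (v.1, v.2.1, v.2.2 ^ 2))
      (a := (w.1, w.2.1 / w.2.2, w.2.2)) k3 (holOpenAt_sq h1)
    have k5 := HolOpenAt.comp (f := fun w : TPlane => ((w.1, w.2.1 / w.2.2, w.2.2) : TPlane))
      (a := w) k4 k1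
    refine HolOpenAt.congr k5 ?_
    filter_upwards [eventually_ne_of_continuousAt (f := fun v : TPlane => v.2.2) (by fun_prop) h1]
      with w hw
    exact (wS_of_snd_ne hw).symm

/-! ## Gluing `S` and `X / σ` -/

/-- The conditions under which `A ⊂ S` and `B ⊂ X` are glued. -/
structure IsGlueDatum (A : Set SSpace) (B : Set XSpace) (σ : XSpace → XSpace) : Prop where
  involution : XSpace.IsInducedInvolution σ
  isOpen_left : IsOpen A
  isOpen_right : IsOpen B
  invariant : ∀ x ∈ B, σ x ∈ B
  notMem_a₂ : ∀ s ∈ A, s ∉ SSpace.a₂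
  disj : (∀ s ∈ A, s ∉ SSpace.C) ∨ ∀ x ∈ B, x ∉ XSpace.p

namespace Glue

variable {A : Set SSpace} {B : Set XSpace} {σ : XSpace → XSpace}

/-- The points of `A` in the gluing. -/
def inS (s : A) : Glue A B σ := Quot.mk _ (Sum.inl s)

/-- The points of `B` in the gluing. -/
def inX (x : B) : Glue A B σ := Quot.mk _ (Sum.inr x)

theorem cases (e : Glue A B σ) : (∃ s, inS s = e) ∨ ∃ x, inX x = e := by
  obtain ⟨s | x, rfl⟩ := Quot.exists_rep e
  · exact .inl ⟨s, rfl⟩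
  · exact .inr ⟨x, rfl⟩

end Glue

namespace IsGlueDatum

open Glue

variable {A : Set SSpace} {B : Set XSpace} {σ : XSpace → XSpace} (D : IsGlueDatum A B σ)
include D

theorem cover_iff (s : A) (x : B) : (∃ v : VSpace, v.cover = s.1 ∧ v.blowdown = x.1.toW) ↔
    x.1.toW.2 ≠ (0, 0) ∧ s.1 = wS x.1.toW :=
  cover_blowdown (D.disj.imp (fun h => h _ s.2) fun h => h _ x.2)

theorem not_isPm (s : A) {x : XSpace} (hx : x.toW.2 ≠ (0, 0)) (h : s.1 = wS x.toW) :
    ¬ XStage.IsPm x.toW := by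
  rw [← wS_mem_a₂ hx, ← h]
  exact D.notMem_a₂ _ s.2

theorem sound_invol (x : B) : (inX ⟨σ x.1, D.invariant _ x.2⟩ : Glue A B σ) = inX x :=
  (Quot.sound (GlueRel.invol _ _ rfl)).symm

theorem sound_cover {s : A} {x : B} (hx : x.1.toW.2 ≠ (0, 0)) (h : s.1 = wS x.1.toW) :
    (inS s : Glue A B σ) = inX x := by
  obtain ⟨v, h1, h2⟩ := (D.cover_iff s x).2 ⟨hx, h⟩
  exact Quot.sound (.cover _ _ v h1 h2)

/-- For the division by `σ` the germs are the identity and `σ`, which is admissible even at the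
fixed point `p`. For the gluing they are the inclusion and `wS ∘ toW`; the point is not over `p_±`
because `a⁽²⁾` has been removed from `A`, so `toW` is a local biholomorphism there. -/
theorem etaleRel : EtaleRel (GlueRel A B σ) := by
  rintro _ _ (⟨x, y, h⟩ | ⟨s, x, v, h1, h2⟩)
  · refine ⟨B, inferInstance, inferInstance, x, Sum.inr,
      fun x => Sum.inr ⟨σ x.1, D.invariant _ x.2⟩, rfl, congrArg Sum.inr (Subtype.ext h),
      holOpenAt_inr _, ?_, Eventually.of_forall fun y => (D.sound_invol y).symm⟩
    have h1 : HolOpenAt (fun x : B => σ x.1) x :=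
      (D.involution.holOpenAt x.1).comp (holOpenAt_subtype_val x (D.isOpen_right.mem_nhds x.2))
    exact (holOpenAt_inr _).comp (h1.codRestrict (q := fun y => y ∈ B) fun x => D.invariant _ x.2)
  · obtain ⟨hx, hs⟩ := (D.cover_iff s x).1 ⟨v, h1, h2⟩
    have hpm := D.not_isPm s hx hs
    have hw : HolOpenAt (fun y : XSpace => wS y.toW) x.1 :=
      (holOpenAt_wS hx).comp (XSpace.holOpenAt_toW hpm)
    have e1 : ∀ᶠ y in 𝓝 x.1, wS y.toW ∈ A :=
      hw.continuousAt.eventually (D.isOpen_left.mem_nhds (show wS x.1.toW ∈ A from hs ▸ s.2))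
    have e2 : ∀ᶠ y in 𝓝 x.1, y.toW.2 ≠ (0, 0) :=
      (continuous_snd.comp XSpace.continuous_toW).continuousAt.eventually (isOpen_ne.mem_nhds hx)
    let Z := {y : XSpace // y ∈ B ∧ wS y.toW ∈ A ∧ y.toW.2 ≠ (0, 0)}
    have hz : wS x.1.toW ∈ A := by rw [← hs]; exact s.2
    let z : Z := ⟨x.1, x.2, hz, hx⟩
    have hval : HolOpenAt (Subtype.val : Z → XSpace) z :=
      holOpenAt_subtype_val z (Eventually.and (D.isOpen_right.mem_nhds x.2) (e1.and e2))
    refine ⟨Z, inferInstance, inferInstance, z, fun y => Sum.inl ⟨wS y.1.toW, y.2.2.1⟩,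
      fun y => Sum.inr ⟨y.1, y.2.1⟩, congrArg Sum.inl (Subtype.ext hs.symm), rfl, ?_, ?_,
      Eventually.of_forall fun y => D.sound_cover y.2.2.2 rfl⟩
    · exact (holOpenAt_inl _).comp
        ((HolOpenAt.comp (f := (Subtype.val : Z → XSpace)) (a := z) hw hval).codRestrict
          (q := fun s => s ∈ A) fun y : Z => y.2.2.1)
    · exact (holOpenAt_inr _).comp (hval.codRestrict (q := fun y => y ∈ B) fun y : Z => y.2.1)

theorem holOpenAt_inS (s : A) : HolOpenAt (inS : A → Glue A B σ) s :=
  HolOpenAt.comp (g := Quot.mk (GlueRel A B σ)) (D.etaleRel.holOpenAt _) (holOpenAt_inl s)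

theorem holOpenAt_inX (x : B) : HolOpenAt (inX : B → Glue A B σ) x :=
  HolOpenAt.comp (g := Quot.mk (GlueRel A B σ)) (D.etaleRel.holOpenAt _) (holOpenAt_inr x)

/-- A property of the points of the gluing. -/
theorem exists_property (P : A → Prop) (Q : B → Prop)
    (hQ : ∀ x, Q ⟨σ x.1, D.invariant _ x.2⟩ ↔ Q x)
    (hPQ : ∀ s x, x.1.toW.2 ≠ (0, 0) → s.1 = wS x.1.toW → (P s ↔ Q x)) :
    ∃ R : Glue A B σ → Prop, (∀ s, R (inS s) ↔ P s) ∧ ∀ x, R (inX x) ↔ Q x := by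
  refine ⟨Quot.lift (fun a => match a with
    | Sum.inl s => P s
    | Sum.inr x => Q x) ?_, fun _ => Iff.rfl, fun _ => Iff.rfl⟩
  rintro _ _ (⟨x, y, h⟩ | ⟨s, x, v, h1, h2⟩)
  · obtain rfl : (⟨σ x.1, D.invariant _ x.2⟩ : B) = y := Subtype.ext h
    exact propext (hQ x).symm
  · obtain ⟨hx, hs⟩ := (D.cover_iff s x).1 ⟨v, h1, h2⟩
    exact propext (hPQ s x hx hs)

/-- The predicate that singles out the point `s` extends to an invariant predicate on `X`, and
invariant predicates separate classes. -/
theorem inS_injective : Function.Injective (inS : A → Glue A B σ) := by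
  intro s s' h
  obtain ⟨R, h1, -⟩ := D.exists_property (fun a => a = s)
    (fun x => x.1.toW.2 ≠ (0, 0) ∧ s.1 = wS x.1.toW) (fun x => by
      simp only [D.involution.2.2, wS_sigmaW]
      simp [sigmaW, Prod.ext_iff]) (fun a x hx ha => by
      rw [Subtype.ext_iff, ha]
      simp [hx, eq_comm])
  exact ((h1 s').1 (by rw [← h, h1])).symm

/-- The predicate describes the class of `x₀`: its `σ`-orbit, and the point of `S` under it if there
is one. It yields the equality criteria that involve points of `X`. -/
theorem exists_property_inX (x₀ : B) : ∃ R : Glue A B σ → Prop,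
    (∀ s, R (inS s) ↔ x₀.1.toW.2 ≠ (0, 0) ∧ s.1 = wS x₀.1.toW) ∧
      ∀ x, R (inX x) ↔ x.1 = x₀.1 ∨ x.1 = σ x₀.1 := by
  refine D.exists_property _ _ (fun x => ?_) (fun s x hx hs => ?_)
  · have h1 : ∀ a b, σ a = b ↔ a = σ b := fun a b =>
      ⟨fun h => by rw [← h, D.involution.2.1], fun h => by rw [h, D.involution.2.1]⟩
    simp only [h1, D.involution.2.1 x₀.1]
    tauto
  · have hpm := D.not_isPm s hx hs
    constructor
    · rintro ⟨h1, h2⟩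
      have h3 := D.not_isPm s h1 h2
      rcases (wS_eq_wS h1 hx).1 (h2.symm.trans hs) with h | h
      · exact .inl (XSpace.eq_of_toW_eq hpm h)
      · exact .inr (XSpace.eq_of_toW_eq hpm (h.trans (D.involution.2.2 _).symm))
    · rintro (h | h)
      · rw [← h]
        exact ⟨hx, hs⟩
      · have h1 := hx
        rw [h, D.involution.2.2] at hs h1
        rw [wS_sigmaW] at hs
        exact ⟨by simpa [sigmaW, Prod.ext_iff] using h1, hs⟩

theorem inS_eq_inX {s : A} {x : B} :
    (inS s : Glue A B σ) = inX x ↔ x.1.toW.2 ≠ (0, 0) ∧ s.1 = wS x.1.toW := by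
  obtain ⟨R, h1, h2⟩ := D.exists_property_inX x
  exact ⟨fun h => (h1 s).1 (by rw [h, h2]; exact .inl rfl), fun h => D.sound_cover h.1 h.2⟩

theorem inX_eq_inX {x y : B} : (inX x : Glue A B σ) = inX y ↔ x.1 = y.1 ∨ x.1 = σ y.1 := by
  obtain ⟨R, h1, h2⟩ := D.exists_property_inX y
  refine ⟨fun h => (h2 x).1 (by rw [h, h2]; exact .inl rfl), ?_⟩
  rintro (h | h)
  · rw [Subtype.ext h]
  · rw [← D.sound_invol y]
    exact congrArg inX (Subtype.ext h)

end IsGlueDatum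

namespace IsGlueDatum

open Glue

variable {A : Set SSpace} {B : Set XSpace} {σ : XSpace → XSpace} (D : IsGlueDatum A B σ)
include D

/-- The time of the points of the gluing. -/
theorem exists_time : ∃ τ : Glue A B σ → ℂ, (∀ s, τ (inS s) = s.1.time) ∧
    (∀ x, τ (inX x) = x.1.toW.1) ∧ Continuous τ ∧ ∀ t e, AtTime t e ↔ τ e = t := by
  let τ : Glue A B σ → ℂ := Quot.lift (fun a => match a with
    | Sum.inl s => s.1.time
    | Sum.inr x => x.1.toW.1) (by
      rintro _ _ (⟨x, y, h⟩ | ⟨s, x, v, h1, h2⟩)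
      · change x.1.toW.1 = y.1.toW.1
        rw [← h, D.involution.2.2]
        rfl
      · change s.1.time = x.1.toW.1
        rw [← h1, ← h2, VSpace.time_cover])
  have h1 : ∀ s, τ (inS s) = s.1.time := fun _ => rfl
  have h2 : ∀ x, τ (inX x) = x.1.toW.1 := fun _ => rfl
  refine ⟨τ, h1, h2, ?_, fun t e => ⟨?_, ?_⟩⟩
  · refine continuous_iff_continuousAt.2 fun e => ?_
    obtain ⟨s, rfl⟩ | ⟨x, rfl⟩ := e.cases
    · rw [ContinuousAt, ← (D.holOpenAt_inS s).1, tendsto_map'_iff]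
      exact (SSpace.continuous_time.comp continuous_subtype_val).continuousAt
    · rw [ContinuousAt, ← (D.holOpenAt_inX x).1, tendsto_map'_iff]
      exact (continuous_fst.comp (XSpace.continuous_toW.comp continuous_subtype_val)).continuousAt
  · rintro (⟨s, ⟨h, rfl⟩, rfl⟩ | ⟨x, ⟨h, rfl⟩, rfl⟩) <;> rfl
  · rintro rfl
    obtain ⟨s, rfl⟩ | ⟨x, rfl⟩ := e.cases
    · exact .inl ⟨s.1, ⟨s.2, rfl⟩, rfl⟩
    · exact .inr ⟨x.1, ⟨x.2, rfl⟩, rfl⟩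

theorem atTime_inS {t : ℂ} {s : A} : AtTime t (inS s : Glue A B σ) ↔ s.1.time = t := by
  obtain ⟨τ, h1, -, -, h2⟩ := D.exists_time
  rw [h2, h1]

theorem atTime_inX {t : ℂ} {x : B} : AtTime t (inX x : Glue A B σ) ↔ x.1.toW.1 = t := by
  obtain ⟨τ, -, h1, -, h2⟩ := D.exists_time
  rw [h2, h1]

/-- If the point `p` is left out, then the gluing is Hausdorff. -/
theorem t2Space (hB : ∀ x ∈ B, x ∉ XSpace.p) : T2Space (Glue A B σ) := by
  have := SSpace.t2Space
  have := XSpace.t2Space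
  have hσ := D.involution.1.1
  have hS : ∀ s : A, map (inS : A → Glue A B σ) (𝓝 s) = 𝓝 (inS s) := fun s => (D.holOpenAt_inS s).1
  have hX : ∀ x : B, map (inX : B → Glue A B σ) (𝓝 x) = 𝓝 (inX x) := fun x => (D.holOpenAt_inX x).1
  have hSX : ∀ (s : A) (x : B), (inS s : Glue A B σ) ≠ inX x → Disjoint (𝓝 (inS s : Glue A B σ)) (𝓝 (inX x)) := by
    intro s x hsx
    refine exists_disjoint_nhds_of_isClosed hS hX ?_ hsx
    have h1 : {a : A × B | (inS a.1 : Glue A B σ) = inX a.2} = {a | a.1.1 = wS a.2.1.toW} := by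
      ext a
      rw [Set.mem_ofPred_eq, Set.mem_ofPred_eq, D.inS_eq_inX]
      exact ⟨fun h => h.2, fun h => ⟨hB _ a.2.2, h⟩⟩
    rw [h1]
    have h2 : Continuous fun x : B => wS x.1.toW := continuous_iff_continuousAt.2 fun x =>
      ContinuousAt.comp (f := fun x : B => x.1.toW) (holOpenAt_wS (hB _ x.2)).continuousAt
        (XSpace.continuous_toW.comp continuous_subtype_val).continuousAt
    exact isClosed_eq (continuous_subtype_val.comp continuous_fst) (h2.comp continuous_snd)
  refine t2Space_iff_disjoint_nhds.2 fun e e' h => ?_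
  obtain ⟨s, rfl⟩ | ⟨x, rfl⟩ := e.cases <;> obtain ⟨s', rfl⟩ | ⟨x', rfl⟩ := e'.cases
  · refine exists_disjoint_nhds_of_isClosed hS hS ?_ h
    simp only [D.inS_injective.eq_iff]
    exact isClosed_eq continuous_fst continuous_snd
  · exact hSX _ _ h
  · exact (hSX _ _ h.symm).symm
  · refine exists_disjoint_nhds_of_isClosed hX hX ?_ h
    simp only [D.inX_eq_inX]
    refine IsClosed.union (isClosed_eq ?_ ?_) (isClosed_eq ?_ ?_)
    · exact continuous_subtype_val.comp continuous_fst
    · exact continuous_subtype_val.comp continuous_snd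
    · exact continuous_subtype_val.comp continuous_fst
    · exact hσ.comp (continuous_subtype_val.comp continuous_snd)

end IsGlueDatum

/-! ### The families `F` and `Ē` -/

theorem SSpace.isOpen_of_pt {P : Set SSpace} (h : ∀ i, IsOpen {v | SSpace.pt i v ∈ P}) : IsOpen P := by
  refine isOpen_iff_mem_nhds.2 fun s hs => ?_
  obtain ⟨i, v, rfl⟩ := SSpace.exists_pt s
  rw [← (SSpace.holOpenAt_pt i v).1]
  exact (h i).mem_nhds hs

theorem SSpace.isClosed_C : IsClosed SSpace.C := by
  refine ⟨SSpace.isOpen_of_pt fun i => ?_⟩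
  simp only [Set.mem_compl_iff, SSpace.mem_C_iff, SSpace.branch_pt, ← isClosed_compl_iff,
    Set.compl_ofPred, not_not]
  refine IsClosed.union (IsClosed.inter isClosed_const ?_) (IsClosed.inter isClosed_const ?_)
  · exact isClosed_eq (by fun_prop) continuous_const
  · exact isClosed_eq (by fun_prop) continuous_const

theorem XSpace.isClosed_p : IsClosed XSpace.p :=
  isClosed_eq (continuous_snd.comp XSpace.continuous_toW) continuous_const

theorem XSpace.IsInducedInvolution.notMem_p {σ : XSpace → XSpace} (hσ : XSpace.IsInducedInvolution σ)
    {x : XSpace} (h : x ∉ XSpace.p) : σ x ∉ XSpace.p := by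
  simpa [XSpace.p, hσ.2.2, sigmaW, Prod.ext_iff] using h

theorem XSpace.IsInducedInvolution.datumF {σ : XSpace → XSpace} (hσ : XSpace.IsInducedInvolution σ) :
    IsGlueDatum (SSpace.C ∪ SSpace.a₂)ᶜ Set.univ σ where
  involution := hσ
  isOpen_left := (SSpace.isClosed_C.union SSpace.isClosed_a₂).isOpen_compl
  isOpen_right := isOpen_univ
  invariant _ _ := trivial
  notMem_a₂ _ h h' := h (.inr h')
  disj := .inl fun _ h h' => h (.inl h')

theorem XSpace.IsInducedInvolution.datumE {σ : XSpace → XSpace} (hσ : XSpace.IsInducedInvolution σ) :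
    IsGlueDatum SSpace.a₂ᶜ XSpace.pᶜ σ where
  involution := hσ
  isOpen_left := SSpace.isClosed_a₂.isOpen_compl
  isOpen_right := XSpace.isClosed_p.isOpen_compl
  invariant _ := hσ.notMem_p
  notMem_a₂ _ h := h
  disj := .inr fun _ h => h

/-! ## Charts of surfaces and smooth rational curves -/

section Surfaces

variable {Y : Type} [TopologicalSpace Y] [HolSpace Y]

/-- A biholomorphic map of an open set of the plane onto an open subset of a surface. -/
structure IsOpenChart (φ : ℂ × ℂ → Y) (O : Set (ℂ × ℂ)) : Prop where
  isOpen : IsOpen O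
  inj : Set.InjOn φ O
  hol : ∀ a ∈ O, HolOpenAt φ a

/-- Local biholomorphisms of the plane. -/
def IsLocalBiholo (f : ℂ × ℂ → ℂ × ℂ) (a : ℂ × ℂ) : Prop :=
  ∃ U, IsOpen U ∧ a ∈ U ∧ Set.InjOn f U ∧ ∀ w ∈ U, HolOpenAt f w

theorem IsLocalBiholo.holOpenAt {f : ℂ × ℂ → ℂ × ℂ} {a : ℂ × ℂ} (h : IsLocalBiholo f a) :
    HolOpenAt f a := by
  obtain ⟨U, -, ha, -, hU⟩ := h
  exact hU a ha

theorem IsLocalBiholo.of_inverse {f g : ℂ × ℂ → ℂ × ℂ} {a : ℂ × ℂ} (hf : AnalyticAt ℂ f a)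
    (hg : AnalyticAt ℂ g (f a)) (hgf : ∀ᶠ x in 𝓝 a, g (f x) = x)
    (hfg : ∀ᶠ y in 𝓝 (f a), f (g y) = y) : IsLocalBiholo f a := by
  have h1 := hf.continuousAt.eventually (hg.eventually_analyticAt.and hfg.eventually_nhds)
  obtain ⟨U, hU, hUo, ha⟩ := eventually_nhds_iff.1
    ((hf.eventually_analyticAt.and hgf.eventually_nhds).and h1)
  refine ⟨U, hUo, ha, fun x hx y hy e => ?_, fun w hw => ?_⟩
  · rw [← (hU x hx).1.2.self_of_nhds, e, (hU y hy).1.2.self_of_nhds]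
  · obtain ⟨⟨k1, k2⟩, k3, k4⟩ := hU w hw
    exact .of_analytic k1 k3 k2 k4

theorem isLocalBiholo_id (a : ℂ × ℂ) : IsLocalBiholo (fun v => v) a :=
  ⟨Set.univ, isOpen_univ, trivial, Function.injective_id.injOn, fun w _ => holOpenAt_id w⟩

theorem IsOpenChart.isLocalCoord {φ : ℂ × ℂ → Y} {O : Set (ℂ × ℂ)} (hφ : IsOpenChart φ O)
    {a : ℂ × ℂ} (ha : a ∈ O) {f : ℂ × ℂ → ℂ × ℂ} (hf : IsLocalBiholo f a) {α β : Y → ℂ}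
    (h : ∀ᶠ v in 𝓝 a, (α (φ v), β (φ v)) = f v) : IsLocalCoord α β (φ a) := by
  obtain ⟨U, hUo, haU, hi, hU⟩ := hf
  obtain ⟨V, hV, hVo, haV⟩ := eventually_nhds_iff.1 h
  have hN : IsOpen (φ '' (U ∩ V ∩ O)) := by
    refine isOpen_iff_mem_nhds.2 ?_
    rintro _ ⟨v, hv, rfl⟩
    rw [← (hφ.hol v hv.2).1]
    exact image_mem_map (((hUo.inter hVo).inter hφ.isOpen).mem_nhds hv)
  refine ⟨_, hN, ⟨a, ⟨⟨haU, haV⟩, ha⟩, rfl⟩, .of_holOpenAt ?_ ?_⟩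
  · rintro ⟨_, v, hv, rfl⟩
    have h1 : HolOpenAt (fun y => (α y, β y)) (φ v) := by
      refine HolOpenAt.cancel (hφ.hol v hv.2) ((hU v hv.1.1).congr ?_)
      filter_upwards [hVo.mem_nhds hv.1.2] with w hw
      exact (hV w hw).symm
    exact h1.comp (f := Subtype.val) (holOpenAt_subtype_val
      (p := fun y => y ∈ φ '' (U ∩ V ∩ O)) ⟨φ v, v, hv, rfl⟩ (hN.mem_nhds ⟨v, hv, rfl⟩))
  · rintro ⟨_, v, hv, rfl⟩ ⟨_, w, hw, rfl⟩ e
    have h1 : f v = f w := by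
      rw [← hV v hv.1.2, ← hV w hw.1.2]
      exact e
    exact Subtype.ext (congrArg φ (hi hv.1.1 hw.1.1 h1))

theorem IsOpenChart.crossTransversally {φ : ℂ × ℂ → Y} {O : Set (ℂ × ℂ)} (hφ : IsOpenChart φ O)
    (h0 : (0 : ℂ × ℂ) ∈ O) {L L' : Set Y} (hL : ∀ v ∈ O, φ v ∈ L ↔ v.1 = 0)
    (hL' : ∀ v ∈ O, φ v ∈ L' ↔ v.2 = 0) : CrossTransversally L L' (φ 0) := by
  have h1 : ∀ v ∈ O, Function.invFunOn φ O (φ v) = v := fun v hv =>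
    hφ.inj.leftInvOn_invFunOn hv
  refine ⟨fun y => (Function.invFunOn φ O y).1, fun y => (Function.invFunOn φ O y).2,
    hφ.isLocalCoord h0 (isLocalBiholo_id 0) ?_, ?_⟩
  · filter_upwards [hφ.isOpen.mem_nhds h0] with v hv
    simp [h1 v hv]
  · rw [← (hφ.hol 0 h0).1, eventually_map]
    filter_upwards [hφ.isOpen.mem_nhds h0] with v hv
    simp [h1 v hv, hL v hv, hL' v hv]

theorem CrossTransversally.symm {L L' : Set Y} {y : Y} (h : CrossTransversally L L' y) :
    CrossTransversally L' L y := by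
  obtain ⟨α, β, ⟨N, hN, hy, he⟩, h2⟩ := h
  refine ⟨β, α, ⟨N, hN, hy, .of_holOpenAt (fun n => ?_) ?_⟩, h2.mono fun _ h => h.symm⟩
  · have h1 : HolOpenAt (Prod.swap : ℂ × ℂ → ℂ × ℂ) (α n, β n) :=
      .of_analytic (g := fun v => (v.2, v.1)) (f := fun v => (v.2, v.1)) (by fun_prop) (by fun_prop)
        (Eventually.of_forall fun _ => rfl) (Eventually.of_forall fun _ => rfl)
    exact h1.comp (f := fun n : N => ((α n, β n) : ℂ × ℂ)) (he.holOpenAt n)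
  · intro n m h
    exact he.1.injective (Prod.swap_injective h)

/-- A smooth rational curve of self-intersection number `-2` that is the union of the line
`{p = 0}` of a chart `B` and a point of another chart `A`. -/
theorem IsSmoothRationalCurve.of_charts {A B : ℂ × ℂ → Y} {OA OB : Set (ℂ × ℂ)}
    (hA : IsOpenChart A OA) (hB : IsOpenChart B OB) (h0 : (0 : ℂ × ℂ) ∈ OA)
    (hline : ∀ a : ℂ, (a, 0) ∈ OB) {f : ℂ × ℂ → ℂ × ℂ} (hf : IsLocalBiholo f 0) (hf0 : f 0 = 0)
    (hAB : ∀ v ∈ OA, ∀ w ∈ OB, A v = B w → w.1 ≠ 0 ∧ f v = (1 / w.1, w.1 ^ 2 * w.2))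
    (hBA : ∀ v ∈ OA, (f v).1 ≠ 0 → (f v).2 = 0 → A v = B (1 / (f v).1, 0))
    (hfA : ∀ v ∈ OA, f v = 0 → v = 0)
    {L : Set Y} (hL : ∀ y ∈ L, (∃ v ∈ OA, A v = y) ∨ ∃ w ∈ OB, B w = y)
    (hLA : ∀ v ∈ OA, A v ∈ L ↔ (f v).2 = 0) (hLB : ∀ w ∈ OB, B w ∈ L ↔ w.2 = 0) :
    IsSmoothRationalCurve L (-2) := by
  classical
  replace hL : ∀ y, y ∈ L ↔ y = A 0 ∨ ∃ a : ℂ, y = B (a, 0) := by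
    refine fun y => ⟨fun hy => ?_, ?_⟩
    · rcases hL y hy with ⟨v, hv, rfl⟩ | ⟨w, hw, rfl⟩
      · have h2 := (hLA v hv).1 hy
        by_cases h1 : (f v).1 = 0
        · exact .inl (by rw [hfA v hv (Prod.ext h1 h2)])
        · exact .inr ⟨_, hBA v hv h1 h2⟩
      · exact .inr ⟨w.1, by rw [← (hLB w hw).1 hy]⟩
    · rintro (rfl | ⟨a, rfl⟩)
      · rw [hLA 0 h0, hf0]
        rfl
      · exact (hLB _ (hline a)).2 rfl
  have iA : ∀ v ∈ OA, Function.invFunOn A OA (A v) = v := fun v hv =>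
    hA.inj.leftInvOn_invFunOn hv
  have iB : ∀ v ∈ OB, Function.invFunOn B OB (B v) = v := fun v hv =>
    hB.inj.leftInvOn_invFunOn hv
  -- The model transition for a normal bundle of degree `-2`: the parameter is inverted and the
  -- normal coordinate is multiplied by its square.
  let g : ℂ × ℂ → ℂ × ℂ := fun w => (1 / w.1, w.1 ^ 2 * w.2)
  have hg : ∀ w : ℂ × ℂ, w.1 ≠ 0 → IsLocalBiholo g w := by
    intro w hw
    have hw' : (g w).1 ≠ 0 := by simpa [g] using hw
    refine .of_inverse (g := g) (by fun_prop (disch := assumption)) (by fun_prop (disch := assumption)) ?_ ?_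
    · filter_upwards [eventually_ne_of_continuousAt (f := fun v : ℂ × ℂ => v.1) (by fun_prop) hw] with v hv
      ext <;> simp [g]
      field_simp
    · filter_upwards [eventually_ne_of_continuousAt (f := fun v : ℂ × ℂ => v.1) (by fun_prop) hw'] with v hv
      ext <;> simp [g]
      field_simp
  -- The coordinates around the point of `A`, continued along the whole line by `B`. The hypothesis
  -- `hAB` makes the two definitions agree on the overlap.
  let F : Y → ℂ × ℂ := fun y => if y ∈ A '' OA then f (Function.invFunOn A OA y)
    else g (Function.invFunOn B OB y)
  have hFA : ∀ v ∈ OA, F (A v) = f v := fun v hv => by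
    simp only [F, if_pos (Set.mem_image_of_mem A hv), iA v hv]
  have hFB : ∀ w ∈ OB, F (B w) = g w := fun w hw => by
    by_cases h : B w ∈ A '' OA
    · obtain ⟨v, hv, e⟩ := h
      rw [← e, hFA v hv]
      exact (hAB v hv w hw e).2
    · simp only [F, if_neg h, iB w hw]
  let γ₀ : ℂ → Y := fun a => if a = 0 then A 0 else B (1 / a, 0)
  have γ₀_zero : γ₀ 0 = A 0 := if_pos rfl
  have γ₀_ne : ∀ a, a ≠ 0 → γ₀ a = B (1 / a, 0) := fun a ha => if_neg ha
  have nA : OA ∈ 𝓝 0 := hA.isOpen.mem_nhds h0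
  have nB : ∀ a : ℂ, OB ∈ 𝓝 (a, 0) := fun a => hB.isOpen.mem_nhds (hline a)
  refine ⟨γ₀, fun a => B (a, 0), fun y => (F y).1, fun y => (F y).2,
    fun y => (Function.invFunOn B OB y).1, fun y => (Function.invFunOn B OB y).2,
    ?_, ?_, ?_, ?_, ?_, ?_, ?_, ?_⟩
  · refine continuous_iff_continuousAt.2 fun a => ?_
    by_cases ha : a = 0
    · subst ha
      intro S hS
      rw [γ₀_zero] at hS
      -- As `f` is open at the origin, all `(a, 0)` with small `a` are values of `f`, and `hBA`
      -- identifies the corresponding points with `B (1 / a, 0)`.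
      have h1 : f '' (A ⁻¹' S ∩ OA) ∈ 𝓝 (0 : ℂ × ℂ) := by
        rw [← hf0, ← hf.holOpenAt.1]
        exact image_mem_map (inter_mem ((hA.hol 0 h0).continuousAt hS) nA)
      have hc : ContinuousAt (fun a : ℂ => (a, (0 : ℂ))) 0 := by fun_prop
      have h2 : ∀ᶠ a : ℂ in 𝓝 0, (a, (0 : ℂ)) ∈ f '' (A ⁻¹' S ∩ OA) := hc h1
      rw [mem_map]
      filter_upwards [h2] with a ⟨v, ⟨hv, hv'⟩, e⟩
      change γ₀ a ∈ S
      by_cases ha : a = 0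
      · rw [ha, γ₀_zero]
        exact mem_of_mem_nhds hS
      · have := hBA v hv' (by rwa [e]) (by rw [e])
        rw [e] at this
        rw [γ₀_ne a ha, ← this]
        exact hv
    · have h1 : ContinuousAt (fun a : ℂ => B (1 / a, 0)) a :=
        ContinuousAt.comp (f := fun a : ℂ => (1 / a, (0 : ℂ))) (hB.hol _ (hline _)).continuousAt
          (by fun_prop (disch := assumption))
      refine h1.congr ?_
      filter_upwards [isOpen_ne.mem_nhds ha] with b hb
      exact (γ₀_ne b hb).symm
  · exact continuous_iff_continuousAt.2 fun a =>
      ContinuousAt.comp (f := fun a : ℂ => (a, (0 : ℂ))) (hB.hol _ (hline _)).continuousAt (by fun_prop)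
  · ext y
    rw [hL]
    constructor
    · rintro (rfl | ⟨a, rfl⟩)
      · exact .inl ⟨0, γ₀_zero⟩
      · exact .inr ⟨a, rfl⟩
    · rintro (⟨a, rfl⟩ | ⟨a, rfl⟩)
      · by_cases ha : a = 0
        · exact .inl (by rw [ha, γ₀_zero])
        · exact .inr ⟨_, γ₀_ne a ha⟩
      · exact .inr ⟨a, rfl⟩
  · intro a ha
    rw [γ₀_ne a ha, one_div]
  · rintro ⟨a, ha⟩
    by_cases h : a = 0
    · rw [h, γ₀_zero] at ha
      exact (hAB 0 h0 _ (hline 0) ha).1 rfl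
    · rw [γ₀_ne a h] at ha
      have := congrArg Prod.fst (hB.inj (hline _) (hline _) ha)
      exact h (by simpa using this)
  · intro a
    by_cases ha : a = 0
    · subst ha
      rw [γ₀_zero]
      refine ⟨hA.isLocalCoord h0 hf ?_, ?_, ?_⟩
      · filter_upwards [nA] with v hv
        exact hFA v hv
      · beta_reduce
        rw [hFA 0 h0, hf0]
        rfl
      · rw [← (hA.hol 0 h0).1, eventually_map]
        filter_upwards [nA] with v hv
        rw [hFA v hv, hLA v hv]
    · rw [γ₀_ne a ha]
      refine ⟨hB.isLocalCoord (hline _) (hg _ (by simpa using ha)) ?_, ?_, ?_⟩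
      · filter_upwards [nB _] with v hv
        exact hFB v hv
      · beta_reduce
        rw [hFB _ (hline _)]
        simp [g]
      · rw [← (hB.hol _ (hline _)).1, eventually_map]
        filter_upwards [nB _, eventually_ne_of_continuousAt (f := fun v : ℂ × ℂ => v.1) (v := (1 / a, 0))
          (by fun_prop) (a := 0) (by simpa using ha)] with v hv hv'
        rw [hFB v hv, hLB v hv]
        simp [g, hv']
  · intro a
    refine ⟨hB.isLocalCoord (hline _) (isLocalBiholo_id _) ?_, ?_, ?_⟩
    · filter_upwards [nB _] with v hv
      simp [iB v hv]
    · beta_reduce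
      rw [iB _ (hline _)]
    · rw [← (hB.hol _ (hline _)).1, eventually_map]
      filter_upwards [nB _] with v hv
      rw [iB v hv, hLB v hv]
  · intro a ha
    rw [γ₀_ne a ha]
    have ev := eventually_ne_of_continuousAt (f := fun v : ℂ × ℂ => v.1) (v := (1 / a, 0))
      (by fun_prop) (a := 0) (by simpa using ha)
    -- In the coordinates `w` of `B` the two local equations are `w₂` and `w₁² w₂`, so their ratio
    -- is `(1 / w₁)²`, which equals `a²` on the curve.
    refine ⟨fun y => (F y).1 ^ 2, ?_, ?_, ?_⟩
    · rw [(hB.hol _ (hline _)).2]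
      have h1 : AnalyticAt ℂ (fun v : ℂ × ℂ => (1 / v.1) ^ 2) (1 / a, 0) := by
        have := ev.self_of_nhds
        fun_prop (disch := assumption)
      refine HolSpace.congr (X := ℂ × ℂ) h1 ?_
      filter_upwards [nB _] with v hv
      simp [hFB v hv, g]
    · beta_reduce
      rw [hFB _ (hline _)]
      simp only [g, one_div, inv_inv, neg_neg]
      norm_cast
    · rw [← (hB.hol _ (hline _)).1, eventually_map]
      filter_upwards [nB _, ev] with v hv hv'
      rw [iB v hv, hFB v hv]
      simp only [g]
      field_simp

end Surfaces

/-! ## Fibres of charts -/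

open Classical in
/-- The chart of a fibre of the family that is induced by a chart of the total space. -/
noncomputable def LocalChart.fibreMap {X : Type} (κ : LocalChart X) (q : X → Prop)
    [Nonempty (Subtype q)] (t : ℂ) (a : ℂ × ℂ) : Subtype q :=
  if h : ∃ h : (t, a) ∈ κ.dom, q (κ.map ⟨_, h⟩) then ⟨κ.map ⟨_, h.fst⟩, h.snd⟩
    else Classical.arbitrary _

namespace LocalChart.IsGood

variable {X : Type} [TopologicalSpace X] [HolSpace X] {κ : LocalChart X} {τ : X → ℂ}
  (hκ : κ.IsGood τ) {q : X → Prop} [Nonempty (Subtype q)] {t : ℂ} (hq : ∀ x, q x ↔ τ x = t)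
include hκ hq

theorem fibreMap_val {a : ℂ × ℂ} (h : (t, a) ∈ κ.dom) : (κ.fibreMap q t a).1 = κ.map ⟨_, h⟩ := by
  have h1 : ∃ h : (t, a) ∈ κ.dom, q (κ.map ⟨_, h⟩) := ⟨h, by rw [hq, hκ.time]⟩
  simp only [LocalChart.fibreMap, dif_pos h1]

theorem isOpenChart_fibreMap : IsOpenChart (κ.fibreMap q t) {a | (t, a) ∈ κ.dom} where
  isOpen := hκ.isOpen.preimage (by fun_prop)
  inj a ha b hb e := by
    have h1 := congrArg Subtype.val e
    rw [hκ.fibreMap_val hq ha, hκ.fibreMap_val hq hb] at h1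
    exact congrArg (fun v => v.1.2) (hκ.inj h1)
  hol a ha := by
    let O : Set (ℂ × ℂ) := {a | (t, a) ∈ κ.dom}
    have hO : IsOpen O := hκ.isOpen.preimage (by fun_prop)
    let p : κ.dom → Prop := fun v => v.1.1 = t
    have hp : ∀ v, p v ↔ q (κ.map v) := fun v => by rw [hq, hκ.time]
    -- The slice of the domain at time `t` is biholomorphic to an open subset of the plane, with
    -- inverse `r`; the chart of the family is then restricted to the fibre.
    let s : O → Subtype p := fun b => ⟨⟨(t, b.1), b.2⟩, rfl⟩
    let r : Subtype p → O := fun v => ⟨v.1.1.2, show (t, v.1.1.2) ∈ κ.dom by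
      have h1 := v.1.2
      rwa [show v.1.1 = (t, v.1.1.2) from Prod.ext v.2 rfl] at h1⟩
    have hs : HolOpenAt s ⟨a, ha⟩ := by
      refine .of_inverse (g := r) ?_ ?_ ?_ ?_
      · refine HolMapAt.codRestrict (q := p) (f := fun b : O => (⟨(t, b.1), b.2⟩ : κ.dom)) ?_ _
        refine HolMapAt.codRestrict (q := fun v => v ∈ κ.dom) (f := fun b : O => ((t, b.1) : TPlane)) ?_ _
        exact (holMapAt_affine (f := fun b : ℂ × ℂ => ((t, b) : TPlane)) (by fun_prop)).comp
          (holMapAt_subtype_val (p := fun a => a ∈ O) ⟨a, ha⟩)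
      · refine HolMapAt.codRestrict (q := fun a => a ∈ O) (f := fun v : Subtype p => v.1.1.2) ?_ _
        exact (holMapAt_affine (f := fun b : TPlane => b.2) (by fun_prop)).comp
          ((holMapAt_subtype_val (p := fun v => v ∈ κ.dom) _).comp (holMapAt_subtype_val (p := p) _))
      · exact Eventually.of_forall fun b => rfl
      · exact Eventually.of_forall fun v => Subtype.ext (Subtype.ext (Prod.ext v.2.symm rfl))
    have h1 := HolOpenAt.fibre hp (s ⟨a, ha⟩) (hκ.hol _) univ_mem hκ.inj.injOn
    have h2 := h1.comp hs
    have h3 : HolOpenAt (κ.fibreMap q t ∘ (Subtype.val : O → ℂ × ℂ)) ⟨a, ha⟩ := by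
      refine h2.congr (Eventually.of_forall fun b => Subtype.ext ?_)
      exact (hκ.fibreMap_val hq b.2).symm
    exact HolOpenAt.cancel (a := (⟨a, ha⟩ : O))
      (holOpenAt_subtype_val (p := fun a => a ∈ O) ⟨a, ha⟩ (hO.mem_nhds ha)) h3

end LocalChart.IsGood

/-! ### Transition formulas between neighbouring charts along the boundary curves -/

namespace SSpace

/-- A boundary curve that misses one of the two charts excludes a vanishing coordinate in the other.
Then both points can be written in the same chart, which is injective. The two analogues below use
the section at infinity and the second exceptional curve. -/
theorem pt_zero_eq_pt_one_iff {t q p q' p' : ℂ} :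
    pt 0 (t, q, p) = pt 1 (t, q', p') ↔ q * q' = 1 ∧ p' = -q ^ 2 * p := by
  constructor
  · intro h
    have hq' : q' ≠ 0 := by
      rintro rfl
      have h1 : fibre (pt 0 (t, q, p)) := by
        rw [h, fibre_pt]
        simp
      simp [fibre_pt] at h1
    have h2 := pt_zero_eq_pt_one (t := t) (q := 1 / q') (p := -q' ^ 2 * p') (by simpa using hq')
    have h3 : pt 1 (t, 1 / (1 / q'), -(1 / q') ^ 2 * (-q' ^ 2 * p')) = pt 1 (t, q', p') := by
      congr 3 <;> field_simp
    have h4 := pt_injective 0 (h.trans (h3.symm.trans h2.symm))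
    simp only [Prod.mk.injEq, true_and] at h4
    obtain ⟨rfl, rfl⟩ := h4
    constructor <;> field_simp
  · rintro ⟨h, rfl⟩
    have hq : q ≠ 0 := left_ne_zero_of_mul_eq_one h
    rw [pt_zero_eq_pt_one hq, eq_one_div_of_mul_eq_one_right h]

theorem pt_one_eq_pt_three_iff {t q p q' p' : ℂ} :
    pt 1 (t, q, p) = pt 3 (t, q', p') ↔ p * p' = 1 ∧ q' = q * p ^ 2 := by
  constructor
  · intro h
    have hp : p ≠ 0 := by
      rintro rfl
      have h1 : infty (pt 3 (t, q', p')) := by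
        rw [← h, infty_pt]
        simp
      simp [infty_pt] at h1
    rw [pt_one_eq_pt_three hp] at h
    have h4 := pt_injective 3 h
    simp only [Prod.mk.injEq, true_and] at h4
    obtain ⟨rfl, rfl⟩ := h4
    exact ⟨by field_simp, rfl⟩
  · rintro ⟨h, rfl⟩
    rw [pt_one_eq_pt_three (left_ne_zero_of_mul_eq_one h), eq_one_div_of_mul_eq_one_right h]

theorem pt_four_eq_pt_five_iff {t q p q' p' : ℂ} :
    pt 4 (t, q, p) = pt 5 (t, q', p') ↔ q * p' = 1 ∧ q' = q ^ 2 * p := by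
  constructor
  · intro h
    have hq : q ≠ 0 := by
      rintro rfl
      have h1 : exc (pt 5 (t, q', p')) := by
        rw [← h, exc_pt]
        simp
      simp [exc_pt] at h1
    rw [pt_four_eq_pt_five hq] at h
    have h4 := pt_injective 5 h
    simp only [Prod.mk.injEq, true_and] at h4
    obtain ⟨rfl, rfl⟩ := h4
    exact ⟨by field_simp, rfl⟩
  · rintro ⟨h, rfl⟩
    rw [pt_four_eq_pt_five (left_ne_zero_of_mul_eq_one h), eq_one_div_of_mul_eq_one_right h]

end SSpace

namespace XStage

theorem pr_node {k j : ℕ} (h : j < k) (b : Bool) {v : TPlane} (hv : v ∈ (node (k + 1) j b).dom) :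
    ∃ hv' : v ∈ (node k j b).dom, pr k ((node (k + 1) j b).map ⟨v, hv⟩) = (node k j b).map ⟨v, hv'⟩ := by
  revert hv
  rw [node_of_lt h]
  exact fun hv => ⟨hv.fst, rfl⟩

theorem pr_node_self (k : ℕ) (b : Bool) {v : TPlane} (hv : v ∈ (node (k + 1) k b).dom) :
    pr k ((node (k + 1) k b).map ⟨v, hv⟩) =
      ((stage k).chart b).map ⟨blowMap₂ (cen k) b v, (isGood k).dom b _⟩ := by
  revert hv
  rw [node_self]
  exact fun hv => rfl

/-- The first chart `(z, w)` of the `j`-th blowup contains the next centre, with `z = 1 / P`, `w = Q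
P` on one side and `z = c + Q'`, `w = Q' P'` on the other. -/
theorem node_eq_node_succ {k j : ℕ} (h : j + 1 < k) (b : Bool) {v v' : TPlane}
    (hv : v ∈ (node k j b).dom) (hv' : v' ∈ (node k (j + 1) b).dom)
    (e : (node k j b).map ⟨v, hv⟩ = (node k (j + 1) b).map ⟨v', hv'⟩) :
    v'.1 = v.1 ∧ (cen (j + 1) b v'.1 + v'.2.1) * v.2.2 = 1 ∧ v'.2.1 * v'.2.2 = v.2.1 * v.2.2 := by
  induction k with
  | zero => omega
  | succ k ih =>
    have e' := congrArg (pr k) e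
    rcases (Nat.lt_succ_iff_lt_or_eq.1 h) with h | rfl
    · obtain ⟨h1, h2⟩ := pr_node (by omega) b hv
      obtain ⟨h1', h2'⟩ := pr_node h b hv'
      exact ih h h1 h1' (h2.symm.trans (e'.trans h2'))
    · obtain ⟨h1, h2⟩ := pr_node (by omega) b hv
      have h2' := pr_node_self (j + 1) b hv'
      have h3 := h2.symm.trans (e'.trans h2')
      revert h1
      rw [node_self]
      intro h1 h2 h3
      exact (datum j).chart₁_eq_chart₂.1 h3.symm

/-- The converse along the exceptional curve `Q = 0`, where `z = 1 / P` and therefore `Q' = 1 / P -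
c`, `P' = 0`. -/
theorem node_zero_eq_node_succ {k j : ℕ} (h : j + 1 < k) (b : Bool) {t p : ℂ} (hp : p ≠ 0)
    (hv : (t, 0, p) ∈ (node k j b).dom)
    (hv' : (t, 1 / p - cen (j + 1) b t, 0) ∈ (node k (j + 1) b).dom) :
    (node k j b).map ⟨_, hv⟩ = (node k (j + 1) b).map ⟨_, hv'⟩ := by
  induction k with
  | zero => omega
  | succ k ih =>
    rcases (Nat.lt_succ_iff_lt_or_eq.1 h) with h | rfl
    · revert hv hv'
      rw [node_of_lt h, node_of_lt (Nat.lt_of_succ_lt h)]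
      intro hv hv'
      exact congrArg Blowup.base (Subtype.ext (ih h hv.fst hv'.fst))
    · revert hv hv'
      rw [node_of_lt (Nat.lt_succ_self j), node_self (j + 1) b]
      intro hv hv'
      refine Blowup.base_eq_chart₂.2 ?_
      obtain ⟨h1, h2⟩ := hv
      change (node (j + 1) j b).map ⟨(t, 0, p), h1⟩ = _
      clear h2
      revert h1
      rw [node_self]
      intro h1
      refine Eq.symm ((datum j).chart₁_eq_chart₂.2 ?_)
      simp only [blowMap₂]
      refine ⟨trivial, ?_, ?_⟩
      · rw [add_sub_cancel]
        field_simp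
      · simp

end XStage

/-! ## The charts and the boundary curves of `Ē` -/

theorem LocalChart.IsGood.restrict {X : Type} [TopologicalSpace X] [HolSpace X] {κ : LocalChart X}
    {τ : X → ℂ} (h : κ.IsGood τ) {P : X → Prop} (hP : IsOpen {x | P x}) :
    IsOpen {v | ∃ h : v ∈ κ.dom, P (κ.map ⟨v, h⟩)} ∧
      ∀ v : {v // ∃ h : v ∈ κ.dom, P (κ.map ⟨v, h⟩)},
        HolOpenAt (fun v : {v // ∃ h : v ∈ κ.dom, P (κ.map ⟨v, h⟩)} => κ.map ⟨v.1, v.2.fst⟩) v := by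
  have h1 : IsOpen {v | ∃ h : v ∈ κ.dom, P (κ.map ⟨v, h⟩)} := by
    have h2 : Continuous κ.map := continuous_iff_continuousAt.2 fun v => (h.hol v).continuousAt
    have h3 := h.isOpen.isOpenMap_subtype_val _ (hP.preimage h2)
    convert h3 using 1
    ext v
    exact ⟨fun ⟨k, hk⟩ => ⟨⟨v, k⟩, hk, rfl⟩, fun ⟨⟨w, k⟩, hk, e⟩ => by subst e; exact ⟨k, hk⟩⟩
  refine ⟨h1, fun v => ?_⟩
  exact (h.hol ⟨v.1, v.2.fst⟩).comp (f := fun v : {v // ∃ h : v ∈ κ.dom, P (κ.map ⟨v, h⟩)} =>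
    (⟨v.1, v.2.fst⟩ : κ.dom)) ((holOpenAt_subtype_val v (h1.mem_nhds v.2)).codRestrict
      (q := fun v => v ∈ κ.dom) fun v => v.2.fst)

namespace LocalChart

/-- A chart of `S`, as a chart of the family `Ē`. -/
def ofS (σ : XSpace → XSpace) (κ : LocalChart SSpace) : LocalChart (EbarSpace σ) :=
  ⟨{v | ∃ h : v ∈ κ.dom, κ.map ⟨v, h⟩ ∈ SSpace.a₂ᶜ},
    fun v => Glue.inS ⟨κ.map ⟨v.1, v.2.fst⟩, v.2.snd⟩⟩

theorem _root_.XSpace.notMem_p_of_pos {x : XSpace} (h : 0 < x.toW.2.1.re) : x ∉ XSpace.p := by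
  intro hx
  have : x.toW.2.1 = 0 := congrArg Prod.fst hx
  simp [this] at h

/-- A chart of `X`, as a chart of the family `Ē`, restricted to a half space on which the
quotient by `σ` is injective. -/
def ofX (σ : XSpace → XSpace) (κ : LocalChart XSpace) : LocalChart (EbarSpace σ) :=
  ⟨{v | ∃ h : v ∈ κ.dom, 0 < (κ.map ⟨v, h⟩).toW.2.1.re},
    fun v => Glue.inX ⟨κ.map ⟨v.1, v.2.fst⟩, XSpace.notMem_p_of_pos v.2.snd⟩⟩

end LocalChart

/-- The time on the gluing. -/
noncomputable def IsGlueDatum.time {A : Set SSpace} {B : Set XSpace} {σ : XSpace → XSpace}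
    (D : IsGlueDatum A B σ) : Glue A B σ → ℂ := D.exists_time.choose

theorem IsGlueDatum.atTime_iff {A : Set SSpace} {B : Set XSpace} {σ : XSpace → XSpace}
    (D : IsGlueDatum A B σ) (t : ℂ) (e : Glue A B σ) : Glue.AtTime t e ↔ D.time e = t :=
  D.exists_time.choose_spec.2.2.2 t e

namespace XSpace.IsInducedInvolution

open Glue

variable {σ : XSpace → XSpace} (hσ : IsInducedInvolution σ)
include hσ

theorem isGood_ofS {κ : LocalChart SSpace} (h : κ.IsGood SSpace.time) :
    (LocalChart.ofS σ κ).IsGood hσ.datumE.time where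
  isOpen := (h.restrict SSpace.isClosed_a₂.isOpen_compl).1
  inj v w e := by
    have h1 := h.inj (congrArg Subtype.val (hσ.datumE.inS_injective e))
    exact Subtype.ext (congrArg (fun v => v.1) h1)
  hol v := (hσ.datumE.holOpenAt_inS _).comp
    (((h.restrict SSpace.isClosed_a₂.isOpen_compl).2 v).codRestrict (q := fun s => s ∈ SSpace.a₂ᶜ)
      fun v => v.2.snd)
  time v := (hσ.datumE.exists_time.choose_spec.1 _).trans (h.time _)

theorem isGood_ofX {κ : LocalChart XSpace} (h : κ.IsGood (fun x => x.toW.1)) :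
    (LocalChart.ofX σ κ).IsGood hσ.datumE.time := by
  have ho : IsOpen {x : XSpace | 0 < x.toW.2.1.re} := by
    have := XSpace.continuous_toW
    exact isOpen_lt continuous_const (by fun_prop)
  refine ⟨(h.restrict ho).1, fun v w e => ?_, fun v => ?_,
    fun v => (hσ.datumE.exists_time.choose_spec.2.1 _).trans (h.time _)⟩
  · rcases hσ.datumE.inX_eq_inX.1 e with h1 | h1
    · exact Subtype.ext (congrArg (fun v => v.1) (h.inj h1))
    · have h2 := congrArg (fun x : XSpace => x.toW.2.1.re) h1
      simp only [hσ.2.2, sigmaW, Complex.neg_re] at h2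
      have h3 := v.2.snd
      have h4 := w.2.snd
      linarith
  · exact (hσ.datumE.holOpenAt_inX _).comp
      (((h.restrict ho).2 v).codRestrict (q := fun x => x ∈ XSpace.pᶜ)
        fun v => XSpace.notMem_p_of_pos v.2.snd)

end XSpace.IsInducedInvolution

/-! ### The configuration of the boundary curves -/

/-- The charts that cover `Ē`: six charts of `S`, the second charts of the six blowups over `p₊`,
and the chart `(z⁽⁸⁾, w⁽⁸⁾)`. -/
abbrev ChartIndex : Type := Fin 6 ⊕ Option (Fin 6)

namespace ChartIndex

/-- The number of the boundary curve on which the first coordinate vanishes. -/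
def fst : ChartIndex → Option (Fin 9)
  | .inl 0 => none
  | .inl 1 => some 1
  | .inl 2 => none
  | .inl 3 => some 1
  | .inl 4 => some 2
  | .inl 5 => some 8
  | .inr (some 5) => none
  | .inr (some j) => some ⟨j + 3, by omega⟩
  | .inr none => none

/-- The number of the boundary curve on which the second coordinate vanishes. -/
def snd : ChartIndex → Option (Fin 9)
  | .inl 0 => some 0
  | .inl 1 => some 0
  | .inl 2 => none
  | .inl 3 => some 2
  | .inl 4 => some 8
  | .inl 5 => none
  | .inr (some j) => some ⟨j + 2, by omega⟩
  | .inr none => none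

/-- In each chart a coordinate line carries at most one curve, so two curves can only meet at the
origin of a chart. Incidence becomes a finite check on labels, done here and in the next two lemmas.
-/
theorem exists_of_adjE8 : ∀ i j : Fin 9, AdjE8 i j → ∃ c : ChartIndex,
    (fst c = some i ∧ snd c = some j) ∨ (fst c = some j ∧ snd c = some i) := by
  unfold AdjE8
  decide

theorem unique_of_crossing : ∀ i j : Fin 9, ∀ c c' : ChartIndex, i ≠ j →
    ((fst c = some i ∧ snd c = some j) ∨ (fst c = some j ∧ snd c = some i)) →
    ((fst c' = some i ∧ snd c' = some j) ∨ (fst c' = some j ∧ snd c' = some i)) → c' = c := by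
  decide +kernel

theorem adjE8_of_crossing : ∀ i j : Fin 9, ∀ c : ChartIndex,
    (fst c = some i ∧ snd c = some j) ∨ (fst c = some j ∧ snd c = some i) → AdjE8 i j := by
  unfold AdjE8
  decide

end ChartIndex

namespace XSpace

/-- The second chart of the `j`-th blowup over `p₊`. -/
noncomputable def node (j : ℕ) : LocalChart XSpace := XStage.node 6 j true

theorem isGood_node {j : ℕ} (h : j < 6) : (node j).IsGood (fun x => x.toW.1) := XStage.isGood_node h true

theorem isGood_zw₈ : zw₈.IsGood (fun x => x.toW.1) := (XStage.isGood 6).good true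

theorem mem_zw₈ (v : TPlane) : v ∈ zw₈.dom := (XStage.isGood 6).dom true v

theorem mem_uv₈ (v : TPlane) : v ∈ uv₈.dom := (XStage.isGood 6).dom false v

/-- The coordinates of `W` in terms of the charts `XSpace.node j`. -/
noncomputable def nodeW (j : ℕ) (v : TPlane) : TPlane :=
  XStage.chartW j true (blowMap₂ (XStage.cen j) true v)

theorem toW_node {j : ℕ} (h : j < 6) (v : (node j).dom) : ((node j).map v).toW = nodeW j v.1 :=
  XStage.toW_node h true v

theorem toW_zw₈ (v : zw₈.dom) : (zw₈.map v).toW = XStage.chartW 6 true v.1 := XStage.toW_chart 6 true v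

theorem curve_node {i j : ℕ} (hi : i < 6) (hj : j < 6) (v : (node j).dom) :
    curve i ((node j).map v) ↔ (i = j ∧ v.1.2.2 = 0) ∨ (i = j + 1 ∧ v.1.2.1 = 0) :=
  XStage.curve_node hi hj true v

theorem not_curve_zw₈ {i : ℕ} (hi : i < 6) (v : zw₈.dom) : ¬ curve i (zw₈.map v) :=
  XStage.not_curve_chart hi true v

theorem mem_node {j : ℕ} (h : j < 6) {v : TPlane} (h1 : 0 < (nodeW j v).2.1.re)
    (h2 : XStage.cen (j + 1) true v.1 * v.2.2 ≠ 1) : v ∈ (node j).dom := by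
  refine XStage.mem_dom_node h true ⟨(XStage.isGood j).dom true _, fun b hb hc => ?_⟩ h2
  have h3 := (XStage.isGood j).isPm hc
  rw [XStage.toW_chart] at h3
  have h4 : b = false := by simpa using hb
  subst h4
  have h5 : (nodeW j v).2.1 = -2 := congrArg Prod.fst h3
  rw [h5] at h1
  norm_num at h1

theorem nodeW_snd (j : ℕ) (v : TPlane) : (nodeW j v).2.2 = v.2.1 * v.2.2 := XStage.chartW_snd j true _

theorem nodeW_zero (v : TPlane) : nodeW 0 v = (v.1, 2 + v.2.1, v.2.1 * v.2.2) := by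
  simp [nodeW, XStage.chartW, blowMap₂, XStage.cen, XStage.ctr]

theorem nodeW_succ_base (j : ℕ) {v : TPlane} (h : v.2.1 * v.2.2 = 0) :
    (nodeW (j + 1) v).2.1 = 2 := by
  have := XStage.chartW_succ_base j true v.1 (XStage.cen (j + 1) true v.1 + v.2.1)
  simpa [nodeW, blowMap₂, h, XStage.sgn] using this

end XSpace

/-- The charts that cover `Ē`. -/
noncomputable def ebarChart (σ : XSpace → XSpace) : ChartIndex → LocalChart (EbarSpace σ)
  | .inl i => .ofS σ (SSpace.chart i)
  | .inr (some j) => .ofX σ (XSpace.node j)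
  | .inr none => .ofX σ XSpace.zw₈

/-- The boundary curves in `S`. -/
def SSpace.label : Fin 9 → SSpace → Prop
  | 0 => SSpace.infty
  | 1 => SSpace.fibre
  | 2 => SSpace.exc
  | 8 => SSpace.branch
  | _ => fun _ => False

/-- The boundary curves in `X`. -/
def XSpace.label (i : Fin 9) (x : XSpace) : Prop := (2 ≤ i.1 ∧ i.1 ≤ 7) ∧ XSpace.curve (i - 2) x

/-- Off `p` and `p_±` only the curve number `2` is visible from both sides: it is the second
exceptional curve in `S` and the line `{s = 0}` in `W`. Thus the labels are compatible with the
gluing. -/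
theorem SSpace.label_wS {w : TPlane} (h : w.2 ≠ (0, 0)) (i : Fin 9) :
    SSpace.label i (wS w) ↔ i = 2 ∧ w.2.2 = 0 := by
  fin_cases i <;> simp [SSpace.label, infty_wS, fibre_wS, exc_wS h, branch_wS h]

theorem XSpace.label_of_not_isPm {x : XSpace} (h : ¬ XStage.IsPm x.toW) (i : Fin 9) :
    XSpace.label i x ↔ i = 2 ∧ x.toW.2.2 = 0 := by
  have h1 : ∀ j < 6, XSpace.curve j x ↔ j = 0 ∧ x.toW.2.2 = 0 := fun j hj =>
    XStage.curve_of_not_isPm hj h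
  unfold XSpace.label
  fin_cases i <;> simp [h1]

namespace XSpace.IsInducedInvolution

open Glue

variable {σ : XSpace → XSpace} (hσ : IsInducedInvolution σ)

theorem exists_boundary (hσ : IsInducedInvolution σ) (i : Fin 9) : ∃ R : EbarSpace σ → Prop,
    (∀ s, R (inS s) ↔ SSpace.label i s.1) ∧ ∀ x, R (inX x) ↔ XSpace.label i x.1 := by
  refine hσ.datumE.exists_property _ _ (fun x => ?_) (fun s x hx hs => ?_)
  · refine and_congr_right fun hi => hσ.curve_iff (by omega) _
  · rw [hs, SSpace.label_wS hx, XSpace.label_of_not_isPm (hσ.datumE.not_isPm s hx hs)]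

/-- The boundary curves of `Ē`. -/
def boundary (hσ : IsInducedInvolution σ) (i : Fin 9) : EbarSpace σ → Prop :=
  (hσ.exists_boundary i).choose

theorem boundary_inS (i : Fin 9) (s) : hσ.boundary i (inS s) ↔ SSpace.label i s.1 :=
  (hσ.exists_boundary i).choose_spec.1 s

theorem boundary_inX (i : Fin 9) (x) : hσ.boundary i (inX x) ↔ XSpace.label i x.1 :=
  (hσ.exists_boundary i).choose_spec.2 x

theorem isGood_ebarChart (c : ChartIndex) : (ebarChart σ c).IsGood hσ.datumE.time :=
  match c with
  | .inl i => hσ.isGood_ofS (SSpace.isGood_chart i)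
  | .inr (some j) => hσ.isGood_ofX (XSpace.isGood_node j.2)
  | .inr none => hσ.isGood_ofX XSpace.isGood_zw₈

theorem boundary_ebarChart (c : ChartIndex) (i : Fin 9) (v : (ebarChart σ c).dom) :
    hσ.boundary i ((ebarChart σ c).map v) ↔
      (c.fst = some i ∧ v.1.2.1 = 0) ∨ (c.snd = some i ∧ v.1.2.2 = 0) := by
  match c, v with
  | .inl k, v =>
    refine (hσ.boundary_inS i _).trans ?_
    change SSpace.label i (SSpace.pt k v.1) ↔ _
    obtain ⟨v, hv⟩ := v
    dsimp only
    clear hv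
    fin_cases k <;> fin_cases i <;> simp [SSpace.label, SSpace.infty_pt, SSpace.fibre_pt,
      SSpace.exc_pt, SSpace.branch_pt, ChartIndex.fst, ChartIndex.snd]
  | .inr (some j), v =>
    refine (hσ.boundary_inX i _).trans ?_
    have h1 : ∀ k < 6, XSpace.curve k ((XSpace.node j).map ⟨v.1, v.2.fst⟩) ↔
        (k = j ∧ v.1.2.2 = 0) ∨ (k = j + 1 ∧ v.1.2.1 = 0) := fun k hk => XSpace.curve_node hk j.2 _
    change (2 ≤ i.1 ∧ i.1 ≤ 7) ∧ XSpace.curve (i - 2) ((XSpace.node j).map ⟨v.1, v.2.fst⟩) ↔ _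
    have h2 : (2 ≤ i.1 ∧ i.1 ≤ 7) ∧ XSpace.curve (i - 2) ((XSpace.node j).map ⟨v.1, v.2.fst⟩) ↔
      (2 ≤ i.1 ∧ i.1 ≤ 7) ∧ ((i - 2 = j.1 ∧ v.1.2.2 = 0) ∨ (i - 2 = j.1 + 1 ∧ v.1.2.1 = 0)) :=
      and_congr_right fun hi => h1 _ (by omega)
    rw [h2]
    clear h1 h2
    obtain ⟨v, hv⟩ := v
    dsimp only
    clear hv
    fin_cases j <;> fin_cases i <;> simp [ChartIndex.fst, ChartIndex.snd]
  | .inr none, v =>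
    refine (hσ.boundary_inX i _).trans ?_
    refine iff_of_false (fun h => ?_) (by simp [ChartIndex.fst, ChartIndex.snd])
    exact XSpace.not_curve_zw₈ (by have := h.1; omega) _ h.2

include hσ in
/-- The charts cover `Ē`. -/
theorem exists_ebarChart (e : EbarSpace σ) : ∃ c v, (ebarChart σ c).map v = e ∧
    (∀ j, c = .inr j → v.1.2.2 = 0) := by
  have hS : ∀ s : (SSpace.a₂ᶜ : Set SSpace), ∃ c v, (ebarChart σ c).map v = inS s ∧
      (∀ j, c = .inr j → v.1.2.2 = 0) := by
    rintro ⟨s, hs⟩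
    obtain ⟨i, v, rfl⟩ := SSpace.exists_pt s
    exact ⟨.inl i, ⟨v, SSpace.mem_chart i v, hs⟩, rfl, fun j h => by simp at h⟩
  obtain ⟨s, rfl⟩ | ⟨x, rfl⟩ := e.cases
  · exact hS s
  · by_cases h : XStage.IsPm x.1.toW
    · have key : ∀ y : (XSpace.pᶜ : Set XSpace), y.1.toW.2 = (2, 0) → ∃ c v,
          (ebarChart σ c).map v = inX y ∧ (∀ j, c = .inr j → v.1.2.2 = 0) := by
        intro y hy
        have hy' : y.1.toW.2.1 = 2 := congrArg Prod.fst hy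
        rcases XStage.exists_node_or_chart (k := 6) (by norm_num) (b := true) (x := y.1)
          (hy.trans (by simp [XStage.sgn])) with ⟨t, z, h1, h2⟩ | ⟨j, hj, t, q, h1, h2⟩
        · have h2' : XSpace.zw₈.map ⟨(t, z, 0), h1⟩ = y.1 := h2
          refine ⟨.inr none, ⟨(t, z, 0), h1, ?_⟩, congrArg inX (Subtype.ext h2), fun _ _ => rfl⟩
          rw [h2', hy']
          norm_num
        · have h2' : (XSpace.node j).map ⟨(t, q, 0), h1⟩ = y.1 := h2
          refine ⟨.inr (some ⟨j, hj⟩), ⟨(t, q, 0), h1, ?_⟩, congrArg inX (Subtype.ext h2), fun _ _ => rfl⟩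
          change 0 < ((XSpace.node j).map ⟨(t, q, 0), h1⟩).toW.2.1.re
          rw [h2', hy']
          norm_num
      obtain ⟨b, hb⟩ := h
      -- A point over `p_-` is replaced by its image under `σ`, which is the same point of `Ē` and
      -- lies over `p_+`.
      cases b
      · rw [← hσ.datumE.sound_invol x]
        refine key _ ?_
        rw [hσ.2.2, sigmaW, hb]
        simp [XStage.sgn]
      · exact key x hb
    · have hx : x.1.toW.2 ≠ (0, 0) := x.2
      rw [← hσ.datumE.sound_cover (s := ⟨wS x.1.toW, fun hs => h ((wS_mem_a₂ hx).1 hs)⟩) hx rfl]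
      exact hS _

theorem mem_inl {i : Fin 6} {v : TPlane} : v ∈ (ebarChart σ (.inl i)).dom ↔ SSpace.pt i v ∉ SSpace.a₂ :=
  ⟨fun h => h.snd, fun h => ⟨SSpace.mem_chart i v, h⟩⟩

theorem mem_inr_some {j : Fin 6} {v : TPlane} (h1 : 0 < (XSpace.nodeW j v).2.1.re)
    (h2 : XStage.cen (j + 1) true v.1 * v.2.2 ≠ 1) : v ∈ (ebarChart σ (.inr (some j))).dom :=
  ⟨XSpace.mem_node j.2 h1 h2, by rw [XSpace.toW_node j.2]; exact h1⟩

theorem mem_inr_none {v : TPlane} (h1 : 0 < (XStage.chartW 6 true v).2.1.re) :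
    v ∈ (ebarChart σ (.inr none)).dom :=
  ⟨XSpace.mem_zw₈ v, by rw [XSpace.toW_zw₈]; exact h1⟩

theorem zero_mem (c : ChartIndex) (t : ℂ) : (t, 0) ∈ (ebarChart σ c).dom := by
  match c with
  | .inl i =>
    rw [mem_inl, SSpace.pt_mem_a₂]
    simp
  | .inr (some ⟨0, h⟩) =>
    refine mem_inr_some ?_ (by simp)
    rw [XSpace.nodeW_zero]
    norm_num
  | .inr (some ⟨j + 1, h⟩) =>
    refine mem_inr_some ?_ (by simp)
    rw [XSpace.nodeW_succ_base j (by simp)]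
    norm_num
  | .inr none =>
    refine mem_inr_none ?_
    have := XStage.chartW_succ_base 5 true t 0
    change 0 < (XStage.chartW 6 true (t, 0, 0)).2.1.re
    rw [this]
    norm_num [XStage.sgn]

end XSpace.IsInducedInvolution

/-- On the exceptional curve `z = 1 / P`, so `c P = 1` would be the next centre, which later stages
leave out of the chart. -/
theorem XStage.cen_mul_ne_one {k j : ℕ} (h : j + 1 < k) (b : Bool) {t p : ℂ}
    (hv : (t, 0, p) ∈ (XStage.node k j b).dom) : XStage.cen (j + 1) b t * p ≠ 1 := by
  induction k with
  | zero => omega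
  | succ k ih =>
    revert hv
    rw [node_of_lt (Nat.lt_of_succ_lt_succ h |> fun h => by omega)]
    rintro ⟨hv, hc⟩
    rcases (Nat.lt_succ_iff_lt_or_eq.1 h) with h | rfl
    · exact ih h hv
    · intro hp
      refine hc b ⟨t, (isGood (j + 1)).dom b _, ?_⟩
      clear hc
      revert hv
      rw [node_self]
      intro hv
      exact (datum j).chart₁_eq_chart₂.2 ⟨rfl, hp, by simp⟩

theorem IsOpenChart.mono {Y : Type} [TopologicalSpace Y] [HolSpace Y] {φ : ℂ × ℂ → Y}
    {O O' : Set (ℂ × ℂ)} (h : IsOpenChart φ O) (hO : IsOpen O') (hs : O' ⊆ O) : IsOpenChart φ O' :=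
  ⟨hO, h.inj.mono hs, fun a ha => h.hol a (hs ha)⟩

theorem IsOpenChart.comp_swap {Y : Type} [TopologicalSpace Y] [HolSpace Y] {φ : ℂ × ℂ → Y}
    {O : Set (ℂ × ℂ)} (h : IsOpenChart φ O) : IsOpenChart (φ ∘ Prod.swap) (Prod.swap ⁻¹' O) where
  isOpen := h.isOpen.preimage continuous_swap
  inj a ha b hb e := Prod.swap_injective (h.inj ha hb e)
  hol a ha := (h.hol _ ha).comp (.of_analytic (f := fun v => (v.2, v.1)) (g := fun v => (v.2, v.1))
    (by fun_prop) (by fun_prop) (Eventually.of_forall fun _ => rfl) (Eventually.of_forall fun _ => rfl))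

open Glue

instance (σ : XSpace → XSpace) (t : ℂ) : Nonempty (Ebar σ t) :=
  ⟨inS ⟨SSpace.pt 2 (t, 0, 0), by simp [SSpace.pt_mem_a₂]⟩, .inl ⟨_, ⟨_, rfl⟩, SSpace.time_pt _ _⟩⟩

/-- The charts that cover the surface `Ē_t`. -/
noncomputable def fchart (σ : XSpace → XSpace) (t : ℂ) (c : ChartIndex) : ℂ × ℂ → Ebar σ t :=
  (ebarChart σ c).fibreMap (AtTime t) t

/-- The domains of the charts that cover the surface `Ē_t`. -/
def fdom (σ : XSpace → XSpace) (t : ℂ) (c : ChartIndex) : Set (ℂ × ℂ) := {a | (t, a) ∈ (ebarChart σ c).dom}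

theorem mem_fdom_inl {σ : XSpace → XSpace} {t : ℂ} {i : Fin 6} {a : ℂ × ℂ} :
    a ∈ fdom σ t (.inl i) ↔
      ¬((i = 4 ∧ a.1 = 0 ∧ a.2 = 4) ∨ (i = 3 ∧ a.2 = 0 ∧ a.1 = 1 / 4)) :=
  (XSpace.IsInducedInvolution.mem_inl (σ := σ)).trans (not_congr SSpace.pt_mem_a₂)

theorem re_pos_of_mem_fdom {σ : XSpace → XSpace} {t : ℂ} {j : Fin 6} {a : ℂ × ℂ}
    (h : a ∈ fdom σ t (.inr (some j))) : 0 < (XSpace.nodeW j (t, a)).2.1.re := by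
  have := h.snd
  rwa [XSpace.toW_node j.2] at this

theorem zero_mem_fdom (σ : XSpace → XSpace) (t : ℂ) (c : ChartIndex) : (0 : ℂ × ℂ) ∈ fdom σ t c :=
  XSpace.IsInducedInvolution.zero_mem c t

/-! ### The nine boundary curves: self-intersection numbers and incidence -/

namespace XSpace.IsInducedInvolution

variable {σ : XSpace → XSpace} (hσ : IsInducedInvolution σ) {t : ℂ}

/-- The boundary curves of `Ē_t`. -/
def curves (hσ : IsInducedInvolution σ) (t : ℂ) (i : Fin 9) : Set (Ebar σ t) := {e | hσ.boundary i e.1}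

include hσ

theorem isOpenChart_fchart (c : ChartIndex) : IsOpenChart (fchart σ t c) (fdom σ t c) :=
  (hσ.isGood_ebarChart c).isOpenChart_fibreMap (hσ.datumE.atTime_iff t)

theorem fchart_val {c : ChartIndex} {a : ℂ × ℂ} (h : a ∈ fdom σ t c) :
    (fchart σ t c a).1 = (ebarChart σ c).map ⟨_, h⟩ :=
  (hσ.isGood_ebarChart c).fibreMap_val (hσ.datumE.atTime_iff t) h

theorem fchart_mem {c : ChartIndex} {a : ℂ × ℂ} (h : a ∈ fdom σ t c) (i : Fin 9) :
    fchart σ t c a ∈ hσ.curves t i ↔ (c.fst = some i ∧ a.1 = 0) ∨ (c.snd = some i ∧ a.2 = 0) := by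
  change hσ.boundary i (fchart σ t c a).1 ↔ _
  rw [hσ.fchart_val h, hσ.boundary_ebarChart]

theorem exists_fchart (e : Ebar σ t) : ∃ c, ∃ a ∈ fdom σ t c, fchart σ t c a = e ∧
    ∀ j, c = .inr j → a.2 = 0 := by
  obtain ⟨c, ⟨⟨s, a⟩, hv⟩, he, h2⟩ := hσ.exists_ebarChart e.1
  have hs : s = t := by
    have := e.2
    rw [hσ.datumE.atTime_iff, ← he, (hσ.isGood_ebarChart c).time] at this
    exact this
  subst hs
  exact ⟨c, a, hv, Subtype.ext ((hσ.fchart_val hv).trans he), h2⟩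

theorem fchart_inl_eq {i j : Fin 6} {a b : ℂ × ℂ} (ha : a ∈ fdom σ t (.inl i))
    (hb : b ∈ fdom σ t (.inl j)) :
    fchart σ t (.inl i) a = fchart σ t (.inl j) b ↔ SSpace.pt i (t, a) = SSpace.pt j (t, b) := by
  rw [Subtype.ext_iff, hσ.fchart_val ha, hσ.fchart_val hb]
  exact hσ.datumE.inS_injective.eq_iff.trans Subtype.ext_iff

/-- If the two points were exchanged by `σ`, their first coordinates in `W` would be opposite, while
both have positive real part in these charts. -/
theorem fchart_inr_eq {i j : Fin 6} {a b : ℂ × ℂ} (ha : a ∈ fdom σ t (.inr (some i)))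
    (hb : b ∈ fdom σ t (.inr (some j))) :
    fchart σ t (.inr (some i)) a = fchart σ t (.inr (some j)) b ↔
      (XSpace.node i).map ⟨_, ha.fst⟩ = (XSpace.node j).map ⟨_, hb.fst⟩ := by
  rw [Subtype.ext_iff, hσ.fchart_val ha, hσ.fchart_val hb]
  refine hσ.datumE.inX_eq_inX.trans ⟨?_, .inl⟩
  rintro (h | h)
  · exact h
  · have h2 := congrArg (fun x : XSpace => x.toW.2.1.re) h
    simp only [hσ.2.2, sigmaW, Complex.neg_re] at h2
    have h3 := ha.snd
    have h4 := hb.snd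
    change _ = -((XSpace.node j).map ⟨_, hb.fst⟩).toW.2.1.re at h2
    linarith

theorem fchart_inl_eq_inr {i j : Fin 6} {a b : ℂ × ℂ} (ha : a ∈ fdom σ t (.inl i))
    (hb : b ∈ fdom σ t (.inr (some j))) :
    fchart σ t (.inl i) a = fchart σ t (.inr (some j)) b ↔
      SSpace.pt i (t, a) = wS (XSpace.nodeW j (t, b)) := by
  rw [Subtype.ext_iff, hσ.fchart_val ha, hσ.fchart_val hb]
  refine hσ.datumE.inS_eq_inX.trans ?_
  change _ ∧ SSpace.pt i (t, a) = wS (((XSpace.node j).map ⟨_, hb.fst⟩).toW) ↔ _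
  have h := XSpace.notMem_p_of_pos hb.snd
  change ((XSpace.node j).map ⟨_, hb.fst⟩).toW.2 ≠ (0, 0) at h
  rw [XSpace.toW_node j.2] at h ⊢
  exact and_iff_right h

theorem exists_of_mem_curves {i : Fin 9} {e : Ebar σ t} (he : e ∈ hσ.curves t i) :
    ∃ c : ChartIndex, (c.fst = some i ∨ c.snd = some i) ∧ ∃ a ∈ fdom σ t c, fchart σ t c a = e := by
  obtain ⟨c, a, ha, rfl, -⟩ := hσ.exists_fchart e
  refine ⟨c, ?_, a, ha, rfl⟩
  rw [hσ.fchart_mem ha] at he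
  exact he.imp And.left And.left

/-- The section at infinity. -/
theorem isSmoothRationalCurve_zero : IsSmoothRationalCurve (hσ.curves t 0) (-2) := by
  have m1 : ∀ a, a ∈ fdom σ t (.inl 1) := fun a => by simp [mem_fdom_inl]
  have m0 : ∀ a, a ∈ fdom σ t (.inl 0) := fun a => by simp [mem_fdom_inl]
  -- The sign in `f` is the one in the gluing `p₁ = -q₂² p₂`.
  refine .of_charts (hσ.isOpenChart_fchart (.inl 1)) (hσ.isOpenChart_fchart (.inl 0)) (m1 _)
    (fun a => m0 _) (f := fun v => (v.1, -v.2)) (.of_inverse (g := fun v => (v.1, -v.2)) (by fun_prop)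
      (by fun_prop) (by simp) (by simp)) (by simp) ?_ ?_ ?_ ?_ ?_ ?_
  · rintro ⟨q', p'⟩ - ⟨q, p⟩ - h
    rw [hσ.fchart_inl_eq (m1 _) (m0 _), eq_comm, SSpace.pt_zero_eq_pt_one_iff] at h
    have hq := left_ne_zero_of_mul_eq_one h.1
    exact ⟨hq, by simp [h.2, eq_one_div_of_mul_eq_one_right h.1]⟩
  · rintro ⟨q', p'⟩ - h1 h2
    simp only [neg_eq_zero] at h1 h2
    rw [hσ.fchart_inl_eq (m1 _) (m0 _), eq_comm, SSpace.pt_zero_eq_pt_one_iff]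
    exact ⟨by simp [h1], by simp [h2]⟩
  · rintro ⟨q, p⟩ - h
    simpa using h
  · intro y hy
    obtain ⟨c, h1, a, h2, h3⟩ := hσ.exists_of_mem_curves hy
    have : ∀ c : ChartIndex, (c.fst = some 0 ∨ c.snd = some 0) → c = .inl 1 ∨ c = .inl 0 := by decide
    rcases this c h1 with rfl | rfl
    · exact .inl ⟨a, h2, h3⟩
    · exact .inr ⟨a, h2, h3⟩
  · intro v hv
    rw [hσ.fchart_mem hv]
    simp [ChartIndex.fst, ChartIndex.snd]
  · intro v hv
    rw [hσ.fchart_mem hv]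
    simp [ChartIndex.fst, ChartIndex.snd]

/-- The proper transform of the fibre over `x = ∞`. -/
theorem isSmoothRationalCurve_one : IsSmoothRationalCurve (hσ.curves t 1) (-2) := by
  have m1 : ∀ a, a ∈ fdom σ t (.inl 1) := fun a => by simp [mem_fdom_inl]
  refine .of_charts (hσ.isOpenChart_fchart (.inl 3)).comp_swap
    (hσ.isOpenChart_fchart (.inl 1)).comp_swap (zero_mem_fdom σ t (.inl 3))
    (fun a => m1 _) (isLocalBiholo_id _) rfl ?_ ?_ (fun _ _ h => h) ?_ ?_ ?_
  · rintro ⟨q', p'⟩ hv ⟨q, p⟩ - h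
    rw [Function.comp, Function.comp, hσ.fchart_inl_eq hv (m1 _), eq_comm] at h
    have h := SSpace.pt_one_eq_pt_three_iff.1 h
    simp only at h
    refine ⟨left_ne_zero_of_mul_eq_one h.1, Prod.ext (eq_one_div_of_mul_eq_one_right h.1) ?_⟩
    rw [h.2, mul_comm]
  · rintro ⟨q', p'⟩ hv h1 h2
    simp only at h1 h2
    subst h2
    rw [Function.comp, Function.comp, hσ.fchart_inl_eq hv (m1 _), eq_comm]
    refine SSpace.pt_one_eq_pt_three_iff.2 ⟨?_, ?_⟩
    · simp [h1]
    · simp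
  · intro y hy
    obtain ⟨c, h1, a, h2, h3⟩ := hσ.exists_of_mem_curves hy
    have : ∀ c : ChartIndex, (c.fst = some 1 ∨ c.snd = some 1) → c = .inl 3 ∨ c = .inl 1 := by decide
    rcases this c h1 with rfl | rfl
    · exact .inl ⟨a.swap, h2, h3⟩
    · exact .inr ⟨a.swap, h2, h3⟩
  · intro v hv
    rw [Function.comp, hσ.fchart_mem hv]
    simp [ChartIndex.fst, ChartIndex.snd]
  · intro v hv
    rw [Function.comp, hσ.fchart_mem hv]
    simp [ChartIndex.fst, ChartIndex.snd]

/-- The branch curve `C`. -/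
theorem isSmoothRationalCurve_eight : IsSmoothRationalCurve (hσ.curves t 8) (-2) := by
  have m5 : ∀ a, a ∈ fdom σ t (.inl 5) := fun a => by simp [mem_fdom_inl]
  refine .of_charts (hσ.isOpenChart_fchart (.inl 4))
    (hσ.isOpenChart_fchart (.inl 5)).comp_swap (zero_mem_fdom _ _ _)
    (fun a => m5 _) (isLocalBiholo_id _) rfl ?_ ?_ (fun _ _ h => h) ?_ ?_ ?_
  · rintro ⟨q', p'⟩ hv ⟨q, p⟩ - h
    rw [Function.comp, hσ.fchart_inl_eq hv (m5 _)] at h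
    have h := SSpace.pt_four_eq_pt_five_iff.1 h
    simp only at h
    have hq := right_ne_zero_of_mul_eq_one h.1
    refine ⟨hq, Prod.ext (eq_one_div_of_mul_eq_one_left h.1) ?_⟩
    rw [h.2, ← mul_assoc, ← mul_pow, mul_comm q, h.1]
    simp
  · rintro ⟨q', p'⟩ hv h1 h2
    simp only at h1 h2
    subst h2
    rw [Function.comp, hσ.fchart_inl_eq hv (m5 _)]
    refine SSpace.pt_four_eq_pt_five_iff.2 ⟨?_, ?_⟩
    · simp [h1]
    · simp
  · intro y hy
    obtain ⟨c, h1, a, h2, h3⟩ := hσ.exists_of_mem_curves hy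
    have : ∀ c : ChartIndex, (c.fst = some 8 ∨ c.snd = some 8) → c = .inl 4 ∨ c = .inl 5 := by decide
    rcases this c h1 with rfl | rfl
    · exact .inl ⟨a, h2, h3⟩
    · exact .inr ⟨a.swap, h2, h3⟩
  · intro v hv
    rw [hσ.fchart_mem hv]
    simp [ChartIndex.fst, ChartIndex.snd]
  · intro v hv
    rw [Function.comp, hσ.fchart_mem hv]
    simp [ChartIndex.fst, ChartIndex.snd]

omit hσ in
theorem _root_.ChartIndex.exceptional : ∀ j : Fin 5,
    ChartIndex.fst (.inr (some j.castSucc)) = some ⟨j + 3, by omega⟩ ∧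
    ChartIndex.snd (.inr (some j.castSucc)) ≠ some ⟨j + 3, by omega⟩ ∧
    ChartIndex.snd (.inr (some j.succ)) = some ⟨j + 3, by omega⟩ ∧
    ChartIndex.fst (.inr (some j.succ)) ≠ some ⟨j + 3, by omega⟩ := by
  decide

omit hσ in
theorem _root_.ChartIndex.exceptional_cases : ∀ j : Fin 5, ∀ c : ChartIndex,
    (c.fst = some ⟨j + 3, by omega⟩ ∨ c.snd = some ⟨j + 3, by omega⟩) →
      c = .inr (some j.castSucc) ∨ c = .inr (some j.succ) := by
  decide

/-- The exceptional curves of the blowups of `W`. -/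
theorem isSmoothRationalCurve_exceptional (j : Fin 5) :
    IsSmoothRationalCurve (hσ.curves t ⟨j + 3, by omega⟩) (-2) := by
  let a := XStage.cen (j + 1) true t
  let i : Fin 6 := j.castSucc
  let i' : Fin 6 := j.succ
  have hi : (i : ℕ) = j := rfl
  have hi' : (i' : ℕ) = j + 1 := rfl
  obtain ⟨f1, f2, f3, f4⟩ : ChartIndex.fst (.inr (some i)) = some ⟨j + 3, by omega⟩ ∧
    ChartIndex.snd (.inr (some i)) ≠ some ⟨j + 3, by omega⟩ ∧
    ChartIndex.snd (.inr (some i')) = some ⟨j + 3, by omega⟩ ∧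
    ChartIndex.fst (.inr (some i')) ≠ some ⟨j + 3, by omega⟩ := ChartIndex.exceptional j
  have f5 := ChartIndex.exceptional_cases j
  -- The coordinates are swapped so that the parameter `P` along the curve comes first. The locus `1
  -- - a P = 0` is left out: on the curve it is the next centre.
  let OA : Set (ℂ × ℂ) := Prod.swap ⁻¹' fdom σ t (.inr (some i)) ∩ {v | 1 - a * v.1 ≠ 0}
  have hA : IsOpenChart (fchart σ t (.inr (some i)) ∘ Prod.swap) OA :=
    (hσ.isOpenChart_fchart (.inr (some i))).comp_swap.mono
      ((hσ.isOpenChart_fchart (.inr (some i))).comp_swap.isOpen.inter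
        (isOpen_ne_fun (by fun_prop) continuous_const)) Set.inter_subset_left
  have m : ∀ q : ℂ, (q, (0 : ℂ)) ∈ fdom σ t (.inr (some i')) := by
    intro q
    refine mem_inr_some (σ := σ) ?_ (by simp)
    rw [hi', XSpace.nodeW_succ_base _ (by simp)]
    norm_num
  have h6 : (j : ℕ) + 1 < 6 := by omega
  -- From `Q' = 1 / P - a` and `Q' P' = Q P` one gets `1 / Q' = P / (1 - a P)` and `Q'² P' = Q (1 -
  -- a P)`, which are the two components of `f`.
  refine .of_charts hA (hσ.isOpenChart_fchart (.inr (some i'))) ⟨zero_mem_fdom σ t (.inr (some i)), by simp⟩ m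
    (f := fun v => (v.1 / (1 - a * v.1), v.2 * (1 - a * v.1))) ?_ (by simp) ?_ ?_ ?_ ?_ ?_ ?_
  · have n1 : 1 - a * (0 : ℂ × ℂ).1 ≠ 0 := by simp
    have n2 : 1 + a * ((0 : ℂ × ℂ).1 / (1 - a * (0 : ℂ × ℂ).1), (0 : ℂ × ℂ).2 * (1 - a * (0 : ℂ × ℂ).1)).1 ≠ 0 := by
      simp
    refine .of_inverse (g := fun v => (v.1 / (1 + a * v.1), v.2 * (1 + a * v.1)))
      (by fun_prop (disch := assumption)) (by fun_prop (disch := assumption)) ?_ ?_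
    · filter_upwards [eventually_ne_of_continuousAt (f := fun v : ℂ × ℂ => 1 - a * v.1) (by fun_prop) n1]
        with v hv
      have h1 : 1 + a * (v.1 / (1 - a * v.1)) = 1 / (1 - a * v.1) := by
        field_simp
        ring
      ext
      · simp only [h1]
        rw [div_div_div_cancel_right₀ hv, div_one]
      · simp only [h1]
        field_simp
    · filter_upwards [eventually_ne_of_continuousAt (f := fun v : ℂ × ℂ => 1 + a * v.1) (by fun_prop) n2]
        with v hv
      have h1 : 1 - a * (v.1 / (1 + a * v.1)) = 1 / (1 + a * v.1) := by
        field_simp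
        ring
      ext
      · simp only [h1]
        rw [div_div_div_cancel_right₀ hv, div_one]
      · simp only [h1]
        field_simp
  · rintro ⟨p, q⟩ ⟨hv, hp⟩ ⟨q', p'⟩ hw h
    simp only [Set.mem_ofPred_eq] at hp
    rw [Function.comp, hσ.fchart_inr_eq hv hw] at h
    obtain ⟨-, h1, h2⟩ := XStage.node_eq_node_succ h6 true hv.fst hw.fst h
    simp only [Prod.fst_swap, Prod.snd_swap] at h1 h2
    change (a + q') * p = 1 at h1
    have h3 : 1 - a * p = q' * p := by linear_combination -h1
    have hq' : q' ≠ 0 := by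
      rintro rfl
      simp [h3] at hp
    have hp0 : p ≠ 0 := right_ne_zero_of_mul_eq_one h1
    refine ⟨hq', Prod.ext ?_ ?_⟩
    · simp only [h3]
      field_simp
    · simp only [h3]
      linear_combination (-q') * h2
  · rintro ⟨p, q⟩ ⟨hv, hp⟩ h1 h2
    simp only [Set.mem_ofPred_eq] at hp h1 h2
    have hq : q = 0 := by simpa [hp] using h2
    subst hq
    have hp0 : p ≠ 0 := by
      rintro rfl
      simp at h1
    have e1 : 1 / (p / (1 - a * p)) = 1 / p - a := by
      field_simp
    rw [Function.comp, e1, hσ.fchart_inr_eq hv (m _)]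
    exact XStage.node_zero_eq_node_succ h6 true hp0 hv.fst (m (1 / p - a)).fst
  · rintro ⟨p, q⟩ ⟨hv, hp⟩ h
    simp only [Set.mem_ofPred_eq] at hp
    simp only [Prod.mk_eq_zero, div_eq_zero_iff, hp, mul_eq_zero, or_false] at h
    exact Prod.ext h.1 h.2
  · intro y hy
    obtain ⟨c, h1, v, h2, h3⟩ := hσ.exists_of_mem_curves hy
    rcases f5 c h1 with rfl | rfl
    · refine .inl ⟨v.swap, ⟨h2, ?_⟩, h3⟩
      obtain ⟨q, p⟩ := v
      subst h3
      rw [hσ.fchart_mem h2] at hy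
      have hq : q = 0 := hy.elim (fun h => h.2) fun h => absurd h.1 f2
      subst hq
      have := XStage.cen_mul_ne_one h6 true h2.fst
      exact fun h => this (sub_eq_zero.1 h).symm
    · exact .inr ⟨v, h2, h3⟩
  · rintro v ⟨hv, hp⟩
    simp only [Set.mem_ofPred_eq] at hp
    rw [Function.comp, hσ.fchart_mem hv]
    simp [f1, f2, hp]
  · intro v hv
    rw [hσ.fchart_mem hv]
    simp [f3, f4]

/-- The exceptional curve of the second blowup of `S`. -/
theorem isSmoothRationalCurve_two : IsSmoothRationalCurve (hσ.curves t 2) (-2) := by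
  classical
  -- The curve without `a⁽²⁾` is an affine line with parameter `1 / (P - 4)`. Where `w₁ = 0`, that
  -- is `P = ∞`, the chart `3` takes over; there `q = 1 / P = w₁ / (1 + 4 w₁)`.
  let B : ℂ × ℂ → Ebar σ t := fun w => if w.1 = 0 then fchart σ t (.inl 3) (0, w.2)
    else fchart σ t (.inl 4) (w.1 * w.2, 4 + 1 / w.1)
  have B0 : ∀ w : ℂ × ℂ, w.1 = 0 → B w = fchart σ t (.inl 3) (0, w.2) := fun w h => if_pos h
  have B1 : ∀ w : ℂ × ℂ, w.1 ≠ 0 → B w = fchart σ t (.inl 4) (w.1 * w.2, 4 + 1 / w.1) := fun w h => if_neg h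
  have m3 : ∀ p : ℂ, ((0 : ℂ), p) ∈ fdom σ t (.inl 3) := fun p => by simp [mem_fdom_inl]
  have m3' : ∀ w : ℂ × ℂ, 1 + 4 * w.1 ≠ 0 →
      (w.1 / (1 + 4 * w.1), w.2 * (1 + 4 * w.1)) ∈ fdom σ t (.inl 3) := by
    intro w hw
    rw [mem_fdom_inl]
    have : w.1 / (1 + 4 * w.1) ≠ 1 / 4 := by
      intro h
      rw [div_eq_div_iff hw (by norm_num)] at h
      have : (1 : ℂ) = 0 := by linear_combination -h
      exact one_ne_zero this
    simpa using fun _ => this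
  have m4 : ∀ w : ℂ × ℂ, w.1 ≠ 0 → (w.1 * w.2, 4 + 1 / w.1) ∈ fdom σ t (.inl 4) := by
    intro w hw
    rw [mem_fdom_inl]
    simp [hw]
  have B3 : ∀ w : ℂ × ℂ, 1 + 4 * w.1 ≠ 0 →
      B w = fchart σ t (.inl 3) (w.1 / (1 + 4 * w.1), w.2 * (1 + 4 * w.1)) := by
    intro w hw
    by_cases h : w.1 = 0
    · rw [B0 w h, h]
      simp
    · rw [B1 w h, eq_comm, hσ.fchart_inl_eq (m3' w hw) (m4 w h),
        SSpace.pt_three_eq_pt_four (div_ne_zero h hw)]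
      congr 3
      · rw [mul_comm (w.2), ← mul_assoc, div_mul_cancel₀ _ hw]
      · rw [one_div_div]
        field_simp
        ring
  have hB : IsOpenChart B Set.univ := by
    refine ⟨isOpen_univ, ?_, fun w _ => ?_⟩
    · have hne : ∀ w w' : ℂ × ℂ, w.1 = 0 → w'.1 ≠ 0 → B w ≠ B w' := by
        intro w w' h h' e
        have h1 : B w ∈ hσ.curves t 1 := by
          rw [B0 w h, hσ.fchart_mem (m3 _)]
          simp [ChartIndex.fst]
        rw [e, B1 w' h', hσ.fchart_mem (m4 _ h')] at h1
        simp [ChartIndex.fst, ChartIndex.snd] at h1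
      intro w _ w' _ e
      by_cases h : w.1 = 0 <;> by_cases h' : w'.1 = 0
      · rw [B0 w h, B0 w' h'] at e
        have := (hσ.isOpenChart_fchart _).inj (m3 _) (m3 _) e
        exact Prod.ext (h.trans h'.symm) (Prod.mk.inj this).2
      · exact absurd e (hne _ _ h h')
      · exact absurd e.symm (hne _ _ h' h)
      · rw [B1 w h, B1 w' h'] at e
        have h1 := (hσ.isOpenChart_fchart _).inj (m4 _ h) (m4 _ h') e
        simp only [Prod.mk.injEq, add_right_inj, one_div, inv_inj] at h1
        refine Prod.ext h1.2 ?_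
        have h2 := h1.1
        rw [h1.2] at h2
        exact mul_left_cancel₀ h' h2
    · by_cases h : w.1 = 0
      · have hw : 1 + 4 * w.1 ≠ 0 := by simp [h]
        have hw' : 1 - 4 * (w.1 / (1 + 4 * w.1), w.2 * (1 + 4 * w.1)).1 ≠ 0 := by simp [h]
        have k1 : HolOpenAt (fun w : ℂ × ℂ => (w.1 / (1 + 4 * w.1), w.2 * (1 + 4 * w.1))) w := by
          refine .of_analytic (g := fun v => (v.1 / (1 - 4 * v.1), v.2 * (1 - 4 * v.1)))
            (by fun_prop (disch := assumption)) (by fun_prop (disch := assumption)) ?_ ?_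
          · filter_upwards [eventually_ne_of_continuousAt (f := fun v : ℂ × ℂ => 1 + 4 * v.1)
              (by fun_prop) hw] with v hv
            have h1 : 1 - 4 * (v.1 / (1 + 4 * v.1)) = 1 / (1 + 4 * v.1) := by
              field_simp
              ring
            ext
            · simp only [h1]
              rw [div_div_div_cancel_right₀ hv, div_one]
            · simp only [h1]
              field_simp
          · filter_upwards [eventually_ne_of_continuousAt (f := fun v : ℂ × ℂ => 1 - 4 * v.1)
              (by fun_prop) hw'] with v hv
            have h1 : 1 + 4 * (v.1 / (1 - 4 * v.1)) = 1 / (1 - 4 * v.1) := by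
              field_simp
              ring
            ext
            · simp only [h1]
              rw [div_div_div_cancel_right₀ hv, div_one]
            · simp only [h1]
              field_simp
        refine (HolOpenAt.comp (f := fun w : ℂ × ℂ => (w.1 / (1 + 4 * w.1), w.2 * (1 + 4 * w.1)))
          (a := w) ((hσ.isOpenChart_fchart _).hol _ (m3' w hw)) k1).congr ?_
        filter_upwards [eventually_ne_of_continuousAt (f := fun v : ℂ × ℂ => 1 + 4 * v.1)
          (by fun_prop) hw] with v hv
        exact (B3 v hv).symm
      · have hw' : (w.1 * w.2, 4 + 1 / w.1).2 - 4 ≠ 0 := by simp [h]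
        have k1 : HolOpenAt (fun w : ℂ × ℂ => (w.1 * w.2, 4 + 1 / w.1)) w := by
          refine .of_analytic (g := fun v => (1 / (v.2 - 4), v.1 * (v.2 - 4)))
            (by fun_prop (disch := assumption)) (by fun_prop (disch := assumption)) ?_ ?_
          · filter_upwards [eventually_ne_of_continuousAt (f := fun v : ℂ × ℂ => v.1)
              (by fun_prop) h] with v hv
            ext
            · simp
            · simp
              field_simp
          · filter_upwards [eventually_ne_of_continuousAt (f := fun v : ℂ × ℂ => v.2 - 4)
              (by fun_prop) hw'] with v hv
            ext
            · simp
              field_simp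
            · simp
        refine (HolOpenAt.comp (f := fun w : ℂ × ℂ => (w.1 * w.2, 4 + 1 / w.1))
          (a := w) ((hσ.isOpenChart_fchart _).hol _ (m4 w h)) k1).congr ?_
        filter_upwards [eventually_ne_of_continuousAt (f := fun v : ℂ × ℂ => v.1)
          (by fun_prop) h] with v hv
        exact (B1 v hv).symm
  -- On this chart `ξ = 2 + v₁` has positive real part, so neither `ξ` nor `ξ + 2` vanishes.
  have hre : ∀ v ∈ fdom σ t (.inr (some 0)), 2 + v.1 ≠ 0 ∧ 4 + v.1 ≠ 0 := by
    intro v hv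
    have h1 := re_pos_of_mem_fdom hv
    change 0 < (XSpace.nodeW 0 (t, v)).2.1.re at h1
    rw [XSpace.nodeW_zero] at h1
    simp only [Complex.add_re] at h1
    constructor
    · intro h
      have := congrArg Complex.re h
      simp at this h1
      linarith
    · intro h
      have := congrArg Complex.re h
      simp at this h1
      linarith
  have hwS : ∀ v ∈ fdom σ t (.inr (some 0)), wS (XSpace.nodeW ((0 : Fin 6) : ℕ) (t, v)) =
      SSpace.pt 4 (t, v.1 * v.2 / (2 + v.1), (2 + v.1) ^ 2) := by
    intro v hv
    change wS (XSpace.nodeW 0 (t, v)) = _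
    rw [XSpace.nodeW_zero, wS_of_fst_ne (hre v hv).1]
  have hA := hσ.isOpenChart_fchart (t := t) (.inr (some 0))
  -- With `ξ = 2 + v₁` and `η = v₁ v₂` one has `P - 4 = ξ² - 4 = v₁ (4 + v₁)` and `Q = η / ξ`. As `1
  -- / w₁ = P - 4` and `w₁ w₂ = Q`, the second component is `w₁² w₂ = Q / (P - 4)`.
  refine .of_charts hA hB (zero_mem_fdom _ _ _) (fun _ => trivial)
    (f := fun v => ((2 + v.1) ^ 2 - 4, v.2 / ((2 + v.1) * (4 + v.1)))) ?_ ?_ ?_ ?_ ?_ ?_ ?_ ?_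
  -- The derivative of `f` at the origin is diagonal with entries `4` and `1 / 8`.
  · let f' : (ℂ × ℂ) ≃L[ℂ] (ℂ × ℂ) :=
      (ContinuousLinearEquiv.unitsEquivAut ℂ (Units.mk0 4 (by norm_num))).prodCongr
        (ContinuousLinearEquiv.unitsEquivAut ℂ (Units.mk0 (1 / 8) (by norm_num)))
    have h1 : HasFDerivAt (fun v : ℂ × ℂ => v.1) (ContinuousLinearMap.fst ℂ ℂ ℂ) (0 : ℂ × ℂ) :=
      hasFDerivAt_fst
    have h2 : HasFDerivAt (fun v : ℂ × ℂ => v.2) (ContinuousLinearMap.snd ℂ ℂ ℂ) (0 : ℂ × ℂ) :=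
      hasFDerivAt_snd
    have k1 : (2 + (0 : ℂ × ℂ).1) * (4 + (0 : ℂ × ℂ).1) ≠ 0 := by norm_num
    have h3 := (((h1.const_add 2).pow 2).sub_const 4).prodMk
      (h2.mul (HasDerivAt.comp_hasFDerivAt (f := fun v : ℂ × ℂ => (2 + v.1) * (4 + v.1)) 0
        (hasDerivAt_inv k1) ((h1.const_add 2).mul (h1.const_add 4))))
    refine exists_holOpenAt_of_hasFDerivAt (f' := f') (by fun_prop (disch := assumption))
      (h3.congr_fderiv ?_)
    ext <;> simp [f', ContinuousLinearEquiv.unitsEquivAut] <;> norm_num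
  · norm_num
  · rintro ⟨q, p⟩ hv w - h
    have hw : w.1 ≠ 0 := by
      intro hw
      have h1 : B w ∈ hσ.curves t 1 := by
        rw [B0 w hw, hσ.fchart_mem (m3 _)]
        simp [ChartIndex.fst]
      rw [← h, hσ.fchart_mem hv] at h1
      revert h1
      simp [ChartIndex.fst, ChartIndex.snd]
    rw [B1 w hw, eq_comm, hσ.fchart_inl_eq_inr (m4 w hw) hv, hwS _ hv] at h
    have h1 := SSpace.pt_injective 4 h
    obtain ⟨k1, k2⟩ := hre _ hv
    simp only [Prod.mk.injEq, true_and] at h1 k1 k2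
    refine ⟨hw, Prod.ext ?_ ?_⟩
    · linear_combination -h1.2
    · have h2 : 1 / w.1 = q * (4 + q) := by linear_combination h1.2
      have h3 : w.1 * (q * (4 + q)) = 1 := by
        rw [← h2]
        field_simp
      have h4 := h1.1
      field_simp at h4 ⊢
      linear_combination (-w.1 * (4 + q)) * h4 - p * h3
  · rintro ⟨q, p⟩ hv h1 h2
    obtain ⟨k1, k2⟩ := hre _ hv
    simp only [div_eq_zero_iff, mul_eq_zero] at h1 h2 k1 k2
    simp only [k1, k2, or_false] at h2
    subst h2
    have hw : 1 / ((2 + q) ^ 2 - 4) ≠ 0 := by simpa using h1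
    rw [B1 _ hw, eq_comm, hσ.fchart_inl_eq_inr (m4 _ hw) hv, hwS _ hv]
    congr 3
    · simp
    · simp
  · rintro ⟨q, p⟩ hv h
    obtain ⟨k1, k2⟩ := hre _ hv
    simp only [Prod.mk_eq_zero, div_eq_zero_iff, mul_eq_zero] at h k1 k2
    simp only [k1, k2, or_false] at h
    have h1 : q * (4 + q) = 0 := by linear_combination h.1
    exact Prod.ext ((mul_eq_zero.1 h1).resolve_right k2) h.2
  · intro y hy
    obtain ⟨c, h1, a, h2, h3⟩ := hσ.exists_of_mem_curves hy
    have : ∀ c : ChartIndex, (c.fst = some 2 ∨ c.snd = some 2) →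
      c = .inr (some 0) ∨ c = .inl 3 ∨ c = .inl 4 := by decide
    subst h3
    rw [hσ.fchart_mem h2] at hy
    rcases this c h1 with rfl | rfl | rfl
    · exact .inl ⟨a, h2, rfl⟩
    · refine .inr ⟨(a.1 / (1 - 4 * a.1), 0), trivial, ?_⟩
      have ha : a.2 = 0 := by simpa [ChartIndex.fst, ChartIndex.snd] using hy
      have h5 : 1 - 4 * a.1 ≠ 0 := by
        intro h
        rw [mem_fdom_inl] at h2
        refine h2 (.inr ⟨rfl, ha, ?_⟩)
        linear_combination (-1 / 4) * h
      have h6 : 1 + 4 * (a.1 / (1 - 4 * a.1)) = 1 / (1 - 4 * a.1) := by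
        field_simp
        ring
      rw [B3 _ (by rw [h6]; simpa using h5)]
      congr 1
      simp only [h6]
      rw [div_div_div_cancel_right₀ h5, div_one]
      exact Prod.ext rfl (by simp [ha])
    · have ha : a.1 = 0 := by simpa [ChartIndex.fst, ChartIndex.snd] using hy
      have h5 : a.2 - 4 ≠ 0 := by
        intro h
        rw [mem_fdom_inl] at h2
        exact h2 (.inl ⟨rfl, ha, sub_eq_zero.1 h⟩)
      refine .inr ⟨(1 / (a.2 - 4), 0), trivial, ?_⟩
      rw [B1 _ (by simpa using h5)]
      congr 1
      exact Prod.ext (by simp [ha]) (by simp)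
  · intro v hv
    rw [hσ.fchart_mem hv]
    obtain ⟨k1, k2⟩ := hre _ hv
    simp only [div_eq_zero_iff, mul_eq_zero, k1, k2, or_false]
    simp [ChartIndex.fst, ChartIndex.snd]
  · intro w _
    by_cases h : w.1 = 0
    · rw [B0 w h, hσ.fchart_mem (m3 _)]
      simp [ChartIndex.fst, ChartIndex.snd]
    · rw [B1 w h, hσ.fchart_mem (m4 _ h)]
      simp [ChartIndex.fst, ChartIndex.snd, h]

theorem isE8Configuration : IsE8Configuration (hσ.curves t) := by
  constructor
  · intro i
    match i with
    | 0 => exact hσ.isSmoothRationalCurve_zero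
    | 1 => exact hσ.isSmoothRationalCurve_one
    | 2 => exact hσ.isSmoothRationalCurve_two
    | 3 => exact hσ.isSmoothRationalCurve_exceptional 0
    | 4 => exact hσ.isSmoothRationalCurve_exceptional 1
    | 5 => exact hσ.isSmoothRationalCurve_exceptional 2
    | 6 => exact hσ.isSmoothRationalCurve_exceptional 3
    | 7 => exact hσ.isSmoothRationalCurve_exceptional 4
    | 8 => exact hσ.isSmoothRationalCurve_eight
  · intro i j hij
    -- One coordinate line carries at most one curve, so on two different curves both coordinates
    -- vanish.
    have key : ∀ e ∈ hσ.curves t i ∩ hσ.curves t j, ∃ c : ChartIndex,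
        ((c.fst = some i ∧ c.snd = some j) ∨ (c.fst = some j ∧ c.snd = some i)) ∧
          e = fchart σ t c 0 := by
      rintro e ⟨h1, h2⟩
      obtain ⟨c, a, ha, rfl, -⟩ := hσ.exists_fchart e
      rw [hσ.fchart_mem ha] at h1 h2
      refine ⟨c, ?_⟩
      rcases h1 with ⟨h1, k1⟩ | ⟨h1, k1⟩ <;> rcases h2 with ⟨h2, k2⟩ | ⟨h2, k2⟩
      · exact absurd (Option.some.inj (h1.symm.trans h2)) hij
      · exact ⟨.inl ⟨h1, h2⟩, congrArg _ (Prod.ext k1 k2)⟩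
      · exact ⟨.inr ⟨h2, h1⟩, congrArg _ (Prod.ext k2 k1)⟩
      · exact absurd (Option.some.inj (h1.symm.trans h2)) hij
    constructor
    · intro hadj
      obtain ⟨c, hc⟩ := ChartIndex.exists_of_adjE8 i j hadj
      have h0 := zero_mem_fdom σ t c
      have cross : ∀ i' j' : Fin 9, i' ≠ j' → c.fst = some i' ∧ c.snd = some j' →
          fchart σ t c 0 ∈ hσ.curves t i' ∧ fchart σ t c 0 ∈ hσ.curves t j' ∧
          CrossTransversally (hσ.curves t i') (hσ.curves t j') (fchart σ t c 0) := by
        rintro i' j' hne ⟨h1, h2⟩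
        refine ⟨?_, ?_, (hσ.isOpenChart_fchart c).crossTransversally h0 (fun v hv => ?_) fun v hv => ?_⟩
        · rw [hσ.fchart_mem h0]
          exact .inl ⟨h1, rfl⟩
        · rw [hσ.fchart_mem h0]
          exact .inr ⟨h2, rfl⟩
        · rw [hσ.fchart_mem hv]
          simp [h1, h2, hne.symm]
        · rw [hσ.fchart_mem hv]
          simp [h1, h2, hne]
      refine ⟨fchart σ t c 0, Set.eq_singleton_iff_unique_mem.2 ⟨?_, fun e he => ?_⟩, ?_⟩
      · rcases hc with hc | hc
        · have := cross _ _ hij hc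
          exact ⟨this.1, this.2.1⟩
        · have := cross _ _ hij.symm hc
          exact ⟨this.2.1, this.1⟩
      · obtain ⟨c', hc', rfl⟩ := key e he
        rw [ChartIndex.unique_of_crossing i j c c' hij hc hc']
      · rcases hc with hc | hc
        · exact (cross _ _ hij hc).2.2
        · exact (cross _ _ hij.symm hc).2.2.symm
    · intro hadj
      refine Set.eq_empty_iff_forall_notMem.2 fun e he => ?_
      obtain ⟨c, hc, -⟩ := key e he
      exact hadj (ChartIndex.adjE8_of_crossing i j c hc)

end XSpace.IsInducedInvolution

/-! ### Vector fields that are related by a map -/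

/-- The vector field `F` at `v` is mapped to the vector field `G` at `T v`. -/
def FieldRelatedAt (T F G : TPlane → TPlane) (v : TPlane) : Prop :=
  ∃ T' : TPlane →L[ℂ] TPlane, HasFDerivAt T T' v ∧ T' (F v) = G (T v)

theorem FieldRelatedAt.comp {T S F G H : TPlane → TPlane} {v : TPlane}
    (hT : FieldRelatedAt T G H (S v)) (hS : FieldRelatedAt S F G v) : FieldRelatedAt (T ∘ S) F H v := by
  obtain ⟨T', h1, h2⟩ := hT
  obtain ⟨S', h3, h4⟩ := hS
  exact ⟨T'.comp S', h1.comp v h3, by rw [ContinuousLinearMap.comp_apply, h4, h2]; rfl⟩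

theorem FieldRelatedAt.id {F : TPlane → TPlane} {v : TPlane} : FieldRelatedAt (fun v => v) F F v :=
  ⟨_, hasFDerivAt_id v, rfl⟩

theorem HasFDerivAt.div_of_ne {E : Type*} [NormedAddCommGroup E] [NormedSpace ℂ E] {f g : E → ℂ}
    {f' g' : E →L[ℂ] ℂ} {v : E} (hg : HasFDerivAt g g' v) (hf : HasFDerivAt f f' v) (h : f v ≠ 0) :
    HasFDerivAt (fun x => g x / f x) ((1 / f v) • g' - (g v / f v ^ 2) • f') v := by
  have h1 := hg.mul (HasDerivAt.comp_hasFDerivAt v (hasDerivAt_inv h) hf)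
  refine (h1.congr_fderiv ?_).congr_of_eventuallyEq (Eventually.of_forall fun x => div_eq_mul_inv _ _)
  ext w
  simp
  field_simp
  ring

theorem fieldPI_eq (v : TPlane) : fieldPI v = (1, v.2.2, 6 * v.2.1 ^ 2 + v.1) := by
  obtain ⟨t, x, y⟩ := v
  have h1 : HasDerivAt (fun y => hamiltonianPI x y t) y y := by
    have := (((hasDerivAt_id y).pow 2).div_const 2).sub_const (2 * x ^ 3) |>.sub_const (t * x)
    refine this.congr_deriv ?_
    simp
  have h2 : HasDerivAt (fun x => hamiltonianPI x y t) (-(6 * x ^ 2 + t)) x := by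
    have := ((((hasDerivAt_id x).pow 3).const_mul 2).const_sub (y ^ 2 / 2)).sub
      ((hasDerivAt_id x).const_mul t)
    refine this.congr_deriv ?_
    simp
    ring
  simp [fieldPI, h1.deriv, h2.deriv]

theorem hasFDerivAt_time (v : TPlane) :
    HasFDerivAt (fun v : TPlane => v.1) (ContinuousLinearMap.fst ℂ ℂ (ℂ × ℂ)) v :=
  (ContinuousLinearMap.fst ℂ ℂ (ℂ × ℂ)).hasFDerivAt

theorem hasFDerivAt_coord₁ (v : TPlane) :
    HasFDerivAt (fun v : TPlane => v.2.1)
      ((ContinuousLinearMap.fst ℂ ℂ ℂ).comp (ContinuousLinearMap.snd ℂ ℂ (ℂ × ℂ))) v :=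
  ((ContinuousLinearMap.fst ℂ ℂ ℂ).comp (ContinuousLinearMap.snd ℂ ℂ (ℂ × ℂ))).hasFDerivAt

theorem hasFDerivAt_coord₂ (v : TPlane) :
    HasFDerivAt (fun v : TPlane => v.2.2)
      ((ContinuousLinearMap.snd ℂ ℂ ℂ).comp (ContinuousLinearMap.snd ℂ ℂ (ℂ × ℂ))) v :=
  ((ContinuousLinearMap.snd ℂ ℂ ℂ).comp (ContinuousLinearMap.snd ℂ ℂ (ℂ × ℂ))).hasFDerivAt

/-- The Painlevé vector field in the six charts that cover `S`. -/
noncomputable def fieldS : Fin 6 → TPlane → TPlane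
  | 0, v => (1, 1 / v.2.2, -v.2.2 ^ 2 * (6 * v.2.1 ^ 2 + v.1))
  | 1, v => (1, 1 / v.2.2, -2 / v.2.1 + 6 * v.2.2 ^ 2 + v.1 * v.2.2 ^ 2 * v.2.1 ^ 2)
  | 2, v => (1, v.2.2, 6 * v.2.1 ^ 2 + v.1)
  | 3, v => (1, -3 * (1 - 4 * v.2.1) / v.2.2 + 2 * v.1 * (v.2.1 * v.2.2) ^ 3,
      2 / v.2.1 - 6 - v.1 * v.2.1 ^ 2 * v.2.2 ^ 4)
  | 4, v => (1, -1 + 6 / v.2.2 + v.1 * v.2.2 * v.2.1 ^ 4,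
      3 * (v.2.2 - 4) / v.2.1 - 2 * v.1 * v.2.2 ^ 2 * v.2.1 ^ 3)
  | 5, v => (1, v.2.1 * v.2.2, -6 / v.2.1 - v.1 * v.2.1 + v.2.2 ^ 2)

theorem SSpace.fieldRelatedAt_toXY {i : Fin 6} {v : TPlane} (h : SSpace.bdry i v ≠ 0) :
    FieldRelatedAt (SSpace.toXY i) (fieldS i) fieldPI v := by
  obtain ⟨t, q, p⟩ := v
  have h0 := hasFDerivAt_time (t, q, p)
  have h1 := hasFDerivAt_coord₁ (t, q, p)
  have h2 := hasFDerivAt_coord₂ (t, q, p)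
  have hc : ∀ c : ℂ, HasFDerivAt (fun _ : TPlane => c) (0 : TPlane →L[ℂ] ℂ) (t, q, p) := fun c => hasFDerivAt_const c _
  fin_cases i <;> simp only [SSpace.bdry, ne_eq, mul_eq_zero, not_or] at h
  · refine ⟨_, h0.prodMk (h1.prodMk ((hc 1).div_of_ne h2 h)), ?_⟩
    simp [fieldPI_eq, fieldS, SSpace.toXY]
    field_simp
  · obtain ⟨hq, hp⟩ := h
    refine ⟨_, h0.prodMk (((hc 1).div_of_ne h1 hq).prodMk ((hc (-1)).div_of_ne
      ((h1.pow 2).fun_mul h2) (mul_ne_zero (pow_ne_zero 2 hq) hp))), ?_⟩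
    simp [fieldPI_eq, fieldS, SSpace.toXY]
    constructor
    · field_simp
    · field_simp
      ring
  · exact ⟨_, hasFDerivAt_id _, by simp [fieldPI_eq, fieldS, SSpace.toXY]⟩
  · obtain ⟨hq, hp⟩ := h
    refine ⟨_, h0.prodMk (((hc 1).div_of_ne (h1.fun_mul (h2.pow 2))
      (mul_ne_zero hq (pow_ne_zero 2 hp))).prodMk ((hc (-1)).div_of_ne
      ((h1.pow 2).fun_mul (h2.pow 3)) (mul_ne_zero (pow_ne_zero 2 hq) (pow_ne_zero 3 hp)))), ?_⟩
    simp [fieldPI_eq, fieldS, SSpace.toXY]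
    constructor
    · field_simp
      ring
    · field_simp
      ring
  · obtain ⟨hq, hp⟩ := h
    refine ⟨_, h0.prodMk (((hc 1).div_of_ne ((h1.pow 2).fun_mul h2)
      (mul_ne_zero (pow_ne_zero 2 hq) hp)).prodMk ((hc (-1)).div_of_ne
      ((h1.pow 3).fun_mul h2) (mul_ne_zero (pow_ne_zero 3 hq) hp))), ?_⟩
    simp [fieldPI_eq, fieldS, SSpace.toXY]
    constructor
    · field_simp
      ring
    · field_simp
      ring
  · refine ⟨_, h0.prodMk (((hc 1).div_of_ne h1 h).prodMk (h2.fun_neg.div_of_ne h1 h)), ?_⟩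
    simp [fieldPI_eq, fieldS, SSpace.toXY]
    constructor
    · field_simp
    · field_simp
      ring

/-- The coordinates `(x, y)` in terms of the coordinates of `W`. -/
noncomputable def wToXY (v : TPlane) : TPlane := (v.1, 1 / v.2.2 ^ 2, -v.2.1 / v.2.2 ^ 3)

/-- The first component of the Painlevé vector field in the charts `(z⁽ᵏ⁺²⁾, w⁽ᵏ⁺²⁾)`. -/
noncomputable def fieldZ : ℕ → TPlane → ℂ
  | 0, (t, z, w) => 3 / 2 * (z ^ 2 - 4) / w - t * w ^ 3
  | 1, (t, z, w) => 5 * z / w + z ^ 2 - t * w ^ 2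
  | 2, (t, z, w) => 4 * z / w + z ^ 2 * w / 2 - t * w
  | 3, (t, z, w) => 3 * z / w - t
  | 4, (t, z, w) => (2 * z - t) / w - z ^ 2 * w ^ 3 / 2
  | 5, (t, z, w) => (z - 1 / 2) / w - (t / 2 + z * w) ^ 2 * w ^ 2 / 2 -
      w ^ 3 * (t / 2 + z * w) * z / 2
  | _, (t, z, w) => -(t / 2 + (1 / 2 + z * w) * w) ^ 2 * w / 2 -
      w ^ 2 * (t / 2 + (1 / 2 + z * w) * w) * (1 / 2 + z * w) / 2 -
      w ^ 3 * (t / 2 + (1 / 2 + z * w) * w) * z / 2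

/-- The Painlevé vector field in the charts `(z⁽ᵏ⁺²⁾, w⁽ᵏ⁺²⁾)`. -/
noncomputable def fieldW (k : ℕ) (v : TPlane) : TPlane :=
  (1, fieldZ k v, (XStage.chartW k true v).2.1 / 2)

/-- Differentiating `x = 1 / η²` and comparing with `x' = y = -ξ / η³` gives `η' = ξ / 2`; the
equation for `y'` then gives `ξ' = (3/2) (ξ² - 4) / η - t η³`. -/
theorem fieldRelatedAt_wToXY {v : TPlane} (h : v.2.2 ≠ 0) : FieldRelatedAt wToXY (fieldW 0) fieldPI v := by
  obtain ⟨t, q, p⟩ := v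
  have h0 := hasFDerivAt_time (t, q, p)
  have h1 := hasFDerivAt_coord₁ (t, q, p)
  have h2 := hasFDerivAt_coord₂ (t, q, p)
  have hc : ∀ c : ℂ, HasFDerivAt (fun _ : TPlane => c) (0 : TPlane →L[ℂ] ℂ) (t, q, p) := fun c => hasFDerivAt_const c _
  simp only [ne_eq] at h
  refine ⟨_, h0.prodMk (((hc 1).div_of_ne (h2.pow 2) (pow_ne_zero 2 h)).prodMk
    (h1.fun_neg.div_of_ne (h2.pow 3) (pow_ne_zero 3 h))), ?_⟩
  simp [fieldPI_eq, fieldW, fieldZ, wToXY, XStage.chartW]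
  constructor
  · field_simp
  · field_simp
    ring

/-- The derivatives of the centres of the blowups over `p₊`. -/
noncomputable def cenDeriv (k : ℕ) : ℂ := if k = 4 then 1 / 2 else 0

theorem hasDerivAt_cen (k : ℕ) (t : ℂ) : HasDerivAt (XStage.cen k true) (cenDeriv k) t := by
  rcases k with _ | _ | _ | _ | _ | _ | k <;>
    simp only [XStage.cen, XStage.ctr, cenDeriv, if_true]
  all_goals first
    | exact (hasDerivAt_const t _).congr_deriv (by simp)
    | exact ((hasDerivAt_id t).div_const 2).congr_deriv (by simp)

/-- The centre is the zero over `p_+` of the polar part of `fieldZ k` along `w = 0`. Passing to `(z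
- c) / w` divides that part by `w` and subtracts `z w' / w` with `w' = 1` on `w = 0`. Therefore the
leading coefficient drops by one, from `6` for `k = 0` down to no pole for `k + 1 = 6`. -/
theorem fieldRelatedAt_blowMap₁ {k : ℕ} (hk : k < 6) {v : TPlane} (h : v.2.2 ≠ 0) :
    FieldRelatedAt (blowMap₁ (XStage.cen k) true) (fieldW (k + 1)) (fieldW k) v := by
  obtain ⟨t, z, w⟩ := v
  have h0 := hasFDerivAt_time (t, z, w)
  have h1 := hasFDerivAt_coord₁ (t, z, w)
  have h2 := hasFDerivAt_coord₂ (t, z, w)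
  simp only [ne_eq] at h
  refine ⟨_, h0.prodMk (((HasDerivAt.comp_hasFDerivAt (f := fun v : TPlane => v.1) _
    (hasDerivAt_cen k t) h0).fun_add (h1.fun_mul h2)).prodMk h2), ?_⟩
  interval_cases k <;>
    simp [fieldW, fieldZ, blowMap₁, XStage.chartW, XStage.cen, XStage.ctr, cenDeriv] <;>
    field_simp <;> ring

/-- The Painlevé vector field in the second charts of the blowups over `p₊`. -/
noncomputable def fieldNode (k : ℕ) (v : TPlane) : TPlane :=
  (1, fieldZ k (blowMap₂ (XStage.cen k) true v) - cenDeriv k,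
    ((XSpace.nodeW k v).2.1 / 2 - (fieldZ k (blowMap₂ (XStage.cen k) true v) - cenDeriv k) * v.2.2) /
      v.2.1)

theorem fieldRelatedAt_blowMap₂ (k : ℕ) {v : TPlane} (h : v.2.1 ≠ 0) :
    FieldRelatedAt (blowMap₂ (XStage.cen k) true) (fieldNode k) (fieldW k) v := by
  obtain ⟨t, z, w⟩ := v
  have h0 := hasFDerivAt_time (t, z, w)
  have h1 := hasFDerivAt_coord₁ (t, z, w)
  have h2 := hasFDerivAt_coord₂ (t, z, w)
  simp only [ne_eq] at h
  refine ⟨_, h0.prodMk (((HasDerivAt.comp_hasFDerivAt (f := fun v : TPlane => v.1) _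
    (hasDerivAt_cen k t) h0).fun_add h1).prodMk (h1.fun_mul h2)), ?_⟩
  simp [fieldW, fieldNode, XSpace.nodeW]
  field_simp
  ring

theorem fieldRelatedAt_chartW {k : ℕ} (hk : k ≤ 6) {v : TPlane} (h : v.2.2 ≠ 0) :
    FieldRelatedAt (fun v => wToXY (XStage.chartW k true v)) (fieldW k) fieldPI v := by
  induction k generalizing v with
  | zero => exact fieldRelatedAt_wToXY h
  | succ k ih => exact FieldRelatedAt.comp (ih (by omega) h) (fieldRelatedAt_blowMap₁ (by omega) h)

theorem fieldRelatedAt_nodeW {k : ℕ} (hk : k < 6) {v : TPlane} (h : v.2.1 * v.2.2 ≠ 0) :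
    FieldRelatedAt (fun v => wToXY (XSpace.nodeW k v)) (fieldNode k) fieldPI v :=
  FieldRelatedAt.comp (T := fun v => wToXY (XStage.chartW k true v))
    (fieldRelatedAt_chartW hk.le h) (fieldRelatedAt_blowMap₂ k (left_ne_zero_of_mul h))

/-! ### Functions in terms of a chart -/

namespace LocalChart

variable {X : Type} {κ : LocalChart X}

theorem pull_of_at {v : TPlane} {x : X} (h : κ.At v x) (g : X → ℂ) : κ.pull g v = g x := by
  obtain ⟨h, rfl⟩ := h
  simp [pull, h]

open Classical in
/-- A function of the coordinates of a chart, as a function on the space. -/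
noncomputable def push (κ : LocalChart X) (f : TPlane → ℂ) (x : X) : ℂ :=
  if h : ∃ v, κ.At v x then f h.choose else 0

namespace IsGood

variable [TopologicalSpace X] [HolSpace X] {τ : X → ℂ} (hκ : κ.IsGood τ)
include hκ

theorem at_unique {v v' : TPlane} {x : X} (h : κ.At v x) (h' : κ.At v' x) : v = v' := by
  obtain ⟨h, e⟩ := h
  obtain ⟨h', e'⟩ := h'
  exact congrArg Subtype.val (hκ.inj (e.trans e'.symm))

theorem push_of_at {v : TPlane} {x : X} (h : κ.At v x) (f : TPlane → ℂ) : κ.push f x = f v := by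
  have h1 : ∃ v, κ.At v x := ⟨v, h⟩
  rw [push, dif_pos h1, hκ.at_unique h1.choose_spec h]

theorem pull_push {v : TPlane} (h : v ∈ κ.dom) (f : TPlane → ℂ) : κ.pull (κ.push f) v = f v :=
  (pull_of_at ⟨h, rfl⟩ _).trans (hκ.push_of_at ⟨h, rfl⟩ f)

theorem holAt_iff (v : κ.dom) (g : X → ℂ) : HolSpace.HolAt g (κ.map v) ↔ AnalyticAt ℂ (κ.pull g) v := by
  refine ((hκ.hol v).2 g).trans (Iff.trans ?_ ((holOpenAt_subtype_val v
    (hκ.isOpen.mem_nhds v.2)).2 (κ.pull g)).symm)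
  exact Iff.of_eq (congrArg (HolSpace.HolAt · v) (funext fun v => (pull_of_at ⟨v.2, rfl⟩ g).symm))

theorem holAt_push (v : κ.dom) {f : TPlane → ℂ} (hf : AnalyticAt ℂ f v) :
    HolSpace.HolAt (κ.push f) (κ.map v) := by
  refine (hκ.holAt_iff v _).2 (hf.congr ?_)
  filter_upwards [hκ.isOpen.mem_nhds v.2] with w hw
  exact (hκ.pull_push hw f).symm

theorem eventually_iff (v : κ.dom) {P : X → Prop} :
    (∀ᶠ x in 𝓝 (κ.map v), P x) ↔ ∀ᶠ w in 𝓝 v.1, ∀ h : w ∈ κ.dom, P (κ.map ⟨w, h⟩) := by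
  rw [← (hκ.hol v).1, ← (holOpenAt_subtype_val v (hκ.isOpen.mem_nhds v.2)).1, eventually_map,
    eventually_map]
  exact eventually_congr (Eventually.of_forall fun w => ⟨fun h _ => h, fun h => h w.2⟩)

end IsGood

end LocalChart

/-! ### The vertical leaves -/

/-- In the chart `κ`, the Painlevé vector field is given by `F` where `off` holds; there, the map
to the coordinates `(x, y)` is `T`, and elsewhere these coordinates are not defined. -/
structure IsPainleveField {σ : XSpace → XSpace} (hσ : XSpace.IsInducedInvolution σ)
    (κ : LocalChart (EbarSpace σ)) (T F : TPlane → TPlane) (off : TPlane → Prop) : Prop where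
  good : κ.IsGood hσ.datumE.time
  isOpen : IsOpen {v | off v}
  at_xy : ∀ v : κ.dom, off v → (chartXY σ).At (T v) (κ.map v)
  related : ∀ v, off v → FieldRelatedAt T F fieldPI v
  off_of_at : ∀ (v : κ.dom) (u : TPlane), (chartXY σ).At u (κ.map v) → off v

namespace IsPainleveField

variable {σ : XSpace → XSpace} {hσ : XSpace.IsInducedInvolution σ}
  {κ : LocalChart (EbarSpace σ)} {T F : TPlane → TPlane} {off : TPlane → Prop}

theorem xy (hσ : XSpace.IsInducedInvolution σ) :
    IsPainleveField hσ (chartXY σ) (fun v => v) fieldPI fun _ => True where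
  good := hσ.isGood_ofS (SSpace.isGood_chart 2)
  isOpen := isOpen_const
  at_xy v _ := ⟨v.2, rfl⟩
  related _ _ := FieldRelatedAt.id
  off_of_at _ _ _ := trivial

variable (D : IsPainleveField hσ κ T F off)
include D

theorem fderiv_pull (v : κ.dom) (h : off v) {g : EbarSpace σ → ℂ} (hg : HolSpace.HolAt g (κ.map v)) :
    fderiv ℂ ((chartXY σ).pull g) (T v) (fieldPI (T v)) = fderiv ℂ (κ.pull g) v (F v) := by
  obtain ⟨h1, h2⟩ := D.at_xy v h
  obtain ⟨T', h3, h4⟩ := D.related v h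
  rw [← h2] at hg
  have h5 := (((xy hσ).good.holAt_iff ⟨_, h1⟩ g).1 hg).differentiableAt.hasFDerivAt.comp v.1 h3
  have h6 : κ.pull g =ᶠ[𝓝 v.1] (chartXY σ).pull g ∘ T := by
    filter_upwards [D.good.isOpen.mem_nhds v.2, D.isOpen.mem_nhds h] with w hw hw'
    rw [LocalChart.pull_of_at ⟨hw, rfl⟩, Function.comp, LocalChart.pull_of_at (D.at_xy ⟨w, hw⟩ hw')]
  rw [h6.fderiv_eq, h5.fderiv, ContinuousLinearMap.comp_apply, h4]

/-- If the field is analytic in the chart, then the derivative of `g` along it is analytic as well;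
by the chain rule it agrees with the derivative taken in the chart `(x, y)`. -/
theorem isTransversalPI (v : κ.dom) (hF : AnalyticAt ℂ F v) : IsTransversalPI σ (κ.map v) := by
  intro g hg
  have h1 := (D.good.holAt_iff v g).1 hg
  refine ⟨κ.push fun w => fderiv ℂ (κ.pull g) w (F w), D.good.holAt_push v (AnalyticAt.comp₂ (h := fun p : (TPlane →L[ℂ] ℂ) × TPlane => p.1 p.2)
    ((ContinuousLinearMap.id ℂ (TPlane →L[ℂ] ℂ)).analyticAt_bilinear _) h1.fderiv hF), ?_⟩
  refine (D.good.eventually_iff v).2 ?_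
  filter_upwards [(D.good.eventually_iff v).1 (HolSpace.nearby hg)] with w hw' hw u hu
  have h2 := D.off_of_at _ u hu
  rw [D.good.push_of_at ⟨hw, rfl⟩, (xy hσ).good.at_unique hu (D.at_xy ⟨w, hw⟩ h2)]
  exact (D.fderiv_pull ⟨w, hw⟩ h2 (hw' hw)).symm

/-- The linear function `l` has a derivative `K / m` along the field with a genuine pole at `v`. A
holomorphic extension `h` would satisfy `m h = K` at points arbitrarily close to `v`, whereas `m h -
K` is nonzero near `v` by continuity. -/
theorem not_isTransversalPI (v : κ.dom) (l : TPlane →L[ℂ] ℂ) {m K : TPlane → ℂ}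
    (hm : ContinuousAt m v) (hK : ContinuousAt K v) (hmK : ∀ w, off w → m w * l (F w) = K w)
    (hmv : m v = 0) (hKv : K v ≠ 0) (hoff : ∃ᶠ w in 𝓝 v.1, off w) : ¬ IsTransversalPI σ (κ.map v) := by
  intro ht
  have hl := D.good.holAt_push v (l.analyticAt v)
  obtain ⟨h, hh, e⟩ := ht _ hl
  have h1 := ((D.good.holAt_iff v h).1 hh).continuousAt
  have h2 : ∀ᶠ w in 𝓝 v.1, m w * κ.pull h w - K w ≠ 0 :=
    ((hm.mul h1).sub hK).eventually_ne (by simpa [hmv] using hKv)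
  have h0 : ∀ᶠ w in 𝓝 v.1, w ∈ κ.dom := D.good.isOpen.mem_nhds v.2
  obtain ⟨w, hw1, hw2, hw3, hw4, hw5⟩ := (hoff.and_eventually (h2.and
    (h0.and (((D.good.eventually_iff v).1 e).and
      ((D.good.eventually_iff v).1 (HolSpace.nearby hl)))))).exists
  refine hw2 (sub_eq_zero.2 ?_)
  have h3 : κ.pull (κ.push l) =ᶠ[𝓝 w] l := by
    filter_upwards [D.good.isOpen.mem_nhds hw3] with u hu using D.good.pull_push hu l
  rw [← hmK w hw1, LocalChart.pull_of_at ⟨hw3, rfl⟩, hw4 hw3 (T w) (D.at_xy ⟨w, hw3⟩ hw1),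
    D.fderiv_pull ⟨w, hw3⟩ hw1 (hw5 hw3), h3.fderiv_eq, l.fderiv]

end IsPainleveField

theorem frequently_mul_ne_zero (v : TPlane) : ∃ᶠ w : TPlane in 𝓝 v, w.2.1 * w.2.2 ≠ 0 := by
  have h1 : ∀ᶠ s : ℂ in 𝓝[≠] 0, s ∉ ({-v.2.1, -v.2.2} : Set ℂ) :=
    nhdsNE_le_cofinite 0 (Set.toFinite _).compl_mem_cofinite
  have h2 : Tendsto (fun s : ℂ => ((v.1, v.2.1 + s, v.2.2 + s) : TPlane)) (𝓝[≠] 0) (𝓝 v) := by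
    have : ContinuousAt (fun s : ℂ => ((v.1, v.2.1 + s, v.2.2 + s) : TPlane)) 0 := by fun_prop
    have h := this.tendsto
    simp only [add_zero] at h
    exact h.mono_left nhdsWithin_le_nhds
  refine h2.frequently (h1.mono fun s hs => ?_).frequently
  simp only [Set.mem_insert_iff, Set.mem_singleton_iff, not_or] at hs
  refine mul_ne_zero (fun h => hs.1 ?_) fun h => hs.2 ?_
  · linear_combination h
  · linear_combination h

/-- The two coordinate functions of a chart. -/
noncomputable def coordL : Bool → TPlane →L[ℂ] ℂ
  | false => (ContinuousLinearMap.fst ℂ ℂ ℂ).comp (ContinuousLinearMap.snd ℂ ℂ (ℂ × ℂ))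
  | true => (ContinuousLinearMap.snd ℂ ℂ ℂ).comp (ContinuousLinearMap.snd ℂ ℂ (ℂ × ℂ))

theorem SSpace.bdry_eq_zero_iff {i : Fin 6} {v : TPlane} : SSpace.bdry i v = 0 ↔
    ∃ j, (ChartIndex.fst (.inl i) = some j ∧ v.2.1 = 0) ∨ (ChartIndex.snd (.inl i) = some j ∧ v.2.2 = 0) := by
  fin_cases i <;> simp [SSpace.bdry, ChartIndex.fst, ChartIndex.snd, exists_or]

namespace XSpace.IsInducedInvolution

open Glue

variable {σ : XSpace → XSpace} (hσ : IsInducedInvolution σ) {t : ℂ}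
include hσ

theorem isPainleveField_inl (i : Fin 6) : IsPainleveField hσ (ebarChart σ (.inl i)) (SSpace.toXY i)
    (fieldS i) fun v => SSpace.bdry i v ≠ 0 := by
  refine ⟨hσ.isGood_ebarChart _, ?_, fun v hv => ?_, fun v hv => SSpace.fieldRelatedAt_toXY hv, ?_⟩
  · have : Continuous fun v => SSpace.bdry i v := by
      fin_cases i <;> simp only [SSpace.bdry] <;> fun_prop
    exact isOpen_ne_fun this continuous_const
  · have h1 := v.2.snd
    have h2 : SSpace.pt 2 (SSpace.toXY i v.1) = SSpace.pt i v.1 := SSpace.pt_two_toXY hv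
    exact ⟨⟨SSpace.mem_chart 2 _, fun h => h1 ((congrArg (· ∈ SSpace.a₂) h2).mp h)⟩, congrArg inS (Subtype.ext h2)⟩
  · rintro v u ⟨h1, h2⟩ h3
    obtain ⟨j, hj⟩ := SSpace.bdry_eq_zero_iff.1 h3
    rw [← hσ.boundary_ebarChart, ← h2] at hj
    have h6 := (hσ.boundary_ebarChart (.inl 2) j ⟨u, h1⟩).1 hj
    simp [ChartIndex.fst, ChartIndex.snd] at h6

/-- The line `η = 0` of `W` is mapped to the second exceptional curve, which the chart `(x, y)`
misses; so the coordinates `(x, y)` exist exactly where `η ≠ 0`. -/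
theorem isPainleveField_ofX {κ : LocalChart XSpace} (hκ : κ.IsGood fun x => x.toW.1)
    {W F : TPlane → TPlane} (hW : ∀ v, (κ.map v).toW = W v.1) (hc : Continuous W)
    (hF : ∀ v, (W v).2.2 ≠ 0 → FieldRelatedAt (fun v => wToXY (W v)) F fieldPI v) :
    IsPainleveField hσ (.ofX σ κ) (fun v => wToXY (W v)) F fun v => (W v).2.2 ≠ 0 := by
  refine ⟨hσ.isGood_ofX hκ, isOpen_ne_fun (by fun_prop) continuous_const, fun v hv => ?_, hF, ?_⟩
  · have h0 : SSpace.pt 2 (wToXY (W v.1)) ∉ SSpace.a₂ := by simp [SSpace.pt_mem_a₂]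
    refine ⟨⟨SSpace.mem_chart 2 _, h0⟩, ?_⟩
    refine hσ.datumE.inS_eq_inX.2 ⟨XSpace.notMem_p_of_pos v.2.snd, ?_⟩
    refine Eq.trans ?_ (congrArg wS (hW ⟨v.1, v.2.fst⟩).symm)
    exact (wS_eq_xy hv).symm
  · rintro v u ⟨h1, h2⟩ h3
    obtain ⟨h4, h5⟩ := hσ.datumE.inS_eq_inX.1 h2
    rw [← hW ⟨v.1, v.2.fst⟩] at h3
    have h6 := (exc_wS h4).2 h3
    rw [← h5] at h6
    exact absurd (SSpace.exc_pt.1 (show SSpace.exc (SSpace.pt 2 u) from h6)) (by simp)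

/-- For every boundary line one of the coordinates has a derivative in `fieldS` with a pole there:
`m` is the equation of the line and `K` the numerator. On the second exceptional curve the
numerators contain `1 - 4 q` and `p - 4`, which vanish only at the removed point `a⁽²⁾`. -/
theorem not_isTransversalPI_inl {i : Fin 6} (v : (ebarChart σ (.inl i)).dom)
    (h : SSpace.bdry i v.1 = 0) : ¬ IsTransversalPI σ ((ebarChart σ (.inl i)).map v) := by
  have D := hσ.isPainleveField_inl i
  obtain ⟨⟨t, q, p⟩, hv⟩ := v
  have hoff : ∃ᶠ w in 𝓝 (t, q, p), SSpace.bdry i w ≠ 0 := by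
    refine (frequently_mul_ne_zero (t, q, p)).mono fun w hw => ?_
    have h1 := left_ne_zero_of_mul hw
    have h2 := right_ne_zero_of_mul hw
    fin_cases i <;> simp [SSpace.bdry, h1, h2]
  have hmem := mem_inl.1 hv
  rw [SSpace.pt_mem_a₂] at hmem
  have key := fun l m K => D.not_isTransversalPI ⟨(t, q, p), hv⟩ l (m := m) (K := K)
  fin_cases i <;> simp only [SSpace.bdry, mul_eq_zero] at h hmem D key hoff
  · refine key (coordL false) (fun v => v.2.2) (fun _ => 1) (by fun_prop) (by fun_prop) ?_ h
      one_ne_zero hoff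
    rintro ⟨t, q, p⟩ hw
    simp only [ne_eq] at hw
    simp [coordL, fieldS, hw]
  · rcases h with rfl | rfl
    · refine key (coordL true) (fun v => v.2.1) (fun v => -2 + v.2.1 * (6 * v.2.2 ^ 2 +
        v.1 * v.2.2 ^ 2 * v.2.1 ^ 2)) (by fun_prop) (by fun_prop) ?_ rfl (by simp) hoff
      rintro ⟨t, q, p⟩ hw
      simp only [ne_eq, mul_eq_zero, not_or] at hw
      obtain ⟨h1, h2⟩ := hw
      simp [coordL, fieldS]
      field_simp
      ring
    · refine key (coordL false) (fun v => v.2.2) (fun _ => 1) (by fun_prop) (by fun_prop) ?_ rfl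
        one_ne_zero hoff
      rintro ⟨t, q, p⟩ hw
      simp only [ne_eq, mul_eq_zero, not_or] at hw
      simp [coordL, fieldS, hw]
  · exact absurd h one_ne_zero
  · rcases h with rfl | rfl
    · refine key (coordL true) (fun v => v.2.1) (fun v => 2 + v.2.1 * (-6 - v.1 * v.2.1 ^ 2 *
        v.2.2 ^ 4)) (by fun_prop) (by fun_prop) ?_ rfl (by simp) hoff
      rintro ⟨t, q, p⟩ hw
      simp only [ne_eq, mul_eq_zero, not_or] at hw
      obtain ⟨h1, h2⟩ := hw
      simp [coordL, fieldS]
      field_simp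
      ring
    · have hq : 1 - 4 * q ≠ 0 := fun h => hmem (.inr ⟨rfl, rfl, by linear_combination (-1 / 4) * h⟩)
      refine key (coordL false) (fun v => v.2.2) (fun v => -3 * (1 - 4 * v.2.1) +
        v.2.2 * (2 * v.1 * (v.2.1 * v.2.2) ^ 3)) (by fun_prop) (by fun_prop) ?_ rfl (by simpa using hq) hoff
      rintro ⟨t, q, p⟩ hw
      simp only [ne_eq, mul_eq_zero, not_or] at hw
      obtain ⟨h1, h2⟩ := hw
      simp [coordL, fieldS]
      field_simp
  · rcases h with rfl | rfl
    · have hp : p - 4 ≠ 0 := fun h => hmem (.inl ⟨rfl, rfl, by linear_combination h⟩)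
      refine key (coordL true) (fun v => v.2.1) (fun v => 3 * (v.2.2 - 4) - v.2.1 * (2 * v.1 * v.2.2 ^ 2 *
        v.2.1 ^ 3)) (by fun_prop) (by fun_prop) ?_ rfl (by simpa using hp) hoff
      rintro ⟨t, q, p⟩ hw
      simp only [ne_eq, mul_eq_zero, not_or] at hw
      obtain ⟨h1, h2⟩ := hw
      simp [coordL, fieldS]
      field_simp
    · refine key (coordL false) (fun v => v.2.2) (fun v => 6 + v.2.2 * (-1 + v.1 * v.2.2 * v.2.1 ^ 4))
        (by fun_prop) (by fun_prop) ?_ rfl (by simp) hoff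
      rintro ⟨t, q, p⟩ hw
      simp only [ne_eq, mul_eq_zero, not_or] at hw
      obtain ⟨h1, h2⟩ := hw
      simp [coordL, fieldS]
      field_simp
      ring
  · refine key (coordL true) (fun v => v.2.1) (fun v => -6 + v.2.1 * (-v.1 * v.2.1 + v.2.2 ^ 2))
      (by fun_prop) (by fun_prop) ?_ h (by simp [h]) hoff
    rintro ⟨t, q, p⟩ hw
    simp only [ne_eq] at hw
    simp [coordL, fieldS]
    field_simp
    ring

/-- With `z = c + Q` and `w = Q P` the polar part of `fieldZ`, divisible by `z - c = Q`, becomes a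
nonzero multiple of `1 / P`. Its numerators on `P = 0` are `(3/2) (4 + Q)`, `5`, `4`, `3`, `2`, `1`;
the first is nonzero since `2 + Q` has positive real part. -/
theorem not_isTransversalPI_inr_some {j : Fin 6} (v : (ebarChart σ (.inr (some j))).dom)
    (h : v.1.2.2 = 0) : ¬ IsTransversalPI σ ((ebarChart σ (.inr (some j))).map v) := by
  have hc : Continuous (XSpace.nodeW j) := by
    have : ∀ k, Continuous (XStage.chartW k true) := fun k => by
      induction k with
      | zero => exact continuous_id
      | succ k ih =>
        have := fun k => continuous_iff_continuousAt.2 fun t => (hasDerivAt_cen k t).continuousAt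
        refine ih.comp ?_
        unfold blowMap₁
        fun_prop
    have h2 := continuous_iff_continuousAt.2 fun t => (hasDerivAt_cen j t).continuousAt
    refine (this j).comp ?_
    unfold blowMap₂
    fun_prop
  have D : IsPainleveField hσ (ebarChart σ (.inr (some j))) _ _ _ :=
    hσ.isPainleveField_ofX (XSpace.isGood_node j.2) (XSpace.toW_node j.2) hc (F := fieldNode j)
      fun v hv => fieldRelatedAt_nodeW j.2 (by rwa [XSpace.nodeW_snd] at hv)
  simp only [XSpace.nodeW_snd] at D
  obtain ⟨⟨t, q, p⟩, hv⟩ := v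
  obtain rfl : p = 0 := h
  have hre : j = 0 → 4 + q ≠ 0 := by
    rintro rfl h4
    have h1 := re_pos_of_mem_fdom (σ := σ) (a := (q, 0)) hv
    change 0 < (XSpace.nodeW 0 (t, q, 0)).2.1.re at h1
    rw [XSpace.nodeW_zero] at h1
    have := congrArg Complex.re h4
    simp at this h1
    linarith
  have key := fun K => D.not_isTransversalPI ⟨(t, q, 0), hv⟩ (coordL false) (m := fun v => v.2.2) (K := K)
    (by fun_prop)
  have hoff := frequently_mul_ne_zero (t, q, 0)
  fin_cases j
  · refine key (fun v => 3 / 2 * (4 + v.2.1) - v.2.2 * (v.1 * (v.2.1 * v.2.2) ^ 3)) (by fun_prop) ?_ rfl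
      (by simpa using hre rfl) hoff
    rintro ⟨t, q, p⟩ hw
    obtain ⟨h1, h2⟩ := mul_ne_zero_iff.1 hw
    simp only at h1 h2
    simp [coordL, fieldNode, fieldZ, blowMap₂, cenDeriv, XStage.cen, XStage.ctr]
    field_simp
    ring
  · refine key (fun v => 5 + v.2.2 * (v.2.1 ^ 2 - v.1 * (v.2.1 * v.2.2) ^ 2)) (by fun_prop) ?_ rfl
      (by simp) hoff
    rintro ⟨t, q, p⟩ hw
    obtain ⟨h1, h2⟩ := mul_ne_zero_iff.1 hw
    simp only at h1 h2
    simp [coordL, fieldNode, fieldZ, blowMap₂, cenDeriv, XStage.cen, XStage.ctr]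
    field_simp
    ring
  · refine key (fun v => 4 + v.2.2 * (v.2.1 ^ 2 * (v.2.1 * v.2.2) / 2 - v.1 * (v.2.1 * v.2.2)))
      (by fun_prop) ?_ rfl (by simp) hoff
    rintro ⟨t, q, p⟩ hw
    obtain ⟨h1, h2⟩ := mul_ne_zero_iff.1 hw
    simp only at h1 h2
    simp [coordL, fieldNode, fieldZ, blowMap₂, cenDeriv, XStage.cen, XStage.ctr]
    field_simp
    ring
  · refine key (fun v => 3 - v.1 * v.2.2) (by fun_prop) ?_ rfl (by simp) hoff
    rintro ⟨t, q, p⟩ hw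
    obtain ⟨h1, h2⟩ := mul_ne_zero_iff.1 hw
    simp only at h1 h2
    simp [coordL, fieldNode, fieldZ, blowMap₂, cenDeriv, XStage.cen, XStage.ctr]
    field_simp
  · refine key (fun v => 2 + v.2.2 * (-(v.1 / 2 + v.2.1) ^ 2 * (v.2.1 * v.2.2) ^ 3 / 2 - 1 / 2))
      (by fun_prop) ?_ rfl (by simp) hoff
    rintro ⟨t, q, p⟩ hw
    obtain ⟨h1, h2⟩ := mul_ne_zero_iff.1 hw
    simp only at h1 h2
    simp [coordL, fieldNode, fieldZ, blowMap₂, cenDeriv, XStage.cen, XStage.ctr]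
    field_simp
    ring
  · refine key (fun v => 1 + v.2.2 * (-(v.1 / 2 + (1 / 2 + v.2.1) * (v.2.1 * v.2.2)) ^ 2 *
      (v.2.1 * v.2.2) ^ 2 / 2 - (v.2.1 * v.2.2) ^ 3 * (v.1 / 2 + (1 / 2 + v.2.1) * (v.2.1 * v.2.2)) *
      (1 / 2 + v.2.1) / 2)) (by fun_prop) ?_ rfl (by simp) hoff
    rintro ⟨t, q, p⟩ hw
    obtain ⟨h1, h2⟩ := mul_ne_zero_iff.1 hw
    simp only at h1 h2
    simp [coordL, fieldNode, fieldZ, blowMap₂, cenDeriv, XStage.cen, XStage.ctr]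
    field_simp
    ring

/-- After the sixth blowup no denominator is left: `fieldW 6` is polynomial, so the last exceptional
curve is not a vertical leaf. -/
theorem isTransversalPI_inr_none (v : (ebarChart σ (.inr none)).dom) :
    IsTransversalPI σ ((ebarChart σ (.inr none)).map v) := by
  have h : ∀ v, AnalyticAt ℂ (XStage.chartW 6 true) v := by
    intro v
    simp only [XStage.chartW, XStage.cen, XStage.ctr, blowMap₁, if_true]
    fun_prop
  have D : IsPainleveField hσ (ebarChart σ (.inr none)) _ _ _ :=
    hσ.isPainleveField_ofX XSpace.isGood_zw₈ XSpace.toW_zw₈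
      (continuous_iff_continuousAt.2 fun v => (h v).continuousAt) (F := fieldW 6)
      fun v hv => fieldRelatedAt_chartW le_rfl (by rwa [XStage.chartW_snd] at hv)
  refine D.isTransversalPI v ?_
  have h2 : AnalyticAt ℂ (fieldZ 6) v.1 := by
    have : fieldZ 6 = fun v : TPlane => fieldZ 6 (v.1, v.2.1, v.2.2) := rfl
    rw [this]
    simp only [fieldZ]
    fun_prop
  unfold fieldW
  simp only [XStage.chartW, XStage.cen, XStage.ctr, blowMap₁, if_true]
  fun_prop

theorem verticalLeaves_eq (t : ℂ) : verticalLeaves σ t = ⋃ i, hσ.curves t i := by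
  ext e
  obtain ⟨c, a, ha, rfl, h⟩ := hσ.exists_fchart e
  simp only [Set.mem_iUnion, hσ.fchart_mem ha, verticalLeaves, Set.mem_ofPred_eq, hσ.fchart_val ha]
  match c with
  | .inl i =>
    rw [show (∃ j, _) ↔ _ from (SSpace.bdry_eq_zero_iff (i := i) (v := (t, a))).symm]
    refine ⟨fun h => by_contra fun hb => h ?_, hσ.not_isTransversalPI_inl ⟨(t, a), ha⟩⟩
    obtain ⟨h1, h2⟩ := (hσ.isPainleveField_inl i).at_xy ⟨(t, a), ha⟩ hb
    rw [← h2]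
    refine (IsPainleveField.xy hσ).isTransversalPI ⟨_, h1⟩ ?_
    rw [show fieldPI = _ from funext fieldPI_eq]
    fun_prop
  | .inr (some j) =>
    refine iff_of_true (hσ.not_isTransversalPI_inr_some ⟨(t, a), ha⟩ (h _ rfl)) ?_
    exact ⟨⟨j + 2, by omega⟩, .inr ⟨rfl, h _ rfl⟩⟩
  | .inr none =>
    refine iff_of_false (not_not.2 (hσ.isTransversalPI_inr_none ⟨(t, a), ha⟩)) ?_
    simp [ChartIndex.fst, ChartIndex.snd]

end XSpace.IsInducedInvolution

/-! ### Even analytic functions -/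

section Even

variable {K F : Type} [TopologicalSpace K] [CompactSpace K] [NormedAddCommGroup F] [NormedSpace ℂ F]

/-- The power series `p`, applied pointwise to functions on a compact space. -/
noncomputable def FormalMultilinearSeries.superposition (p : FormalMultilinearSeries ℂ F ℂ) :
    FormalMultilinearSeries ℂ C(K, F) C(K, ℂ) := fun n =>
  MultilinearMap.mkContinuous
    { toFun := fun φ => ⟨fun x => p n fun i => φ i x, by fun_prop⟩
      map_update_add' := fun φ i f g => by
        ext x
        have h : ∀ f : C(K, F), (fun j => Function.update φ i f j x) =
          Function.update (fun j => φ j x) i (f x) := fun f => funext fun j =>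
            Function.apply_update (fun _ (f : C(K, F)) => f x) φ i f j
        simp [h]
      map_update_smul' := fun φ i c f => by
        ext x
        have h : ∀ f : C(K, F), (fun j => Function.update φ i f j x) =
          Function.update (fun j => φ j x) i (f x) := fun f => funext fun j =>
            Function.apply_update (fun _ (f : C(K, F)) => f x) φ i f j
        simp [h] }
    ‖p n‖ fun φ => (ContinuousMap.norm_le _ (by positivity)).2 fun x =>
      ((p n).le_opNorm _).trans (mul_le_mul_of_nonneg_left
        (Finset.prod_le_prod (fun _ _ => norm_nonneg _) fun i _ => (φ i).norm_coe_le_norm x)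
        (norm_nonneg _))

/-- The supremum norm bounds each coefficient of the pointwise series by that of `p`, so the radius
of convergence does not shrink. -/
theorem FormalMultilinearSeries.le_radius_superposition (p : FormalMultilinearSeries ℂ F ℂ) :
    p.radius ≤ (p.superposition (K := K)).radius := by
  refine ENNReal.le_of_forall_nnreal_lt fun r hr => ?_
  obtain ⟨C, hC, h⟩ := p.norm_mul_pow_le_of_lt_radius hr
  refine le_radius_of_bound _ C fun n => le_trans ?_ (h n)
  gcongr
  exact MultilinearMap.mkContinuous_norm_le _ (norm_nonneg _) _

/-- Composition with an analytic function is analytic on spaces of continuous functions. -/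
theorem AnalyticAt.exists_superposition {G : F → ℂ} {x₀ : F} (hG : AnalyticAt ℂ G x₀) :
    ∃ r > 0, ∀ (K : Type) [TopologicalSpace K] [CompactSpace K], ∃ N : C(K, F) → C(K, ℂ),
      AnalyticOnNhd ℂ N (Metric.ball 0 r) ∧ ∀ φ ∈ Metric.ball 0 r, ∀ x, N φ x = G (x₀ + φ x) := by
  obtain ⟨p, R, hp⟩ := hG
  obtain ⟨r, hr0, hr⟩ := ENNReal.lt_iff_exists_nnreal_btwn.1 hp.r_pos
  refine ⟨r, by exact_mod_cast hr0, fun K _ _ => ?_⟩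
  have h1 : (r : ENNReal) < (p.superposition (K := K)).radius :=
    (hr.trans_le hp.r_le).trans_le p.le_radius_superposition
  have h2 := (p.superposition (K := K)).hasFPowerSeriesOnBall (hr0.trans h1)
  have hsub : Metric.ball (0 : C(K, F)) r ⊆ Metric.eball 0 (p.superposition (K := K)).radius := by
    intro φ hφ
    rw [← Metric.eball_coe] at hφ
    exact Metric.eball_subset_eball h1.le hφ
  refine ⟨_, h2.analyticOnNhd.mono hsub, fun φ hφ x => ?_⟩
  have h3 := h2.hasSum (hsub hφ)
  rw [zero_add] at h3
  have h4 := h3.mapL (ContinuousMap.evalCLM ℂ x)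
  refine h4.unique (hp.hasSum ?_)
  rw [mem_ball_zero_iff] at hφ
  have h5 := (φ.norm_coe_le_norm x).trans_lt hφ
  refine Metric.eball_subset_eball hr.le ?_
  rwa [Metric.eball_coe, mem_ball_zero_iff]

/-- For an even function the Cauchy formulas at `s` and `-s` may be averaged. The averaged kernel is
`z / (z² - s²)` and depends only on `s²`. -/
theorem Complex.circleIntegral_even {f : ℂ → ℂ} {ρ : ℝ} {s : ℂ}
    (hf : DifferentiableOn ℂ f (Metric.closedBall 0 ρ)) (he : f (-s) = f s) (hs : ‖s‖ < ρ) :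
    (∮ z in C(0, ρ), f z * (z * (z ^ 2 - s ^ 2)⁻¹)) = (2 * Real.pi * Complex.I) * f s := by
  have hρ : 0 < ρ := (norm_nonneg s).trans_lt hs
  have h1 := hf.circleIntegral_sub_inv_smul (w := s) (by simpa using hs)
  have h2 := hf.circleIntegral_sub_inv_smul (w := -s) (by simpa using hs)
  have hne : ∀ w : ℂ, ‖w‖ < ρ → ∀ z ∈ Metric.sphere (0 : ℂ) ρ, z - w ≠ 0 := by
    intro w hw z hz h
    rw [mem_sphere_zero_iff_norm, sub_eq_zero.1 h] at hz
    exact hw.ne hz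
  have hint : ∀ w : ℂ, ‖w‖ < ρ → CircleIntegrable (fun z => (z - w)⁻¹ • f z) 0 ρ := by
    intro w hw
    refine ContinuousOn.circleIntegrable hρ.le ?_
    refine ContinuousOn.smul (ContinuousOn.inv₀ (by fun_prop) (hne w hw)) ?_
    exact hf.continuousOn.mono Metric.sphere_subset_closedBall
  have h3 := circleIntegral.integral_add (hint s hs) (hint (-s) (by simpa using hs))
  rw [h1, h2, he] at h3
  have h4 : (∮ z in C(0, ρ), f z * (z * (z ^ 2 - s ^ 2)⁻¹)) =
      ∮ z in C(0, ρ), (2 : ℂ)⁻¹ * ((z - s)⁻¹ • f z + (z - -s)⁻¹ • f z) := by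
    refine circleIntegral.integral_congr hρ.le fun z hz => ?_
    have k1 := hne s hs z hz
    have k2 := hne (-s) (by simpa using hs) z hz
    have k3 : z ^ 2 - s ^ 2 = (z - s) * (z - -s) := by ring
    simp only [k3, smul_eq_mul]
    field_simp
    ring
  rw [h4, circleIntegral.integral_const_mul, h3, smul_eq_mul]
  ring

/-- An analytic function that is even in the last variable is an analytic function of its square. -/
theorem AnalyticAt.exists_comp_sq {E : Type} [NormedAddCommGroup E] [NormedSpace ℂ E]
    {G : E × ℂ → ℂ} {e₀ : E} (hG : AnalyticAt ℂ G (e₀, 0))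
    (he : ∀ᶠ v in 𝓝 (e₀, (0 : ℂ)), G (v.1, -v.2) = G v) :
    ∃ k : E × ℂ → ℂ, AnalyticAt ℂ k (e₀, 0) ∧ ∀ᶠ v in 𝓝 (e₀, (0 : ℂ)), k (v.1, v.2 ^ 2) = G v := by
  obtain ⟨δ, hδ, hball⟩ := Metric.eventually_nhds_iff_ball.1 (he.and hG.eventually_analyticAt)
  have mem : ∀ {ε : ℝ} {e : E} {s : ℂ}, (e, s) ∈ Metric.ball (e₀, (0 : ℂ)) ε ↔ ‖e - e₀‖ < ε ∧ ‖s‖ < ε := by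
    intro ε e s
    rw [mem_ball_iff_norm]
    simp [Prod.norm_def]
  obtain ⟨r, hr, hN⟩ := hG.exists_superposition
  let ρ : ℝ := min δ r / 2
  have hρ : 0 < ρ := half_pos (lt_min hδ hr)
  have hρδ : ρ < δ := (half_lt_self (lt_min hδ hr)).trans_le (min_le_left _ _)
  have hρr : ρ < r := (half_lt_self (lt_min hδ hr)).trans_le (min_le_right _ _)
  let K : Type := Metric.sphere (0 : ℂ) ρ
  have : CompactSpace K := isCompact_iff_compactSpace.1 (isCompact_sphere 0 ρ)
  obtain ⟨N, hNa, hNv⟩ := hN K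
  have hK : ∀ x : K, ‖x.1‖ = ρ := fun x => mem_sphere_zero_iff_norm.1 x.2
  let S : C(K, ℂ) := ⟨fun x => x.1, continuous_subtype_val⟩
  let ι : E →L[ℂ] C(K, E × ℂ) := LinearMap.mkContinuous
    { toFun := fun e => ⟨fun _ => (e, 0), continuous_const⟩
      map_add' := fun e e' => by ext x <;> simp
      map_smul' := fun c e => by ext x <;> simp } 1 fun e =>
        (ContinuousMap.norm_le _ (by positivity)).2 fun x => by simp [Prod.norm_def]
  let φ : E → C(K, E × ℂ) := fun e => ι (e - e₀) + ⟨fun x => (0, x.1), by fun_prop⟩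
  have hφ : ∀ e x, φ e x = (e - e₀, x.1) := fun e x => by
    change ((e - e₀, 0) : E × ℂ) + (0, x.1) = _
    simp
  have hφr : ∀ e, ‖e - e₀‖ < ρ → φ e ∈ Metric.ball 0 r := fun e he => by
    rw [mem_ball_zero_iff]
    refine lt_of_le_of_lt ((ContinuousMap.norm_le _ hρ.le).2 fun x => ?_) hρr
    rw [hφ, Prod.norm_def, hK]
    exact max_le he.le le_rfl
  have circ : ∀ θ, circleMap 0 ρ θ ∈ Metric.sphere (0 : ℂ) ρ := circleMap_mem_sphere 0 hρ.le
  let γ : C(ℝ, K) := ⟨fun θ => ⟨circleMap 0 ρ θ, circ θ⟩, by fun_prop⟩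
  have hint : ∀ f : C(K, ℂ), IntervalIntegrable (fun θ => circleMap 0 ρ θ * Complex.I * f (γ θ))
      MeasureTheory.volume 0 (2 * Real.pi) := fun f => Continuous.intervalIntegrable (by fun_prop) _ _
  let L : C(K, ℂ) →L[ℂ] ℂ := LinearMap.mkContinuous
    { toFun := fun f => ∫ θ in (0)..(2 * Real.pi), circleMap 0 ρ θ * Complex.I * f (γ θ)
      map_add' := fun f g => by
        rw [← intervalIntegral.integral_add (hint f) (hint g)]
        simp [mul_add]
      map_smul' := fun c f => by
        rw [RingHom.id_apply, smul_eq_mul, ← intervalIntegral.integral_const_mul]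
        congr 1
        ext θ
        simp
        ring } (ρ * (2 * Real.pi)) fun f => by
        refine (intervalIntegral.norm_integral_le_of_norm_le_const (C := ρ * ‖f‖) fun θ _ => ?_).trans
          (le_of_eq ?_)
        · rw [norm_mul, norm_mul, norm_circleMap_zero, Complex.norm_I, mul_one, abs_of_pos hρ]
          gcongr
          exact f.norm_coe_le_norm _
        · rw [sub_zero, abs_of_pos Real.two_pi_pos]
          ring
  have hS : ∀ q : ℂ, ‖q‖ < ρ ^ 2 → IsUnit (S ^ 2 - ContinuousMap.const K q) := fun q hq => by
    refine (ContinuousMap.isUnit_iff_forall_ne_zero _).2 fun x h => ?_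
    have h1 : x.1 ^ 2 = q := sub_eq_zero.1 h
    rw [← h1, norm_pow, hK] at hq
    exact lt_irrefl _ hq
  let cst : ℂ →L[ℂ] C(K, ℂ) := (ContinuousLinearMap.id ℂ ℂ).smulRight (1 : C(K, ℂ))
  have hcst : ∀ q, cst q = ContinuousMap.const K q := fun q => by ext x; simp [cst]
  -- The averaged Cauchy integral with `s²` replaced by a free variable. It is a composition of
  -- superposition by `G`, inversion in the Banach algebra `C(K, ℂ)` and the continuous linear
  -- functional `L`, which gives analyticity in both variables jointly. The element inverted is a
  -- unit because `|z²| = ρ²` on the circle.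
  let k : E × ℂ → ℂ := fun v => (2 * Real.pi * Complex.I)⁻¹ *
    L (N (φ v.1) * (S * Ring.inverse (S ^ 2 - cst v.2)))
  refine ⟨k, ?_, ?_⟩
  · have h1 : AnalyticAt ℂ (fun v : E × ℂ => N (φ v.1)) (e₀, 0) := by
      refine AnalyticAt.fun_comp (g := N) (hNa _ (hφr _ (by simpa using hρ))) ?_
      refine AnalyticAt.add (AnalyticAt.fun_comp (g := ι) (ι.analyticAt _) (by fun_prop)) analyticAt_const
    have h2 : AnalyticAt ℂ (fun v : E × ℂ => Ring.inverse (S ^ 2 - cst v.2)) (e₀, 0) := by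
      have h3 : IsUnit (S ^ 2 - cst 0) := by
        rw [hcst]
        exact hS 0 (by simpa using pow_pos hρ 2)
      obtain ⟨u, hu⟩ := h3
      refine AnalyticAt.fun_comp (g := Ring.inverse) (f := fun v : E × ℂ => S ^ 2 - cst v.2) ?_ ?_
      · rw [← hu]
        exact analyticAt_inverse u
      · exact analyticAt_const.sub (AnalyticAt.fun_comp (g := cst) (cst.analyticAt _) (by fun_prop))
    refine analyticAt_const.mul (AnalyticAt.fun_comp (g := L) (L.analyticAt _) ?_)
    exact h1.mul (analyticAt_const.mul h2)
  · filter_upwards [Metric.ball_mem_nhds (e₀, (0 : ℂ)) hρ] with ⟨e, s⟩ hv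
    obtain ⟨h1, h2⟩ := mem.1 hv
    have h3 : DifferentiableOn ℂ (fun z => G (e, z)) (Metric.closedBall 0 ρ) := by
      intro z hz
      have h4 := (hball (e, z) (mem.2 ⟨h1.trans hρδ,
        (mem_closedBall_zero_iff.1 hz).trans_lt hρδ⟩)).2.differentiableAt
      exact (h4.comp z (by fun_prop : DifferentiableAt ℂ (fun z => (e, z)) z)).differentiableWithinAt
    have h4 := Complex.circleIntegral_even h3 (hball (e, s) (mem.2 ⟨h1.trans hρδ, h2.trans hρδ⟩)).1 h2
    have h5 : L (N (φ e) * (S * Ring.inverse (S ^ 2 - cst (s ^ 2)))) =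
        ∮ z in C(0, ρ), G (e, z) * (z * (z ^ 2 - s ^ 2)⁻¹) := by
      refine intervalIntegral.integral_congr fun θ _ => ?_
      have hu := hS (s ^ 2) (by rw [norm_pow]; gcongr)
      have h6 := congrArg (fun f : C(K, ℂ) => f (γ θ)) (Ring.mul_inverse_cancel _ hu)
      have h7 : (Ring.inverse (S ^ 2 - ContinuousMap.const K (s ^ 2))) (γ θ) =
          ((circleMap 0 ρ θ) ^ 2 - s ^ 2)⁻¹ := (inv_eq_of_mul_eq_one_right h6).symm
      have h8 : N (φ e) (γ θ) = G (e, circleMap 0 ρ θ) := by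
        rw [hNv _ (hφr e h1), hφ]
        simp [γ]
      simp only [deriv_circleMap, smul_eq_mul, hcst, ContinuousMap.mul_apply, h7, h8]
      rfl
    change (2 * Real.pi * Complex.I)⁻¹ * L (N (φ e) * (S * Ring.inverse (S ^ 2 - cst (s ^ 2)))) = _
    rw [h5, h4, ← mul_assoc, inv_mul_cancel₀ Complex.two_pi_I_ne_zero, one_mul]

end Even

/-! ## The contraction of `C` -/

theorem XStage.not_isPm_zero (t : ℂ) : ¬ XStage.IsPm (t, 0, 0) := by
  rintro ⟨b, hb⟩
  have h := (Prod.mk.inj hb).1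
  cases b <;> norm_num [XStage.sgn] at h

theorem XStage.isOpen_not_isPm : IsOpen {w : TPlane | ¬ XStage.IsPm w} := by
  have h : {w : TPlane | ¬ XStage.IsPm w} = {w | w.2 ≠ (XStage.sgn true, 0)} ∩
      {w | w.2 ≠ (XStage.sgn false, 0)} := by
    ext w
    simp [XStage.IsPm, and_comm]
  rw [h]
  exact (isOpen_ne_fun (by fun_prop) continuous_const).inter
    (isOpen_ne_fun (by fun_prop) continuous_const)

theorem XStage.isPm_sigmaW {w : TPlane} : XStage.IsPm (sigmaW w) ↔ XStage.IsPm w := by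
  simp [XStage.IsPm, sigmaW, XStage.sgn, Prod.ext_iff, neg_eq_iff_eq_neg, or_comm]

namespace XSpace

/-- The point `p` of `X` at the time `t`. -/
noncomputable def origin (t : ℂ) : XSpace := (exists_toW_eq (XStage.not_isPm_zero t)).choose

theorem toW_origin (t : ℂ) : (origin t).toW = (t, 0, 0) :=
  (exists_toW_eq (XStage.not_isPm_zero t)).choose_spec

instance : Nonempty XSpace := ⟨origin 0⟩

theorem eq_origin {x : XSpace} (h : x ∈ p) : x = origin x.toW.1 := by
  have h1 : x.toW = (x.toW.1, 0, 0) := Prod.ext rfl h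
  have h2 := XStage.not_isPm_zero x.toW.1
  rw [← h1] at h2
  exact eq_of_toW_eq h2 (h1.trans (toW_origin _).symm)

end XSpace

open Glue

/-- The points of `X`, as points of `F`. -/
abbrev inF (σ : XSpace → XSpace) (x : XSpace) : FSpace σ := inX (B := Set.univ) ⟨x, trivial⟩

/-- The points of `F` with the given coordinates in `W`. -/
noncomputable def wF (σ : XSpace → XSpace) (w : TPlane) : FSpace σ :=
  inF σ (Function.invFun XSpace.toW w)

namespace XSpace.IsInducedInvolution

variable {σ : XSpace → XSpace} (hσ : IsInducedInvolution σ)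

omit hσ in
-- Off `p_±` the projection to `W` is injective, so the arbitrary choice in `Function.invFun` is
-- forced.
theorem wF_toW {x : XSpace} (h : ¬ XStage.IsPm x.toW) : wF σ x.toW = inF σ x := by
  have h1 : (Function.invFun XSpace.toW x.toW).toW = x.toW := Function.invFun_eq ⟨x, rfl⟩
  exact congrArg inX (Subtype.ext (XSpace.eq_of_toW_eq (by rwa [h1]) h1))

omit hσ in
theorem wF_zero (t : ℂ) : wF σ (t, 0, 0) = inF σ (origin t) := by
  rw [← toW_origin]
  exact wF_toW (by rw [toW_origin]; exact XStage.not_isPm_zero t)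

include hσ

theorem holMapAt_wF {w : TPlane} (h : ¬ XStage.IsPm w) : HolMapAt (wF σ) w := by
  obtain ⟨x, rfl⟩ := XSpace.exists_toW_eq h
  refine (XSpace.holOpenAt_toW h).cancel_holMapAt (HolMapAt.congr
    (((hσ.datumF.holOpenAt_inX ⟨x, trivial⟩).comp
      ((holOpenAt_id x).codRestrict (q := fun x => x ∈ Set.univ) fun _ => trivial)).holMapAt) ?_)
  filter_upwards [XSpace.continuous_toW.continuousAt.eventually
    (XStage.isOpen_not_isPm.mem_nhds h)] with y hy
  exact (wF_toW hy).symm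

theorem wF_sigmaW {w : TPlane} (h : ¬ XStage.IsPm w) : wF σ (sigmaW w) = wF σ w := by
  obtain ⟨x, rfl⟩ := XSpace.exists_toW_eq h
  rw [← hσ.2.2, wF_toW h, wF_toW (by rwa [hσ.2.2, XStage.isPm_sigmaW])]
  exact hσ.datumF.sound_invol ⟨x, trivial⟩

theorem exists_contraction : ∃ ρ : EbarSpace σ → FSpace σ,
    (∀ s : (SSpace.a₂ᶜ : Set SSpace), ∀ h : s.1 ∉ SSpace.C,
      ρ (inS s) = inS ⟨s.1, fun h' => h'.elim h s.2⟩) ∧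
    (∀ s : (SSpace.a₂ᶜ : Set SSpace), s.1 ∈ SSpace.C → ρ (inS s) = inF σ (origin s.1.time)) ∧
    ∀ x, ρ (inX x) = inF σ x.1 := by
  classical
  refine ⟨Quot.lift (fun a => match a with
    | Sum.inl s => if h : s.1 ∉ SSpace.C then inS ⟨s.1, fun h' => h'.elim h s.2⟩
        else inF σ (origin s.1.time)
    | Sum.inr x => inF σ x.1) ?_, fun s h => dif_pos h, fun s h => dif_neg (not_not.2 h),
    fun _ => rfl⟩
  rintro _ _ (⟨x, y, h⟩ | ⟨s, x, v, h1, h2⟩)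
  · exact hσ.datumF.inX_eq_inX.2 (.inr (by rw [← h, hσ.2.1]))
  · obtain ⟨hx, hs⟩ := (hσ.datumE.cover_iff s x).1 ⟨v, h1, h2⟩
    have h3 : s.1 ∉ SSpace.C := by
      rw [SSpace.mem_C_iff, hs]
      exact branch_wS hx
    exact (dif_pos h3).trans (hσ.datumF.sound_cover (x := ⟨x.1, trivial⟩) hx hs)

omit hσ in
/-- The contraction of `C` in the total space of the family. -/
noncomputable def contract (hσ : IsInducedInvolution σ) : EbarSpace σ → FSpace σ :=
  hσ.exists_contraction.choose

theorem contract_inS {s : (SSpace.a₂ᶜ : Set SSpace)} (h : s.1 ∉ SSpace.C) :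
    hσ.contract (inS s) = inS ⟨s.1, fun h' => h'.elim h s.2⟩ :=
  hσ.exists_contraction.choose_spec.1 s h

theorem contract_inS_of_mem {s : (SSpace.a₂ᶜ : Set SSpace)} (h : s.1 ∈ SSpace.C) :
    hσ.contract (inS s) = inF σ (origin s.1.time) :=
  hσ.exists_contraction.choose_spec.2.1 s h

theorem contract_inX (x : (XSpace.pᶜ : Set XSpace)) : hσ.contract (inX x) = inF σ x.1 :=
  hσ.exists_contraction.choose_spec.2.2 x

theorem contract_of_wS {s : (SSpace.a₂ᶜ : Set SSpace)} {w : TPlane} (hw : w.2 ≠ (0, 0))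
    (h : s.1 = wS w) : hσ.contract (inS s) = wF σ w := by
  have h1 : ¬ XStage.IsPm w := by
    rw [← wS_mem_a₂ hw, ← h]
    exact s.2
  obtain ⟨x, rfl⟩ := XSpace.exists_toW_eq h1
  rw [hσ.datumE.sound_cover (x := ⟨x, hw⟩) hw h, hσ.contract_inX, wF_toW h1]

theorem boundary_inS_eight (s : (SSpace.a₂ᶜ : Set SSpace)) :
    hσ.boundary 8 (inS s) ↔ s.1 ∈ SSpace.C :=
  (hσ.boundary_inS 8 s).trans SSpace.mem_C_iff.symm

theorem boundary_inX_eight (x : (XSpace.pᶜ : Set XSpace)) : ¬ hσ.boundary 8 (inX x) := by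
  rw [hσ.boundary_inX]
  exact fun h => absurd h.1.2 (by decide)

theorem time_contract (e : EbarSpace σ) : hσ.datumF.time (hσ.contract e) = hσ.datumE.time e := by
  obtain ⟨hS, hX, -⟩ := hσ.datumF.exists_time.choose_spec
  obtain ⟨hS', hX', -⟩ := hσ.datumE.exists_time.choose_spec
  obtain ⟨s, rfl⟩ | ⟨x, rfl⟩ := e.cases
  · refine Eq.trans ?_ (hS' s).symm
    by_cases h : s.1 ∈ SSpace.C
    · rw [hσ.contract_inS_of_mem h]
      exact (hX _).trans (congrArg Prod.fst (toW_origin _))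
    · rw [hσ.contract_inS h]
      exact hS _
  · rw [hσ.contract_inX]
    exact (hX _).trans (hX' _).symm

theorem contract_eq_origin_iff {e : EbarSpace σ} {t : ℂ} :
    hσ.contract e = inF σ (origin t) ↔ hσ.boundary 8 e ∧ hσ.datumE.time e = t := by
  have ho : ∀ x : XSpace, x = origin t ∨ x = σ (origin t) → x ∈ p := by
    rintro x (rfl | rfl)
    · exact congrArg Prod.snd (toW_origin t)
    · simp [p, hσ.2.2, toW_origin, sigmaW]
  constructor
  · intro h
    have ht := congrArg hσ.datumF.time h
    rw [hσ.time_contract] at ht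
    refine ⟨?_, ht.trans ((hσ.datumF.exists_time.choose_spec.2.1 _).trans (congrArg Prod.fst (toW_origin t)))⟩
    obtain ⟨s, rfl⟩ | ⟨x, rfl⟩ := e.cases
    · rw [hσ.boundary_inS_eight]
      by_contra hs
      rw [hσ.contract_inS hs] at h
      exact (hσ.datumF.inS_eq_inX.1 h).1 (congrArg Prod.snd (toW_origin t))
    · rw [hσ.contract_inX] at h
      exact absurd (ho _ (hσ.datumF.inX_eq_inX.1 h)) x.2
  · rintro ⟨h, ht⟩
    obtain ⟨s, rfl⟩ | ⟨x, rfl⟩ := e.cases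
    · rw [hσ.contract_inS_of_mem ((hσ.boundary_inS_eight s).1 h)]
      rw [← show s.1.time = t from (hσ.datumE.exists_time.choose_spec.1 s).symm.trans ht]
    · exact absurd h (hσ.boundary_inX_eight x)

/-- Only points of `C` are sent to `p`, so neither point lies on `C`, and both lie in parts on which
the equality criteria of the two gluings coincide. -/
theorem contract_injective {e e' : EbarSpace σ} (he : ¬ hσ.boundary 8 e)
    (h : hσ.contract e = hσ.contract e') : e = e' := by
  have he' : ¬ hσ.boundary 8 e' := fun h' =>
    he (hσ.contract_eq_origin_iff.1 (h.trans (hσ.contract_eq_origin_iff.2 ⟨h', rfl⟩))).1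
  obtain ⟨s, rfl⟩ | ⟨x, rfl⟩ := e.cases <;> obtain ⟨s', rfl⟩ | ⟨x', rfl⟩ := e'.cases
  · rw [hσ.boundary_inS_eight] at he he'
    rw [hσ.contract_inS he, hσ.contract_inS he'] at h
    have := congrArg Subtype.val (hσ.datumF.inS_injective h)
    exact congrArg inS (Subtype.ext this)
  · rw [hσ.boundary_inS_eight] at he
    rw [hσ.contract_inS he, hσ.contract_inX] at h
    exact hσ.datumE.inS_eq_inX.2 (hσ.datumF.inS_eq_inX.1 h)
  · rw [hσ.boundary_inS_eight] at he'
    rw [hσ.contract_inS he', hσ.contract_inX] at h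
    exact (hσ.datumE.inS_eq_inX.2 (hσ.datumF.inS_eq_inX.1 h.symm)).symm
  · rw [hσ.contract_inX, hσ.contract_inX] at h
    exact hσ.datumE.inX_eq_inX.2 (hσ.datumF.inX_eq_inX.1 h)

theorem holOpenAt_contract {e : EbarSpace σ} (he : ¬ hσ.boundary 8 e) : HolOpenAt hσ.contract e := by
  obtain ⟨s, rfl⟩ | ⟨x, rfl⟩ := e.cases
  · rw [hσ.boundary_inS_eight] at he
    let Z := {s : SSpace // s ∈ (SSpace.C ∪ SSpace.a₂)ᶜ}
    let z : Z := ⟨s.1, fun h' => h'.elim he s.2⟩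
    have h1 : HolOpenAt (fun z : Z => (⟨z.1, fun h => z.2 (.inr h)⟩ : (SSpace.a₂ᶜ : Set SSpace))) z :=
      (holOpenAt_subtype_val z (hσ.datumF.isOpen_left.mem_nhds z.2)).codRestrict
        (q := fun s => s ∈ SSpace.a₂ᶜ) fun z => fun h => z.2 (.inr h)
    let f : Z → (SSpace.a₂ᶜ : Set SSpace) := fun z => ⟨z.1, fun h => z.2 (.inr h)⟩
    have h2 : HolOpenAt ((inS : _ → EbarSpace σ) ∘ f) z := (hσ.datumE.holOpenAt_inS s).comp h1
    refine HolOpenAt.cancel (f := inS ∘ f) (a := z) h2 ?_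
    refine (hσ.datumF.holOpenAt_inS z).congr (Eventually.of_forall fun y => ?_)
    exact (hσ.contract_inS (s := f y) fun h => y.2 (.inl h)).symm
  · refine HolOpenAt.cancel (hσ.datumE.holOpenAt_inX x) ?_
    have h1 : HolOpenAt (fun x : (XSpace.pᶜ : Set XSpace) => (⟨x.1, trivial⟩ : (Set.univ : Set XSpace))) x :=
      (holOpenAt_subtype_val x (hσ.datumE.isOpen_right.mem_nhds x.2)).codRestrict
        (q := fun s => s ∈ Set.univ) fun _ => trivial
    refine ((hσ.datumF.holOpenAt_inX ⟨x.1, trivial⟩).comp h1).congr (Eventually.of_forall fun y => ?_)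
    exact (hσ.contract_inX y).symm

/-- Along `C`, the contraction is holomorphic: its pullback to the double covering is. -/
theorem holMapAt_contract_of_even {κ : LocalChart (EbarSpace σ)} {τ : EbarSpace σ → ℂ} (hκ : κ.IsGood τ)
    {T : (ℂ × ℂ) × ℂ → TPlane} {T' : TPlane → (ℂ × ℂ) × ℂ} {ω : (ℂ × ℂ) × ℂ → TPlane} {e : ℂ × ℂ}
    (hT : ∀ v, T (T' v) = v) (hT' : ∀ v, T' (T v) = v) (hTa : ∀ v, AnalyticAt ℂ T' v)
    (hω : ∀ v, AnalyticAt ℂ ω v) (hω₀ : ω (e, 0) = (e.1, 0, 0)) (hωn : ∀ e s, ω (e, -s) = sigmaW (ω (e, s)))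
    (h0 : T (e, 0) ∈ κ.dom)
    (h : ∀ e s, ∀ hv : T (e, s ^ 2) ∈ κ.dom, hσ.contract (κ.map ⟨_, hv⟩) = wF σ (ω (e, s))) :
    HolMapAt hσ.contract (κ.map ⟨_, h0⟩) := by
  -- Any root would do: only `sq q ^ 2 = q` and continuity at `0` are used. The jump of the branch
  -- is harmless because the composite is even.
  let sq : ℂ → ℂ := fun q => q ^ (1 / 2 : ℂ)
  have hsq : ∀ q, sq q ^ 2 = q := fun q => by
    simp [sq]
  have hsq0 : sq 0 = 0 := by simpa using hsq 0
  have hsqc : ContinuousAt sq 0 := by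
    rw [ContinuousAt, hsq0, tendsto_zero_iff_norm_tendsto_zero]
    have h1 : ∀ q, ‖sq q‖ = √‖q‖ := fun q => by
      rw [← hsq q, norm_pow, Real.sqrt_sq (norm_nonneg _), hsq q]
    simp only [h1]
    have h2 : Continuous fun q : ℂ => √‖q‖ := by fun_prop
    simpa using h2.tendsto 0
  have hpm : ¬ XStage.IsPm (ω (e, 0)) := by rw [hω₀]; exact XStage.not_isPm_zero _
  have hF : ∀ v (hv : v ∈ κ.dom), hσ.contract (κ.map ⟨v, hv⟩) = wF σ (ω ((T' v).1, sq (T' v).2)) := by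
    intro v hv
    have h1 : T ((T' v).1, sq (T' v).2 ^ 2) = v := by rw [hsq]; exact hT v
    have h2 := h (T' v).1 (sq (T' v).2) (by rwa [h1])
    rw [← h2]
    congr 2
    exact Subtype.ext h1.symm
  have hroot : ContinuousAt (fun v => ((T' v).1, sq (T' v).2)) (T (e, 0)) := by
    have h1 := (hTa (T (e, 0))).continuousAt
    have h2 : (T' (T (e, 0))).2 = 0 := by rw [hT']
    refine ContinuousAt.prodMk h1.fst (ContinuousAt.comp (g := sq) (f := fun v => (T' v).2) ?_ h1.snd)
    rwa [h2]
  have hroot0 : (fun v => ((T' v).1, sq (T' v).2)) (T (e, 0)) = (e, 0) := by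
    simp only [hT', hsq0]
  have hp0 : hσ.contract (κ.map ⟨_, h0⟩) = wF σ (ω (e, 0)) := by rw [hF _ h0, hT', hsq0]
  have hwF := hσ.holMapAt_wF hpm
  constructor
  · rw [ContinuousAt, ← (hκ.hol ⟨_, h0⟩).1, tendsto_map'_iff, hp0]
    have h1 : ContinuousAt (fun v => wF σ (ω ((T' v).1, sq (T' v).2))) (T (e, 0)) := by
      refine ContinuousAt.comp (g := wF σ) (f := fun v => ω ((T' v).1, sq (T' v).2)) ?_
        (ContinuousAt.comp (g := ω) (hω _).continuousAt hroot)
      have := hwF.1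
      rw [← hroot0] at this
      exact this
    have h2 := h1.tendsto.comp (continuous_subtype_val.tendsto (⟨_, h0⟩ : κ.dom))
    simp only [hT', hsq0] at h2
    exact h2.congr fun v => (hF v.1 v.2).symm
  · intro g hg
    rw [hp0] at hg
    have h1 : AnalyticAt ℂ (fun v => g (wF σ (ω v))) (e, 0) :=
      AnalyticAt.comp (g := g ∘ wF σ) (hwF.2 g hg) (hω _)
    -- Changing the sign of the branched coordinate is the deck involution, under which the points
    -- of `F` do not change.
    have h2 : ∀ᶠ v in 𝓝 (e, (0 : ℂ)), g (wF σ (ω (v.1, -v.2))) = g (wF σ (ω v)) := by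
      filter_upwards [(hω (e, 0)).continuousAt.eventually (XStage.isOpen_not_isPm.mem_nhds hpm)] with v hv
      rw [hωn, hσ.wF_sigmaW hv]
    obtain ⟨k, hk, hk'⟩ := h1.exists_comp_sq h2
    rw [hκ.holAt_iff]
    have h3 : AnalyticAt ℂ (k ∘ T') (T (e, 0)) := by
      refine AnalyticAt.comp ?_ (hTa _)
      rwa [hT']
    refine h3.congr ?_
    rw [← hroot0] at hk'
    filter_upwards [hroot.eventually hk', hκ.isOpen.mem_nhds h0] with v hv hv'
    rw [LocalChart.pull_of_at ⟨hv', rfl⟩, Function.comp, Function.comp, hF v hv', ← hv, hsq]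

/-- In the chart `(Q⁽²⁾, P⁽²⁾) = (S, R²)` the double cover reaches `W` by `(R, R S)`, and in `(Q⁽¹⁾,
P⁽¹⁾) = (s², r)` by `(r s, s)`. The map `T` merely puts the squared coordinate last. -/
theorem holMapAt_contract (e : EbarSpace σ) : HolMapAt hσ.contract e := by
  by_cases he : hσ.boundary 8 e
  · obtain ⟨s, rfl⟩ | ⟨x, rfl⟩ := e.cases
    · obtain ⟨s, hs⟩ := s
      have hC := (hσ.boundary_inS_eight _).1 he
      have time : ∀ (s : (SSpace.a₂ᶜ : Set SSpace)) t, s.1 ∈ SSpace.C → s.1.time = t →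
          hσ.contract (inS s) = wF σ (t, 0, 0) := by
        rintro s t h1 rfl
        rw [hσ.contract_inS_of_mem h1, wF_zero]
      obtain ⟨i, ⟨t, q, p⟩, rfl⟩ := SSpace.exists_pt s
      rcases SSpace.branch_pt.1 (SSpace.mem_C_iff.1 hC) with ⟨rfl, h⟩ | ⟨rfl, h⟩
      · obtain rfl : p = 0 := h
        refine hσ.holMapAt_contract_of_even (hσ.isGood_ebarChart (.inl 4)) (T := fun v => (v.1.1, v.1.2, v.2))
          (T' := fun v => ((v.1, v.2.1), v.2.2)) (ω := fun v => (v.1.1, v.2, v.2 * v.1.2)) (e := (t, q))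
          (fun _ => rfl) (fun _ => rfl) (by fun_prop) (by fun_prop) (by simp) (by simp [sigmaW])
          (mem_inl.2 hs) fun e s hv => ?_
        by_cases h0 : s = 0
        · subst h0
          refine (time ⟨SSpace.pt 4 _, hv.snd⟩ e.1 ?_ (SSpace.time_pt 4 _)).trans (by simp)
          rw [SSpace.mem_C_iff, SSpace.branch_pt]
          simp
        · refine hσ.contract_of_wS (s := ⟨SSpace.pt 4 _, hv.snd⟩) (by simp [h0]) ?_
          rw [wS_of_fst_ne h0]
          change SSpace.pt 4 _ = _
          congr 3
          field_simp
      · obtain rfl : q = 0 := h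
        refine hσ.holMapAt_contract_of_even (hσ.isGood_ebarChart (.inl 5)) (T := fun v => (v.1.1, v.2, v.1.2))
          (T' := fun v => ((v.1, v.2.2), v.2.1)) (ω := fun v => (v.1.1, v.1.2 * v.2, v.2)) (e := (t, p))
          (fun _ => rfl) (fun _ => rfl) (by fun_prop) (by fun_prop) (by simp) (by simp [sigmaW])
          (mem_inl.2 hs) fun e s hv => ?_
        by_cases h0 : s = 0
        · subst h0
          refine (time ⟨SSpace.pt 5 _, hv.snd⟩ e.1 ?_ (SSpace.time_pt 5 _)).trans (by simp)
          rw [SSpace.mem_C_iff, SSpace.branch_pt]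
          simp
        · refine hσ.contract_of_wS (s := ⟨SSpace.pt 5 _, hv.snd⟩) (by simp [h0]) ?_
          rw [wS_of_snd_ne h0]
          change SSpace.pt 5 _ = _
          congr 3
          field_simp
    · exact absurd he (hσ.boundary_inX_eight x)
  · exact (hσ.holOpenAt_contract he).holMapAt

end XSpace.IsInducedInvolution

open Glue

/-! ### The contraction on the surface `Ē_t` and its properness -/

namespace XSpace.IsInducedInvolution

variable {σ : XSpace → XSpace} (hσ : IsInducedInvolution σ) {t : ℂ}

/-- The contraction of `C` in `Ē_t`. -/
noncomputable def rho (t : ℂ) (e : Ebar σ t) : FFibre σ t :=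
  ⟨hσ.contract e.1, (hσ.datumF.atTime_iff t _).2 ((hσ.time_contract e.1).trans
    ((hσ.datumE.atTime_iff t _).1 e.2))⟩

/-- The point `p` of `F_t`. -/
noncomputable def node (hσ : IsInducedInvolution σ) (t : ℂ) : FFibre σ t :=
  ⟨inF σ (origin t), hσ.datumF.atTime_inX.2 (congrArg Prod.fst (toW_origin t))⟩

include hσ

theorem rho_eq_node_iff {e : Ebar σ t} : hσ.rho t e = hσ.node t ↔ e ∈ hσ.curves t 8 := by
  refine Subtype.ext_iff.trans (hσ.contract_eq_origin_iff.trans ?_)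
  exact and_iff_left ((hσ.datumE.atTime_iff t _).1 e.2)

theorem isSmoothSurface : IsSmoothSurface (Ebar σ t) := by
  have := hσ.datumE.t2Space fun _ h => h
  refine ⟨inferInstance, fun e => ?_⟩
  obtain ⟨c, a, ha, rfl, -⟩ := hσ.exists_fchart e
  let r := Function.invFunOn (fchart σ t c) (fdom σ t c)
  refine ⟨fun e => (r e).1, fun e => (r e).2,
    (hσ.isOpenChart_fchart c).isLocalCoord ha (isLocalBiholo_id a) ?_⟩
  filter_upwards [(hσ.isOpenChart_fchart (t := t) c).isOpen.mem_nhds ha] with v hv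
  exact (hσ.isOpenChart_fchart (t := t) c).inj.leftInvOn_invFunOn hv

theorem isHolMap_rho : IsHolMap (hσ.rho t) :=
  isHolMap_iff.2 fun e => HolMapAt.codRestrict (q := AtTime t)
    (f := fun e : Ebar σ t => hσ.contract e.1)
    ((hσ.holMapAt_contract e.1).comp (holMapAt_subtype_val e)) _

theorem isContraction_rho : IsContraction σ t (hσ.rho t) := by
  refine ⟨?_, ?_, ?_⟩
  · rintro s ⟨_, he⟩ hs ⟨h, rfl⟩
    exact ⟨fun h' => h'.elim hs h, (hσ.contract_inS (s := ⟨s, h⟩) hs).symm⟩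
  · rintro x ⟨_, he⟩ ⟨h, rfl⟩
    exact ⟨trivial, (hσ.contract_inX ⟨x, h⟩).symm⟩
  · rintro s ⟨_, he⟩ hs ⟨h, rfl⟩
    exact ⟨origin s.time, congrArg Prod.snd (toW_origin _), trivial,
      (hσ.contract_inS_of_mem (s := ⟨s, h⟩) hs).symm⟩

theorem dense_rho_ne : Dense {e : Ebar σ t | hσ.rho t e ≠ hσ.node t} := by
  intro e
  obtain ⟨c, a, ha, rfl, -⟩ := hσ.exists_fchart e
  have h1 : ∃ᶠ b : ℂ × ℂ in 𝓝 a, b.1 * b.2 ≠ 0 :=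
    (continuous_snd.tendsto ((t, a) : TPlane)).frequently (frequently_mul_ne_zero (t, a))
  have h2 := h1.and_eventually ((hσ.isOpenChart_fchart (t := t) c).isOpen.mem_nhds ha)
  refine mem_closure_iff_frequently.2 (((hσ.isOpenChart_fchart c).hol a ha).continuousAt.tendsto.frequently
    (h2.mono ?_))
  rintro b ⟨hb, hb'⟩
  rw [Set.mem_ofPred_eq, Ne, hσ.rho_eq_node_iff, hσ.fchart_mem hb']
  simp [left_ne_zero_of_mul hb, right_ne_zero_of_mul hb]

theorem isOpen_not_boundary_eight : IsOpen {e | ¬ hσ.boundary 8 e} := by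
  refine isOpen_iff_mem_nhds.2 fun e he => ?_
  obtain ⟨s, rfl⟩ | ⟨x, rfl⟩ := e.cases
  · rw [← (hσ.datumE.holOpenAt_inS s).1, mem_map]
    have h1 : s.1 ∉ SSpace.C := fun h => he ((hσ.boundary_inS_eight s).2 h)
    filter_upwards [continuous_subtype_val.continuousAt.preimage_mem_nhds
      (SSpace.isClosed_C.isOpen_compl.mem_nhds h1)] with s' hs' h
    exact hs' ((hσ.boundary_inS_eight s').1 h)
  · rw [← (hσ.datumE.holOpenAt_inX x).1, mem_map]
    exact Eventually.of_forall fun y => hσ.boundary_inX_eight y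

theorem isOpenHolEmbedding_rho :
    IsOpenHolEmbedding (fun e : {e : Ebar σ t // hσ.rho t e ≠ hσ.node t} => hσ.rho t e) := by
  have h8 : ∀ e : Ebar σ t, hσ.rho t e ≠ hσ.node t → ¬ hσ.boundary 8 e.1 := fun e h h' =>
    h (hσ.rho_eq_node_iff.2 h')
  refine .of_holOpenAt (fun e => ?_) fun e e' h => ?_
  · have h1 : HolOpenAt (hσ.rho t) e.1 := by
      refine HolOpenAt.fibre (p := AtTime t) (q := AtTime t) (fun e => ?_) e.1
        (hσ.holOpenAt_contract (h8 _ e.2)) (hσ.isOpen_not_boundary_eight.mem_nhds (h8 _ e.2))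
        fun e he e' _ h => hσ.contract_injective he h
      rw [hσ.datumE.atTime_iff, hσ.datumF.atTime_iff, hσ.time_contract]
    refine h1.comp (holOpenAt_subtype_val e ?_)
    filter_upwards [(continuous_subtype_val (p := AtTime (A := SSpace.a₂ᶜ) (B := XSpace.pᶜ) (σ := σ) t)).continuousAt.preimage_mem_nhds
      (hσ.isOpen_not_boundary_eight.mem_nhds (h8 _ e.2))] with e' h h'
    exact h (hσ.rho_eq_node_iff.1 h')
  · exact Subtype.ext (Subtype.ext (hσ.contract_injective (h8 _ e.2) (congrArg Subtype.val h)))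

theorem surjective_rho (f : FFibre σ t) : ∃ e, hσ.rho t e = f := by
  obtain ⟨f, hf⟩ := f
  obtain ⟨s, rfl⟩ | ⟨x, rfl⟩ := f.cases
  · have h1 : s.1 ∉ SSpace.C := fun h => s.2 (.inl h)
    refine ⟨⟨inS ⟨s.1, fun h => s.2 (.inr h)⟩, ?_⟩, Subtype.ext (hσ.contract_inS (s := ⟨s.1, _⟩) h1)⟩
    exact hσ.datumE.atTime_inS.2 (hσ.datumF.atTime_inS.1 hf)
  · have ht := hσ.datumF.atTime_inX.1 hf
    by_cases h : x.1 ∈ p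
    · have h5 : ((0 : ℂ), (0 : ℂ)) ∈ fdom σ t (.inl 5) := zero_mem_fdom _ _ _
      refine ⟨fchart σ t (.inl 5) (0, 0), (hσ.rho_eq_node_iff.2 ?_).trans (Subtype.ext ?_)⟩
      · rw [hσ.fchart_mem h5]
        exact .inl ⟨rfl, rfl⟩
      · refine congrArg inX (Subtype.ext ?_)
        change origin t = x.1
        rw [XSpace.eq_origin h, ht]
    · exact ⟨⟨inX ⟨x.1, h⟩, hσ.datumE.atTime_inX.2 ht⟩, Subtype.ext (hσ.contract_inX ⟨x.1, h⟩)⟩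

/-- Compact neighbourhoods of `C` in `Ē_t`. -/
def tube (σ : XSpace → XSpace) (t : ℂ) (δ : ℝ) : Set (Ebar σ t) :=
  fchart σ t (.inl 5) '' (Metric.closedBall 0 δ ×ˢ Metric.closedBall 0 1) ∪
    fchart σ t (.inl 4) '' (Metric.closedBall 0 1 ×ˢ Metric.closedBall 0 δ)

omit hσ in
theorem mem_fdom_five (a : ℂ × ℂ) : a ∈ fdom σ t (.inl 5) := by simp [mem_fdom_inl]

omit hσ in
theorem mem_fdom_four {a : ℂ × ℂ} (h : ‖a.2‖ ≤ 1) : a ∈ fdom σ t (.inl 4) := by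
  have : a.2 ≠ 4 := by
    rintro h'
    rw [h'] at h
    norm_num at h
  simp [mem_fdom_inl, this]

theorem isCompact_tube {δ : ℝ} (h : δ ≤ 1) : IsCompact (tube σ t δ) := by
  refine IsCompact.union ?_ ?_
  · refine ((isCompact_closedBall 0 δ).prod (isCompact_closedBall 0 1)).image_of_continuousOn fun a _ => ?_
    exact ((hσ.isOpenChart_fchart _).hol a (mem_fdom_five a)).continuousAt.continuousWithinAt
  · refine ((isCompact_closedBall 0 1).prod (isCompact_closedBall 0 δ)).image_of_continuousOn fun a ha => ?_
    exact ((hσ.isOpenChart_fchart _).hol a (mem_fdom_four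
      ((mem_closedBall_zero_iff.1 ha.2).trans h))).continuousAt.continuousWithinAt

/-- Off `C` the local equation of `C` has a nonzero value, and a tube of smaller width misses the
point. If the tube presents the point in the other chart, the estimate is transferred by `Q⁽¹⁾ =
(Q⁽²⁾)² P⁽²⁾` and `Q⁽²⁾ P⁽¹⁾ = 1`, using that the parameters along `C` are bounded by `1`. -/
theorem mem_curves_of_forall_mem_tube {e : Ebar σ t} (h : ∀ δ, 0 < δ → δ ≤ 1 → e ∈ tube σ t δ) :
    e ∈ hσ.curves t 8 := by
  by_contra he
  have key : ∀ z : ℂ, z ≠ 0 → ∃ δ, 0 < δ ∧ δ ≤ 1 ∧ δ < ‖z‖ := fun z hz =>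
    ⟨min 1 (‖z‖ / 2), lt_min one_pos (half_pos (norm_pos_iff.2 hz)), min_le_left _ _,
      (min_le_right _ _).trans_lt (half_lt_self (norm_pos_iff.2 hz))⟩
  rcases h 1 one_pos le_rfl with ⟨a, ⟨-, ha2⟩, rfl⟩ | ⟨a, ⟨ha1, ha2⟩, rfl⟩
  · rw [hσ.fchart_mem (mem_fdom_five a)] at he
    have ha : a.1 ≠ 0 := fun h => he (.inl ⟨rfl, h⟩)
    obtain ⟨δ, h1, h2, h3⟩ := key _ ha
    rcases h δ h1 h2 with ⟨b, ⟨hb1, hb2⟩, hb⟩ | ⟨b, ⟨hb1, hb2⟩, hb⟩ <;>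
      rw [mem_closedBall_zero_iff] at hb1 hb2
    · rw [(hσ.isOpenChart_fchart _).inj (mem_fdom_five _) (mem_fdom_five _) hb] at hb1
      exact absurd hb1 h3.not_ge
    · rw [hσ.fchart_inl_eq (mem_fdom_four (hb2.trans h2)) (mem_fdom_five _),
        SSpace.pt_four_eq_pt_five_iff] at hb
      have h4 : ‖a.1‖ ≤ δ := by
        rw [hb.2, norm_mul, norm_pow]
        calc ‖b.1‖ ^ 2 * ‖b.2‖ ≤ 1 ^ 2 * δ := by gcongr
          _ = δ := by ring
      exact absurd h4 h3.not_ge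
  · rw [mem_closedBall_zero_iff] at ha1 ha2
    rw [hσ.fchart_mem (mem_fdom_four ha2)] at he
    have ha : a.2 ≠ 0 := fun h => he (.inr ⟨rfl, h⟩)
    obtain ⟨δ, h1, h2, h3⟩ := key _ ha
    rcases h δ h1 h2 with ⟨b, ⟨hb1, hb2⟩, hb⟩ | ⟨b, ⟨hb1, hb2⟩, hb⟩ <;>
      rw [mem_closedBall_zero_iff] at hb1 hb2
    · rw [eq_comm, hσ.fchart_inl_eq (mem_fdom_four ha2) (mem_fdom_five _),
        SSpace.pt_four_eq_pt_five_iff] at hb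
      have h5 : ‖a.1‖ * ‖b.2‖ = 1 := by rw [← norm_mul, hb.1, norm_one]
      have h6 : 1 ≤ ‖a.1‖ := by nlinarith [norm_nonneg a.1, norm_nonneg b.2]
      have h4 : ‖a.2‖ ≤ δ := by
        refine le_trans ?_ hb1
        rw [hb.2, norm_mul, norm_pow]
        calc ‖a.2‖ = 1 ^ 2 * ‖a.2‖ := by ring
          _ ≤ ‖a.1‖ ^ 2 * ‖a.2‖ := by gcongr
      exact absurd h4 h3.not_ge
    · rw [(hσ.isOpenChart_fchart _).inj (mem_fdom_four (hb2.trans h2)) (mem_fdom_four ha2) hb] at hb2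
      exact absurd hb2 h3.not_ge

/-- A point `(ξ, η)` near `p` is presented as `(η², ξ / η)` or `(η / ξ, ξ²)`, dividing by the larger
of the two coordinates so that the parameter along `C` is at most `1` in absolute value. Thus the
preimages of small neighbourhoods of `p` lie in a tube. -/
theorem mem_tube {e : Ebar σ t} {x : XSpace} {δ : ℝ} (hδ : 0 < δ) (hδ' : δ ≤ 1)
    (he : hσ.contract e.1 = inF σ x)
    (h1 : ‖x.toW.2.1‖ ^ 2 < δ) (h2 : ‖x.toW.2.2‖ ^ 2 < δ) : e ∈ tube σ t δ := by
  by_cases hx : x ∈ p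
  · rw [XSpace.eq_origin hx] at he
    have h3 : e ∈ hσ.curves t 8 := (hσ.contract_eq_origin_iff.1 he).1
    obtain ⟨c, a, ha, rfl, -⟩ := hσ.exists_fchart e
    rw [hσ.fchart_mem ha] at h3
    have h5 : ∀ c : ChartIndex, c.fst = some 8 → c = .inl 5 := by decide
    have h4 : ∀ c : ChartIndex, c.snd = some 8 → c = .inl 4 := by decide
    obtain ⟨q, p⟩ := a
    rcases h3 with ⟨h3, hq⟩ | ⟨h3, hp⟩
    · obtain rfl := h5 c h3
      obtain rfl : q = 0 := hq
      by_cases hp : ‖p‖ ≤ 1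
      · exact .inl ⟨_, ⟨by simpa using hδ.le, by simpa using hp⟩, rfl⟩
      · have hp0 : p ≠ 0 := by
          rintro rfl
          simp at hp
        refine .inr ⟨(1 / p, 0), ⟨?_, by simpa using hδ.le⟩, ?_⟩
        · simp only [mem_closedBall_zero_iff, norm_div, norm_one]
          exact div_le_one_of_le₀ (not_le.1 hp).le (norm_nonneg _)
        · rw [hσ.fchart_inl_eq (mem_fdom_four (by simp)) (mem_fdom_five _), SSpace.pt_four_eq_pt_five_iff]
          exact ⟨by field_simp, by simp⟩
    · obtain rfl := h4 c h3
      obtain rfl : p = 0 := hp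
      by_cases hq : ‖q‖ ≤ 1
      · exact .inr ⟨_, ⟨by simpa using hq, by simpa using hδ.le⟩, rfl⟩
      · have hq0 : q ≠ 0 := by
          rintro rfl
          simp at hq
        refine .inl ⟨(0, 1 / q), ⟨by simpa using hδ.le, ?_⟩, ?_⟩
        · simp only [mem_closedBall_zero_iff, norm_div, norm_one]
          exact div_le_one_of_le₀ (not_le.1 hq).le (norm_nonneg _)
        · rw [eq_comm, hσ.fchart_inl_eq (mem_fdom_four (by simp)) (mem_fdom_five _), SSpace.pt_four_eq_pt_five_iff]
          exact ⟨by field_simp, by simp⟩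
  · have he' : inX ⟨x, hx⟩ = e.1 := hσ.contract_injective (hσ.boundary_inX_eight ⟨x, hx⟩)
      ((hσ.contract_inX ⟨x, hx⟩).trans he.symm)
    have ht : x.toW.1 = t := hσ.datumE.atTime_inX.1 (he' ▸ e.2 : AtTime t (inX ⟨x, hx⟩))
    have hpm : ¬ XStage.IsPm x.toW := by
      rintro ⟨b, hb⟩
      have h3 : x.toW.2.1 = XStage.sgn b := congrArg Prod.fst hb
      rw [h3] at h1
      cases b <;> norm_num [XStage.sgn] at h1 <;> linarith
    have ha : wS x.toW ∉ SSpace.a₂ := fun h => hpm ((wS_mem_a₂ hx).1 h)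
    have hS : inS ⟨wS x.toW, ha⟩ = e.1 := (hσ.datumE.sound_cover (x := ⟨x, hx⟩) hx rfl).trans he'
    by_cases hle : ‖x.toW.2.1‖ ≤ ‖x.toW.2.2‖
    · have h0 : x.toW.2.2 ≠ 0 := by
        intro h0
        have : x.toW.2.1 = 0 := by simpa [h0] using hle
        exact hx (Prod.ext this h0)
      refine .inl ⟨(x.toW.2.2 ^ 2, x.toW.2.1 / x.toW.2.2), ⟨?_, ?_⟩, ?_⟩
      · simpa using h2.le
      · rw [mem_closedBall_zero_iff, norm_div]
        exact div_le_one_of_le₀ hle (norm_nonneg _)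
      · refine Subtype.ext ((hσ.fchart_val (mem_fdom_five _)).trans (Eq.trans ?_ hS))
        refine congrArg inS (Subtype.ext ?_)
        rw [← ht]
        exact (wS_of_snd_ne h0).symm
    · have h0 : x.toW.2.1 ≠ 0 := by
        intro h0
        simp [h0] at hle
      refine .inr ⟨(x.toW.2.2 / x.toW.2.1, x.toW.2.1 ^ 2), ⟨?_, ?_⟩, ?_⟩
      · rw [mem_closedBall_zero_iff, norm_div]
        exact div_le_one_of_le₀ (not_le.1 hle).le (norm_nonneg _)
      · simpa using h1.le
      · refine Subtype.ext ((hσ.fchart_val (mem_fdom_four ?_)).trans (Eq.trans ?_ hS))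
        · rw [norm_pow]
          exact h1.le.trans hδ'
        · refine congrArg inS (Subtype.ext ?_)
          rw [← ht]
          exact (wS_of_fst_ne h0).symm

theorem tube_mem_comap {δ : ℝ} (hδ : 0 < δ) (hδ' : δ ≤ 1) :
    tube σ t δ ∈ comap (hσ.rho t) (𝓝 (hσ.node t)) := by
  have h1 : ∀ᶠ f in 𝓝 (inF σ (origin t)), ∃ x, f = inF σ x ∧ ‖x.toW.2.1‖ ^ 2 < δ ∧ ‖x.toW.2.2‖ ^ 2 < δ := by
    rw [← (hσ.datumF.holOpenAt_inX ⟨origin t, trivial⟩).1, eventually_map]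
    have hc : Continuous fun x : (Set.univ : Set XSpace) => x.1.toW :=
      XSpace.continuous_toW.comp continuous_subtype_val
    have k1 : ∀ᶠ x : (Set.univ : Set XSpace) in 𝓝 ⟨origin t, trivial⟩, ‖x.1.toW.2.1‖ ^ 2 < δ := by
      refine ContinuousAt.eventually_lt (Continuous.continuousAt (by fun_prop)) continuousAt_const ?_
      simpa [toW_origin] using hδ
    have k2 : ∀ᶠ x : (Set.univ : Set XSpace) in 𝓝 ⟨origin t, trivial⟩, ‖x.1.toW.2.2‖ ^ 2 < δ := by
      refine ContinuousAt.eventually_lt (Continuous.continuousAt (by fun_prop)) continuousAt_const ?_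
      simpa [toW_origin] using hδ
    filter_upwards [k1, k2] with x h1 h2 using ⟨x.1, rfl, h1, h2⟩
  have h2 : ∀ᶠ f : FFibre σ t in 𝓝 (hσ.node t), _ :=
    (continuous_subtype_val.tendsto (hσ.node t)).eventually h1
  filter_upwards [preimage_mem_comap h2] with e he
  obtain ⟨x, h3, h4, h5⟩ := he
  exact hσ.mem_tube hδ hδ' h3 h4 h5

/-- An ultrafilter whose image converges to `p` contains all tubes; it converges in a compact one,
and the limit lies in all of them, hence on `C`. At the other points of `F_t` the map is an open
embedding and the ultrafilter can be lifted. -/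
theorem isProperMap_rho : IsProperMap (hσ.rho t) := by
  have hT2 : T2Space (Ebar σ t) := hσ.isSmoothSurface.1
  refine isProperMap_iff_ultrafilter.2 ⟨hσ.isHolMap_rho.1, fun U y hU => ?_⟩
  by_cases hy : y = hσ.node t
  · subst hy
    have h1 : ∀ δ, 0 < δ → δ ≤ 1 → tube σ t δ ∈ U := fun δ h h' =>
      (tendsto_iff_comap.1 hU) (hσ.tube_mem_comap h h')
    obtain ⟨e, -, he⟩ := isCompact_iff_ultrafilter_le_nhds'.1 (hσ.isCompact_tube le_rfl) U (h1 1 one_pos le_rfl)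
    refine ⟨e, hσ.rho_eq_node_iff.2 (hσ.mem_curves_of_forall_mem_tube fun δ h h' => ?_), he⟩
    exact (hσ.isCompact_tube h').isClosed.mem_of_tendsto (f := id) he (h1 δ h h')
  · obtain ⟨e, rfl⟩ := hσ.surjective_rho y
    refine ⟨e, rfl, fun N hN => ?_⟩
    have h1 := hσ.isOpenHolEmbedding_rho.holOpenAt (⟨e, hy⟩ : {e // hσ.rho t e ≠ hσ.node t})
    have h2 : (fun e : {e // hσ.rho t e ≠ hσ.node t} => hσ.rho t e) '' (Subtype.val ⁻¹' N) ∈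
        𝓝 (hσ.rho t e) := by
      rw [← h1.1]
      exact image_mem_map (continuous_subtype_val.continuousAt.preimage_mem_nhds hN)
    filter_upwards [hU h2] with e' he'
    obtain ⟨e'', h3, h4⟩ := he'
    have h5 := hσ.contract_injective (fun h => e''.2 (hσ.rho_eq_node_iff.2 h)) (congrArg Subtype.val h4)
    rw [← Subtype.ext h5]
    exact h3

theorem isResolution_rho : IsResolution (hσ.rho t) (hσ.node t) :=
  ⟨hσ.isSmoothSurface, hσ.isHolMap_rho, hσ.isProperMap_rho, hσ.dense_rho_ne, hσ.isOpenHolEmbedding_rho,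
    hσ.surjective_rho⟩

end XSpace.IsInducedInvolution

/-! ## Symplectic maps -/

theorem IsSymplecticAt.of_shear {f : ℂ × ℂ → ℂ × ℂ} {φ : ℂ → ℂ} {a : ℂ × ℂ} (ε : ℂ) (hε : ε * ε = 1)
    (hφ : DifferentiableAt ℂ φ a.2) (hf : ∀ b, f b = (ε * b.1 + φ b.2, ε * b.2)) : IsSymplecticAt f a := by
  have h2 : HasFDerivAt (fun b : ℂ × ℂ => b.2) (ContinuousLinearMap.snd ℂ ℂ ℂ) a := hasFDerivAt_snd
  have h1 : HasFDerivAt (fun b : ℂ × ℂ => b.1) (ContinuousLinearMap.fst ℂ ℂ ℂ) a := hasFDerivAt_fst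
  have h := ((h1.const_mul ε).fun_add (HasDerivAt.comp_hasFDerivAt (f := fun b : ℂ × ℂ => b.2) a
    hφ.hasDerivAt h2)).prodMk (h2.const_mul ε)
  have h' : HasFDerivAt f _ a := h.congr_of_eventuallyEq (Eventually.of_forall hf)
  refine ⟨h'.differentiableAt, fun b c => ?_⟩
  rw [h'.fderiv]
  simp
  linear_combination (b.1 * c.2 - b.2 * c.1) * hε

/-- The Jacobian determinant is `-α' γ`, since the first component does not depend on the first
variable. -/
theorem IsSymplecticAt.of_affine {f : ℂ × ℂ → ℂ × ℂ} {α β γ : ℂ → ℂ} {α' : ℂ} {a : ℂ × ℂ}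
    (hα : HasDerivAt α α' a.2) (hβ : DifferentiableAt ℂ β a.2) (hγ : DifferentiableAt ℂ γ a.2)
    (h1 : α' * γ a.2 = -1) (hf : ∀ b, f b = (α b.2, β b.2 + b.1 * γ b.2)) : IsSymplecticAt f a := by
  have k2 : HasFDerivAt (fun b : ℂ × ℂ => b.2) (ContinuousLinearMap.snd ℂ ℂ ℂ) a := hasFDerivAt_snd
  have k1 : HasFDerivAt (fun b : ℂ × ℂ => b.1) (ContinuousLinearMap.fst ℂ ℂ ℂ) a := hasFDerivAt_fst
  have kc : ∀ {g : ℂ → ℂ} {g' : ℂ}, HasDerivAt g g' a.2 →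
      HasFDerivAt (fun b : ℂ × ℂ => g b.2) (g' • ContinuousLinearMap.snd ℂ ℂ ℂ) a := fun h =>
    HasDerivAt.comp_hasFDerivAt (f := fun b : ℂ × ℂ => b.2) a h k2
  have h := (kc hα).prodMk ((kc hβ.hasDerivAt).fun_add (k1.fun_mul (kc hγ.hasDerivAt)))
  have h' : HasFDerivAt f _ a := h.congr_of_eventuallyEq (Eventually.of_forall hf)
  refine ⟨h'.differentiableAt, fun b c => ?_⟩
  rw [h'.fderiv]
  simp
  linear_combination (b.2 * c.1 - b.1 * c.2) * h1

/-- Analytic symplectic maps are local isomorphisms. -/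
theorem IsSymplecticAt.holOpenAt {f : ℂ × ℂ → ℂ × ℂ} {a : ℂ × ℂ} (h : IsSymplecticAt f a)
    (hf : AnalyticAt ℂ f a) : HolOpenAt f a := by
  have hinj : Function.Injective (fderiv ℂ f a).toLinearMap := by
    refine (injective_iff_map_eq_zero _).2 fun b hb => ?_
    have hb' : fderiv ℂ f a b = 0 := hb
    have h1 := h.2 b (1, 0)
    have h2 := h.2 b (0, 1)
    simp only [hb', Prod.fst_zero, Prod.snd_zero] at h1 h2
    refine Prod.ext ?_ ?_
    · change b.1 = 0
      linear_combination -h2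
    · change b.2 = 0
      linear_combination h1
  let L : (ℂ × ℂ) ≃L[ℂ] (ℂ × ℂ) :=
    (LinearEquiv.ofInjectiveEndo _ hinj).toContinuousLinearEquiv
  have hL : (L : (ℂ × ℂ) →L[ℂ] (ℂ × ℂ)) = fderiv ℂ f a := by
    ext <;> rfl
  obtain ⟨U, -, haU, -, hU⟩ := exists_holOpenAt_of_hasFDerivAt hf (f' := L)
    (hL ▸ h.1.hasFDerivAt)
  exact hU a haU

section

variable (t : ℂ) {a : ℂ × ℂ} (h : a.2 ≠ 0)
include h

theorem isSymplecticAt_mapZWtoUV : IsSymplecticAt (mapZWtoUV t) a :=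
  .of_shear (φ := fun w => -2 * t / w ^ 2 - 8 / w ^ 6) 1 (by ring)
    (by fun_prop (disch := exact pow_ne_zero _ h)) fun b => by
      simp only [mapZWtoUV]
      ext <;> ring

theorem isSymplecticAt_mapSigmaZW : IsSymplecticAt (mapSigmaZW t) a :=
  .of_shear (φ := fun w => 2 * t / w ^ 2 + 8 / w ^ 6) (-1) (by ring)
    (by fun_prop (disch := exact pow_ne_zero _ h)) fun b => by
      simp only [mapSigmaZW]
      ext <;> ring

theorem isSymplecticAt_mapSigmaUV : IsSymplecticAt (mapSigmaUV t) a :=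
  .of_shear (φ := fun w => -2 * t / w ^ 2 - 8 / w ^ 6) (-1) (by ring)
    (by fun_prop (disch := exact pow_ne_zero _ h)) fun b => by
      simp only [mapSigmaUV]
      ext <;> ring

theorem hasDerivAt_one_div_sq : HasDerivAt (fun w : ℂ => 1 / w ^ 2) (-2 / a.2 ^ 3) a.2 := by
  have := (hasDerivAt_const a.2 (1 : ℂ)).div ((hasDerivAt_id a.2).pow 2) (pow_ne_zero 2 h)
  refine this.congr_deriv ?_
  simp
  field_simp

theorem isSymplecticAt_mapZWtoXY : IsSymplecticAt (mapZWtoXY t) a :=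
  .of_affine (β := fun w => -2 / w ^ 3 - t * w / 2 - w ^ 2 / 2) (γ := fun w => w ^ 3 / 2)
    (hasDerivAt_one_div_sq h) (by fun_prop (disch := exact pow_ne_zero _ h)) (by fun_prop)
    (by field_simp) fun b => by
      simp only [mapZWtoXY]
      ext <;> ring

theorem isSymplecticAt_mapUVtoXY : IsSymplecticAt (mapUVtoXY t) a :=
  .of_affine (β := fun w => 2 / w ^ 3 + t * w / 2 - w ^ 2 / 2) (γ := fun w => w ^ 3 / 2)
    (hasDerivAt_one_div_sq h) (by fun_prop (disch := exact pow_ne_zero _ h)) (by fun_prop)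
    (by field_simp) fun b => by
      simp only [mapUVtoXY]
      ext <;> ring

theorem holOpenAt_mapZWtoUV : HolOpenAt (mapZWtoUV t) a :=
  (isSymplecticAt_mapZWtoUV t h).holOpenAt (by
    unfold mapZWtoUV
    fun_prop (disch := exact pow_ne_zero _ h))

theorem holOpenAt_mapZWtoXY : HolOpenAt (mapZWtoXY t) a :=
  (isSymplecticAt_mapZWtoXY t h).holOpenAt (by
    unfold mapZWtoXY
    fun_prop (disch := exact pow_ne_zero _ h))

theorem holOpenAt_mapUVtoXY : HolOpenAt (mapUVtoXY t) a :=
  (isSymplecticAt_mapUVtoXY t h).holOpenAt (by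
    unfold mapUVtoXY
    fun_prop (disch := exact pow_ne_zero _ h))

end

/-! ## The surface `ℂ²_(z,w) ∪ ℂ²_(u,v)` in `X` -/

namespace XSpace

theorem toW_zw₈_eq (t z w : ℂ) : (zw₈.map ⟨(t, z, w), mem_zw₈ _⟩).toW =
    (t, 2 + w ^ 4 * (t / 2 + w * (1 / 2 + w * z)), w) := by
  rw [toW_zw₈]
  simp [XStage.chartW, blowMap₁, XStage.cen, XStage.ctr]
  ring

theorem toW_uv₈_eq (t z w : ℂ) : (uv₈.map ⟨(t, z, w), mem_uv₈ _⟩).toW =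
    (t, -2 + w ^ 4 * (-t / 2 + w * (1 / 2 + w * z)), w) := by
  refine (XStage.toW_chart 6 false ⟨(t, z, w), mem_uv₈ _⟩).trans ?_
  simp [XStage.chartW, blowMap₁, XStage.cen, XStage.ctr]
  ring

theorem isGood_uv₈ : uv₈.IsGood (fun x => x.toW.1) := (XStage.isGood 6).good false

instance (t : ℂ) : Nonempty (Fibre t) := ⟨origin t, congrArg Prod.fst (toW_origin t)⟩

end XSpace

theorem LocalChart.IsGood.holOpenAt_fibre {X : Type} [TopologicalSpace X] [HolSpace X] {κ : LocalChart X}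
    {τ : X → ℂ} (hκ : κ.IsGood τ) {t : ℂ} {f : ℂ × ℂ → {x // τ x = t}} {g : ℂ × ℂ → ℂ × ℂ} {a : ℂ × ℂ}
    (hg : HolOpenAt g a) (h0 : (t, g a) ∈ κ.dom)
    (h : ∀ᶠ b in 𝓝 a, ∀ hb : (t, g b) ∈ κ.dom, (f b).1 = κ.map ⟨_, hb⟩) : HolOpenAt f a := by
  have : Nonempty {x // τ x = t} := ⟨f a⟩
  have hc := hκ.isOpenChart_fibreMap (q := fun x => τ x = t) (fun _ => Iff.rfl)
  refine ((hc.hol _ h0).comp hg).congr ?_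
  filter_upwards [h, hg.continuousAt.preimage_mem_nhds (hc.isOpen.mem_nhds h0)] with b hb hb'
  exact Subtype.ext ((hκ.fibreMap_val (q := fun x => τ x = t) (fun _ => Iff.rfl) hb').trans (hb hb').symm)

namespace Horn

variable (t : ℂ)

theorem cases (h : Horn t) : (∃ a, zw t a = h) ∨ ∃ a, uv t a = h := by
  obtain ⟨a | a, rfl⟩ := Quot.exists_rep h
  exacts [.inl ⟨a, rfl⟩, .inr ⟨a, rfl⟩]

theorem sound {a : ℂ × ℂ} (h : a.2 ≠ 0) : zw t a = uv t (mapZWtoUV t a) := Quot.sound (.mk a h)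

theorem etaleRel : EtaleRel (HornRel t) := by
  rintro _ _ ⟨a, ha⟩
  refine ⟨ℂ × ℂ, inferInstance, inferInstance, a, Sum.inl, Sum.inr ∘ mapZWtoUV t, rfl, rfl,
    holOpenAt_inl _, (holOpenAt_inr _).comp (holOpenAt_mapZWtoUV t ha), ?_⟩
  filter_upwards [eventually_ne_of_continuousAt (f := fun v : ℂ × ℂ => v.2) (by fun_prop) ha] with b hb
  exact sound t hb

theorem holOpenAt_zw (a : ℂ × ℂ) : HolOpenAt (zw t) a :=
  HolOpenAt.comp (g := Quot.mk (HornRel t)) ((etaleRel t).holOpenAt _) (holOpenAt_inl a)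

theorem holOpenAt_uv (a : ℂ × ℂ) : HolOpenAt (uv t) a :=
  HolOpenAt.comp (g := Quot.mk (HornRel t)) ((etaleRel t).holOpenAt _) (holOpenAt_inr a)

/-- The surface `ℂ²_(z,w) ∪ ℂ²_(u,v)` in `X`. -/
noncomputable def toX : Horn t → XSpace.Fibre t :=
  Quot.lift (fun a => match a with
    | Sum.inl a => ⟨XSpace.zw₈.map ⟨(t, -a.1 / 2, a.2), XSpace.mem_zw₈ _⟩, by rw [XSpace.toW_zw₈_eq]⟩
    | Sum.inr a => ⟨XSpace.uv₈.map ⟨(t, -a.1 / 2, a.2), XSpace.mem_uv₈ _⟩, by rw [XSpace.toW_uv₈_eq]⟩) (by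
    rintro _ _ ⟨⟨z, w⟩, h⟩
    refine Subtype.ext (XSpace.eq_of_toW_eq ?_ ?_)
    · rintro ⟨b, hb⟩
      have := congrArg Prod.snd hb
      rw [XSpace.toW_zw₈_eq] at this
      exact h this
    · simp only [XSpace.toW_zw₈_eq, XSpace.toW_uv₈_eq, mapZWtoUV]
      refine Prod.ext rfl (Prod.ext ?_ rfl)
      simp only at h
      field_simp
      ring)

theorem toX_zw (a : ℂ × ℂ) :
    (toX t (zw t a)).1 = XSpace.zw₈.map ⟨(t, -a.1 / 2, a.2), XSpace.mem_zw₈ _⟩ := rfl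

theorem toX_uv (a : ℂ × ℂ) :
    (toX t (uv t a)).1 = XSpace.uv₈.map ⟨(t, -a.1 / 2, a.2), XSpace.mem_uv₈ _⟩ := rfl

theorem toW_zw (a : ℂ × ℂ) : (toX t (zw t a)).1.toW =
    (t, 2 + a.2 ^ 4 * (t / 2 + a.2 * (1 / 2 + a.2 * (-a.1 / 2))), a.2) := XSpace.toW_zw₈_eq _ _ _

theorem toW_uv (a : ℂ × ℂ) : (toX t (uv t a)).1.toW =
    (t, -2 + a.2 ^ 4 * (-t / 2 + a.2 * (1 / 2 + a.2 * (-a.1 / 2))), a.2) := XSpace.toW_uv₈_eq _ _ _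

theorem of_toX_zw_eq_toX_uv {a b : ℂ × ℂ} (h : toX t (zw t a) = toX t (uv t b)) :
    a.2 ≠ 0 ∧ b = mapZWtoUV t a := by
  have h1 := congrArg (fun x : XSpace.Fibre t => x.1.toW.2) h
  simp only [toW_zw, toW_uv, Prod.mk.injEq] at h1
  obtain ⟨z, w⟩ := a
  obtain ⟨u, v⟩ := b
  obtain ⟨h1, rfl⟩ := h1
  simp only at h1
  -- On `w = 0` the first coordinates in `W` are `2` and `-2`, so the two charts do not meet there.
  have hw : w ≠ 0 := by
    rintro rfl
    norm_num [Complex.ext_iff] at h1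
  refine ⟨hw, Prod.ext ?_ rfl⟩
  simp only [mapZWtoUV]
  field_simp
  linear_combination 2 * h1

theorem toX_injective : Function.Injective (toX t) := by
  have hz : ∀ a b, toX t (zw t a) = toX t (zw t b) → zw t a = zw t b := by
    intro a b h
    have h1 := congrArg (fun v => v.1.2) (XSpace.isGood_zw₈.inj (congrArg Subtype.val h))
    simp only [Prod.mk.injEq] at h1
    congr 1
    exact Prod.ext (by linear_combination -2 * h1.1) h1.2
  have hu : ∀ a b, toX t (uv t a) = toX t (uv t b) → uv t a = uv t b := by
    intro a b h
    have h1 := congrArg (fun v => v.1.2) (XSpace.isGood_uv₈.inj (congrArg Subtype.val h))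
    simp only [Prod.mk.injEq] at h1
    congr 1
    exact Prod.ext (by linear_combination -2 * h1.1) h1.2
  have hm : ∀ a b, toX t (zw t a) = toX t (uv t b) → zw t a = uv t b := by
    intro a b h
    obtain ⟨h1, rfl⟩ := of_toX_zw_eq_toX_uv t h
    exact sound t h1
  intro h h' e
  obtain ⟨a, rfl⟩ | ⟨a, rfl⟩ := cases t h <;> obtain ⟨b, rfl⟩ | ⟨b, rfl⟩ := cases t h'
  exacts [hz _ _ e, hm _ _ e, (hm _ _ e.symm).symm, hu _ _ e]

theorem holOpenAt_scale (a : ℂ × ℂ) : HolOpenAt (fun a : ℂ × ℂ => (-a.1 / 2, a.2)) a :=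
  .of_analytic (g := fun a => (-2 * a.1, a.2)) (by fun_prop) (by fun_prop)
    (Eventually.of_forall fun b => by ext <;> simp; ring)
    (Eventually.of_forall fun b => by ext <;> simp)

theorem holOpenAt_toX (h : Horn t) : HolOpenAt (toX t) h := by
  obtain ⟨a, rfl⟩ | ⟨a, rfl⟩ := cases t h
  · refine HolOpenAt.cancel (holOpenAt_zw t a) ?_
    exact XSpace.isGood_zw₈.holOpenAt_fibre (holOpenAt_scale a) (XSpace.mem_zw₈ _)
      (Eventually.of_forall fun b hb => toX_zw t b)
  · refine HolOpenAt.cancel (holOpenAt_uv t a) ?_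
    exact XSpace.isGood_uv₈.holOpenAt_fibre (holOpenAt_scale a) (XSpace.mem_uv₈ _)
      (Eventually.of_forall fun b hb => toX_uv t b)

theorem isOpenHolEmbedding_toX : IsOpenHolEmbedding (toX t) := .of_holOpenAt (holOpenAt_toX t) (toX_injective t)

theorem zw_eq_uv_iff (a b : ℂ × ℂ) : zw t a = uv t b ↔ a.2 ≠ 0 ∧ b = mapZWtoUV t a :=
  ⟨fun h => of_toX_zw_eq_toX_uv t (congrArg _ h), fun ⟨h, e⟩ => e ▸ sound t h⟩

theorem zw_injective : Function.Injective (zw t) := by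
  intro a b h
  have h1 := congrArg (fun v => v.1.2) (XSpace.isGood_zw₈.inj (congrArg (fun h => (toX t h).1) h))
  simp only [Prod.mk.injEq] at h1
  exact Prod.ext (by linear_combination -2 * h1.1) h1.2

theorem uv_injective : Function.Injective (uv t) := by
  intro a b h
  have h1 := congrArg (fun v => v.1.2) (XSpace.isGood_uv₈.inj (congrArg (fun h => (toX t h).1) h))
  simp only [Prod.mk.injEq] at h1
  exact Prod.ext (by linear_combination -2 * h1.1) h1.2

theorem sigma_zw (a : ℂ × ℂ) : sigma t (zw t a) = uv t (-a) := rfl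

theorem sigma_uv (a : ℂ × ℂ) : sigma t (uv t a) = zw t (-a) := rfl

theorem sigma_involutive : Function.Involutive (sigma t) := by
  intro h
  obtain ⟨a, rfl⟩ | ⟨a, rfl⟩ := cases t h
  · rw [sigma_zw, sigma_uv, neg_neg]
  · rw [sigma_uv, sigma_zw, neg_neg]

theorem holOpenAt_neg (a : ℂ × ℂ) : HolOpenAt (fun a : ℂ × ℂ => -a) a :=
  .of_analytic (g := fun a => -a) (by fun_prop) (by fun_prop)
    (Eventually.of_forall neg_neg) (Eventually.of_forall neg_neg)

theorem holOpenAt_sigma (h : Horn t) : HolOpenAt (sigma t) h := by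
  obtain ⟨a, rfl⟩ | ⟨a, rfl⟩ := cases t h
  · exact HolOpenAt.cancel (holOpenAt_zw t a) ((holOpenAt_uv t (-a)).comp (holOpenAt_neg a))
  · exact HolOpenAt.cancel (holOpenAt_uv t a) ((holOpenAt_zw t (-a)).comp (holOpenAt_neg a))

theorem sigma_zw_of_ne {a : ℂ × ℂ} (h : a.2 ≠ 0) : sigma t (zw t a) = zw t (mapSigmaZW t a) := by
  rw [sigma_zw, eq_comm, zw_eq_uv_iff]
  refine ⟨by simpa [mapSigmaZW] using h, ?_⟩
  simp only [mapZWtoUV, mapSigmaZW]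
  refine Prod.ext ?_ rfl
  simp only [Prod.fst_neg]
  rw [Even.neg_pow (by decide), Even.neg_pow (by decide)]
  ring

theorem sigma_uv_of_ne {a : ℂ × ℂ} (h : a.2 ≠ 0) : sigma t (uv t a) = uv t (mapSigmaUV t a) := by
  rw [sigma_uv, zw_eq_uv_iff]
  refine ⟨by simpa using h, ?_⟩
  simp only [mapZWtoUV, mapSigmaUV]
  refine Prod.ext ?_ rfl
  simp only [Prod.fst_neg, Prod.snd_neg]
  rw [Even.neg_pow (by decide), Even.neg_pow (by decide)]

theorem involution_toX {σ : XSpace → XSpace} (hσ : XSpace.IsInducedInvolution σ) (h : Horn t) :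
    σ (toX t h).1 = (toX t (sigma t h)).1 := by
  obtain ⟨a, rfl⟩ | ⟨a, rfl⟩ := cases t h
  · obtain ⟨h1, h2⟩ := hσ.at_uv ⟨XSpace.mem_zw₈ _, (toX_zw t a).symm⟩
    rw [← h2, sigma_zw, toX_uv]
    congr 2
    refine Prod.ext rfl (Prod.ext ?_ rfl)
    simp
    ring
  · obtain ⟨h1, h2⟩ := hσ.at_zw ⟨XSpace.mem_uv₈ _, (toX_uv t a).symm⟩
    rw [← h2, sigma_uv, toX_zw]
    congr 2
    refine Prod.ext rfl (Prod.ext ?_ rfl)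
    simp
    ring

end Horn

/-! ## The explicit model of `E_t` -/

theorem HornQuot.etaleRel (t : ℂ) : EtaleRel (fun a b : Horn t => Horn.sigma t a = b) := by
  rintro a _ rfl
  exact ⟨Horn t, inferInstance, inferInstance, a, id, Horn.sigma t, rfl, rfl, holOpenAt_id _,
    Horn.holOpenAt_sigma t a, Eventually.of_forall fun b => Quot.sound rfl⟩

theorem HornQuot.holOpenAt_mk (t : ℂ) (h : Horn t) : HolOpenAt (HornQuot.mk t) h :=
  (HornQuot.etaleRel t).holOpenAt h

namespace Model

variable (t : ℂ)

theorem sound_zw {a : ℂ × ℂ} (h : a.2 ≠ 0) : xy t (mapZWtoXY t a) = ofHorn t (Horn.zw t a) :=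
  Quot.sound (.zw a h)

theorem sound_uv {a : ℂ × ℂ} (h : a.2 ≠ 0) : xy t (mapUVtoXY t a) = ofHorn t (Horn.uv t a) :=
  Quot.sound (.uv a h)

theorem ofHorn_sigma (h : Horn t) : ofHorn t (Horn.sigma t h) = ofHorn t h :=
  congrArg (fun q => Quot.mk (ModelRel t) (Sum.inr q)) (Quot.sound rfl : HornQuot.mk t h = HornQuot.mk t _).symm

theorem etaleRel : EtaleRel (ModelRel t) := by
  rintro _ _ (⟨a, ha⟩ | ⟨a, ha⟩)
  · refine ⟨ℂ × ℂ, inferInstance, inferInstance, a, Sum.inl ∘ mapZWtoXY t,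
      Sum.inr ∘ HornQuot.mk t ∘ Horn.zw t, rfl, rfl, (holOpenAt_inl _).comp (holOpenAt_mapZWtoXY t ha),
      (holOpenAt_inr _).comp ((HornQuot.holOpenAt_mk t _).comp (Horn.holOpenAt_zw t a)), ?_⟩
    filter_upwards [eventually_ne_of_continuousAt (f := fun v : ℂ × ℂ => v.2) (by fun_prop) ha] with b hb
    exact sound_zw t hb
  · refine ⟨ℂ × ℂ, inferInstance, inferInstance, a, Sum.inl ∘ mapUVtoXY t,
      Sum.inr ∘ HornQuot.mk t ∘ Horn.uv t, rfl, rfl, (holOpenAt_inl _).comp (holOpenAt_mapUVtoXY t ha),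
      (holOpenAt_inr _).comp ((HornQuot.holOpenAt_mk t _).comp (Horn.holOpenAt_uv t a)), ?_⟩
    filter_upwards [eventually_ne_of_continuousAt (f := fun v : ℂ × ℂ => v.2) (by fun_prop) ha] with b hb
    exact sound_uv t hb

theorem holOpenAt_xy (a : ℂ × ℂ) : HolOpenAt (xy t) a :=
  HolOpenAt.comp (g := Quot.mk (ModelRel t)) ((etaleRel t).holOpenAt _) (holOpenAt_inl a)

theorem holOpenAt_ofHorn (h : Horn t) : HolOpenAt (ofHorn t) h :=
  HolOpenAt.comp (g := Quot.mk (ModelRel t)) ((etaleRel t).holOpenAt _)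
    (HolOpenAt.comp (g := Sum.inr) (f := HornQuot.mk t) (holOpenAt_inr _) (HornQuot.holOpenAt_mk t h))

theorem cases (m : Model t) : (∃ a, xy t a = m) ∨ ∃ a, ofHorn t (Horn.zw t a) = m := by
  obtain ⟨a | q, rfl⟩ := Quot.exists_rep m
  · exact .inl ⟨a, rfl⟩
  · obtain ⟨h, rfl⟩ := Quot.exists_rep q
    obtain ⟨a, rfl⟩ | ⟨a, rfl⟩ := Horn.cases t h
    · exact .inr ⟨a, rfl⟩
    · exact .inr ⟨-a, ofHorn_sigma t (Horn.uv t a)⟩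

end Model

namespace Horn

variable (t : ℂ)

theorem toX_notMem_p (h : Horn t) : (toX t h).1 ∉ XSpace.p := by
  change ¬ (toX t h).1.toW.2 = (0, 0)
  obtain ⟨a, rfl⟩ | ⟨a, rfl⟩ := cases t h
  · rw [toW_zw, Prod.mk.injEq]
    rintro ⟨h1, h2⟩
    simp [h2] at h1
  · rw [toW_uv, Prod.mk.injEq]
    rintro ⟨h1, h2⟩
    simp [h2] at h1

theorem not_label_toX (h : Horn t) (i : Fin 9) : ¬ XSpace.label i (toX t h).1 := by
  rintro ⟨h1, h2⟩
  obtain ⟨a, rfl⟩ | ⟨a, rfl⟩ := cases t h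
  · exact XSpace.not_curve_zw₈ (by omega) _ h2
  · exact XStage.not_curve_chart (by omega) false _ h2

theorem wS_toX_zw {a : ℂ × ℂ} (h : a.2 ≠ 0) :
    wS (toX t (zw t a)).1.toW = SSpace.pt 2 (t, mapZWtoXY t a) := by
  rw [toW_zw, wS_eq_xy h]
  simp only [mapZWtoXY]
  congr 3
  field_simp
  ring

theorem wS_toX_uv {a : ℂ × ℂ} (h : a.2 ≠ 0) :
    wS (toX t (uv t a)).1.toW = SSpace.pt 2 (t, mapUVtoXY t a) := by
  rw [toW_uv, wS_eq_xy h]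
  simp only [mapUVtoXY]
  congr 3
  field_simp
  ring

theorem pt_eq_wS_toX_zw {a b : ℂ × ℂ} (h : SSpace.pt 2 (t, a) = wS (toX t (zw t b)).1.toW) :
    b.2 ≠ 0 ∧ a = mapZWtoXY t b := by
  have hb : b.2 ≠ 0 := by
    intro hb
    have h1 := (exc_wS (w := (toX t (zw t b)).1.toW) (toX_notMem_p t _)).2 (by rw [toW_zw, hb])
    rw [← h, SSpace.exc_pt] at h1
    simp at h1
  rw [wS_toX_zw t hb] at h
  exact ⟨hb, congrArg Prod.snd (SSpace.pt_injective 2 h)⟩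

theorem pt_eq_wS_toX_uv {a b : ℂ × ℂ} (h : SSpace.pt 2 (t, a) = wS (toX t (uv t b)).1.toW) :
    b.2 ≠ 0 ∧ a = mapUVtoXY t b := by
  have hb : b.2 ≠ 0 := by
    intro hb
    have h1 := (exc_wS (w := (toX t (uv t b)).1.toW) (toX_notMem_p t _)).2 (by rw [toW_uv, hb])
    rw [← h, SSpace.exc_pt] at h1
    simp at h1
  rw [wS_toX_uv t hb] at h
  exact ⟨hb, congrArg Prod.snd (SSpace.pt_injective 2 h)⟩

end Horn

namespace Model

open Glue

variable {σ : XSpace → XSpace} (hσ : XSpace.IsInducedInvolution σ) (t : ℂ)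

theorem pt_two_notMem_a₂ (v : TPlane) : SSpace.pt 2 v ∈ SSpace.a₂ᶜ := by
  simp [SSpace.pt_mem_a₂]

/-- The model as a part of the compactified surface. -/
noncomputable def toEbar (hσ : XSpace.IsInducedInvolution σ) (t : ℂ) : Model t → Ebar σ t :=
  Quot.lift (Sum.elim
    (fun a => ⟨inS ⟨SSpace.pt 2 (t, a), pt_two_notMem_a₂ _⟩, hσ.datumE.atTime_inS.2 (SSpace.time_pt 2 (t, a))⟩)
    (Quot.lift (fun h => ⟨inX ⟨(Horn.toX t h).1, Horn.toX_notMem_p t h⟩,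
        hσ.datumE.atTime_inX.2 (Horn.toX t h).2⟩) (by
      rintro h _ rfl
      exact Subtype.ext (hσ.datumE.inX_eq_inX.2 (.inr
        ((hσ.2.1 _).symm.trans (congrArg σ (Horn.involution_toX t hσ h)))))))) (by
    rintro _ _ (⟨a, ha⟩ | ⟨a, ha⟩)
    · exact Subtype.ext (hσ.datumE.inS_eq_inX.2 ⟨Horn.toX_notMem_p t _, (Horn.wS_toX_zw t ha).symm⟩)
    · exact Subtype.ext (hσ.datumE.inS_eq_inX.2 ⟨Horn.toX_notMem_p t _, (Horn.wS_toX_uv t ha).symm⟩))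

/-- Equality of points is already explicit in `Ē_t`. Mapping the model there decides its own
equalities, without any analysis of the equivalence relation generated by `ModelRel`. -/
theorem of_toEbar_xy_eq_ofHorn_zw {a b : ℂ × ℂ}
    (h : toEbar hσ t (xy t a) = toEbar hσ t (ofHorn t (Horn.zw t b))) : b.2 ≠ 0 ∧ a = mapZWtoXY t b :=
  Horn.pt_eq_wS_toX_zw t (hσ.datumE.inS_eq_inX.1 (congrArg Subtype.val h)).2

theorem of_toEbar_xy_eq_ofHorn_uv {a b : ℂ × ℂ}
    (h : toEbar hσ t (xy t a) = toEbar hσ t (ofHorn t (Horn.uv t b))) : b.2 ≠ 0 ∧ a = mapUVtoXY t b :=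
  Horn.pt_eq_wS_toX_uv t (hσ.datumE.inS_eq_inX.1 (congrArg Subtype.val h)).2

theorem of_toEbar_ofHorn_eq_ofHorn {h h' : Horn t}
    (e : toEbar hσ t (ofHorn t h) = toEbar hσ t (ofHorn t h')) : h' = h ∨ h' = Horn.sigma t h := by
  rcases hσ.datumE.inX_eq_inX.1 (congrArg Subtype.val e) with e | e
  · exact .inl (Horn.toX_injective t (Subtype.ext e)).symm
  · refine .inr (Horn.toX_injective t (Subtype.ext ?_))
    rw [← Horn.involution_toX t hσ]
    exact (hσ.2.1 _).symm.trans (congrArg σ e.symm)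

theorem of_toEbar_xy_eq_xy {a b : ℂ × ℂ} (h : toEbar hσ t (xy t a) = toEbar hσ t (xy t b)) : a = b :=
  congrArg Prod.snd (SSpace.pt_injective 2
    (congrArg Subtype.val (hσ.datumE.inS_injective (congrArg Subtype.val h))))

theorem toEbar_injective : Function.Injective (toEbar hσ t) := by
  have hm : ∀ a b, toEbar hσ t (xy t a) = toEbar hσ t (ofHorn t (Horn.zw t b)) →
      xy t a = ofHorn t (Horn.zw t b) := by
    intro a b h
    obtain ⟨h1, rfl⟩ := of_toEbar_xy_eq_ofHorn_zw hσ t h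
    exact sound_zw t h1
  intro m m' h
  obtain ⟨a, rfl⟩ | ⟨a, rfl⟩ := cases t m <;> obtain ⟨b, rfl⟩ | ⟨b, rfl⟩ := cases t m'
  · rw [of_toEbar_xy_eq_xy hσ t h]
  · exact hm _ _ h
  · exact (hm _ _ h.symm).symm
  · rcases of_toEbar_ofHorn_eq_ofHorn hσ t h with h | h
    · rw [h]
    · rw [h, ofHorn_sigma]

theorem toEbar_xy_eq_fchart (a : ℂ × ℂ) : toEbar hσ t (xy t a) = fchart σ t (.inl 2) a := by
  have ha : a ∈ fdom σ t (.inl 2) := by simp [mem_fdom_inl]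
  exact Subtype.ext (hσ.fchart_val ha).symm

theorem toEbar_zw_eq_fchart {a : ℂ × ℂ} (ha : (-a.1 / 2, a.2) ∈ fdom σ t (.inr none)) :
    toEbar hσ t (ofHorn t (Horn.zw t a)) = fchart σ t (.inr none) (-a.1 / 2, a.2) :=
  Subtype.ext (hσ.fchart_val ha).symm

theorem mem_fdom_none (σ : XSpace → XSpace) (z : ℂ) : (z, (0 : ℂ)) ∈ fdom σ t (.inr none) := by
  refine XSpace.IsInducedInvolution.mem_inr_none (σ := σ) (v := (t, z, 0)) ?_
  simp [XStage.chartW, blowMap₁, XStage.cen, XStage.ctr]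

theorem toEbar_notMem_curves (m : Model t) (i : Fin 9) : toEbar hσ t m ∉ hσ.curves t i := by
  obtain ⟨a, rfl⟩ | ⟨a, rfl⟩ := cases t m
  · rw [toEbar_xy_eq_fchart, hσ.fchart_mem (by simp [mem_fdom_inl])]
    simp [ChartIndex.fst, ChartIndex.snd]
  · exact fun h => Horn.not_label_toX t _ i ((hσ.boundary_inX i _).1 h)

theorem toEbar_notMem_verticalLeaves (m : Model t) : toEbar hσ t m ∉ verticalLeaves σ t := by
  simp [hσ.verticalLeaves_eq, toEbar_notMem_curves]

theorem holOpenAt_toEbar (m : Model t) : HolOpenAt (toEbar hσ t) m := by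
  have hxy : ∀ a, HolOpenAt (toEbar hσ t) (xy t a) := fun a =>
    HolOpenAt.cancel (holOpenAt_xy t a) (((hσ.isOpenChart_fchart (.inl 2)).hol a
      (by simp [mem_fdom_inl])).congr (Eventually.of_forall fun b => (toEbar_xy_eq_fchart hσ t b).symm))
  obtain ⟨a, rfl⟩ | ⟨a, rfl⟩ := cases t m
  · exact hxy a
  · by_cases ha : a.2 = 0
    · obtain ⟨z, w⟩ := a
      obtain rfl : w = 0 := ha
      refine HolOpenAt.cancel (f := fun a => ofHorn t (Horn.zw t a))
        (HolOpenAt.comp (g := ofHorn t) (f := Horn.zw t) (holOpenAt_ofHorn t _)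
          (Horn.holOpenAt_zw t _)) ?_
      have h1 := hσ.isOpenChart_fchart (t := t) (.inr none)
      have h2 := Horn.holOpenAt_scale (z, 0)
      have h3 : (-z / 2, (0 : ℂ)) ∈ fdom σ t (.inr none) := mem_fdom_none t σ _
      have h4 : HolOpenAt (fchart σ t (.inr none) ∘ fun a : ℂ × ℂ => (-a.1 / 2, a.2)) (z, 0) :=
        HolOpenAt.comp (g := fchart σ t (.inr none)) (h1.hol _ h3) h2
      refine HolOpenAt.congr h4 ?_
      filter_upwards [h2.continuousAt.preimage_mem_nhds (h1.isOpen.mem_nhds h3)] with b hb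
      exact (toEbar_zw_eq_fchart hσ t hb).symm
    · rw [← sound_zw t ha]
      exact hxy _

/-- The model is Okamoto's space. -/
noncomputable def toOkamoto (hσ : XSpace.IsInducedInvolution σ) (t : ℂ) (m : Model t) : OkamotoSpace σ t :=
  ⟨toEbar hσ t m, toEbar_notMem_verticalLeaves hσ t m⟩

theorem holOpenAt_toOkamoto (m : Model t) : HolOpenAt (toOkamoto hσ t) m :=
  (holOpenAt_toEbar hσ t m).codRestrict _

/-- For surjectivity, a point off the nine curves lies in a chart of `S` where the boundary equation
is nonzero, hence in the chart `(x, y)`, or on the last exceptional curve. The charts of the other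
blowups occur only with vanishing second coordinate, which puts the point on a boundary curve. -/
theorem toOkamoto_bijective : Function.Bijective (toOkamoto hσ t) := by
  refine ⟨fun m m' h => toEbar_injective hσ t (congrArg Subtype.val h), ?_⟩
  rintro ⟨e, he⟩
  suffices ∃ m, toEbar hσ t m = e from this.imp fun m hm => Subtype.ext hm
  simp only [hσ.verticalLeaves_eq, Set.mem_iUnion, not_exists] at he
  obtain ⟨c, a, ha, rfl, h⟩ := hσ.exists_fchart e
  simp only [hσ.fchart_mem ha] at he
  match c with
  | .inl i =>
    have hb : SSpace.bdry i (t, a) ≠ 0 := fun hb => by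
      obtain ⟨j, hj⟩ := SSpace.bdry_eq_zero_iff.1 hb
      exact he j hj
    have h2 := SSpace.pt_two_toXY hb
    have h3 : (SSpace.toXY i (t, a)).1 = t := by
      have := congrArg SSpace.time h2
      rwa [SSpace.time_pt, SSpace.time_pt] at this
    refine ⟨xy t (SSpace.toXY i (t, a)).2, ?_⟩
    rw [toEbar_xy_eq_fchart, hσ.fchart_inl_eq (by simp [mem_fdom_inl]) ha, ← h2]
    congr 1
    exact Prod.ext h3.symm rfl
  | .inr (some j) => exact absurd (.inr ⟨rfl, h _ rfl⟩) (he ⟨j + 2, by omega⟩)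
  | .inr none =>
    obtain ⟨z, w⟩ := a
    obtain rfl : w = 0 := h _ rfl
    refine ⟨ofHorn t (Horn.zw t (-2 * z, 0)), ?_⟩
    have e : -(-2 * z) / 2 = z := by ring
    rw [toEbar_zw_eq_fchart hσ t (by simpa only [e] using ha)]
    simp only [e]

/-- The model is Okamoto's space, as a complex surface. -/
noncomputable def biholo (hσ : XSpace.IsInducedInvolution σ) (t : ℂ) : Biholo (Model t) (OkamotoSpace σ t) where
  toEquiv := .ofBijective (toOkamoto hσ t) (toOkamoto_bijective hσ t)
  hol := isHolMap_iff.2 fun m => (holOpenAt_toOkamoto hσ t m).holMapAt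
  hol_inv := isHolMap_iff.2 fun e => by
    obtain ⟨m, rfl⟩ := (Equiv.ofBijective _ (toOkamoto_bijective hσ t)).surjective e
    refine HolOpenAt.cancel_holMapAt (holOpenAt_toOkamoto hσ t m) ?_
    have : (Equiv.ofBijective _ (toOkamoto_bijective hσ t)).invFun ∘ toOkamoto hσ t = id :=
      funext (Equiv.ofBijective _ (toOkamoto_bijective hσ t)).left_inv
    exact (congrArg (HolMapAt · m) this).mpr (holOpenAt_id m).holMapAt

include hσ

theorem isOpenHolEmbedding_xy : IsOpenHolEmbedding (xy t) :=
  .of_holOpenAt (holOpenAt_xy t) fun _ _ h => of_toEbar_xy_eq_xy hσ t (congrArg _ h)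

theorem xy_eq_ofHorn_zw_iff (a b : ℂ × ℂ) :
    xy t a = ofHorn t (Horn.zw t b) ↔ b.2 ≠ 0 ∧ a = mapZWtoXY t b :=
  ⟨fun h => of_toEbar_xy_eq_ofHorn_zw hσ t (congrArg _ h), fun ⟨h, e⟩ => e ▸ sound_zw t h⟩

theorem xy_eq_ofHorn_uv_iff (a b : ℂ × ℂ) :
    xy t a = ofHorn t (Horn.uv t b) ↔ b.2 ≠ 0 ∧ a = mapUVtoXY t b :=
  ⟨fun h => of_toEbar_xy_eq_ofHorn_uv hσ t (congrArg _ h), fun ⟨h, e⟩ => e ▸ sound_uv t h⟩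

theorem ofHorn_eq_ofHorn_iff (h h' : Horn t) :
    ofHorn t h = ofHorn t h' ↔ h' = h ∨ h' = Horn.sigma t h := by
  refine ⟨fun e => of_toEbar_ofHorn_eq_ofHorn hσ t (congrArg _ e), ?_⟩
  rintro (rfl | rfl)
  · rfl
  · exact (ofHorn_sigma t h).symm

theorem exists_xy_eq_ofHorn_iff (a : ℂ × ℂ) : (∃ h : Horn t, xy t a = ofHorn t h) ↔ a.1 ≠ 0 := by
  constructor
  · rintro ⟨h, e⟩
    obtain ⟨b, rfl⟩ | ⟨b, rfl⟩ := Horn.cases t h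
    · obtain ⟨h1, rfl⟩ := (xy_eq_ofHorn_zw_iff hσ t _ _).1 e
      simpa [mapZWtoXY] using h1
    · obtain ⟨h1, rfl⟩ := (xy_eq_ofHorn_uv_iff hσ t _ _).1 e
      simpa [mapUVtoXY] using h1
  · obtain ⟨x, y⟩ := a
    intro hx
    simp only at hx
    -- Either root of `1 / x` serves as `w`; since `y` is affine in `z` with slope `w³ / 2 ≠ 0`, the
    -- equation for `y` is then solved for `z`.
    obtain ⟨w, hw⟩ := IsAlgClosed.exists_pow_nat_eq (1 / x) two_pos
    have h0 : w ≠ 0 := by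
      rintro rfl
      simp at hw
      exact hx hw.symm
    refine ⟨Horn.zw t ((y + 2 / w ^ 3 + t * w / 2 + w ^ 2 / 2) * (2 / w ^ 3), w), ?_⟩
    rw [xy_eq_ofHorn_zw_iff hσ]
    refine ⟨h0, Prod.ext ?_ ?_⟩
    · simp [mapZWtoXY, hw]
    · simp only [mapZWtoXY]
      field_simp
      ring

end Model

/-! ### Assembly of the theorem -/

theorem theorem1 :
    ∃ σ : XSpace → XSpace, XSpace.IsInducedInvolution σ ∧
      (∀ τ : XSpace → XSpace, XSpace.IsInducedInvolution τ → τ = σ) ∧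
    ∀ t : ℂ,
      -- `Ē_t` is the minimal resolution of `p ∈ F_t`, and the vertical leaves are of type `E₈⁽¹⁾`
      (∃ (p : FFibre σ t) (ρ : Ebar σ t → FFibre σ t) (L : Fin 9 → Set (Ebar σ t)),
        (∃ x ∈ XSpace.p, Glue.IsX x p.1) ∧ IsContraction σ t ρ ∧ IsResolution ρ p ∧
        IsE8Configuration L ∧ L 8 = ρ ⁻¹' {p} ∧ verticalLeaves σ t = ⋃ i, L i) ∧
      -- the surface `ℂ²_(z,w) ∪ ℂ²_(u,v)` and its involution
      (IsOpenHolEmbedding (Horn.zw t) ∧ IsOpenHolEmbedding (Horn.uv t) ∧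
        (∀ a b : ℂ × ℂ, Horn.zw t a = Horn.uv t b ↔ a.2 ≠ 0 ∧ b = mapZWtoUV t a) ∧
        IsHolMap (Horn.sigma t) ∧ Function.Involutive (Horn.sigma t) ∧
        (∀ a : ℂ × ℂ, Horn.sigma t (Horn.zw t a) = Horn.uv t (-a)) ∧
        (∀ a : ℂ × ℂ, a.2 ≠ 0 → Horn.sigma t (Horn.zw t a) = Horn.zw t (mapSigmaZW t a)) ∧
        (∀ a : ℂ × ℂ, a.2 ≠ 0 → Horn.sigma t (Horn.uv t a) = Horn.uv t (mapSigmaUV t a))) ∧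
      -- the gluing of `ℂ²_(x,y)` with the quotient
      (IsOpenHolEmbedding (Model.xy t) ∧
        (∀ a b : ℂ × ℂ, Model.xy t a = Model.ofHorn t (Horn.zw t b) ↔
          b.2 ≠ 0 ∧ a = mapZWtoXY t b) ∧
        (∀ a b : ℂ × ℂ, Model.xy t a = Model.ofHorn t (Horn.uv t b) ↔
          b.2 ≠ 0 ∧ a = mapUVtoXY t b) ∧
        (∀ h h' : Horn t, Model.ofHorn t h = Model.ofHorn t h' ↔ h' = h ∨ h' = Horn.sigma t h) ∧
        (∀ a : ℂ × ℂ, (∃ h : Horn t, Model.xy t a = Model.ofHorn t h) ↔ a.1 ≠ 0)) ∧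
      -- `E_t` is the model, through the charts of the construction
      (∃ (Ψ : Horn t → XSpace.Fibre t) (Θ : Biholo (Model t) (OkamotoSpace σ t)),
        IsOpenHolEmbedding Ψ ∧
        (∀ a : ℂ × ℂ, XSpace.zw₈.At (t, -a.1 / 2, a.2) (Ψ (Horn.zw t a)).1) ∧
        (∀ a : ℂ × ℂ, XSpace.uv₈.At (t, -a.1 / 2, a.2) (Ψ (Horn.uv t a)).1) ∧
        (∀ h : Horn t, σ (Ψ h).1 = (Ψ (Horn.sigma t h)).1) ∧
        (∀ a : ℂ × ℂ, (chartXY σ).At (t, a.1, a.2) (Θ.toFun (Model.xy t a)).1.1) ∧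
        (∀ h : Horn t, Glue.IsX (Ψ h).1 (Θ.toFun (Model.ofHorn t h)).1.1)) ∧
      -- the gluing maps and the involution are symplectic
      (∀ a : ℂ × ℂ, a.2 ≠ 0 →
        IsSymplecticAt (mapZWtoUV t) a ∧ IsSymplecticAt (mapZWtoXY t) a ∧
        IsSymplecticAt (mapUVtoXY t) a ∧ IsSymplecticAt (mapSigmaZW t) a ∧
        IsSymplecticAt (mapSigmaUV t) a) := by
  obtain ⟨σ, hσ⟩ : ∃ σ : XSpace → XSpace, XSpace.IsInducedInvolution σ :=
    XSpace.exists_involution.imp fun _ h => h.1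
  refine ⟨σ, hσ, fun τ hτ => hσ.unique hτ, fun t => ⟨?_, ?_, ?_, ?_, ?_⟩⟩
  · exact ⟨hσ.node t, hσ.rho t, hσ.curves t,
      ⟨XSpace.origin t, congrArg Prod.snd (XSpace.toW_origin t), trivial, rfl⟩,
      hσ.isContraction_rho, hσ.isResolution_rho, hσ.isE8Configuration,
      Set.ext fun _ => hσ.rho_eq_node_iff.symm, hσ.verticalLeaves_eq t⟩
  · exact ⟨.of_holOpenAt (Horn.holOpenAt_zw t) (Horn.zw_injective t),
      .of_holOpenAt (Horn.holOpenAt_uv t) (Horn.uv_injective t), Horn.zw_eq_uv_iff t,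
      isHolMap_iff.2 fun h => (Horn.holOpenAt_sigma t h).holMapAt, Horn.sigma_involutive t,
      Horn.sigma_zw t, fun _ => Horn.sigma_zw_of_ne t, fun _ => Horn.sigma_uv_of_ne t⟩
  · exact ⟨Model.isOpenHolEmbedding_xy hσ t, Model.xy_eq_ofHorn_zw_iff hσ t,
      Model.xy_eq_ofHorn_uv_iff hσ t, Model.ofHorn_eq_ofHorn_iff hσ t,
      Model.exists_xy_eq_ofHorn_iff hσ t⟩
  · exact ⟨Horn.toX t, Model.biholo hσ t, Horn.isOpenHolEmbedding_toX t,
      fun a => ⟨XSpace.mem_zw₈ _, rfl⟩, fun a => ⟨XSpace.mem_uv₈ _, rfl⟩,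
      Horn.involution_toX t hσ,
      fun a => ⟨⟨SSpace.mem_chart 2 _, Model.pt_two_notMem_a₂ _⟩, rfl⟩,
      fun h => ⟨Horn.toX_notMem_p t h, rfl⟩⟩
  · exact fun a h => ⟨isSymplecticAt_mapZWtoUV t h, isSymplecticAt_mapZWtoXY t h,
      isSymplecticAt_mapUVtoXY t h, isSymplecticAt_mapSigmaZW t h, isSymplecticAt_mapSigmaUV t h⟩
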